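/- **Setting.** Let $d\ge 1$, $\mathfrak H=L^2(\mathbf R^d)$, and for each $\hbar\in(0,1]$ let $R=R_\hbar$ be a density operator on $\mathfrak H$ ($R\ge 0$, $\operatorname{trace}R=1$). The Wigner function at scale $\hbar$ of a Hilbert–Schmidt operator with integral kernel $r$ is $W_\hbar[\cdot](x,\xi)=(2\pi)^{-d}\int e^{-i\xi\cdot y}r(x+\frac12\hbar y,x-\frac12\hbar y)\,dy$ (Fourier transform in the $L^2$ sense), and $\widetilde W_\hbar[R]=e^{\hbar\Delta_{x,\xi}/4}W_\hbar[R]$ is the Husimi function of $R$. A coupling of a probability density $p$ on $\mathbf R^{2d}$ and of $R$ is a (weakly) measurable family of positive operators $Q(x,\xi)$ on $\mathfrak H$ with $\operatorname{trace}Q(x,\xi)=p(x,\xi)$ a.e. and $\iint Q\,dx\,d\xi=R$, and $$E_\hbar(p,R)=\Big(\inf_Q\iint\operatorname{trace}\big(c_\hbar(x,\xi)Q(x,\xi)\big)dx\,d\xi\Big)^{1/2},\qquad c_\hbar(x,\xi)=\tfrac12\big(|x-y|^2+|\xi+i\hbar\nabla_y|^2\big).$$ For $a$ on $\mathbf R^{2d}$,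 with $z_l=(x_l,\xi_l)\simeq x_l+i\xi_l$ and $k\in\mathbf Z^d$, let $a_k(z)=\int_{[0,2\pi]^d}a(e^{i\theta_1}z_1,\dots,e^{i\theta_d}z_d)e^{ik\cdot\theta}d\theta$ and $$\|a\|_{M,K,N}=\sup_{k\in\mathbf Z^d}\sup_{z}\ \prod_{l=1}^d(|z_l|^2+1)^M(|k_l|+d)^K\sup_{|\alpha_1|,\dots,|\alpha_d|\le N}\Big|\prod_{m=1}^d(\sqrt\hbar D_{z_m})^{\alpha_m}a_k(z)\Big|$$ ($=\infty$ unless the derivatives of $a$ involved exist and are continuous). Let $H_j=h_{j_1}\otimes\dots\otimes h_{j_d}$, $j\in\mathbf N^d$, be the orthonormal Hermite basis, $(-\hbar^2\partial_x^2+x^2)h_k=(2k+1)\hbar h_k$. Let $|z\rangle(y)=(\pi\hbar)^{-d/4}e^{-|y-x|^2/2\hbar}e^{i\xi\cdot(y-x)/\hbar}$ and, for a probability density $F>0$ on $\mathbf R^{2d}$, let $T_F=\int F(z)|z\rangle\langle z|\,dz$, a positive injective operator. **Constants.** For such $F$ let $D_{III}(F)=2\max\big((\int(1+|x|+|\xi|)F\,dx\,d\xi)^{1/2},\sqrt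 d\big)$. For $\epsilon\in(0,1)$ let $F_\epsilon(z)=\prod_{l}\frac{1+2\epsilon}{\pi}(1+|z_l|^2)^{-2-2\epsilon}$, and $$D_{II}=\big(4^6(2+\epsilon)+\epsilon^{-d}\big)D_{III}(F_\epsilon),\qquad D_{II}'=\big(2d\,(10^5/\epsilon)^d\big)^{1/2},$$ $$D_I=\Big(\tfrac{\sqrt{2\pi}}2+2(2\pi)^{5/2}e^{1/8}\big(\tfrac{4m}e\big)^m\Big)D_{II},\qquad m=\tfrac94+\epsilon.$$ **Theorem.** (I) Let $\epsilon\in(0,1)$ and $\mu,\nu$ be functions of $\hbar$ with $\sqrt\hbar\mu(\hbar)=o(1)$, $\mu(\hbar)\nu(\hbar)=o(1)$ as $\hbar\to0$, and suppose that for all $\hbar\in(0,1]$ $$\|W_\hbar[\sqrt R]\|_{\frac34+\epsilon,\frac72+3\epsilon,3}\le(2\pi\hbar)^{-d/2}\mu(\hbar),\qquad \hbar^{1/2}\|W_\hbar[\sqrt R]\|_{\frac34+\epsilon,\frac52+3\epsilon,4}\le(2\pi\hbar)^{-d/2}\nu(\hbar).$$ Then for all $\hbar\in(0,1]$ $$E_\hbar(\widetilde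 W_\hbar[R],R)\le\tfrac{D_I}{\sqrt2}\max\big(\sqrt\hbar,\sqrt\hbar\,\mu(\hbar),\sqrt{\hbar\mu(\hbar)\nu(\hbar)}\big).$$ (II) Let $\epsilon\in(0,1)$ and $\mu',\nu'$ be functions of $\hbar$ with $\sqrt\hbar\mu'(\hbar)=o(1)$, $\mu'(\hbar)\nu'(\hbar)=o(1)$ as $\hbar\to0$, and suppose that for all $\hbar\in(0,1]$ and all $i,j\in\mathbf N^d$ $$|(H_i,\sqrt R\,H_j)|\le(2\pi\hbar)^{d/2}\mu'(\hbar)\prod_{l}(\hbar j_l+\tfrac12)^{-\frac34-\epsilon}(|i_l-j_l|+1)^{-2-\epsilon},$$ $$|(H_i,[O,\sqrt R]H_j)|\le(2\pi\hbar)^{d/2}\nu'(\hbar)\prod_{l}(\hbar j_l+\tfrac12)^{-\frac12-\epsilon}(|i_l-j_l|+1)^{-1-\epsilon}\quad\text{for }O\in\{y_n,\pm\hbar\partial_{y_n}:1\le n\le d\}.$$ Then there is $\hbar_0\in(0,1]$ such that for all $\hbar\in(0,\hbar_0]$ $$E_\hbar(\widetilde W_\hbar[R],R)\le\tfrac{D_{II}}{\sqrt2}\max\big(\sqrt\hbar,\sqrt\hbar\,\mu'(\hbar),\sqrt{\mu'(\hbar)\nu'(\hbar)}\big);$$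 moreover, the same inequality with $D_{II}'$ in place of $D_{II}$ holds for every $\hbar\in(0,1]$ such that $\mu'(\hbar)\nu'(\hbar)\le1$. (III) Let $F>0$ be a probability density on $\mathbf R^{2d}$ with $\int(|x|+|\xi|)F<\infty$ and let $\tau(\hbar)=o(1)$ as $\hbar\to0$. Suppose that for all $\hbar\in(0,1]$ the operators $\sqrt R\,T_F^{-1/2}$ and $T_F^{-1/2}\sqrt R$ have bounded extensions to $\mathfrak H$ and that, for every $O\in\{-\hbar^2\Delta_y+|y|^2,\,y_n,\,\pm\hbar\partial_{y_n}:1\le n\le d\}$, the operator $T_F^{-1/2}\sqrt R\,[O,\sqrt R\,T_F^{-1/2}]$ (formed with these extensions) is defined on Schwartz functions with norm at most $\tau(\hbar)$. Then for all $\hbar\in(0,1]$ $$E_\hbar(\widetilde W_\hbar[R],R)\le d^{1/4}D_{III}(F)\max\big(\sqrt\hbar,\sqrt{\tau(\hbar)}\big).$$ -/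

import Mathlib

open MeasureTheory Filter Topology
open scoped ENNReal SchwartzMap InnerProductSpace

noncomputable section

namespace SemiWass

/-! ### Configuration space, phase space, Hilbert space -/

/-- Configuration space `ℝ^d` with its Euclidean norm. -/
abbrev Conf (d : ℕ) : Type := EuclideanSpace ℝ (Fin d)

/-- Phase space `ℝ^d × ℝ^d`, with points `z = (x, ξ)`. -/
abbrev Phase (d : ℕ) : Type := Conf d × Conf d

/-- The Hilbert space `L²(ℝ^d)`. -/
abbrev L2 (d : ℕ) : Type := Lp ℂ 2 (volume : Measure (Conf d))

/-- Bounded operators on `L²(ℝ^d)`. -/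
abbrev Op (d : ℕ) : Type := L2 d →L[ℂ] L2 d

/-- The `j`-th vector of the canonical basis of `ℝ^d`. -/
def basisVec {d : ℕ} (j : Fin d) : Conf d := EuclideanSpace.single j (1 : ℝ)

open Classical in
/-- The class in `L²` of a square integrable function (`0` if `f` is not square integrable). -/
def toL2 {d : ℕ} (f : Conf d → ℂ) : L2 d :=
  if h : MemLp f 2 (volume : Measure (Conf d)) then h.toLp f else 0

/-! ### Square roots, traces and density operators -/

/-- The positive square root of a positive bounded operator on a complex Hilbert space. -/
def posSqrt {H : Type*} [NormedAddCommGroup H] [InnerProductSpace ℂ H] [CompleteSpace H]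
    (T : H →L[ℂ] H) : H →L[ℂ] H := CFC.sqrt T

/-- A Hilbert basis of `L²(ℝ^d)`.  The traces below do not depend on it. -/
def onbIndex (d : ℕ) : Set (L2 d) := Classical.choose (exists_hilbertBasis ℂ (L2 d))

/-- The vectors of that Hilbert basis. -/
def onb (d : ℕ) : HilbertBasis (onbIndex d) ℂ (L2 d) :=
  Classical.choose (Classical.choose_spec (exists_hilbertBasis ℂ (L2 d)))

/-- The trace, in `[0, ∞]`, of a positive bounded operator. -/
def opTrace {d : ℕ} (T : Op d) : ℝ≥0∞ :=
  ∑' n, ENNReal.ofReal (RCLike.re ⟪onb d n, T (onb d n)⟫_ℂ)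

/-- Density operators: positive operators of trace one. -/
def IsDensityOp {d : ℕ} (R : Op d) : Prop := R.IsPositive ∧ opTrace R = 1

/-! ### The transport cost and the pseudo-distance between classical and quantum densities -/

/-- `ψ` is the weak partial derivative `∂_j φ`, both being in `L²`. -/
def IsWeakDeriv {d : ℕ} (j : Fin d) (φ ψ : L2 d) : Prop :=
  ∀ g : 𝓢(Conf d, ℂ),
    ∫ y, lineDeriv ℝ (g : Conf d → ℂ) y (basisVec j) * φ y = - ∫ y, g y * ψ y

/-- The quadratic form `⟨φ, c_ħ(x,ξ) φ⟩ ∈ [0, ∞]` of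
`c_ħ(x,ξ) = ½ ∑_j ((x_j - y_j)² + (ξ_j + iħ∂_j)²)`, namely
`½ ∑_j (‖(x_j - y_j) φ‖² + ‖(ξ_j + iħ∂_j) φ‖²)`; it is `∞` outside of the form domain
(the infimum is over the empty set if `φ` has no weak derivative in `L²`, and over one element
otherwise). -/
def costForm {d : ℕ} (ħ : ℝ) (z : Phase d) (φ : L2 d) : ℝ≥0∞ :=
  (1 / 2) * ∑ j : Fin d,
    ((∫⁻ y, ‖(((z.1 j - y j : ℝ) : ℂ)) * φ y‖ₑ ^ 2) +
      ⨅ (ψ : L2 d) (_ : IsWeakDeriv j φ ψ),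
        ∫⁻ y, ‖((z.2 j : ℝ) : ℂ) * φ y + Complex.I * (ħ : ℂ) * ψ y‖ₑ ^ 2)

/-- `trace (c_ħ(z) Q) = trace (Q^{1/2} c_ħ(z) Q^{1/2}) ∈ [0, ∞]` for a positive operator `Q`. -/
def costTrace {d : ℕ} (ħ : ℝ) (z : Phase d) (Q : Op d) : ℝ≥0∞ :=
  ∑' n, costForm ħ z (posSqrt Q (onb d n))

/-- Couplings of a classical density `p` and a density operator `R`: (weakly) measurable fields of
positive operators `Q(z)` with `trace Q(z) = p(z)` for almost every `z` and `∫ Q(z) dz = R`. -/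
structure IsCoupling {d : ℕ} (p : Phase d → ℝ) (R : Op d) (Q : Phase d → Op d) : Prop where
  aemeasurable : ∀ u v : L2 d, AEMeasurable (fun z => ⟪u, Q z v⟫_ℂ)
  isPositive : ∀ᵐ z, (Q z).IsPositive
  trace_eq : ∀ᵐ z, opTrace (Q z) = ENNReal.ofReal (p z)
  integrable : ∀ u v : L2 d, Integrable (fun z => ⟪u, Q z v⟫_ℂ)
  integral_eq : ∀ u v : L2 d, ∫ z, ⟪u, Q z v⟫_ℂ = ⟪u, R v⟫_ℂ

/-- The pseudo-distance
`E_ħ(p, R) = (inf_Q ∫ trace (c_ħ(x,ξ) Q(x,ξ)) dx dξ)^{1/2} ∈ [0, ∞]`. -/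
def quantumWass {d : ℕ} (ħ : ℝ) (p : Phase d → ℝ) (R : Op d) : ℝ≥0∞ :=
  (⨅ (Q : Phase d → Op d) (_ : IsCoupling p R Q), ∫⁻ z, costTrace ħ z (Q z)) ^ (1 / 2 : ℝ)

/-! ### Wigner and Husimi functions -/

/-- `r ∈ L²(ℝ^d × ℝ^d)` is the integral kernel of the (Hilbert–Schmidt) operator `T`. -/
def IsKernel {d : ℕ} (T : Op d) (r : Conf d × Conf d → ℂ) : Prop :=
  MemLp r 2 (volume : Measure (Conf d × Conf d)) ∧
    ∀ f : L2 d, (T f : Conf d → ℂ) =ᵐ[volume] fun x => ∫ y, r (x, y) * f y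

/-- `W` is (a representative of) the Wigner function at scale `ħ` of the Hilbert–Schmidt
operator `T` of kernel `r`:
`W(x,ξ) = (2π)^{-d} ∫ e^{-iξ·y} r(x + ħy/2, x - ħy/2) dy`.
Since `r` is only square integrable, the Fourier transform in `y` is the one of `L²`, which is
expressed here by testing against Schwartz functions. -/
def IsWigner {d : ℕ} (ħ : ℝ) (T : Op d) (W : Phase d → ℂ) : Prop :=
  MemLp W 2 (volume : Measure (Phase d)) ∧
    ∃ r : Conf d × Conf d → ℂ, IsKernel T r ∧
      ∀ φ : 𝓢(Phase d, ℂ),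
        ∫ z, W z * φ z =
          (((2 * Real.pi) ^ d)⁻¹ : ℂ) * ∫ q : Conf d × Conf d,
            r (q.1 + (ħ / 2) • q.2, q.1 - (ħ / 2) • q.2) *
              ∫ ξ : Conf d, Complex.exp (-(Complex.I * (⟪ξ, q.2⟫_ℝ : ℂ))) * φ (q.1, ξ)

/-- The Husimi function `e^{ħΔ/4} W`, i.e. the convolution of the Wigner function `W` with the
heat kernel `(πħ)^{-d} e^{-|z|²/ħ}` of `ℝ^{2d}` at time `ħ/4` (the Wigner function of a
self-adjoint operator is real). -/
def husimi {d : ℕ} (ħ : ℝ) (W : Phase d → ℂ) (z : Phase d) : ℝ :=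
  ((Real.pi * ħ) ^ d)⁻¹ *
    ∫ z' : Phase d, Real.exp (-(‖z.1 - z'.1‖ ^ 2 + ‖z.2 - z'.2‖ ^ 2) / ħ) * (W z').re

/-! ### The weighted norms of Wigner functions -/

/-- The rotation `z ↦ (e^{iθ_1} z_1, …, e^{iθ_d} z_d)` of phase space, where `z_l = x_l + iξ_l`. -/
def rotate {d : ℕ} (θ : Fin d → ℝ) (z : Phase d) : Phase d :=
  (WithLp.toLp 2 fun l => Real.cos (θ l) * z.1 l - Real.sin (θ l) * z.2 l,
    WithLp.toLp 2 fun l => Real.sin (θ l) * z.1 l + Real.cos (θ l) * z.2 l)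

/-- `a_k(z) = ∫_{[0,2π]^d} a(e^{iθ} z) e^{ik·θ} dθ`. -/
def fourierCoef {d : ℕ} (a : Phase d → ℂ) (k : Fin d → ℤ) (z : Phase d) : ℂ :=
  ∫ θ in Set.pi Set.univ (fun _ : Fin d => Set.Icc (0 : ℝ) (2 * Real.pi)),
    a (rotate θ z) * Complex.exp (Complex.I * ((∑ l, (k l : ℝ) * θ l : ℝ) : ℂ))

/-- Coordinate directions of phase space: `(l, false)` is `x_l` and `(l, true)` is `ξ_l`. -/
def dir {d : ℕ} (m : Fin d × Bool) : Phase d :=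
  if m.2 then (0, basisVec m.1) else (basisVec m.1, 0)

/-- Iterated partial derivatives along a list of coordinates. -/
def partialD {d : ℕ} : List (Fin d × Bool) → (Phase d → ℂ) → Phase d → ℂ
  | [], a => a
  | m :: w, a => fun z => lineDeriv ℝ (partialD w a) z (dir m)

/-- At most `N` of the derivatives fall on each plane `z_l = (x_l, ξ_l)`, i.e. `|α_l| ≤ N`. -/
def Admissible {d : ℕ} (N : ℕ) (w : List (Fin d × Bool)) : Prop :=
  ∀ l : Fin d, (w.map Prod.fst).count l ≤ N

/-- The partial derivatives of `a` of orders `|α_1|, …, |α_d| ≤ N` exist and are continuous. -/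
def MixedContDiff {d : ℕ} (N : ℕ) (a : Phase d → ℂ) : Prop :=
  (∀ w, Admissible N w → Continuous (partialD w a)) ∧
    ∀ m w, Admissible N (m :: w) → ∀ z, LineDifferentiableAt ℝ (partialD w a) z (dir m)

open Classical in
/-- The norm
`‖a‖_{M,K,N} = sup_{k,z} ∏_l (|z_l|²+1)^M (|k_l|+d)^K sup_{|α_l| ≤ N} |(√ħ D)^α a_k(z)|`,
with the value `∞` if `a` lacks the derivatives that occur in it. -/
def mknNorm {d : ℕ} (ħ M K : ℝ) (N : ℕ) (a : Phase d → ℂ) : ℝ≥0∞ :=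
  if MixedContDiff N a then
    ⨆ (k : Fin d → ℤ) (z : Phase d) (w : List (Fin d × Bool)) (_ : Admissible N w),
      ENNReal.ofReal
        ((∏ l, ((z.1 l ^ 2 + z.2 l ^ 2 + 1) ^ M * (|(k l : ℝ)| + d) ^ K)) *
          (Real.sqrt ħ ^ w.length * ‖partialD w (fourierCoef a k) z‖))
  else ∞

/-! ### Observables -/

/-- Labels for the operators `-ħ²Δ + |y|²`, `y_j`, `ħ∂_j`, `-ħ∂_j`. -/
inductive Obs (d : ℕ) : Type
  | osc : Obs d
  | pos (j : Fin d) : Obs d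
  | gradPlus (j : Fin d) : Obs d
  | gradMinus (j : Fin d) : Obs d

/-- The (formal) adjoint. -/
def Obs.adj {d : ℕ} : Obs d → Obs d
  | .osc => .osc
  | .pos j => .pos j
  | .gradPlus j => .gradMinus j
  | .gradMinus j => .gradPlus j

/-- Action of the operators on smooth functions. -/
def Obs.act {d : ℕ} (ħ : ℝ) : Obs d → (Conf d → ℂ) → Conf d → ℂ
  | .osc, f => fun y =>
      -((ħ : ℂ) ^ 2 * ∑ j, lineDeriv ℝ (fun y' => lineDeriv ℝ f y' (basisVec j)) y (basisVec j))
        + ((‖y‖ ^ 2 : ℝ) : ℂ) * f y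
  | .pos j, f => fun y => ((y j : ℝ) : ℂ) * f y
  | .gradPlus j, f => fun y => (ħ : ℂ) * lineDeriv ℝ f y (basisVec j)
  | .gradMinus j, f => fun y => -((ħ : ℂ) * lineDeriv ℝ f y (basisVec j))

/-- `u ∈ L²` lies in the maximal domain of `O`, and `O u = w`. -/
def Obs.IsImage {d : ℕ} (ħ : ℝ) (O : Obs d) (u w : L2 d) : Prop :=
  ∀ g : 𝓢(Conf d, ℂ), ⟪toL2 (O.adj.act ħ g), u⟫_ℂ = ⟪toL2 (g : Conf d → ℂ), w⟫_ℂ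

/-! ### Hermite functions -/

/-- The normalized Hermite function `h_k`, with
`(-ħ² d²/dx² + x²) h_k = (2k+1) ħ h_k`.  (Mathlib's `Polynomial.hermite` are the polynomials
that are orthogonal for `e^{-x²/2}`.) -/
def hermite1 (ħ : ℝ) (k : ℕ) (x : ℝ) : ℝ :=
  (Real.pi * ħ) ^ (-(1 / 4) : ℝ) * (Real.sqrt (k.factorial : ℝ))⁻¹ *
    Polynomial.aeval (Real.sqrt (2 / ħ) * x) (Polynomial.hermite k) *
    Real.exp (-(x ^ 2) / (2 * ħ))

/-- `H_j = h_{j_1} ⊗ ⋯ ⊗ h_{j_d}`. -/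
def hermiteFun {d : ℕ} (ħ : ℝ) (j : Fin d → ℕ) (y : Conf d) : ℂ :=
  ((∏ l, hermite1 ħ (j l) (y l) : ℝ) : ℂ)

/-- `(H_i, A H_j)`. -/
def hermiteElt {d : ℕ} (ħ : ℝ) (A : Op d) (i j : Fin d → ℕ) : ℂ :=
  ⟪toL2 (hermiteFun ħ i), A (toL2 (hermiteFun ħ j))⟫_ℂ

/-- `(H_i, [O, A] H_j) = (O^* H_i, A H_j) - (H_i, A O H_j)`. -/
def hermiteCommElt {d : ℕ} (ħ : ℝ) (O : Obs d) (A : Op d) (i j : Fin d → ℕ) : ℂ :=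
  ⟪toL2 (O.adj.act ħ (hermiteFun ħ i)), A (toL2 (hermiteFun ħ j))⟫_ℂ -
    ⟪toL2 (hermiteFun ħ i), A (toL2 (O.act ħ (hermiteFun ħ j)))⟫_ℂ

/-! ### Coherent states and Töplitz operators -/

/-- `|z,ħ⟩ : y ↦ (πħ)^{-d/4} e^{-|y-x|²/2ħ} e^{iξ·(y-x)/ħ}`. -/
def coherentFun {d : ℕ} (ħ : ℝ) (z : Phase d) (y : Conf d) : ℂ :=
  (((Real.pi * ħ) ^ (-(d : ℝ) / 4) * Real.exp (-‖y - z.1‖ ^ 2 / (2 * ħ)) : ℝ) : ℂ) *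
    Complex.exp (Complex.I * ((⟪z.2, y - z.1⟫_ℝ / ħ : ℝ) : ℂ))

/-- The coherent state `|z,ħ⟩` as a vector of `L²`. -/
def coherent {d : ℕ} (ħ : ℝ) (z : Phase d) : L2 d := toL2 (coherentFun ħ z)

/-- The Töplitz operator of symbol `m`:
`Op^T_ħ(m) = (2πħ)^{-d} ∫ m(z) |z,ħ⟩⟨z,ħ| dz`. -/
def toeplitz {d : ℕ} (ħ : ℝ) (m : Phase d → ℝ) : Op d :=
  (((2 * Real.pi * ħ) ^ d)⁻¹ : ℂ) •
    ∫ z, (m z : ℂ) • InnerProductSpace.rankOne ℂ (coherent ħ z) (coherent ħ z)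

/-- `T^{-1/2}` for an injective positive operator `T`, as an unbounded operator whose domain is
the range of `T^{1/2}`. -/
def negSqrt {d : ℕ} (T : Op d) : L2 d →ₗ.[ℂ] L2 d :=
  LinearPMap.inverse (((posSqrt T : Op d) : L2 d →ₗ[ℂ] L2 d).toPMap ⊤)

/-- `B` is a bounded extension of `A S`, for an unbounded operator `S`. -/
def ExtendsRight {d : ℕ} (A : Op d) (S : L2 d →ₗ.[ℂ] L2 d) (B : Op d) : Prop :=
  ∀ u : S.domain, B (u : L2 d) = A (S u)

/-- `C` is a bounded extension of `S A`, for an unbounded operator `S`. -/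
def ExtendsLeft {d : ℕ} (S : L2 d →ₗ.[ℂ] L2 d) (A : Op d) (C : Op d) : Prop :=
  ∀ (v : L2 d) (hv : A v ∈ S.domain), C v = S ⟨A v, hv⟩

/-! ### The three sets of hypotheses, at a given value of `ħ` -/

/-- First set: bounds on the Wigner function of `√R`. -/
def WignerHyp {d : ℕ} (ħ ε μ ν : ℝ) (R : Op d) : Prop :=
  ∃ a : Phase d → ℂ, IsWigner ħ (posSqrt R) a ∧
    mknNorm ħ (3 / 4 + ε) (7 / 2 + 3 * ε) 3 a ≤
      ENNReal.ofReal ((2 * Real.pi * ħ) ^ (-(d : ℝ) / 2) * μ) ∧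
    ENNReal.ofReal (Real.sqrt ħ) * mknNorm ħ (3 / 4 + ε) (5 / 2 + 3 * ε) 4 a ≤
      ENNReal.ofReal ((2 * Real.pi * ħ) ^ (-(d : ℝ) / 2) * ν)

/-- Second set: bounds on the matrix elements of `√R` and of its commutators with
`y_l`, `±ħ∂_l` between Hermite functions. -/
def HermiteHyp {d : ℕ} (ħ ε μ' ν' : ℝ) (R : Op d) : Prop :=
  (∀ i j : Fin d → ℕ, ‖hermiteElt ħ (posSqrt R) i j‖ ≤
    (2 * Real.pi * ħ) ^ ((d : ℝ) / 2) * μ' *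
      ∏ l, ((ħ * j l + 1 / 2) ^ (-(3 / 4) - ε) *
        (|(i l : ℝ) - (j l : ℝ)| + 1) ^ (-2 - ε))) ∧
  ∀ O : Obs d, O ≠ Obs.osc → ∀ i j : Fin d → ℕ,
    ‖hermiteCommElt ħ O (posSqrt R) i j‖ ≤
      (2 * Real.pi * ħ) ^ ((d : ℝ) / 2) * ν' *
        ∏ l, ((ħ * j l + 1 / 2) ^ (-(1 / 2) - ε) *
          (|(i l : ℝ) - (j l : ℝ)| + 1) ^ (-1 - ε))

/-- Third set, for the Töplitz operator `T = Op^T_ħ((2πħ)^d F)`: the operators `√R T^{-1/2}` and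
`T^{-1/2} √R` have bounded extensions `B` and `C`, and `‖C [O, B]‖ ≤ τ` for all `O` among
`-ħ²Δ + |y|²`, `y_j`, `±ħ∂_j`, the commutators being defined on Schwartz functions. -/
def ToeplitzHyp {d : ℕ} (ħ τ : ℝ) (F : Phase d → ℝ) (R : Op d) : Prop :=
  ∃ B C : Op d,
    ExtendsRight (posSqrt R) (negSqrt (toeplitz ħ fun z => (2 * Real.pi * ħ) ^ d * F z)) B ∧
    ExtendsLeft (negSqrt (toeplitz ħ fun z => (2 * Real.pi * ħ) ^ d * F z)) (posSqrt R) C ∧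
    ∀ (O : Obs d) (g : 𝓢(Conf d, ℂ)), ∃ w : L2 d,
      O.IsImage ħ (B (toL2 (g : Conf d → ℂ))) w ∧
        ‖C (w - B (toL2 (O.act ħ g)))‖ ≤ τ * ‖toL2 (g : Conf d → ℂ)‖

/-- Positive probability densities `F` on phase space with `∫ (|x| + |ξ|) F dx dξ < ∞`. -/
structure IsPosDensity {d : ℕ} (F : Phase d → ℝ) : Prop where
  pos : ∀ z, 0 < F z
  integrable : Integrable F
  integral_eq_one : ∫ z, F z = 1
  integrable_moment : Integrable fun z => (‖z.1‖ + ‖z.2‖) * F z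

/-! ### The constants -/

/-- `D_III(F) = 2 max ((∫ (1 + |x| + |ξ|) F)^{1/2}, d^{1/2})`. -/
def constIII {d : ℕ} (F : Phase d → ℝ) : ℝ :=
  2 * max (Real.sqrt (∫ z, (1 + ‖z.1‖ + ‖z.2‖) * F z)) (Real.sqrt d)

/-- The probability density `∏_l π^{-1} (1 + 2ε) (1 + x_l² + ξ_l²)^{-2-2ε}`. -/
def refDensity (d : ℕ) (ε : ℝ) (z : Phase d) : ℝ :=
  ∏ l, ((1 + 2 * ε) / Real.pi * (1 + z.1 l ^ 2 + z.2 l ^ 2) ^ (-2 - 2 * ε))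

/-- `D_II = (4^6 (2 + ε) + ε^{-d}) D_III(F)`, for the density above. -/
def constII (d : ℕ) (ε : ℝ) : ℝ :=
  (4 ^ 6 * (2 + ε) + (ε ^ d)⁻¹) * constIII (refDensity d ε)

/-- A constant for the second case that is uniform in `ħ`. -/
def constII' (d : ℕ) (ε : ℝ) : ℝ :=
  Real.sqrt (2 * d * (10 ^ 5 / ε) ^ d)

/-- `D_I = (√(2π)/2 + 2 (2π)^{5/2} e^{1/8} (4m/e)^m) D_II` with `m = 9/4 + ε`. -/
def constI (d : ℕ) (ε : ℝ) : ℝ :=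
  (Real.sqrt (2 * Real.pi) / 2 +
    2 * (2 * Real.pi) ^ (5 / 2 : ℝ) * Real.exp (1 / 8) *
      (4 * (9 / 4 + ε) / Real.exp 1) ^ (9 / 4 + ε)) * constII d ε

end SemiWass

end

noncomputable section
namespace SemiWass

open scoped Nat LineDeriv

/-! ### Schwartz functions -/

/-! The distance is an infimum over couplings, so each bound follows from one explicit coupling and
an estimate of its cost. Two couplings are used, both built from coherent states `|z⟩`.

Cases (I) and (II). Take Q(z) = (2πħ)^{-d} √R|z⟩⟨z|√R. Its trace is (2πħ)^{-d}⟨z|R|z⟩, the Husimi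
function (`husimi_eq`), and its integral is √R √R = R by the resolution of the identity. Moving √R
to the left, (x_j - y_j)√R|z⟩ becomes √R φ_j(z) - [y_j, √R]|z⟩ with φ_j(z) = (x_j - y_j)|z⟩, and the
momentum term has the same shape up to a phase. Since |z⟩ and φ_j(z) are wave packets with
orthogonal windows, the integral over z has no cross term (`lintegral_coherent`). The total cost is
at most dħ/2 plus half the sum of the squared Hilbert–Schmidt norms of the commutators of √R with
positions and momenta (`quantumWass_le_comm`).

In case (II) these norms are sums of squares of matrix elements, of order ν'². Trace one means that
√R has Hilbert–Schmidt norm 1, which bounds μ' from below; hence ν'² is at most a constant times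
(μ'ν')². One factor μ'ν' absorbs the constant when it is small, and otherwise the constant goes into
D_II'.

In case (I) the Wigner transform turns the commutators into ħ times first derivatives of the Wigner
function a of √R. Bessel's inequality for the cross-Wigner functions of Hermite functions
(`tsum_cross_le`) bounds the Hilbert–Schmidt norms by L² norms of these derivatives
(`tsum_comm_le`). The function a is the sum of its angular Fourier components a_k, and the weighted
norm makes the derivatives of a_k summable in k and square integrable in z
(`norm_deriv_le_of_fourierCoef`). Each squared Hilbert–Schmidt norm is then at most ħ max(μ, 0)².

Case (III). With B the extension of √R T^{-1/2}, `toeplitz_factor` gives R = B T B* = ∫ F(w)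
B|w⟩⟨w|B* dw. Each pure piece is coupled to its own Husimi function by the product coupling, and
these couplings are superposed. For a pure state the product coupling costs at most twice the cost
from any chosen point, plus dħ/2 (`HasMoments.lintegral_costForm_le`). The point chosen is w: twice
the cost operator at w is the oscillator plus an affine combination of positions and momenta, and it
maps |w⟩ to dħ|w⟩. Commuting it past B leaves terms B*[O, B] of norm at most τ, with weights of
first order in |w| (`costForm_coh_le`), which the first moment of F integrates.

Throughout, unbounded operators act on Schwartz functions and weak identities are tested on Hermite
functions only; `costForm_eq` rewrites the cost in these terms. -/

lemma one_add_pow_mul_exp_le (a : ℝ) (ha : 0 < a) (N : ℕ) (t : ℝ) (ht : 0 ≤ t) :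
    (1 + t) ^ N * Real.exp (-a * t ^ 2) ≤ N ! * Real.exp (1 + 1 / (4 * a)) := by
  have h1 : (1 + t) ^ N ≤ N ! * Real.exp (1 + t) := by
    have := Real.pow_div_factorial_le_exp (1 + t) (by linarith) N
    rw [div_le_iff₀ (by positivity)] at this
    linarith
  calc (1 + t) ^ N * Real.exp (-a * t ^ 2)
      ≤ N ! * Real.exp (1 + t) * Real.exp (-a * t ^ 2) := by gcongr
    _ = N ! * Real.exp (1 + t + -a * t ^ 2) := by rw [mul_assoc, ← Real.exp_add]
    _ ≤ _ := by
      refine mul_le_mul_of_nonneg_left (Real.exp_le_exp.2 ?_) (by positivity)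
      have : 0 ≤ a * (t - 1 / (2 * a)) ^ 2 := by positivity
      have h2 : a * (t - 1 / (2 * a)) ^ 2 = a * t ^ 2 - t + 1 / (4 * a) := by
        field_simp; ring
      linarith

section Gaussian
variable {E : Type*} [NormedAddCommGroup E] [InnerProductSpace ℝ E]

/-- Faà di Bruno for exp after the quadratic: every derivative of exp at that point equals the
Gaussian value itself, the derivatives of the quadratic grow polynomially, and the Gaussian absorbs
all powers of 1 + ‖x‖. -/
lemma exp_neg_norm_sq_decay (a : ℝ) (ha : 0 < a) (k n : ℕ) :
    ∃ C : ℝ, ∀ x : E, ‖x‖ ^ k *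
      ‖iteratedFDeriv ℝ n (fun y : E => Real.exp (-a * ‖y‖ ^ 2)) x‖ ≤ C := by
  have hq : Function.HasTemperateGrowth (fun y : E => -a * ‖y‖ ^ 2) :=
    (Function.HasTemperateGrowth.const (-a)).mul (Function.hasTemperateGrowth_norm_sq E)
  obtain ⟨l, C, hC, hl⟩ := hq.norm_iteratedFDeriv_le_uniform n
  refine ⟨(n ! * (C + 1) ^ n) * ((k + l * n) ! * Real.exp (1 + 1 / (4 * a))), fun x => ?_⟩
  have hexp : ∀ i, ‖iteratedFDeriv ℝ i Real.exp (-a * ‖x‖ ^ 2)‖ ≤ Real.exp (-a * ‖x‖ ^ 2) := by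
    intro i
    rw [norm_iteratedFDeriv_eq_norm_iteratedDeriv, iteratedDeriv_eq_iterate, Real.iter_deriv_exp]
    simp
  have key := norm_iteratedFDeriv_comp_le (𝕜 := ℝ) (g := Real.exp) (n := n) (N := ⊤)
    (f := fun y : E => -a * ‖y‖ ^ 2) Real.contDiff_exp (contDiff_const.mul (contDiff_norm_sq ℝ)) (by exact le_top) x
    (C := Real.exp (-a * ‖x‖ ^ 2)) (D := (C + 1) * (1 + ‖x‖) ^ l) (fun i _ => hexp i) (by
      intro i hi hin
      refine (hl i hin x).trans ?_
      -- The composition estimate asks for the i-th power of D. The constant is C + 1 rather than C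
      -- so that D ≥ 1, hence D ≤ D ^ i for i ≥ 1.
      have h1 : (1:ℝ) ≤ (C + 1) * (1 + ‖x‖) ^ l :=
        one_le_mul_of_one_le_of_one_le (by linarith) (one_le_pow₀ (by linarith [norm_nonneg x]))
      refine le_trans ?_ (le_self_pow₀ h1 (by omega))
      gcongr; linarith)
  have e : (Real.exp ∘ fun y : E => -a * ‖y‖ ^ 2) = fun y : E => Real.exp (-a * ‖y‖ ^ 2) := rfl
  rw [e] at key
  calc _ ≤ (1 + ‖x‖) ^ k * (n ! * Real.exp (-a * ‖x‖ ^ 2) * ((C + 1) * (1 + ‖x‖) ^ l) ^ n) := by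
        gcongr; linarith
    _ = (n ! * (C + 1) ^ n) * ((1 + ‖x‖) ^ (k + l * n) * Real.exp (-a * ‖x‖ ^ 2)) := by
        rw [pow_add, pow_mul, mul_pow]; ring
    _ ≤ _ := by
        refine mul_le_mul_of_nonneg_left ?_ (by positivity)
        exact one_add_pow_mul_exp_le a ha _ _ (norm_nonneg x)

/-- The Gaussian `e^{-a|y|²}` as a Schwartz function. -/
def gaussS (a : ℝ) (ha : 0 < a) : 𝓢(E, ℂ) :=
  SchwartzMap.postcompCLM (𝕜 := ℝ) Complex.ofRealCLM
    ({ toFun := fun y : E => Real.exp (-a * ‖y‖ ^ 2)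
       smooth' := (contDiff_const.mul (contDiff_norm_sq ℝ)).exp
       decay' := exp_neg_norm_sq_decay a ha } : 𝓢(E, ℝ))

@[simp] lemma gaussS_apply (a : ℝ) (ha : 0 < a) (y : E) :
    gaussS a ha y = ((Real.exp (-a * ‖y‖ ^ 2) : ℝ) : ℂ) := rfl

lemma hasTemperateGrowth_cexp_I :
    Function.HasTemperateGrowth (fun t : ℝ => Complex.exp (Complex.I * t)) := by
  have hd : ∀ n : ℕ, iteratedDeriv n (fun t : ℝ => Complex.exp (Complex.I * t)) =
      fun t : ℝ => Complex.I ^ n * Complex.exp (Complex.I * t) := by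
    intro n
    induction n with
    | zero => simp
    | succ n ih =>
      rw [iteratedDeriv_succ, ih]
      ext t
      have h1 : HasDerivAt (fun t : ℝ => Complex.exp (Complex.I * t))
          (Complex.exp (Complex.I * t) * (Complex.I * 1)) t :=
        ((Complex.ofRealCLM.hasDerivAt (x := t)).const_mul Complex.I).cexp
      rw [(h1.const_mul (Complex.I ^ n)).deriv]
      ring
  refine ⟨(contDiff_const.mul Complex.ofRealCLM.contDiff).cexp, fun n => ⟨0, 1, fun t => ?_⟩⟩
  rw [norm_iteratedFDeriv_eq_norm_iteratedDeriv, hd]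
  simp [mul_comm Complex.I, Complex.norm_exp_ofReal_mul_I]

end Gaussian

variable {d : ℕ}

/-- Schwartz functions as elements of `L²`. -/
def sL2 : 𝓢(Conf d, ℂ) →L[ℂ] L2 d := SchwartzMap.toLpCLM ℂ ℂ 2 volume

lemma toL2_coe (f : 𝓢(Conf d, ℂ)) : toL2 (f : Conf d → ℂ) = sL2 f := by
  rw [toL2, dif_pos (f.memLp 2 volume)]; rfl

lemma sL2_coeFn (f : 𝓢(Conf d, ℂ)) : (sL2 f : Conf d → ℂ) =ᵐ[volume] f :=
  f.coeFn_toLp 2 volume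

lemma inner_sL2_left (f : 𝓢(Conf d, ℂ)) (u : L2 d) :
    ⟪sL2 f, u⟫_ℂ = ∫ y, (starRingEnd ℂ) (f y) * u y := by
  rw [L2.inner_def]
  refine integral_congr_ae ?_
  filter_upwards [sL2_coeFn f] with y hy
  rw [hy, RCLike.inner_apply, mul_comm]

lemma inner_sL2_sL2 (f g : 𝓢(Conf d, ℂ)) :
    ⟪sL2 f, sL2 g⟫_ℂ = ∫ y, (starRingEnd ℂ) (f y) * g y := by
  rw [inner_sL2_left]
  refine integral_congr_ae ?_
  filter_upwards [sL2_coeFn g] with y hy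
  rw [hy]

lemma denseRange_sL2 : DenseRange (sL2 : 𝓢(Conf d, ℂ) →L[ℂ] L2 d) := by
  have := SchwartzMap.denseRange_toLpCLM (E := Conf d) (F := ℂ) (p := 2) (μ := volume)
    (by norm_num)
  exact this

/-- Complex conjugation of Schwartz functions. -/
def conjS {E : Type*} [NormedAddCommGroup E] [NormedSpace ℝ E] (f : 𝓢(E, ℂ)) : 𝓢(E, ℂ) :=
  SchwartzMap.postcompCLM (𝕜 := ℝ) (Complex.conjCLE : ℂ →L[ℝ] ℂ) f

@[simp] lemma conjS_apply {E : Type*} [NormedAddCommGroup E] [NormedSpace ℝ E] (f : 𝓢(E, ℂ))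
    (y : E) : conjS f y = (starRingEnd ℂ) (f y) := rfl

lemma lineDerivOp_conjS {E : Type*} [NormedAddCommGroup E] [NormedSpace ℝ E] (f : 𝓢(E, ℂ))
    (v y : E) : ∂_{v} (conjS f) y = (starRingEnd ℂ) (∂_{v} f y) := by
  rw [SchwartzMap.lineDerivOp_apply_eq_fderiv, SchwartzMap.lineDerivOp_apply_eq_fderiv]
  have : HasFDerivAt (conjS f) ((Complex.conjCLE : ℂ →L[ℝ] ℂ).comp (fderiv ℝ f y)) y :=
    (Complex.conjCLE : ℂ →L[ℝ] ℂ).hasFDerivAt.comp y (f.hasFDerivAt y)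
  rw [this.fderiv]; rfl

lemma hasTemperateGrowth_coord (j : Fin d) :
    Function.HasTemperateGrowth (fun y : Conf d => ((y j : ℝ) : ℂ)) :=
  (Complex.ofRealCLM.comp (EuclideanSpace.proj (𝕜 := ℝ) j)).hasTemperateGrowth

/-- Multiplication by the `j`-th coordinate. -/
def mulS (j : Fin d) : 𝓢(Conf d, ℂ) →L[ℂ] 𝓢(Conf d, ℂ) :=
  SchwartzMap.smulLeftCLM ℂ (fun y : Conf d => ((y j : ℝ) : ℂ))

@[simp] lemma mulS_apply (j : Fin d) (f : 𝓢(Conf d, ℂ)) (y : Conf d) :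
    mulS j f y = ((y j : ℝ) : ℂ) * f y := by
  rw [mulS, SchwartzMap.smulLeftCLM_apply_apply (hasTemperateGrowth_coord j)]; rfl

/-- The partial derivative `∂_j`. -/
def gradS (j : Fin d) : 𝓢(Conf d, ℂ) →L[ℂ] 𝓢(Conf d, ℂ) :=
  LineDeriv.lineDerivOpCLM ℂ 𝓢(Conf d, ℂ) (basisVec j)

lemma gradS_apply (j : Fin d) (f : 𝓢(Conf d, ℂ)) (y : Conf d) :
    gradS j f y = lineDeriv ℝ (f : Conf d → ℂ) y (basisVec j) :=
  SchwartzMap.lineDerivOp_apply _ _ _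

lemma inner_mulS (j : Fin d) (f g : 𝓢(Conf d, ℂ)) :
    ⟪sL2 (mulS j f), sL2 g⟫_ℂ = ⟪sL2 f, sL2 (mulS j g)⟫_ℂ := by
  rw [inner_sL2_sL2, inner_sL2_sL2]
  congr 1; ext y; simp; ring

lemma inner_gradS (j : Fin d) (f g : 𝓢(Conf d, ℂ)) :
    ⟪sL2 (gradS j f), sL2 g⟫_ℂ = -⟪sL2 f, sL2 (gradS j g)⟫_ℂ := by
  rw [inner_sL2_sL2, inner_sL2_sL2]
  have := SchwartzMap.integral_mul_lineDerivOp_right_eq_neg_left (μ := volume) (conjS f) g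
    (basisVec j)
  simp only [conjS_apply, lineDerivOp_conjS] at this
  change _ = -∫ y, (starRingEnd ℂ) (f y) * ∂_{basisVec j} g y
  rw [this, neg_neg]; rfl

/-- The observables acting on Schwartz functions. -/
def actS (ħ : ℝ) : Obs d → 𝓢(Conf d, ℂ) →L[ℂ] 𝓢(Conf d, ℂ)
  | .osc => ∑ j, ((mulS j).comp (mulS j) - ((ħ : ℂ) ^ 2) • (gradS j).comp (gradS j))
  | .pos j => mulS j
  | .gradPlus j => (ħ : ℂ) • gradS j
  | .gradMinus j => -((ħ : ℂ) • gradS j)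

lemma actS_coe (ħ : ℝ) (O : Obs d) (f : 𝓢(Conf d, ℂ)) :
    (actS ħ O f : Conf d → ℂ) = O.act ħ f := by
  ext y
  cases O with
  | osc =>
    have h : ((‖y‖ ^ 2 : ℝ) : ℂ) = ∑ j, ((y j : ℝ) : ℂ) ^ 2 := by
      rw [EuclideanSpace.norm_sq_eq]; push_cast; simp [← Complex.ofReal_pow]
    have h2 : ∀ j : Fin d, gradS j (gradS j f) y =
        lineDeriv ℝ (fun y' => lineDeriv ℝ (f : Conf d → ℂ) y' (basisVec j)) y (basisVec j) := by
      intro j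
      rw [gradS_apply]
      congr 1
      exact funext fun y' => gradS_apply j f y'
    simp only [actS, Obs.act, sum_apply, sub_apply, ContinuousLinearMap.comp_apply,
      smul_apply, mulS_apply, h, h2, Finset.sum_sub_distrib, Finset.mul_sum, Finset.sum_mul,
      smul_eq_mul]
    rw [sub_eq_neg_add]
    congr 1
    exact Finset.sum_congr rfl fun j _ => by ring
  | pos j => simp [actS, Obs.act]
  | gradPlus j => simp [actS, Obs.act, gradS_apply]
  | gradMinus j => simp [actS, Obs.act, gradS_apply]

lemma isImage_iff (ħ : ℝ) (O : Obs d) (u w : L2 d) :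
    O.IsImage ħ u w ↔ ∀ g : 𝓢(Conf d, ℂ), ⟪sL2 (actS ħ O.adj g), u⟫_ℂ = ⟪sL2 g, w⟫_ℂ := by
  simp only [Obs.IsImage, ← actS_coe, toL2_coe]

end SemiWass
end

noncomputable section
namespace SemiWass

/-! ### Wave packets and the resolution of the identity -/

section WavePacket
open scoped FourierTransform
variable {d : ℕ}

lemma enorm_sq_L2 (u : L2 d) : ‖u‖ₑ ^ 2 = ∫⁻ y, ‖u y‖ₑ ^ 2 := by
  have h := eLpNorm_eq_lintegral_rpow_enorm_toReal (μ := (volume : Measure (Conf d)))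
    (f := (u : Conf d → ℂ)) (p := 2) (by norm_num) (by norm_num)
  rw [Lp.enorm_def, h]
  simp only [ENNReal.toReal_ofNat, ← ENNReal.rpow_natCast, ← ENNReal.rpow_mul, Nat.cast_ofNat]
  norm_num

lemma lintegral_enorm_sq_schwartz (f : 𝓢(Conf d, ℂ)) :
    ∫⁻ y, ‖f y‖ₑ ^ 2 = ‖sL2 f‖ₑ ^ 2 := by
  rw [enorm_sq_L2]
  refine lintegral_congr_ae ?_
  filter_upwards [sL2_coeFn f] with y hy
  rw [hy]

lemma enorm_sq_eq_ofReal {E : Type*} [SeminormedAddCommGroup E] (u : E) :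
    ‖u‖ₑ ^ 2 = ENNReal.ofReal (‖u‖ ^ 2) := by
  rw [← ofReal_norm, ENNReal.ofReal_pow (norm_nonneg _)]

lemma lintegral_comp_smul_conf (f : Conf d → ℝ≥0∞) (hf : Measurable f) (r : ℝ) (hr : 0 < r) :
    ∫⁻ y, f (r⁻¹ • y) = ENNReal.ofReal (r ^ d) * ∫⁻ y, f y := by
  have h := Measure.map_addHaar_smul (volume : Measure (Conf d)) (inv_ne_zero hr.ne')
  rw [← lintegral_map (μ := (volume : Measure (Conf d))) hf
    (g := fun y : Conf d => r⁻¹ • y) (by fun_prop), h, lintegral_smul_measure]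
  simp only [finrank_euclideanSpace, Fintype.card_fin, inv_pow, inv_inv, smul_eq_mul]
  rw [abs_of_pos (by positivity)]

lemma hasTemperateGrowth_phase (ħ : ℝ) (z : Phase d) : Function.HasTemperateGrowth
    (fun y : Conf d => Complex.exp (Complex.I * ((⟪z.2, y - z.1⟫_ℝ / ħ : ℝ) : ℂ))) := by
  have h1 : Function.HasTemperateGrowth (fun y : Conf d => ⟪z.2, y - z.1⟫_ℝ / ħ) := by
    have : (fun y : Conf d => ⟪z.2, y - z.1⟫_ℝ / ħ) =
        fun y => ħ⁻¹ * (⟪z.2, y⟫_ℝ - ⟪z.2, z.1⟫_ℝ) := by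
      ext y; rw [inner_sub_right]; ring
    rw [this]
    exact (Function.HasTemperateGrowth.const _).mul
      ((Function.hasTemperateGrowth_inner_right z.2).sub (Function.HasTemperateGrowth.const _))
  exact hasTemperateGrowth_cexp_I.comp h1

/-- The wave packet `y ↦ G(y - x) e^{iξ·(y-x)/ħ}` with window `G`. -/
def wp (ħ : ℝ) (G : 𝓢(Conf d, ℂ)) (z : Phase d) : 𝓢(Conf d, ℂ) :=
  SchwartzMap.smulLeftCLM ℂ
    (fun y : Conf d => Complex.exp (Complex.I * ((⟪z.2, y - z.1⟫_ℝ / ħ : ℝ) : ℂ)))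
    (SchwartzMap.compSubConstCLM ℂ z.1 G)

lemma wp_apply (ħ : ℝ) (G : 𝓢(Conf d, ℂ)) (z : Phase d) (y : Conf d) :
    wp ħ G z y = Complex.exp (Complex.I * ((⟪z.2, y - z.1⟫_ℝ / ħ : ℝ) : ℂ)) * G (y - z.1) := by
  rw [wp, SchwartzMap.smulLeftCLM_apply_apply (hasTemperateGrowth_phase ħ z)]; rfl

lemma stronglyMeasurable_inner_wp (ħ : ℝ) (G : 𝓢(Conf d, ℂ)) (u : L2 d) :
    StronglyMeasurable (fun z : Phase d => ⟪sL2 (wp ħ G z), u⟫_ℂ) := by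
  simp only [inner_sL2_left, wp_apply]
  refine StronglyMeasurable.integral_prod_right
    (f := fun (q : Phase d) (y : Conf d) => (starRingEnd ℂ)
      (Complex.exp (Complex.I * ((⟪q.2, y - q.1⟫_ℝ / ħ : ℝ) : ℂ)) * G (y - q.1)) * u y) ?_
  refine StronglyMeasurable.mul ?_ ((Lp.stronglyMeasurable u).comp_measurable measurable_snd)
  have hG := G.continuous
  exact Continuous.stronglyMeasurable (by fun_prop)

/-- The product of two Schwartz functions. -/
def prodS (f g : 𝓢(Conf d, ℂ)) : 𝓢(Conf d, ℂ) :=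
  SchwartzMap.pairing (ContinuousLinearMap.mul ℂ ℂ) f g

@[simp] lemma prodS_apply (f g : 𝓢(Conf d, ℂ)) (y : Conf d) : prodS f g y = f y * g y := rfl

/-- A short-time Fourier transform: for fixed x, the pairing as a function of ξ is, up to a phase,
the Fourier transform of the windowed function. The rescaling by 2πħ reconciles e^{iξ·y/ħ} with the
convention e^{2πi ξ·y}. -/
lemma inner_wp_sL2 (ħ : ℝ) (G f : 𝓢(Conf d, ℂ)) (z : Phase d) :
    ⟪sL2 (wp ħ G z), sL2 f⟫_ℂ = Complex.exp (Complex.I * ((⟪z.2, z.1⟫_ℝ / ħ : ℝ) : ℂ)) *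
      𝓕 (prodS (conjS (SchwartzMap.compSubConstCLM ℂ z.1 G)) f) ((2 * Real.pi * ħ)⁻¹ • z.2) := by
  rw [inner_sL2_sL2, SchwartzMap.fourier_coe, Real.fourier_eq', ← integral_const_mul]
  congr 1; ext y
  rw [wp_apply, map_mul, ← Complex.exp_conj, smul_eq_mul, prodS_apply, conjS_apply,
    SchwartzMap.compSubConstCLM_apply, ← mul_assoc, ← mul_assoc, ← Complex.exp_add]
  congr 3
  rw [map_mul, Complex.conj_I, Complex.conj_ofReal, inner_smul_right, inner_sub_right,
    real_inner_comm y z.2]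
  push_cast
  have : (Real.pi : ℂ) ≠ 0 := by exact_mod_cast Real.pi_ne_zero
  by_cases h : ħ = 0
  · simp [h]
  have h' : (ħ : ℂ) ≠ 0 := by exact_mod_cast h
  field_simp
  ring

lemma norm_add_sq_sL2 (G₁ G₂ : 𝓢(Conf d, ℂ)) (h : ⟪sL2 G₁, sL2 G₂⟫_ℂ = 0) (a b : ℂ) :
    ∫⁻ t, ‖(starRingEnd ℂ) (G₁ t) * a + (starRingEnd ℂ) (G₂ t) * b‖ₑ ^ 2 =
      ‖sL2 G₁‖ₑ ^ 2 * ‖a‖ₑ ^ 2 + ‖sL2 G₂‖ₑ ^ 2 * ‖b‖ₑ ^ 2 := by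
  have e : ∀ t, ‖(starRingEnd ℂ) (G₁ t) * a + (starRingEnd ℂ) (G₂ t) * b‖ₑ ^ 2 =
      ‖(((starRingEnd ℂ) a) • G₁ + ((starRingEnd ℂ) b) • G₂) t‖ₑ ^ 2 := by
    intro t
    rw [add_apply, smul_apply, smul_apply, smul_eq_mul, smul_eq_mul, ← RCLike.enorm_conj]
    simp [mul_comm]
  simp_rw [e, lintegral_enorm_sq_schwartz, enorm_sq_eq_ofReal]
  rw [← ENNReal.ofReal_mul (by positivity), ← ENNReal.ofReal_mul (by positivity),
    ← ENNReal.ofReal_add (by positivity) (by positivity), map_add, map_smul, map_smul]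
  congr 1
  have h0 : ⟪(starRingEnd ℂ) a • sL2 G₁, (starRingEnd ℂ) b • sL2 G₂⟫_ℂ = 0 := by
    rw [inner_smul_left, inner_smul_right, h]; simp
  have := norm_add_sq_eq_norm_sq_add_norm_sq_of_inner_eq_zero _ _ h0
  rw [sq, this, norm_smul, norm_smul, RCLike.norm_conj, RCLike.norm_conj]
  ring

/-- Plancherel in ξ at fixed x, then Tonelli; the remaining integral over x only sees translates of
the windows, and their orthogonality removes the cross term. -/
lemma lintegral_wp_schwartz (ħ : ℝ) (hħ : 0 < ħ) (G₁ G₂ : 𝓢(Conf d, ℂ))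
    (h : ⟪sL2 G₁, sL2 G₂⟫_ℂ = 0) (f g : 𝓢(Conf d, ℂ)) :
    ∫⁻ z : Phase d, ‖⟪sL2 (wp ħ G₁ z), sL2 f⟫_ℂ + ⟪sL2 (wp ħ G₂ z), sL2 g⟫_ℂ‖ₑ ^ 2 =
      ENNReal.ofReal ((2 * Real.pi * ħ) ^ d) *
        (‖sL2 G₁‖ₑ ^ 2 * ‖sL2 f‖ₑ ^ 2 + ‖sL2 G₂‖ₑ ^ 2 * ‖sL2 g‖ₑ ^ 2) := by
  have hm : Measurable (fun z : Phase d =>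
      ‖⟪sL2 (wp ħ G₁ z), sL2 f⟫_ℂ + ⟪sL2 (wp ħ G₂ z), sL2 g⟫_ℂ‖ₑ ^ 2) :=
    (((stronglyMeasurable_inner_wp ħ G₁ _).add
      (stronglyMeasurable_inner_wp ħ G₂ _)).measurable.enorm).pow_const 2
  rw [Measure.volume_eq_prod, lintegral_prod _ hm.aemeasurable]
  set A : Conf d → 𝓢(Conf d, ℂ) := fun x =>
    prodS (conjS (SchwartzMap.compSubConstCLM ℂ x G₁)) f +
    prodS (conjS (SchwartzMap.compSubConstCLM ℂ x G₂)) g with hA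
  have hAa : ∀ x y, A x y = (starRingEnd ℂ) (G₁ (y - x)) * f y + (starRingEnd ℂ) (G₂ (y - x)) * g y :=
    fun x y => rfl
  have h1 : ∀ x : Conf d, ∫⁻ ξ : Conf d, ‖⟪sL2 (wp ħ G₁ (x, ξ)), sL2 f⟫_ℂ +
      ⟪sL2 (wp ħ G₂ (x, ξ)), sL2 g⟫_ℂ‖ₑ ^ 2 =
      ENNReal.ofReal ((2 * Real.pi * ħ) ^ d) * ∫⁻ y, ‖A x y‖ₑ ^ 2 := by
    intro x
    have e : ∀ ξ : Conf d, ‖⟪sL2 (wp ħ G₁ (x, ξ)), sL2 f⟫_ℂ +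
      ⟪sL2 (wp ħ G₂ (x, ξ)), sL2 g⟫_ℂ‖ₑ ^ 2 = ‖𝓕 (A x) ((2 * Real.pi * ħ)⁻¹ • ξ)‖ₑ ^ 2 := by
      intro ξ
      rw [inner_wp_sL2, inner_wp_sL2, ← mul_add, enorm_mul, FourierTransform.fourier_add,
        add_apply]
      rw [show ‖Complex.exp (Complex.I * ((⟪ξ, x⟫_ℝ / ħ : ℝ) : ℂ))‖ₑ = 1 by
        rw [← ofReal_norm, mul_comm, Complex.norm_exp_ofReal_mul_I]; simp, one_mul]
    simp_rw [e]
    rw [lintegral_comp_smul_conf (fun η => ‖𝓕 (A x) η‖ₑ ^ 2)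
      ((𝓕 (A x)).continuous.enorm.measurable.pow_const 2) _ (by positivity),
      lintegral_enorm_sq_schwartz, lintegral_enorm_sq_schwartz]
    congr 2
    rw [← ofReal_norm, ← ofReal_norm]
    congr 1
    exact SchwartzMap.norm_fourier_toL2_eq (A x)
  simp_rw [h1]
  have hcont : Continuous (fun q : Conf d × Conf d => A q.1 q.2) := by
    simp only [hAa]
    have := G₁.continuous
    have := G₂.continuous
    have := f.continuous
    have := g.continuous
    fun_prop
  have hmA : Measurable (fun q : Conf d × Conf d => ‖A q.1 q.2‖ₑ ^ 2) :=
    hcont.enorm.measurable.pow_const 2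
  rw [lintegral_const_mul' _ _ ENNReal.ofReal_ne_top]
  congr 1
  rw [lintegral_lintegral_swap hmA.aemeasurable]
  have h2 : ∀ y : Conf d, ∫⁻ x : Conf d, ‖A x y‖ₑ ^ 2 =
      ‖sL2 G₁‖ₑ ^ 2 * ‖f y‖ₑ ^ 2 + ‖sL2 G₂‖ₑ ^ 2 * ‖g y‖ₑ ^ 2 := by
    intro y
    rw [← norm_add_sq_sL2 G₁ G₂ h (f y) (g y)]
    simp only [hAa]
    exact lintegral_sub_left_eq_self (fun t => ‖(starRingEnd ℂ) (G₁ t) * f y +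
      (starRingEnd ℂ) (G₂ t) * g y‖ₑ ^ 2) y
  simp_rw [h2]
  have hf : Measurable (fun y => ‖f y‖ₑ ^ 2) := f.continuous.enorm.measurable.pow_const 2
  have hg : Measurable (fun y => ‖g y‖ₑ ^ 2) := g.continuous.enorm.measurable.pow_const 2
  rw [lintegral_add_left (hf.const_mul _), lintegral_const_mul _ hf, lintegral_const_mul _ hg,
    lintegral_enorm_sq_schwartz, lintegral_enorm_sq_schwartz]

/-- A quadratic identity `∫ |ℓ_z(u)|² dz = q(u)` extends from a dense set. -/
lemma lintegral_enorm_sq_eq_of_dense {H α : Type*} [NormedAddCommGroup H] [NormedSpace ℂ H]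
    [MeasurableSpace α] {μ : Measure α} (l : α → H →L[ℂ] ℂ) (hm : ∀ u, Measurable fun z => l z u)
    (q : H → ℝ≥0∞) (hqc : Continuous q) (hneg : ∀ u, q (-u) = q u) (hfin : ∀ u, q u ≠ ∞)
    (D : Set H) (hD : Dense D) (heq : ∀ u ∈ D, ∫⁻ z, ‖l z u‖ₑ ^ 2 ∂μ = q u) (u : H) :
    ∫⁻ z, ‖l z u‖ₑ ^ 2 ∂μ = q u := by
  have hm2 : ∀ u, Measurable fun z => ‖l z u‖ₑ ^ 2 := fun u => (hm u).enorm.pow_const 2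
  -- Fatou along an approximating sequence gives one inequality.
  have hle : ∀ u, ∫⁻ z, ‖l z u‖ₑ ^ 2 ∂μ ≤ q u := by
    intro u
    obtain ⟨v, hv, hlim⟩ := mem_closure_iff_seq_limit.1 (hD u)
    have hfat := lintegral_liminf_le (μ := μ) (u := atTop) (fun n => hm2 (v n))
    have e1 : ∀ z, liminf (fun n => ‖l z (v n)‖ₑ ^ 2) atTop = ‖l z u‖ₑ ^ 2 := by
      intro z
      apply Tendsto.liminf_eq
      exact ((ENNReal.continuous_pow 2).tendsto _).comp
        ((continuous_enorm.tendsto _).comp (((l z).continuous.tendsto u).comp hlim))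
    simp only [e1] at hfat
    refine hfat.trans (le_of_eq ?_)
    simp only [heq _ (hv _)]
    exact ((hqc.tendsto u).comp hlim).liminf_eq
  refine le_antisymm (hle u) ?_
  -- The reverse inequality uses the parallelogram law for u - v and v: as v tends to u, the vector
  -- u - 2v tends to -u, where the upper bound already holds.
  have hpar : ∀ v, ∫⁻ z, ‖l z u‖ₑ ^ 2 ∂μ + ∫⁻ z, ‖l z (u - (2 : ℂ) • v)‖ₑ ^ 2 ∂μ =
      2 * ∫⁻ z, ‖l z (u - v)‖ₑ ^ 2 ∂μ + 2 * ∫⁻ z, ‖l z v‖ₑ ^ 2 ∂μ := by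
    intro v
    rw [← lintegral_add_left (hm2 u), ← lintegral_const_mul _ (hm2 _),
      ← lintegral_const_mul _ (hm2 _), ← lintegral_add_left ((hm2 _).const_mul _)]
    refine lintegral_congr fun z => ?_
    simp only [map_sub, map_smul, enorm_sq_eq_ofReal, smul_eq_mul]
    rw [← ENNReal.ofReal_add (by positivity) (by positivity),
      show (2 : ℝ≥0∞) = ENNReal.ofReal 2 by simp, ← ENNReal.ofReal_mul (by norm_num),
      ← ENNReal.ofReal_mul (by norm_num), ← ENNReal.ofReal_add (by positivity) (by positivity)]
    congr 1
    have := parallelogram_law_with_norm ℝ (l z u - l z v) (l z v)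
    rw [sub_add_cancel, show l z u - l z v - l z v = l z u - 2 * l z v by ring] at this
    nlinarith
  obtain ⟨v, hv, hlim⟩ := mem_closure_iff_seq_limit.1 (hD u)
  have hn : ∀ n, 2 * q (v n) ≤ ∫⁻ z, ‖l z u‖ₑ ^ 2 ∂μ + q (u - (2 : ℂ) • v n) := by
    intro n
    have e := hpar (v n)
    rw [heq _ (hv n)] at e
    calc 2 * q (v n) ≤ _ := le_add_self
      _ = _ := e.symm
      _ ≤ _ := by gcongr; exact hle _
  have l1 : Tendsto (fun n => 2 * q (v n)) atTop (𝓝 (2 * q u)) :=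
    ENNReal.Tendsto.const_mul ((hqc.tendsto _).comp hlim) (Or.inr (by simp))
  have l2 : Tendsto (fun n => ∫⁻ z, ‖l z u‖ₑ ^ 2 ∂μ + q (u - (2 : ℂ) • v n)) atTop
      (𝓝 (∫⁻ z, ‖l z u‖ₑ ^ 2 ∂μ + q (u - (2 : ℂ) • u))) :=
    tendsto_const_nhds.add ((hqc.tendsto _).comp (tendsto_const_nhds.sub (hlim.const_smul _)))
  have := le_of_tendsto_of_tendsto' l1 l2 hn
  rw [show u - (2 : ℂ) • u = -u by rw [two_smul]; abel, hneg, two_mul] at this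
  exact (ENNReal.add_le_add_iff_right (hfin _)).1 this

/-- The orthogonality relations for wave packets with orthogonal windows `G₁` and `G₂`. -/
theorem lintegral_wp (ħ : ℝ) (hħ : 0 < ħ) (G₁ G₂ : 𝓢(Conf d, ℂ))
    (h : ⟪sL2 G₁, sL2 G₂⟫_ℂ = 0) (κ p : L2 d) :
    ∫⁻ z : Phase d, ‖⟪sL2 (wp ħ G₁ z), κ⟫_ℂ + ⟪sL2 (wp ħ G₂ z), p⟫_ℂ‖ₑ ^ 2 =
      ENNReal.ofReal ((2 * Real.pi * ħ) ^ d) *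
        (‖sL2 G₁‖ₑ ^ 2 * ‖κ‖ₑ ^ 2 + ‖sL2 G₂‖ₑ ^ 2 * ‖p‖ₑ ^ 2) := by
  set q : L2 d × L2 d → ℝ≥0∞ := fun u => ENNReal.ofReal ((2 * Real.pi * ħ) ^ d) *
        (‖sL2 G₁‖ₑ ^ 2 * ‖u.1‖ₑ ^ 2 + ‖sL2 G₂‖ₑ ^ 2 * ‖u.2‖ₑ ^ 2) with hq
  have hqr : q = fun u => ENNReal.ofReal ((2 * Real.pi * ħ) ^ d *
        (‖sL2 G₁‖ ^ 2 * ‖u.1‖ ^ 2 + ‖sL2 G₂‖ ^ 2 * ‖u.2‖ ^ 2)) := by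
    ext u
    simp only [hq, enorm_sq_eq_ofReal]
    rw [← ENNReal.ofReal_mul (by positivity), ← ENNReal.ofReal_mul (by positivity),
      ← ENNReal.ofReal_add (by positivity) (by positivity), ← ENNReal.ofReal_mul (by positivity)]
  -- The pair (κ, p) is a single vector of L² × L², on which the sum of the two pairings is one
  -- linear form.
  refine lintegral_enorm_sq_eq_of_dense (H := L2 d × L2 d) (μ := (volume : Measure (Phase d)))
    (fun z => (innerSL ℂ (sL2 (wp ħ G₁ z))).coprod (innerSL ℂ (sL2 (wp ħ G₂ z))))
    (fun u => ?_) q ?_ (fun u => ?_) (fun u => ?_)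
    (Set.range (sL2 : 𝓢(Conf d, ℂ) → L2 d) ×ˢ Set.range (sL2 : 𝓢(Conf d, ℂ) → L2 d))
    (denseRange_sL2.prod denseRange_sL2) ?_ (κ, p)
  · exact ((stronglyMeasurable_inner_wp ħ G₁ _).add
      (stronglyMeasurable_inner_wp ħ G₂ _)).measurable
  · rw [hqr]
    exact ENNReal.continuous_ofReal.comp (by fun_prop)
  · rw [hqr]; simp
  · rw [hqr]; exact ENNReal.ofReal_ne_top
  · rintro ⟨_, _⟩ ⟨⟨f, rfl⟩, ⟨g, rfl⟩⟩
    exact lintegral_wp_schwartz ħ hħ G₁ G₂ h f g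

end WavePacket

end SemiWass
end

noncomputable section
namespace SemiWass

/-! ### Hermite functions -/

section Hermite
open scoped LineDeriv

/-- The Appell property, by induction from the recursion He_{n+1} = X He_n - He_n'. -/
lemma derivative_hermite_succ (n : ℕ) :
    Polynomial.derivative (Polynomial.hermite (n + 1)) =
      ((n + 1 : ℕ) : Polynomial ℤ) * Polynomial.hermite n := by
  induction n with
  | zero => simp [Polynomial.hermite_succ]
  | succ n ih =>
    conv_lhs => rw [Polynomial.hermite_succ (n + 1), ih]
    rw [Polynomial.derivative_sub, Polynomial.derivative_mul, Polynomial.derivative_X, ih,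
      Polynomial.derivative_mul, Polynomial.derivative_natCast]
    conv_rhs => rw [Polynomial.hermite_succ n]
    conv_lhs => rw [Polynomial.hermite_succ n]
    push_cast
    ring

/-- `s He_n(s) = He_{n+1}(s) + He_n'(s)` with `He_n' = n He_{n-1}`. -/
lemma aeval_derivative_hermite (n : ℕ) (s : ℝ) :
    Polynomial.aeval s (Polynomial.derivative (Polynomial.hermite n)) =
      n * Polynomial.aeval s (Polynomial.hermite (n - 1)) := by
  cases n with
  | zero => simp
  | succ n => rw [derivative_hermite_succ, map_mul, map_natCast, Nat.add_sub_cancel]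

lemma mul_aeval_hermite (n : ℕ) (s : ℝ) :
    s * Polynomial.aeval s (Polynomial.hermite n) =
      Polynomial.aeval s (Polynomial.hermite (n + 1)) +
        n * Polynomial.aeval s (Polynomial.hermite (n - 1)) := by
  rw [Polynomial.hermite_succ, map_sub, map_mul, Polynomial.aeval_X, aeval_derivative_hermite]
  ring

/-- At k = 0 both sides vanish, so the truncated k - 1 is harmless; for this reason the ladder
relations below need no separate case for the lowest level. -/
lemma inv_sqrt_factorial_pred (k : ℕ) :
    (k : ℝ) * (Real.sqrt (k.factorial : ℝ))⁻¹ =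
      Real.sqrt k * (Real.sqrt ((k - 1).factorial : ℝ))⁻¹ := by
  cases k with
  | zero => simp
  | succ k =>
    have h1 : (0:ℝ) < Real.sqrt (k + 1 : ℝ) := Real.sqrt_pos.2 (by positivity)
    have h2 : (0:ℝ) < Real.sqrt (k.factorial : ℝ) := Real.sqrt_pos.2 (by positivity)
    rw [Nat.factorial_succ, Nat.cast_mul, Real.sqrt_mul (by positivity), Nat.add_sub_cancel]
    push_cast
    field_simp
    rw [Real.sq_sqrt (by positivity)]

lemma inv_sqrt_factorial_succ (k : ℕ) :
    (Real.sqrt (k.factorial : ℝ))⁻¹ =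
      Real.sqrt (k + 1) * (Real.sqrt ((k + 1).factorial : ℝ))⁻¹ := by
  have h1 : (0:ℝ) < Real.sqrt (k + 1 : ℝ) := Real.sqrt_pos.2 (by positivity)
  have h2 : (0:ℝ) < Real.sqrt (k.factorial : ℝ) := Real.sqrt_pos.2 (by positivity)
  rw [Nat.factorial_succ, Nat.cast_mul, Real.sqrt_mul (by positivity)]
  push_cast
  field_simp

lemma sqrt_two_div_mul (ħ : ℝ) (hħ : 0 < ħ) : Real.sqrt (2 / ħ) * Real.sqrt (ħ / 2) = 1 := by
  rw [← Real.sqrt_mul (by positivity), show 2 / ħ * (ħ / 2) = 1 by field_simp, Real.sqrt_one]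

lemma mul_hermite1 (ħ : ℝ) (hħ : 0 < ħ) (k : ℕ) (x : ℝ) :
    x * hermite1 ħ k x = Real.sqrt (ħ / 2) *
      (Real.sqrt k * hermite1 ħ (k - 1) x + Real.sqrt (k + 1) * hermite1 ħ (k + 1) x) := by
  have h := mul_aeval_hermite k (Real.sqrt (2 / ħ) * x)
  have h3 := sqrt_two_div_mul ħ hħ
  have hx : x = Real.sqrt (ħ / 2) * (Real.sqrt (2 / ħ) * x) := by
    rw [← mul_assoc, mul_comm (Real.sqrt (ħ / 2)), h3, one_mul]
  simp only [hermite1]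
  have e1 := inv_sqrt_factorial_pred k
  have e2 := inv_sqrt_factorial_succ k
  set E := Real.exp (-(x ^ 2) / (2 * ħ))
  set A := (Real.pi * ħ) ^ (-(1 / 4) : ℝ)
  set P := Polynomial.aeval (Real.sqrt (2 / ħ) * x) (Polynomial.hermite k)
  set P' := Polynomial.aeval (Real.sqrt (2 / ħ) * x) (Polynomial.hermite (k - 1))
  set P'' := Polynomial.aeval (Real.sqrt (2 / ħ) * x) (Polynomial.hermite (k + 1))
  set f := (Real.sqrt (k.factorial : ℝ))⁻¹
  calc x * (A * f * P * E)
      = Real.sqrt (ħ / 2) * (A * E * f * (Real.sqrt (2 / ħ) * x * P)) := by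
        conv_lhs => rw [hx]
        ring
    _ = Real.sqrt (ħ / 2) * (A * E * ((k * f) * P' + f * P'')) := by rw [h]; ring
    _ = _ := by rw [e1]; conv_lhs => rw [e2]
                ring

lemma hasDerivAt_hermite1 (ħ : ℝ) (hħ : 0 < ħ) (k : ℕ) (x : ℝ) :
    HasDerivAt (hermite1 ħ k) (ħ⁻¹ * (Real.sqrt (ħ / 2) *
      (Real.sqrt k * hermite1 ħ (k - 1) x - Real.sqrt (k + 1) * hermite1 ħ (k + 1) x))) x := by
  have h1 : HasDerivAt (fun x : ℝ => Polynomial.aeval (Real.sqrt (2 / ħ) * x)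
      (Polynomial.hermite k)) (Polynomial.aeval (Real.sqrt (2 / ħ) * x)
      (Polynomial.derivative (Polynomial.hermite k)) * (Real.sqrt (2 / ħ) * 1)) x := by
    exact ((Polynomial.hermite k).hasDerivAt_aeval _).comp x ((hasDerivAt_id x).const_mul _)
  have h2 : HasDerivAt (fun x : ℝ => Real.exp (-(x ^ 2) / (2 * ħ)))
      (Real.exp (-(x ^ 2) / (2 * ħ)) * (-(2 * x) / (2 * ħ))) x := by
    have := (((hasDerivAt_pow 2 x).neg).div_const (2 * ħ)).exp
    simpa using this
  have h3 := (h1.const_mul ((Real.pi * ħ) ^ (-(1 / 4) : ℝ) * (Real.sqrt (k.factorial : ℝ))⁻¹)).mul h2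
  refine h3.congr_deriv ?_
  rw [aeval_derivative_hermite]
  have hm := mul_hermite1 ħ hħ k x
  have e1 := inv_sqrt_factorial_pred k
  have h4 := sqrt_two_div_mul ħ hħ
  have h5 : Real.sqrt (2 / ħ) = 2 * ħ⁻¹ * Real.sqrt (ħ / 2) := by
    have : Real.sqrt (ħ / 2) * Real.sqrt (ħ / 2) = ħ / 2 := Real.mul_self_sqrt (by positivity)
    calc Real.sqrt (2 / ħ) = Real.sqrt (2 / ħ) * (2 * ħ⁻¹ * (ħ / 2)) := by field_simp
      _ = 2 * ħ⁻¹ * (Real.sqrt (2 / ħ) * Real.sqrt (ħ / 2)) * Real.sqrt (ħ / 2) := by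
        linear_combination (-(2 * ħ⁻¹ * Real.sqrt (2 / ħ))) * this
      _ = _ := by rw [h4]; ring
  -- The polynomial factor yields the lowering term and the Gaussian factor yields -x/ħ; eliminating
  -- x by `mul_hermite1` gives the antisymmetric ladder form.
  have h6 : ħ⁻¹ * (Real.sqrt (ħ / 2) *
      (Real.sqrt k * hermite1 ħ (k - 1) x - Real.sqrt (k + 1) * hermite1 ħ (k + 1) x)) =
      Real.sqrt (2 / ħ) * (Real.sqrt k * hermite1 ħ (k - 1) x) - ħ⁻¹ * (x * hermite1 ħ k x) := by
    rw [hm, h5]; ring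
  rw [h6]
  simp only [hermite1]
  set E := Real.exp (-(x ^ 2) / (2 * ħ))
  set A := (Real.pi * ħ) ^ (-(1 / 4) : ℝ)
  set P := Polynomial.aeval (Real.sqrt (2 / ħ) * x) (Polynomial.hermite k)
  set P' := Polynomial.aeval (Real.sqrt (2 / ħ) * x) (Polynomial.hermite (k - 1))
  set f := (Real.sqrt (k.factorial : ℝ))⁻¹
  calc _ = A * (k * f) * P' * E * Real.sqrt (2 / ħ) - ħ⁻¹ * (x * (A * f * P * E)) := by
        field_simp; ring
    _ = _ := by rw [e1]; ring

variable {d : ℕ}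

/-- The multi-indices `m + e_j` and `m - e_j`. -/
def up (m : Fin d → ℕ) (j : Fin d) : Fin d → ℕ := Function.update m j (m j + 1)

/-- See `up`. -/
def dn (m : Fin d → ℕ) (j : Fin d) : Fin d → ℕ := Function.update m j (m j - 1)

lemma hermiteFun_update (ħ : ℝ) (m : Fin d → ℕ) (j : Fin d) (k : ℕ) (y : Conf d) :
    hermiteFun ħ (Function.update m j k) y =
      ((hermite1 ħ k (y j) * ∏ l ∈ Finset.univ.erase j, hermite1 ħ (m l) (y l) : ℝ) : ℂ) := by
  rw [hermiteFun, ← Finset.mul_prod_erase _ _ (Finset.mem_univ j), Function.update_self]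
  congr 2
  exact Finset.prod_congr rfl fun l hl => by rw [Function.update_of_ne (Finset.ne_of_mem_erase hl)]

lemma hermiteFun_eq (ħ : ℝ) (m : Fin d → ℕ) (j : Fin d) (y : Conf d) :
    hermiteFun ħ m y =
      ((hermite1 ħ (m j) (y j) * ∏ l ∈ Finset.univ.erase j, hermite1 ħ (m l) (y l) : ℝ) : ℂ) := by
  rw [← hermiteFun_update, Function.update_eq_self]

lemma hasTemperateGrowth_aeval_coord (c : ℝ) (p : Polynomial ℤ) (l : Fin d) :
    Function.HasTemperateGrowth (fun y : Conf d => Polynomial.aeval (c * y l) p) := by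
  simp only [Polynomial.aeval_eq_sum_range]
  refine Function.HasTemperateGrowth.sum fun i _ => ?_
  simp only [zsmul_eq_mul]
  refine (Function.HasTemperateGrowth.const _).mul (Function.HasTemperateGrowth.pow ?_ i)
  exact (Function.HasTemperateGrowth.const c).mul
    (EuclideanSpace.proj (𝕜 := ℝ) l).hasTemperateGrowth

lemma hasTemperateGrowth_prod {ι E : Type*} [NormedAddCommGroup E] [NormedSpace ℝ E]
    (s : Finset ι) (f : ι → E → ℝ)
    (h : ∀ i ∈ s, Function.HasTemperateGrowth (f i)) :
    Function.HasTemperateGrowth (fun y => ∏ i ∈ s, f i y) := by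
  classical
  induction s using Finset.induction_on with
  | empty => simpa only [Finset.prod_empty] using Function.HasTemperateGrowth.const (1 : ℝ)
  | insert a s ha ih =>
    simp only [Finset.prod_insert ha]
    exact (h a (Finset.mem_insert_self a s)).mul
      (ih fun i hi => h i (Finset.mem_insert_of_mem hi))

lemma hasTemperateGrowth_hermite_prod (ħ : ℝ) (m : Fin d → ℕ) :
    Function.HasTemperateGrowth (fun y : Conf d => ((∏ l, ((Real.pi * ħ) ^ (-(1 / 4) : ℝ) *
      (Real.sqrt ((m l).factorial : ℝ))⁻¹ *
      Polynomial.aeval (Real.sqrt (2 / ħ) * y l) (Polynomial.hermite (m l))) : ℝ) : ℂ)) := by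
  have h := hasTemperateGrowth_prod Finset.univ (fun (l : Fin d) (y : Conf d) =>
      (Real.pi * ħ) ^ (-(1 / 4) : ℝ) * (Real.sqrt ((m l).factorial : ℝ))⁻¹ *
      Polynomial.aeval (Real.sqrt (2 / ħ) * y l) (Polynomial.hermite (m l))) fun l _ =>
    (Function.HasTemperateGrowth.const _).mul (hasTemperateGrowth_aeval_coord _ _ l)
  exact Complex.ofRealCLM.hasTemperateGrowth.comp h

/-- The Hermite functions as Schwartz functions. -/
def hermS (ħ : ℝ) (hħ : 0 < ħ) (m : Fin d → ℕ) : 𝓢(Conf d, ℂ) :=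
  SchwartzMap.smulLeftCLM ℂ (fun y : Conf d => ((∏ l, ((Real.pi * ħ) ^ (-(1 / 4) : ℝ) *
      (Real.sqrt ((m l).factorial : ℝ))⁻¹ *
      Polynomial.aeval (Real.sqrt (2 / ħ) * y l) (Polynomial.hermite (m l))) : ℝ) : ℂ))
    (gaussS (1 / (2 * ħ)) (by positivity))

lemma exp_norm_sq_eq_prod (a : ℝ) (y : Conf d) :
    Real.exp (a * ‖y‖ ^ 2) = ∏ l, Real.exp (a * y l ^ 2) := by
  rw [EuclideanSpace.norm_sq_eq, Finset.mul_sum, Real.exp_sum]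
  simp

lemma hermS_coe (ħ : ℝ) (hħ : 0 < ħ) (m : Fin d → ℕ) :
    (hermS ħ hħ m : Conf d → ℂ) = hermiteFun ħ m := by
  ext y
  rw [hermS, SchwartzMap.smulLeftCLM_apply_apply (hasTemperateGrowth_hermite_prod ħ m),
    gaussS_apply, exp_norm_sq_eq_prod, smul_eq_mul, ← Complex.ofReal_mul,
    ← Finset.prod_mul_distrib, hermiteFun]
  simp only [hermite1]
  congr 2; ext l
  congr 2
  field_simp

lemma mulS_hermS (ħ : ℝ) (hħ : 0 < ħ) (m : Fin d → ℕ) (j : Fin d) :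
    mulS j (hermS ħ hħ m) = ((Real.sqrt (ħ / 2) * Real.sqrt (m j) : ℝ) : ℂ) • hermS ħ hħ (dn m j)
      + ((Real.sqrt (ħ / 2) * Real.sqrt (m j + 1) : ℝ) : ℂ) • hermS ħ hħ (up m j) := by
  ext y
  rw [mulS_apply, add_apply, smul_apply, smul_apply, hermS_coe, hermS_coe, hermS_coe, dn, up,
    hermiteFun_update, hermiteFun_update, hermiteFun_eq ħ m j, ← Complex.ofReal_mul, ← mul_assoc,
    mul_hermite1 ħ hħ]
  simp only [smul_eq_mul]
  push_cast
  ring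

lemma gradS_hermS (ħ : ℝ) (hħ : 0 < ħ) (m : Fin d → ℕ) (j : Fin d) :
    (ħ : ℂ) • gradS j (hermS ħ hħ m) =
      ((Real.sqrt (ħ / 2) * Real.sqrt (m j) : ℝ) : ℂ) • hermS ħ hħ (dn m j)
      - ((Real.sqrt (ħ / 2) * Real.sqrt (m j + 1) : ℝ) : ℂ) • hermS ħ hħ (up m j) := by
  ext y
  have hd : HasLineDerivAt ℝ (hermiteFun ħ m) (((ħ⁻¹ * (Real.sqrt (ħ / 2) *
      (Real.sqrt (m j) * hermite1 ħ (m j - 1) (y j) -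
        Real.sqrt (m j + 1) * hermite1 ħ (m j + 1) (y j))) *
        ∏ l ∈ Finset.univ.erase j, hermite1 ħ (m l) (y l) : ℝ) : ℂ)) y (basisVec j) := by
    have e : (fun t : ℝ => hermiteFun ħ m (y + t • basisVec j)) = fun t : ℝ =>
        ((hermite1 ħ (m j) (y j + t) * ∏ l ∈ Finset.univ.erase j, hermite1 ħ (m l) (y l) : ℝ) : ℂ) := by
      ext t
      rw [hermiteFun_eq ħ m j]
      congr 2
      · simp [basisVec]
      · refine Finset.prod_congr rfl fun l hl => ?_
        simp [basisVec, Finset.ne_of_mem_erase hl]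
    unfold HasLineDerivAt
    rw [e]
    have h1 : HasDerivAt (fun t : ℝ => hermite1 ħ (m j) (y j + t)) (ħ⁻¹ * (Real.sqrt (ħ / 2) *
      (Real.sqrt (m j) * hermite1 ħ (m j - 1) (y j) -
        Real.sqrt (m j + 1) * hermite1 ħ (m j + 1) (y j)))) 0 := by
      have := hasDerivAt_hermite1 ħ hħ (m j) (y j + 0)
      have h2 := HasDerivAt.comp_const_add (y j) 0 this
      simpa using h2
    exact (h1.mul_const _).ofReal_comp
  rw [smul_apply, gradS_apply, hermS_coe, hd.lineDeriv, sub_apply, smul_apply, smul_apply,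
    hermS_coe, hermS_coe, dn, up, hermiteFun_update, hermiteFun_update]
  have h' : (ħ : ℂ) ≠ 0 := by exact_mod_cast hħ.ne'
  simp only [smul_eq_mul]
  push_cast
  field_simp

lemma lower_hermS (ħ : ℝ) (hħ : 0 < ħ) (m : Fin d → ℕ) (j : Fin d) :
    mulS j (hermS ħ hħ m) + (ħ : ℂ) • gradS j (hermS ħ hħ m) =
      ((2 * Real.sqrt (ħ / 2) * Real.sqrt (m j) : ℝ) : ℂ) • hermS ħ hħ (dn m j) := by
  rw [mulS_hermS, gradS_hermS]
  push_cast
  module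

lemma raise_hermS (ħ : ℝ) (hħ : 0 < ħ) (m : Fin d → ℕ) (j : Fin d) :
    mulS j (hermS ħ hħ m) - (ħ : ℂ) • gradS j (hermS ħ hħ m) =
      ((2 * Real.sqrt (ħ / 2) * Real.sqrt (m j + 1) : ℝ) : ℂ) • hermS ħ hħ (up m j) := by
  rw [mulS_hermS, gradS_hermS]
  push_cast
  module

/-- The raising operator y - ħ∂ and the lowering operator y + ħ∂ are formal adjoints; orthonormality
and all reindexings of Hermite sums rest on this. -/
lemma inner_raise_lower (ħ : ℝ) (j : Fin d) (f g : 𝓢(Conf d, ℂ)) :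
    ⟪sL2 (mulS j f - (ħ : ℂ) • gradS j f), sL2 g⟫_ℂ =
      ⟪sL2 f, sL2 (mulS j g + (ħ : ℂ) • gradS j g)⟫_ℂ := by
  simp only [map_sub, map_add, map_smul, inner_sub_left, inner_add_right, inner_smul_left,
    inner_smul_right, inner_mulS, inner_gradS, Complex.conj_ofReal]
  ring

lemma up_dn (m : Fin d → ℕ) (j : Fin d) (h : m j ≠ 0) : up (dn m j) j = m := by
  ext l
  by_cases hl : l = j
  · subst hl; simp [up, dn]; omega
  · simp [up, dn, hl]

lemma dn_up (m : Fin d → ℕ) (j : Fin d) : dn (up m j) j = m := by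
  ext l
  by_cases hl : l = j
  · subst hl; simp [up, dn]
  · simp [up, dn, hl]

lemma sum_dn (m : Fin d → ℕ) (j : Fin d) (h : m j ≠ 0) : ∑ l, dn m j l < ∑ l, m l := by
  refine Finset.sum_lt_sum (fun l _ => ?_) ⟨j, Finset.mem_univ j, ?_⟩
  · by_cases hl : l = j
    · subst hl; simp [dn]
    · simp [dn, hl]
  · simp [dn]; omega

/-- One quantum is moved across the inner product: H_m is raised from H_{m-e_j}, and the adjoint
lowers H_n. If n_j = 0 the coefficient on the right is zero, so the truncated index is irrelevant.
-/
lemma inner_hermS_raise (ħ : ℝ) (hħ : 0 < ħ) (m n : Fin d → ℕ) (j : Fin d) (h : m j ≠ 0) :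
    ((Real.sqrt (m j) : ℝ) : ℂ) * ⟪sL2 (hermS ħ hħ m), sL2 (hermS ħ hħ n)⟫_ℂ =
      ((Real.sqrt (n j) : ℝ) : ℂ) * ⟪sL2 (hermS ħ hħ (dn m j)), sL2 (hermS ħ hħ (dn n j))⟫_ℂ := by
  have h1 := inner_raise_lower ħ j (hermS ħ hħ (dn m j)) (hermS ħ hħ n)
  rw [raise_hermS, lower_hermS, up_dn m j h, map_smul, map_smul, inner_smul_left, inner_smul_right,
    Complex.conj_ofReal] at h1
  have h2 : ((dn m j j : ℕ) : ℝ) + 1 = m j := by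
    simp only [dn, Function.update_self]
    rw [Nat.cast_sub (by omega)]; simp
  rw [h2] at h1
  have h3 : ((2 * Real.sqrt (ħ / 2) : ℝ) : ℂ) ≠ 0 := by
    have : 0 < Real.sqrt (ħ / 2) := Real.sqrt_pos.2 (by positivity)
    exact_mod_cast (by positivity : (2 * Real.sqrt (ħ / 2)) ≠ 0)
  apply mul_left_cancel₀ h3
  push_cast at h1 ⊢
  linear_combination h1

lemma hermS_zero_apply (ħ : ℝ) (hħ : 0 < ħ) (y : Conf d) :
    hermS ħ hħ 0 y =
      (((Real.pi * ħ) ^ (-(d : ℝ) / 4) * Real.exp (-‖y‖ ^ 2 / (2 * ħ)) : ℝ) : ℂ) := by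
  rw [hermS_coe, hermiteFun]
  simp only [hermite1, Pi.zero_apply, Nat.factorial_zero, Nat.cast_one, Real.sqrt_one, inv_one,
    mul_one, Polynomial.hermite_zero, map_one]
  rw [Finset.prod_mul_distrib, Finset.prod_const, Finset.card_univ, Fintype.card_fin,
    ← Real.rpow_natCast, ← Real.rpow_mul (by positivity)]
  have := exp_norm_sq_eq_prod (-(1 / (2 * ħ))) y
  rw [show -‖y‖ ^ 2 / (2 * ħ) = -(1 / (2 * ħ)) * ‖y‖ ^ 2 by field_simp, this]
  congr 2
  · congr 1; ring
  · refine Finset.prod_congr rfl fun l _ => ?_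
    congr 1; field_simp

lemma inner_hermS_zero_zero (ħ : ℝ) (hħ : 0 < ħ) :
    ⟪sL2 (hermS ħ hħ (0 : Fin d → ℕ)), sL2 (hermS ħ hħ 0)⟫_ℂ = 1 := by
  rw [inner_sL2_sL2]
  have h1 : ∀ y : Conf d, (starRingEnd ℂ) (hermS ħ hħ 0 y) * hermS ħ hħ 0 y =
      (((Real.pi * ħ) ^ (-(d : ℝ) / 2) * Real.exp (-(1 / ħ) * ‖y‖ ^ 2) : ℝ) : ℂ) := by
    intro y
    rw [hermS_zero_apply, Complex.conj_ofReal, ← Complex.ofReal_mul]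
    congr 1
    rw [mul_mul_mul_comm, ← Real.rpow_add (by positivity), ← Real.exp_add]
    congr 2
    · ring
    · field_simp; ring
  simp_rw [h1]
  rw [integral_complex_ofReal, integral_const_mul,
    GaussianFourier.integral_rexp_neg_mul_sq_norm (by positivity)]
  simp only [finrank_euclideanSpace, Fintype.card_fin]
  rw [show Real.pi / (1 / ħ) = Real.pi * ħ by field_simp, ← Real.rpow_add (by positivity)]
  norm_num
  ring_nf
  norm_num

lemma inner_hermS (ħ : ℝ) (hħ : 0 < ħ) (m n : Fin d → ℕ) :
    ⟪sL2 (hermS ħ hħ m), sL2 (hermS ħ hħ n)⟫_ℂ = if m = n then 1 else 0 := by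
  -- Induction on the total degree of m, removing a quantum from both sides; when m = 0 the same
  -- relation is applied with the roles of m and n exchanged.
  induction hs : ∑ l, m l using Nat.strong_induction_on generalizing m n with
  | _ s ih =>
  by_cases hm : ∃ j, m j ≠ 0
  · obtain ⟨j, hj⟩ := hm
    have h := inner_hermS_raise ħ hħ m n j hj
    rw [ih _ (hs ▸ sum_dn m j hj) (dn m j) (dn n j) rfl] at h
    have hmj : ((Real.sqrt (m j) : ℝ) : ℂ) ≠ 0 := by
      have : 0 < Real.sqrt (m j) := Real.sqrt_pos.2 (by exact_mod_cast Nat.pos_of_ne_zero hj)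
      exact_mod_cast this.ne'
    apply mul_left_cancel₀ hmj
    rw [h]
    by_cases hmn : m = n
    · subst hmn; simp
    · by_cases hn : n j = 0
      · simp [hn, hmn]
      · have : dn m j ≠ dn n j := fun e => hmn (by rw [← up_dn m j hj, e, up_dn n j hn])
        simp [this, hmn]
  · push Not at hm
    have hm0 : m = 0 := funext hm
    subst hm0
    by_cases hn : ∃ j, n j ≠ 0
    · obtain ⟨j, hj⟩ := hn
      have h := inner_hermS_raise ħ hħ n 0 j hj
      have hnj : ((Real.sqrt (n j) : ℝ) : ℂ) ≠ 0 := by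
        have : 0 < Real.sqrt (n j) := Real.sqrt_pos.2 (by exact_mod_cast Nat.pos_of_ne_zero hj)
        exact_mod_cast this.ne'
      have h0 : ⟪sL2 (hermS ħ hħ n), sL2 (hermS ħ hħ 0)⟫_ℂ = 0 := by
        apply mul_left_cancel₀ hnj
        rw [h]; simp
      have hne : (0 : Fin d → ℕ) ≠ n := fun e => hj (by rw [← e]; rfl)
      rw [if_neg hne, ← inner_conj_symm, h0, map_zero]
    · push Not at hn
      have hn0 : n = 0 := funext hn
      subst hn0
      rw [inner_hermS_zero_zero, if_pos rfl]

lemma orthonormal_hermS (ħ : ℝ) (hħ : 0 < ħ) :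
    Orthonormal ℂ (fun m : Fin d → ℕ => sL2 (hermS ħ hħ m)) := by
  classical
  rw [orthonormal_iff_ite]
  intro m n
  rw [inner_hermS]

end Hermite
end SemiWass
end

noncomputable section
namespace SemiWass

/-! ### Coherent states and completeness of the Hermite functions -/

section Coherent
open scoped LineDeriv
variable {d : ℕ}

/-- The coherent states as Schwartz functions. -/
def cohS (ħ : ℝ) (hħ : 0 < ħ) (z : Phase d) : 𝓢(Conf d, ℂ) := wp ħ (hermS ħ hħ 0) z

/-- The functions `(x_j - y_j) |z⟩`. -/
def phiS (ħ : ℝ) (hħ : 0 < ħ) (j : Fin d) (z : Phase d) : 𝓢(Conf d, ℂ) :=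
  wp ħ (-(mulS j (hermS ħ hħ 0))) z

lemma cohS_coe (ħ : ℝ) (hħ : 0 < ħ) (z : Phase d) :
    (cohS ħ hħ z : Conf d → ℂ) = coherentFun ħ z := by
  ext y
  rw [cohS, wp_apply, hermS_zero_apply, coherentFun, mul_comm]

lemma coherent_eq (ħ : ℝ) (hħ : 0 < ħ) (z : Phase d) : coherent ħ z = sL2 (cohS ħ hħ z) := by
  rw [coherent, ← cohS_coe ħ hħ, toL2_coe]

lemma phiS_eq (ħ : ℝ) (hħ : 0 < ħ) (j : Fin d) (z : Phase d) :
    phiS ħ hħ j z = ((z.1 j : ℝ) : ℂ) • cohS ħ hħ z - mulS j (cohS ħ hħ z) := by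
  ext y
  rw [phiS, cohS, wp_apply, sub_apply, smul_apply, mulS_apply, wp_apply, neg_apply, mulS_apply]
  simp only [smul_eq_mul, PiLp.sub_apply]
  push_cast
  ring

lemma mulS_cohS (ħ : ℝ) (hħ : 0 < ħ) (j : Fin d) (z : Phase d) :
    mulS j (cohS ħ hħ z) = ((z.1 j : ℝ) : ℂ) • cohS ħ hħ z - phiS ħ hħ j z := by
  rw [phiS_eq]; abel

/-- Together with `mulS_cohS` this is the eigenvalue relation (y_j + ħ∂_j)|z⟩ = (x_j + iξ_j)|z⟩. The
centred position and the centred momentum produce the same vector `phiS` up to a phase, so one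
integral identity serves both. -/
lemma gradS_cohS (ħ : ℝ) (hħ : 0 < ħ) (j : Fin d) (z : Phase d) :
    (ħ : ℂ) • gradS j (cohS ħ hħ z) =
      (Complex.I * ((z.2 j : ℝ) : ℂ)) • cohS ħ hħ z + phiS ħ hħ j z := by
  ext y
  have h0 : ∀ y : Conf d, cohS ħ hħ z y = Complex.exp (Complex.I * ((⟪z.2, y - z.1⟫_ℝ / ħ : ℝ) : ℂ)) *
      (((Real.pi * ħ) ^ (-(d : ℝ) / 4) * Real.exp (-‖y - z.1‖ ^ 2 / (2 * ħ)) : ℝ) : ℂ) := by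
    intro y; rw [cohS, wp_apply, hermS_zero_apply]
  have e1 : ∀ t : ℝ, ⟪z.2, y + t • basisVec j - z.1⟫_ℝ = ⟪z.2, y - z.1⟫_ℝ + t * z.2 j := by
    intro t
    rw [show y + t • basisVec j - z.1 = (y - z.1) + t • basisVec j by abel, inner_add_right,
      inner_smul_right, basisVec, EuclideanSpace.inner_single_right]
    simp
  have e2 : ∀ t : ℝ, ‖y + t • basisVec j - z.1‖ ^ 2 =
      ‖y - z.1‖ ^ 2 + 2 * t * (y j - z.1 j) + t ^ 2 := by
    intro t
    rw [show y + t • basisVec j - z.1 = (y - z.1) + t • basisVec j by abel, norm_add_sq_real,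
      inner_smul_right, norm_smul, basisVec, EuclideanSpace.inner_single_right]
    simp; ring
  have hd : HasLineDerivAt ℝ (cohS ħ hħ z : Conf d → ℂ)
      ((Complex.I * ((z.2 j / ħ : ℝ) : ℂ) + (((z.1 j - y j) / ħ : ℝ) : ℂ)) * cohS ħ hħ z y) y
      (basisVec j) := by
    unfold HasLineDerivAt
    simp only [h0, e1, e2]
    have a1 : HasDerivAt (fun t : ℝ => (⟪z.2, y - z.1⟫_ℝ + t * z.2 j) / ħ) (z.2 j / ħ) 0 := by
      have := (((hasDerivAt_id (0:ℝ)).mul_const (z.2 j)).const_add ⟪z.2, y - z.1⟫_ℝ).div_const ħ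
      simpa using this
    have a2 := (a1.ofReal_comp.const_mul Complex.I).cexp
    have b1 : HasDerivAt (fun t : ℝ => -(‖y - z.1‖ ^ 2 + 2 * t * (y j - z.1 j) + t ^ 2) / (2 * ħ))
        ((z.1 j - y j) / ħ) 0 := by
      have h1 : HasDerivAt (fun t : ℝ => 2 * t * (y j - z.1 j)) (2 * 1 * (y j - z.1 j)) 0 :=
        ((hasDerivAt_id (0:ℝ)).const_mul 2).mul_const _
      have h2 : HasDerivAt (fun t : ℝ => t ^ 2) 0 (0:ℝ) := by simpa using hasDerivAt_pow 2 (0:ℝ)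
      have := ((((h1.const_add (‖y - z.1‖ ^ 2))).add h2).neg).div_const (2 * ħ)
      refine this.congr_deriv ?_
      field_simp
      ring
    have b2 := ((b1.exp.const_mul ((Real.pi * ħ) ^ (-(d : ℝ) / 4)))).ofReal_comp
    refine (a2.mul b2).congr_deriv ?_
    simp
    ring
  rw [smul_apply, gradS_apply, hd.lineDeriv, phiS_eq, add_apply, sub_apply, smul_apply, smul_apply,
    mulS_apply]
  have h' : (ħ : ℂ) ≠ 0 := by exact_mod_cast hħ.ne'
  simp only [smul_eq_mul]
  push_cast
  field_simp

lemma mulS_hermS_zero (ħ : ℝ) (hħ : 0 < ħ) (j : Fin d) :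
    mulS j (hermS ħ hħ 0) = ((Real.sqrt (ħ / 2) : ℝ) : ℂ) • hermS ħ hħ (up 0 j) := by
  rw [mulS_hermS]; simp

lemma norm_hermS (ħ : ℝ) (hħ : 0 < ħ) (m : Fin d → ℕ) : ‖sL2 (hermS ħ hħ m)‖ = 1 :=
  (orthonormal_hermS ħ hħ).1 m

/-- Resolution of the identity by coherent states, including the functions `(x_j - y_j)|z⟩`. -/
theorem lintegral_coherent (ħ : ℝ) (hħ : 0 < ħ) (j : Fin d) (κ p : L2 d) :
    ∫⁻ z : Phase d, ‖⟪sL2 (cohS ħ hħ z), κ⟫_ℂ + ⟪sL2 (phiS ħ hħ j z), p⟫_ℂ‖ₑ ^ 2 =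
      ENNReal.ofReal ((2 * Real.pi * ħ) ^ d) * (‖κ‖ₑ ^ 2 + ENNReal.ofReal (ħ / 2) * ‖p‖ₑ ^ 2) := by
  -- The windows are H_0 and a multiple of H_{e_j}: they are orthogonal, and the second has squared
  -- norm ħ/2.
  have h := lintegral_wp ħ hħ (hermS ħ hħ 0) (-(mulS j (hermS ħ hħ 0))) (by
    rw [mulS_hermS_zero, map_neg, map_smul, inner_neg_right, inner_smul_right, inner_hermS,
      if_neg]
    · simp
    · intro e
      have := congrFun e j
      simp [up] at this) κ p
  unfold cohS phiS
  rw [h, mulS_hermS_zero, map_neg, map_smul, enorm_neg, enorm_smul,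
    enorm_sq_eq_ofReal (sL2 (hermS ħ hħ 0)), norm_hermS,
    mul_pow ‖((Real.sqrt (ħ / 2) : ℝ) : ℂ)‖ₑ, enorm_sq_eq_ofReal (sL2 (hermS ħ hħ (up 0 j))), norm_hermS,
    enorm_sq_eq_ofReal ((Real.sqrt (ħ / 2) : ℝ) : ℂ)]
  rw [Complex.norm_real, Real.norm_of_nonneg (Real.sqrt_nonneg _), Real.sq_sqrt (by positivity)]
  simp

lemma lintegral_coherent' (ħ : ℝ) (hħ : 0 < ħ) (κ : L2 d) :
    ∫⁻ z : Phase d, ‖⟪sL2 (cohS ħ hħ z), κ⟫_ℂ‖ₑ ^ 2 =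
      ENNReal.ofReal ((2 * Real.pi * ħ) ^ d) * ‖κ‖ₑ ^ 2 := by
  have h := lintegral_wp ħ hħ (hermS ħ hħ 0) 0 (by simp) κ 0
  unfold cohS
  simp only [inner_zero_right, add_zero] at h
  rw [h, enorm_sq_eq_ofReal (sL2 (hermS ħ hħ 0)), norm_hermS]
  simp

lemma eq_zero_of_inner_coherent (ħ : ℝ) (hħ : 0 < ħ) (v : L2 d)
    (h : ∀ z : Phase d, ⟪sL2 (cohS ħ hħ z), v⟫_ℂ = 0) : v = 0 := by
  have h1 := lintegral_coherent' ħ hħ v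
  simp only [h, enorm_zero, ne_eq, OfNat.ofNat_ne_zero, not_false_eq_true, zero_pow,
    lintegral_zero] at h1
  have h2 := h1.symm
  rw [mul_eq_zero] at h2
  rcases h2 with h2 | h2
  · rw [ENNReal.ofReal_eq_zero] at h2
    have : 0 < (2 * Real.pi * ħ) ^ d := by positivity
    linarith
  · simpa using h2

/-- Multiplication by the linear form `∑ ζ_j y_j`. -/
def mulLin (ζ : Fin d → ℂ) : 𝓢(Conf d, ℂ) →L[ℂ] 𝓢(Conf d, ℂ) := ∑ j, ζ j • mulS j

lemma mulLin_apply (ζ : Fin d → ℂ) (f : 𝓢(Conf d, ℂ)) (y : Conf d) :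
    mulLin ζ f y = (∑ j, ζ j * ((y j : ℝ) : ℂ)) * f y := by
  simp only [mulLin, sum_apply, smul_apply, mulS_apply, smul_eq_mul, Finset.sum_mul, mul_assoc]

lemma mulLin_pow_mem_span (ħ : ℝ) (hħ : 0 < ħ) (ζ : Fin d → ℂ) (n : ℕ) :
    (mulLin ζ)^[n] (hermS ħ hħ 0) ∈ Submodule.span ℂ (Set.range (hermS (d := d) ħ hħ)) := by
  induction n with
  | zero => exact Submodule.subset_span ⟨0, rfl⟩
  | succ n ih =>
    rw [Function.iterate_succ_apply']
    have hmap : Submodule.span ℂ (Set.range (hermS (d := d) ħ hħ)) ≤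
        (Submodule.span ℂ (Set.range (hermS (d := d) ħ hħ))).comap
          (mulLin ζ : 𝓢(Conf d, ℂ) →ₗ[ℂ] 𝓢(Conf d, ℂ)) := by
      rw [Submodule.span_le]
      rintro _ ⟨m, rfl⟩
      simp only [Submodule.comap_coe, Set.mem_preimage, SetLike.mem_coe,
        ContinuousLinearMap.coe_coe, mulLin, sum_apply, smul_apply]
      refine Submodule.sum_mem _ fun j _ => Submodule.smul_mem _ _ ?_
      rw [mulS_hermS]
      exact Submodule.add_mem _ (Submodule.smul_mem _ _ (Submodule.subset_span ⟨_, rfl⟩))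
        (Submodule.smul_mem _ _ (Submodule.subset_span ⟨_, rfl⟩))
    exact hmap ih

lemma mulLin_pow_apply (ζ : Fin d → ℂ) (n : ℕ) (f : 𝓢(Conf d, ℂ)) (y : Conf d) :
    (mulLin ζ)^[n] f y = (∑ j, ζ j * ((y j : ℝ) : ℂ)) ^ n * f y := by
  induction n with
  | zero => simp
  | succ n ih => rw [Function.iterate_succ_apply', mulLin_apply, ih, pow_succ]; ring

lemma norm_linear_form_le (ζ : Fin d → ℂ) (y : Conf d) :
    ‖∑ j, ζ j * ((y j : ℝ) : ℂ)‖ ≤ (∑ j, ‖ζ j‖) * ‖y‖ := by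
  rw [Finset.sum_mul]
  refine norm_sum_le_of_le _ fun j _ => ?_
  rw [norm_mul, Complex.norm_real]
  gcongr
  exact PiLp.norm_apply_le y j

/-- Half of the Gaussian exponent absorbs the exponential by completing the square; the other half
is square integrable and pairs with v. It dominates the power series in the proof of completeness.
-/
lemma integrable_exp_mul_gauss (ħ : ℝ) (hħ : 0 < ħ) (C : ℝ) (v : L2 d) :
    Integrable (fun y : Conf d => Real.exp (C * ‖y‖) * (‖hermS ħ hħ 0 y‖ * ‖v y‖)) := by
  have h1 : Integrable (fun y : Conf d => ‖gaussS (1 / (4 * ħ)) (by positivity) y‖ * ‖v y‖) :=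
    ((gaussS (E := Conf d) (1 / (4 * ħ)) (by positivity)).memLp 2 volume).norm.integrable_mul
      (Lp.memLp v).norm
  refine Integrable.mono' (h1.const_mul
    ((Real.pi * ħ) ^ (-(d : ℝ) / 4) * Real.exp (C ^ 2 * ħ))) ?_ (ae_of_all _ fun y => ?_)
  · refine AEStronglyMeasurable.mul (Continuous.aestronglyMeasurable (by fun_prop)) ?_
    exact (hermS ħ hħ 0).continuous.norm.aestronglyMeasurable.mul
      (Lp.aestronglyMeasurable v).norm
  · rw [Real.norm_of_nonneg (by positivity), hermS_zero_apply, gaussS_apply, Complex.norm_real,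
      Complex.norm_real, Real.norm_of_nonneg (by positivity), Real.norm_of_nonneg (by positivity)]
    have : Real.exp (C * ‖y‖) * Real.exp (-‖y‖ ^ 2 / (2 * ħ)) ≤
        Real.exp (C ^ 2 * ħ) * Real.exp (-(1 / (4 * ħ)) * ‖y‖ ^ 2) := by
      rw [← Real.exp_add, ← Real.exp_add, Real.exp_le_exp]
      have h2 : 0 ≤ (‖y‖ - 2 * ħ * C) ^ 2 / (4 * ħ) := by positivity
      have h3 : (‖y‖ - 2 * ħ * C) ^ 2 / (4 * ħ) =
        C ^ 2 * ħ + -(1 / (4 * ħ)) * ‖y‖ ^ 2 - (C * ‖y‖ + -‖y‖ ^ 2 / (2 * ħ)) := by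
        field_simp; ring
      linarith
    calc _ = (Real.pi * ħ) ^ (-(d : ℝ) / 4) *
          (Real.exp (C * ‖y‖) * Real.exp (-‖y‖ ^ 2 / (2 * ħ))) * ‖v y‖ := by ring
      _ ≤ (Real.pi * ħ) ^ (-(d : ℝ) / 4) *
          (Real.exp (C ^ 2 * ħ) * Real.exp (-(1 / (4 * ħ)) * ‖y‖ ^ 2)) * ‖v y‖ := by gcongr
      _ = _ := by ring

lemma cohS_eq_exp (ħ : ℝ) (hħ : 0 < ħ) (z : Phase d) : ∃ K : ℂ, ∀ y : Conf d,
    cohS ħ hħ z y = K * (Complex.exp (∑ j, ((z.1 j : ℂ) + Complex.I * (z.2 j : ℂ)) / (ħ : ℂ) *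
      ((y j : ℝ) : ℂ)) * hermS ħ hħ 0 y) := by
  refine ⟨Complex.exp (-(Complex.I * (⟪z.2, z.1⟫_ℝ : ℂ) / ħ) - (‖z.1‖ ^ 2 : ℝ) / (2 * ħ)),
    fun y => ?_⟩
  have h' : (ħ : ℂ) ≠ 0 := by exact_mod_cast hħ.ne'
  have hsum : ∑ j, ((z.1 j : ℂ) + Complex.I * (z.2 j : ℂ)) / (ħ : ℂ) * ((y j : ℝ) : ℂ) =
      ((⟪z.1, y⟫_ℝ : ℂ) + Complex.I * (⟪z.2, y⟫_ℝ : ℂ)) / ħ := by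
    simp only [PiLp.inner_apply, RCLike.inner_apply, conj_trivial]
    push_cast
    rw [Finset.mul_sum, ← Finset.sum_add_distrib, Finset.sum_div]
    refine Finset.sum_congr rfl fun j _ => by ring
  rw [cohS, wp_apply, hermS_zero_apply, hermS_zero_apply, hsum, norm_sub_sq_real]
  push_cast
  rw [mul_left_comm, mul_left_comm (Complex.exp (((⟪z.1, y⟫_ℝ : ℂ) +
    Complex.I * (⟪z.2, y⟫_ℝ : ℂ)) / ħ)), mul_left_comm (Complex.exp (_ - _)), ← Complex.exp_add,
    ← Complex.exp_add, ← Complex.exp_add, inner_sub_right, real_inner_comm y z.1]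
  congr 2
  push_cast
  field_simp
  ring

/-- A vector orthogonal to the Hermite functions is orthogonal to H_0 times any power of a linear
form. A coherent state is a multiple of H_0 times the exponential of a complex linear form, so
expanding the exponential makes the vector orthogonal to all coherent states, and the resolution of
the identity shows that it vanishes. -/
theorem eq_zero_of_inner_hermS (ħ : ℝ) (hħ : 0 < ħ) (v : L2 d)
    (h : ∀ m : Fin d → ℕ, ⟪sL2 (hermS ħ hħ m), v⟫_ℂ = 0) : v = 0 := by
  have hspan : ∀ f ∈ Submodule.span ℂ (Set.range (hermS (d := d) ħ hħ)), ⟪sL2 f, v⟫_ℂ = 0 := by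
    intro f hf
    induction hf using Submodule.span_induction with
    | mem x hx => obtain ⟨m, rfl⟩ := hx; exact h m
    | zero => simp
    | add x y _ _ hx hy => rw [map_add, inner_add_left, hx, hy, add_zero]
    | smul a x _ hx => rw [map_smul, inner_smul_left, hx, mul_zero]
  refine eq_zero_of_inner_coherent ħ hħ v fun z => ?_
  obtain ⟨K, hK⟩ := cohS_eq_exp ħ hħ z
  set ζ : Fin d → ℂ := fun j => ((z.1 j : ℂ) + Complex.I * (z.2 j : ℂ)) / (ħ : ℂ) with hζ
  set w : Conf d → ℂ := fun y => ∑ j, ζ j * ((y j : ℝ) : ℂ) with hw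
  have hsum : HasSum (fun n : ℕ => ∫ y, (starRingEnd ℂ) (w y ^ n / n.factorial * hermS ħ hħ 0 y) * v y)
      (∫ y, (starRingEnd ℂ) (Complex.exp (w y) * hermS ħ hħ 0 y) * v y) := by
    refine hasSum_integral_of_dominated_convergence
      (fun n y => ‖w y‖ ^ n / n.factorial * (‖hermS ħ hħ 0 y‖ * ‖v y‖)) (fun n => ?_)
      (fun n => ae_of_all _ fun y => ?_) (ae_of_all _ fun y => ?_) ?_ (ae_of_all _ fun y => ?_)
    · refine AEStronglyMeasurable.mul (Continuous.aestronglyMeasurable ?_)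
        (Lp.aestronglyMeasurable v)
      have := (hermS (d := d) ħ hħ 0).continuous
      fun_prop
    · simp [mul_assoc]
    · exact (Real.summable_pow_div_factorial _).mul_right _
    · have e : (fun y => ∑' n : ℕ, ‖w y‖ ^ n / n.factorial * (‖hermS ħ hħ 0 y‖ * ‖v y‖)) =
          fun y => Real.exp ‖w y‖ * (‖hermS ħ hħ 0 y‖ * ‖v y‖) := by
        ext y
        rw [tsum_mul_right, Real.exp_eq_exp_ℝ, NormedSpace.exp_eq_tsum_div]
      rw [e]
      refine (integrable_exp_mul_gauss ħ hħ (∑ j, ‖ζ j‖) v).mono' ?_ (ae_of_all _ fun y => ?_)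
      · refine AEStronglyMeasurable.mul (Continuous.aestronglyMeasurable (by fun_prop)) ?_
        exact (hermS ħ hħ 0).continuous.norm.aestronglyMeasurable.mul
          (Lp.aestronglyMeasurable v).norm
      · rw [Real.norm_of_nonneg (by positivity)]
        gcongr
        exact norm_linear_form_le ζ y
    · refine HasSum.mul_right _ ?_
      refine ((Complex.conjCLE : ℂ →L[ℝ] ℂ).hasSum (f := fun n : ℕ =>
        w y ^ n / n.factorial * hermS ħ hħ 0 y)) (HasSum.mul_right _ ?_)
      rw [Complex.exp_eq_exp_ℂ]
      exact NormedSpace.expSeries_div_hasSum_exp (w y)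
  -- Each term of the series pairs v with an element of the span of Hermite functions, which is
  -- stable under multiplication by coordinates.
  have hz : ∀ n : ℕ, ∫ y, (starRingEnd ℂ) (w y ^ n / n.factorial * hermS ħ hħ 0 y) * v y = 0 := by
    intro n
    have h1 := hspan _ (mulLin_pow_mem_span ħ hħ ζ n)
    rw [inner_sL2_left] at h1
    have e : ∀ y, (starRingEnd ℂ) (w y ^ n / n.factorial * hermS ħ hħ 0 y) * v y =
        ((n.factorial : ℂ))⁻¹ * ((starRingEnd ℂ) ((mulLin ζ)^[n] (hermS ħ hħ 0) y) * v y) := by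
      intro y
      rw [mulLin_pow_apply]
      simp only [map_mul, map_div₀, map_pow, map_natCast, hw]
      ring
    simp_rw [e]
    rw [integral_const_mul, h1, mul_zero]
  simp only [hz] at hsum
  have h0 := hsum.unique hasSum_zero
  rw [inner_sL2_left]
  have e : ∀ y, (starRingEnd ℂ) (cohS ħ hħ z y) * v y = (starRingEnd ℂ) K *
      ((starRingEnd ℂ) (Complex.exp (w y) * hermS ħ hħ 0 y) * v y) := by
    intro y
    rw [hK, map_mul]; ring
  simp_rw [e]
  rw [integral_const_mul, h0, mul_zero]

/-- The Hilbert basis of Hermite functions. -/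
def hermB (ħ : ℝ) (hħ : 0 < ħ) : HilbertBasis (Fin d → ℕ) ℂ (L2 d) :=
  HilbertBasis.mkOfOrthogonalEqBot (orthonormal_hermS ħ hħ) (by
    rw [Submodule.eq_bot_iff]
    intro v hv
    refine eq_zero_of_inner_hermS ħ hħ v fun m => ?_
    exact (Submodule.mem_orthogonal _ _).1 hv _ (Submodule.subset_span ⟨m, rfl⟩))

@[simp] lemma hermB_apply (ħ : ℝ) (hħ : 0 < ħ) (m : Fin d → ℕ) :
    hermB ħ hħ m = sL2 (hermS ħ hħ m) := by
  rw [hermB, HilbertBasis.coe_mkOfOrthogonalEqBot]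

end Coherent
end SemiWass
end

noncomputable section
namespace SemiWass

/-! ### The transport cost in the Hermite basis -/

section Parseval
variable {E ι : Type*} [NormedAddCommGroup E] [InnerProductSpace ℂ E]

lemma tsum_enorm_sq_inner (b : HilbertBasis ι ℂ E) (x : E) :
    ∑' i, ‖⟪b i, x⟫_ℂ‖ₑ ^ 2 = ‖x‖ₑ ^ 2 := by
  have h := b.hasSum_inner_mul_inner x x
  have h1 : HasSum (fun i => ‖⟪b i, x⟫_ℂ‖ ^ 2) (‖x‖ ^ 2) := by
    have h2 := Complex.reCLM.hasSum h
    have e1 : Complex.reCLM ⟪x, x⟫_ℂ = ‖x‖ ^ 2 := by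
      rw [inner_self_eq_norm_sq_to_K]
      simp [← Complex.ofReal_pow]
    rw [e1] at h2
    convert h2 using 2 with i
    simp only [Complex.reCLM_apply]
    rw [← inner_conj_symm x (b i), ← Complex.normSq_eq_conj_mul_self, Complex.ofReal_re,
      Complex.normSq_eq_norm_sq]
  simp_rw [enorm_sq_eq_ofReal]
  rw [← ENNReal.ofReal_tsum_of_nonneg (fun i => by positivity) h1.summable, h1.tsum_eq]

lemma exists_of_tsum_enorm_sq_ne_top (b : HilbertBasis ι ℂ E) (c : ι → ℂ)
    (h : ∑' i, ‖c i‖ₑ ^ 2 ≠ ∞) : ∃ x : E, ∀ i, ⟪b i, x⟫_ℂ = c i := by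
  have hs : Summable (fun i => ‖c i‖ ^ 2) := by
    simp_rw [enorm_sq_eq_ofReal] at h
    have := ENNReal.summable_toReal h
    refine this.congr fun i => ?_
    rw [ENNReal.toReal_ofReal (by positivity)]
  have hm : Memℓp c 2 := by
    rw [memℓp_gen_iff (by norm_num)]
    refine hs.congr fun i => ?_
    norm_num
  refine ⟨b.repr.symm ⟨c, hm⟩, fun i => ?_⟩
  rw [← b.repr_apply_apply]
  simp

end Parseval

/-! ### Weak images of unbounded operators, tested on Hermite functions -/

section Core
variable {d : ℕ}

lemma hasSum_of_eq {ι : Type*} {f g : ι → ℂ} {a : ℂ} (h : ∀ i, f i = g i) (hg : HasSum g a) :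
    HasSum f a := by
  rwa [show f = g from funext h]

/-- `⟨A g, φ⟩ = ∑_m ⟨g, H_m⟩ ⟨A H_m, φ⟩` for all Schwartz functions `g`. -/
def HermiteSummable (ħ : ℝ) (hħ : 0 < ħ) (A : 𝓢(Conf d, ℂ) →L[ℂ] 𝓢(Conf d, ℂ)) : Prop :=
  ∀ (g : 𝓢(Conf d, ℂ)) (φ : L2 d), HasSum (fun m : Fin d → ℕ =>
    ⟪sL2 g, sL2 (hermS ħ hħ m)⟫_ℂ * ⟪sL2 (A (hermS ħ hħ m)), φ⟫_ℂ) ⟪sL2 (A g), φ⟫_ℂ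

lemma hermiteSummable_id (ħ : ℝ) (hħ : 0 < ħ) :
    HermiteSummable (d := d) ħ hħ (ContinuousLinearMap.id ℂ _) := by
  intro g φ
  have := (hermB ħ hħ).hasSum_inner_mul_inner (sL2 g) φ
  simpa using this

lemma HermiteSummable.add {ħ : ℝ} {hħ : 0 < ħ} {A B : 𝓢(Conf d, ℂ) →L[ℂ] 𝓢(Conf d, ℂ)}
    (hA : HermiteSummable ħ hħ A) (hB : HermiteSummable ħ hħ B) :
    HermiteSummable ħ hħ (A + B) := by
  intro g φ
  rw [add_apply, map_add, inner_add_left]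
  refine hasSum_of_eq (fun m => ?_) ((hA g φ).add (hB g φ))
  rw [add_apply, map_add, inner_add_left]; ring

lemma HermiteSummable.smul {ħ : ℝ} {hħ : 0 < ħ} {A : 𝓢(Conf d, ℂ) →L[ℂ] 𝓢(Conf d, ℂ)}
    (hA : HermiteSummable ħ hħ A) (c : ℂ) :
    HermiteSummable ħ hħ (c • A) := by
  intro g φ
  rw [smul_apply, map_smul, inner_smul_left]
  refine hasSum_of_eq (fun m => ?_) ((hA g φ).mul_left ((starRingEnd ℂ) c))
  rw [smul_apply, map_smul, inner_smul_left]; ring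

lemma up_injective (j : Fin d) : Function.Injective (fun m : Fin d → ℕ => up m j) := by
  intro m n h
  have : dn (up m j) j = dn (up n j) j := congrArg (fun k => dn k j) h
  rwa [dn_up, dn_up] at this

lemma notMem_range_up (j : Fin d) (m : Fin d → ℕ) (h : m ∉ Set.range fun m : Fin d → ℕ => up m j) :
    m j = 0 := by
  by_contra h0
  exact h ⟨dn m j, up_dn m j h0⟩

lemma up_self (m : Fin d → ℕ) (j : Fin d) : up m j j = m j + 1 := by simp [up]

/-- Parseval for the lowered function paired with φ, after passing the operator to the other side as
a raising operator and shifting the index by e_j. Terms outside the range of the shift vanish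
because lowering kills them. Only L² convergence of Hermite expansions enters. -/
lemma hermiteSummable_lower (ħ : ℝ) (hħ : 0 < ħ) (j : Fin d) :
    HermiteSummable ħ hħ (mulS j + (ħ : ℂ) • gradS j) := by
  intro g φ
  have h := (hermB ħ hħ).hasSum_inner_mul_inner (sL2 (mulS j g + (ħ : ℂ) • gradS j g)) φ
  rw [← (up_injective j).hasSum_iff]
  · refine hasSum_of_eq (fun m => ?_) h
    simp only [Function.comp_apply, add_apply, smul_apply, hermB_apply]
    rw [lower_hermS, dn_up, up_self, ← inner_conj_symm (sL2 (mulS j g + (ħ : ℂ) • gradS j g)),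
      ← inner_raise_lower, raise_hermS, map_smul, map_smul, inner_smul_left, inner_smul_left,
      map_mul, inner_conj_symm]
    simp only [Complex.conj_ofReal, Nat.cast_add, Nat.cast_one]
    ring
  · intro m hm
    simp only [add_apply, smul_apply]
    rw [lower_hermS, notMem_range_up j m hm]
    simp

lemma hermiteSummable_raise (ħ : ℝ) (hħ : 0 < ħ) (j : Fin d) :
    HermiteSummable ħ hħ (mulS j - (ħ : ℂ) • gradS j) := by
  intro g φ
  have h := (hermB ħ hħ).hasSum_inner_mul_inner (sL2 (mulS j g - (ħ : ℂ) • gradS j g)) φ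
  rw [← (up_injective j).hasSum_iff] at h
  · refine hasSum_of_eq (fun m => ?_) h
    simp only [Function.comp_apply, sub_apply, smul_apply, hermB_apply]
    rw [raise_hermS, inner_raise_lower, lower_hermS, dn_up, up_self, map_smul, map_smul,
      inner_smul_left, inner_smul_right]
    simp only [Complex.conj_ofReal, Nat.cast_add, Nat.cast_one]
    ring
  · intro m hm
    rw [hermB_apply, inner_raise_lower, lower_hermS, notMem_range_up j m hm]
    simp

lemma hermiteSummable_mulS (ħ : ℝ) (hħ : 0 < ħ) (j : Fin d) : HermiteSummable ħ hħ (mulS j) := by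
  have h := ((hermiteSummable_lower ħ hħ j).add (hermiteSummable_raise ħ hħ j)).smul (1 / 2)
  convert h using 1
  module

lemma hermiteSummable_gradS (ħ : ℝ) (hħ : 0 < ħ) (j : Fin d) :
    HermiteSummable ħ hħ (gradS j) := by
  have h := ((hermiteSummable_lower ħ hħ j).add
    ((hermiteSummable_raise ħ hħ j).smul (-1))).smul (1 / (2 * (ħ : ℂ)))
  convert h using 1
  have h' : (ħ : ℂ) ≠ 0 := by exact_mod_cast hħ.ne'
  match_scalars <;> field_simp <;> ring

/-- A weak identity tested on Hermite functions holds for all Schwartz functions. -/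
lemma HermiteSummable.inner_eq {ħ : ℝ} {hħ : 0 < ħ} {A : 𝓢(Conf d, ℂ) →L[ℂ] 𝓢(Conf d, ℂ)}
    (hA : HermiteSummable ħ hħ A) {φ ψ : L2 d}
    (h : ∀ m : Fin d → ℕ, ⟪sL2 (A (hermS ħ hħ m)), φ⟫_ℂ = ⟪sL2 (hermS ħ hħ m), ψ⟫_ℂ)
    (g : 𝓢(Conf d, ℂ)) : ⟪sL2 (A g), φ⟫_ℂ = ⟪sL2 g, ψ⟫_ℂ := by
  refine (hA g φ).unique ?_
  simp only [h]
  exact hermiteSummable_id ħ hħ g ψ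

lemma hermiteSummable_actS (ħ : ℝ) (hħ : 0 < ħ) (O : Obs d) (hO : O ≠ Obs.osc) :
    HermiteSummable ħ hħ (actS ħ O) := by
  cases O with
  | osc => exact absurd rfl hO
  | pos j => exact hermiteSummable_mulS ħ hħ j
  | gradPlus j => exact (hermiteSummable_gradS ħ hħ j).smul _
  | gradMinus j =>
    have := (hermiteSummable_gradS ħ hħ j).smul (-(ħ : ℂ))
    rwa [neg_smul] at this

/-- `x_j - y_j` on Schwartz functions. -/
def posOp (z : Phase d) (j : Fin d) : 𝓢(Conf d, ℂ) →L[ℂ] 𝓢(Conf d, ℂ) :=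
  ((z.1 j : ℝ) : ℂ) • ContinuousLinearMap.id ℂ _ + (-1 : ℂ) • mulS j

/-- `ξ_j + iħ∂_j` on Schwartz functions. -/
def momOp (ħ : ℝ) (z : Phase d) (j : Fin d) : 𝓢(Conf d, ℂ) →L[ℂ] 𝓢(Conf d, ℂ) :=
  ((z.2 j : ℝ) : ℂ) • ContinuousLinearMap.id ℂ _ + (Complex.I * (ħ : ℂ)) • gradS j

lemma hermiteSummable_posOp (ħ : ℝ) (hħ : 0 < ħ) (z : Phase d) (j : Fin d) :
    HermiteSummable ħ hħ (posOp z j) :=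
  ((hermiteSummable_id ħ hħ).smul _).add ((hermiteSummable_mulS ħ hħ j).smul _)

lemma hermiteSummable_momOp (ħ : ℝ) (hħ : 0 < ħ) (z : Phase d) (j : Fin d) :
    HermiteSummable ħ hħ (momOp ħ z j) :=
  ((hermiteSummable_id ħ hħ).smul _).add ((hermiteSummable_gradS ħ hħ j).smul _)

lemma isWeakDeriv_iff (j : Fin d) (φ ψ : L2 d) :
    IsWeakDeriv j φ ψ ↔ ∀ g : 𝓢(Conf d, ℂ), ⟪sL2 (gradS j g), φ⟫_ℂ = -⟪sL2 g, ψ⟫_ℂ := by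
  have e : ∀ (g : 𝓢(Conf d, ℂ)) (y : Conf d), (starRingEnd ℂ) (gradS j g y) =
      lineDeriv ℝ (conjS g : Conf d → ℂ) y (basisVec j) := by
    intro g y
    have := lineDerivOp_conjS g (basisVec j) y
    rw [SchwartzMap.lineDerivOp_apply] at this
    rw [this]; rfl
  simp only [inner_sL2_left, IsWeakDeriv, e]
  constructor
  · intro h g
    exact h (conjS g)
  · intro h g
    have h1 := h (conjS g)
    have h2 : conjS (conjS g) = g := by ext y; simp
    simpa [h2] using h1

lemma integral_starRingEnd_mul_eq_inner (g : 𝓢(Conf d, ℂ)) (f : Conf d → ℂ)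
    (hf : MemLp f 2 (volume : Measure (Conf d))) :
    ⟪sL2 g, hf.toLp f⟫_ℂ = ∫ y, (starRingEnd ℂ) (g y) * f y := by
  rw [inner_sL2_left]
  refine integral_congr_ae ?_
  filter_upwards [hf.coeFn_toLp] with y hy
  rw [hy]

lemma lintegral_enorm_sq_eq_enorm_sq (u : L2 d) (f : Conf d → ℂ) (h : f =ᵐ[volume] u) :
    ∫⁻ y, ‖f y‖ₑ ^ 2 = ‖u‖ₑ ^ 2 := by
  rw [enorm_sq_L2]
  refine lintegral_congr_ae ?_
  filter_upwards [h] with y hy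
  rw [hy]

/-- The squared norm of the image of `φ` under the weak extension of an operator. -/
lemma tsum_hermite_eq (ħ : ℝ) (hħ : 0 < ħ) (A : 𝓢(Conf d, ℂ) →L[ℂ] 𝓢(Conf d, ℂ)) (φ ψ : L2 d)
    (h : ∀ g, ⟪sL2 (A g), φ⟫_ℂ = ⟪sL2 g, ψ⟫_ℂ) :
    ∑' m, ‖⟪sL2 (A (hermS ħ hħ m)), φ⟫_ℂ‖ₑ ^ 2 = ‖ψ‖ₑ ^ 2 := by
  simp only [h]
  have := tsum_enorm_sq_inner (hermB ħ hħ) ψ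
  simpa using this

/-- Riesz–Fischer produces a vector with the prescribed Hermite coefficients, and `HermiteSummable`
extends the identity from Hermite functions to every Schwartz test function. -/
lemma exists_weak_image {ħ : ℝ} {hħ : 0 < ħ} {A : 𝓢(Conf d, ℂ) →L[ℂ] 𝓢(Conf d, ℂ)}
    (hA : HermiteSummable ħ hħ A) (φ : L2 d)
    (h : ∑' m, ‖⟪sL2 (A (hermS ħ hħ m)), φ⟫_ℂ‖ₑ ^ 2 ≠ ∞) :
    ∃ ψ : L2 d, ∀ g, ⟪sL2 (A g), φ⟫_ℂ = ⟪sL2 g, ψ⟫_ℂ := by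
  obtain ⟨ψ, hψ⟩ := exists_of_tsum_enorm_sq_ne_top (hermB ħ hħ) _ h
  exact ⟨ψ, hA.inner_eq fun m => by rw [← hψ m, hermB_apply]⟩

lemma posOp_apply (z : Phase d) (j : Fin d) (g : 𝓢(Conf d, ℂ)) (y : Conf d) :
    posOp z j g y = ((z.1 j - y j : ℝ) : ℂ) * g y := by
  simp only [posOp, add_apply, smul_apply, mulS_apply, smul_eq_mul, ContinuousLinearMap.id_apply]
  push_cast; ring

/-- An `L²` function is determined by its pairings with Schwartz functions, among locally
integrable functions. -/
lemma ae_eq_of_inner_schwartz (f : Conf d → ℂ) (hf : LocallyIntegrable f) (ψ : L2 d)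
    (h : ∀ g : 𝓢(Conf d, ℂ), ∫ y, (starRingEnd ℂ) (g y) * f y = ⟪sL2 g, ψ⟫_ℂ) :
    f =ᵐ[volume] ψ := by
  have hψ : LocallyIntegrable (ψ : Conf d → ℂ) :=
    (Lp.memLp ψ).locallyIntegrable (by norm_num)
  refine ae_eq_of_integral_contDiff_smul_eq hf hψ fun g hg hgc => ?_
  have hgc' : HasCompactSupport (fun y => ((g y : ℝ) : ℂ)) := hgc.comp_left (g := Complex.ofReal) (by simp)
  have hg' : ContDiff ℝ (⊤ : ℕ∞) (fun y => ((g y : ℝ) : ℂ)) := Complex.ofRealCLM.contDiff.comp hg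
  have := h (hgc'.toSchwartzMap hg')
  rw [inner_sL2_left] at this
  simpa using this

/-- Both sides may be infinite, so finiteness has to be transferred each way. If the right side is
finite, a weak image exists and must agree almost everywhere with the product, which is then square
integrable. If the left side is finite, the product is in L² and Parseval applies. -/
lemma lintegral_pos_eq (ħ : ℝ) (hħ : 0 < ħ) (z : Phase d) (j : Fin d) (φ : L2 d) :
    ∫⁻ y, ‖(((z.1 j - y j : ℝ) : ℂ)) * φ y‖ₑ ^ 2 =
      ∑' m, ‖⟪sL2 (posOp z j (hermS ħ hħ m)), φ⟫_ℂ‖ₑ ^ 2 := by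
  have hmeas : AEStronglyMeasurable (fun y : Conf d => ((z.1 j - y j : ℝ) : ℂ) * φ y) volume :=
    (Continuous.aestronglyMeasurable (by fun_prop)).mul (Lp.aestronglyMeasurable φ)
  have hpair : ∀ g : 𝓢(Conf d, ℂ), ⟪sL2 (posOp z j g), φ⟫_ℂ =
      ∫ y, (starRingEnd ℂ) (g y) * (((z.1 j - y j : ℝ) : ℂ) * φ y) := by
    intro g
    rw [inner_sL2_left]
    congr 1; ext y
    rw [posOp_apply, map_mul, Complex.conj_ofReal]; ring
  by_cases h1 : ∫⁻ y, ‖(((z.1 j - y j : ℝ) : ℂ)) * φ y‖ₑ ^ 2 = ∞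
  · by_contra hne
    rw [h1] at hne
    obtain ⟨ψ, hψ⟩ := exists_weak_image (hermiteSummable_posOp ħ hħ z j) φ (Ne.symm hne)
    have hloc : LocallyIntegrable (fun y : Conf d => ((z.1 j - y j : ℝ) : ℂ) * φ y) := by
      have h2 : LocallyIntegrable (φ : Conf d → ℂ) :=
        (Lp.memLp φ).locallyIntegrable (by norm_num)
      rw [locallyIntegrable_iff] at h2 ⊢
      intro K hK
      exact (h2 K hK).continuousOn_mul (Continuous.continuousOn (by fun_prop)) hK
    have hae := ae_eq_of_inner_schwartz _ hloc ψ fun g => by rw [← hpair, hψ]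
    rw [lintegral_enorm_sq_eq_enorm_sq ψ _ hae] at h1
    simp at h1
  · have hmem : MemLp (fun y : Conf d => ((z.1 j - y j : ℝ) : ℂ) * φ y) 2 volume := by
      refine ⟨hmeas, ?_⟩
      rw [eLpNorm_lt_top_iff_lintegral_rpow_enorm_lt_top (by norm_num) (by norm_num)]
      simpa [lt_top_iff_ne_top] using h1
    rw [tsum_hermite_eq ħ hħ (posOp z j) φ (hmem.toLp _) fun g => by
      rw [hpair, integral_starRingEnd_mul_eq_inner]]
    exact lintegral_enorm_sq_eq_enorm_sq _ _ hmem.coeFn_toLp.symm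

lemma inner_momOp (ħ : ℝ) (z : Phase d) (j : Fin d) (φ ψ : L2 d) (h : IsWeakDeriv j φ ψ)
    (g : 𝓢(Conf d, ℂ)) : ⟪sL2 (momOp ħ z j g), φ⟫_ℂ =
      ⟪sL2 g, ((z.2 j : ℝ) : ℂ) • φ + (Complex.I * (ħ : ℂ)) • ψ⟫_ℂ := by
  rw [isWeakDeriv_iff] at h
  rw [momOp, add_apply, smul_apply, smul_apply, map_add, map_smul, map_smul, inner_add_left,
    inner_smul_left, inner_smul_left, h, inner_add_right, inner_smul_right, inner_smul_right]
  simp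

lemma iInf_mom_eq (ħ : ℝ) (hħ : 0 < ħ) (z : Phase d) (j : Fin d) (φ : L2 d) :
    (⨅ (ψ : L2 d) (_ : IsWeakDeriv j φ ψ),
        ∫⁻ y, ‖((z.2 j : ℝ) : ℂ) * φ y + Complex.I * (ħ : ℂ) * ψ y‖ₑ ^ 2) =
      ∑' m, ‖⟪sL2 (momOp ħ z j (hermS ħ hħ m)), φ⟫_ℂ‖ₑ ^ 2 := by
  -- Every weak derivative gives the same value, so the infimum only records whether one exists.
  have hval : ∀ ψ : L2 d, IsWeakDeriv j φ ψ →
      ∫⁻ y, ‖((z.2 j : ℝ) : ℂ) * φ y + Complex.I * (ħ : ℂ) * ψ y‖ₑ ^ 2 =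
      ∑' m, ‖⟪sL2 (momOp ħ z j (hermS ħ hħ m)), φ⟫_ℂ‖ₑ ^ 2 := by
    intro ψ hψ
    rw [tsum_hermite_eq ħ hħ (momOp ħ z j) φ _ (inner_momOp ħ z j φ ψ hψ)]
    refine lintegral_enorm_sq_eq_enorm_sq _ _ ?_
    filter_upwards [Lp.coeFn_add (((z.2 j : ℝ) : ℂ) • φ) ((Complex.I * (ħ : ℂ)) • ψ),
      Lp.coeFn_smul ((z.2 j : ℝ) : ℂ) φ, Lp.coeFn_smul (Complex.I * (ħ : ℂ)) ψ] with y h1 h2 h3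
    rw [h1, Pi.add_apply, h2, h3]; rfl
  refine le_antisymm ?_ (le_iInf₂ fun ψ hψ => (hval ψ hψ).ge)
  by_cases hfin : ∑' m, ‖⟪sL2 (momOp ħ z j (hermS ħ hħ m)), φ⟫_ℂ‖ₑ ^ 2 = ∞
  · rw [hfin]; exact le_top
  obtain ⟨ψ₀, hψ₀⟩ := exists_weak_image (hermiteSummable_momOp ħ hħ z j) φ hfin
  have h' : (ħ : ℂ) ≠ 0 := by exact_mod_cast hħ.ne'
  -- The weak image ψ₀ stands for ξ_j φ + iħ∂_j φ; solving for ∂_j φ exhibits the weak derivative.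
  have hw : IsWeakDeriv j φ ((Complex.I * (ħ : ℂ))⁻¹ • (ψ₀ - ((z.2 j : ℝ) : ℂ) • φ)) := by
    rw [isWeakDeriv_iff]
    intro g
    have := hψ₀ g
    rw [momOp, add_apply, smul_apply, smul_apply, map_add, map_smul, map_smul, inner_add_left,
      inner_smul_left, inner_smul_left] at this
    simp only [Complex.conj_ofReal, map_mul, Complex.conj_I, ContinuousLinearMap.id_apply] at this
    rw [inner_smul_right, inner_sub_right, inner_smul_right, ← this]
    field_simp
    ring
  exact (iInf₂_le _ hw).trans (hval _ hw).le

/-- The quadratic form of the transport cost in terms of Hermite functions. -/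
theorem costForm_eq (ħ : ℝ) (hħ : 0 < ħ) (z : Phase d) (φ : L2 d) :
    costForm ħ z φ = (1 / 2) * ∑ j : Fin d,
      ((∑' m, ‖⟪sL2 (posOp z j (hermS ħ hħ m)), φ⟫_ℂ‖ₑ ^ 2) +
        ∑' m, ‖⟪sL2 (momOp ħ z j (hermS ħ hħ m)), φ⟫_ℂ‖ₑ ^ 2) := by
  rw [costForm]
  simp_rw [lintegral_pos_eq ħ hħ, iInf_mom_eq ħ hħ]

lemma posSqrt_isSelfAdjoint {H : Type*} [NormedAddCommGroup H] [InnerProductSpace ℂ H]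
    [CompleteSpace H] (Q : H →L[ℂ] H) (u v : H) :
    ⟪posSqrt Q u, v⟫_ℂ = ⟪u, posSqrt Q v⟫_ℂ := by
  have h : (posSqrt Q).IsPositive := by
    rw [← ContinuousLinearMap.nonneg_iff_isPositive]
    exact CFC.sqrt_nonneg Q
  exact h.isSymmetric u v

lemma posSqrt_mul_self {H : Type*} [NormedAddCommGroup H] [InnerProductSpace ℂ H]
    [CompleteSpace H] (Q : H →L[ℂ] H) (hQ : Q.IsPositive) (u : H) :
    posSqrt Q (posSqrt Q u) = Q u := by
  have h := CFC.sqrt_mul_sqrt_self Q (by rwa [ContinuousLinearMap.nonneg_iff_isPositive])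
  exact congrArg (fun T : H →L[ℂ] H => T u) h

lemma enorm_posSqrt_sq {H : Type*} [NormedAddCommGroup H] [InnerProductSpace ℂ H]
    [CompleteSpace H] (Q : H →L[ℂ] H) (hQ : Q.IsPositive) (f : H) :
    ‖posSqrt Q f‖ₑ ^ 2 = ENNReal.ofReal (RCLike.re ⟪f, Q f⟫_ℂ) := by
  rw [enorm_sq_eq_ofReal, ← posSqrt_mul_self Q hQ, ← posSqrt_isSelfAdjoint,
    inner_self_eq_norm_sq]

lemma tsum_onb_posSqrt (Q : Op d) (hQ : Q.IsPositive) (f : L2 d) :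
    ∑' n, ‖⟪f, posSqrt Q (onb d n)⟫_ℂ‖ₑ ^ 2 = ENNReal.ofReal (RCLike.re ⟪f, Q f⟫_ℂ) := by
  rw [← enorm_posSqrt_sq Q hQ, ← tsum_enorm_sq_inner (onb d)]
  refine tsum_congr fun n => ?_
  rw [← posSqrt_isSelfAdjoint, ← inner_conj_symm, RCLike.enorm_conj]

/-- The trace does not depend on the basis. -/
lemma opTrace_eq_hermite (ħ : ℝ) (hħ : 0 < ħ) (Q : Op d) (hQ : Q.IsPositive) :
    opTrace Q = ∑' m, ‖posSqrt Q (sL2 (hermS ħ hħ m))‖ₑ ^ 2 := by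
  simp only [opTrace, ← enorm_posSqrt_sq Q hQ]
  conv_lhs => simp only [← tsum_enorm_sq_inner (hermB ħ hħ) (posSqrt Q _)]
  rw [ENNReal.tsum_comm]
  refine tsum_congr fun m => ?_
  rw [← tsum_enorm_sq_inner (onb d) (posSqrt Q _)]
  refine tsum_congr fun n => ?_
  rw [hermB_apply, ← posSqrt_isSelfAdjoint, ← inner_conj_symm, RCLike.enorm_conj]

/-- The trace of the transport cost in terms of Hermite functions. -/
theorem costTrace_eq (ħ : ℝ) (hħ : 0 < ħ) (z : Phase d) (Q : Op d) (hQ : Q.IsPositive) :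
    costTrace ħ z Q = (1 / 2) * ∑ j : Fin d,
      ((∑' m, ENNReal.ofReal (RCLike.re ⟪sL2 (posOp z j (hermS ħ hħ m)),
          Q (sL2 (posOp z j (hermS ħ hħ m)))⟫_ℂ)) +
        ∑' m, ENNReal.ofReal (RCLike.re ⟪sL2 (momOp ħ z j (hermS ħ hħ m)),
          Q (sL2 (momOp ħ z j (hermS ħ hħ m)))⟫_ℂ)) := by
  -- By Tonelli the sum over the basis defining the trace becomes the inner one, and it evaluates to
  -- ⟨f, Q f⟩ for each vector f of the Hermite sum; no square root of Q remains.
  simp_rw [costTrace, costForm_eq ħ hħ, ← tsum_onb_posSqrt Q hQ]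
  rw [ENNReal.tsum_mul_left, Summable.tsum_finsetSum (fun _ _ => ENNReal.summable)]
  congr 1
  refine Finset.sum_congr rfl fun j _ => ?_
  rw [ENNReal.tsum_add, ENNReal.tsum_comm, ENNReal.tsum_comm (f := fun n m =>
    ‖⟪sL2 (momOp ħ z j (hermS ħ hħ m)), posSqrt Q (onb d n)⟫_ℂ‖ₑ ^ 2)]

end Core
end SemiWass
end

noncomputable section
namespace SemiWass

/-! ### Husimi functions -/

section Husimi
variable {d : ℕ}

instance : (volume : Measure (Phase d)).IsAddHaarMeasure :=
  inferInstanceAs ((volume : Measure (Conf d)).prod (volume : Measure (Conf d))).IsAddHaarMeasure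

lemma norm_iteratedFDeriv_comp_clm_le {E F G : Type*} [NormedAddCommGroup E] [NormedSpace ℝ E]
    [NormedAddCommGroup F] [NormedSpace ℝ F] [NormedAddCommGroup G] [NormedSpace ℝ G]
    (L : E →L[ℝ] F) (hL : ‖L‖ ≤ 1) (A : 𝓢(F, G)) (n : ℕ) (x : E) :
    ‖iteratedFDeriv ℝ n (fun y => A (L y)) x‖ ≤ ‖iteratedFDeriv ℝ n A (L x)‖ := by
  have h := L.iteratedFDeriv_comp_right (f := A) (A.smooth n) x (i := n) le_rfl
  have e : (A ∘ L : E → G) = fun y => A (L y) := rfl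
  rw [e] at h
  rw [h]
  refine (ContinuousMultilinearMap.norm_compContinuousLinearMap_le _ _).trans ?_
  refine mul_le_of_le_one_right (norm_nonneg _) ?_
  exact Finset.prod_le_one (fun _ _ => norm_nonneg _) fun _ _ => hL

/-- Leibniz's rule, with the power of the sup norm of q split as ‖q.1‖ ^ k + ‖q.2‖ ^ k so that each
factor is controlled by its own seminorms. -/
lemma tensor_decay (A B : 𝓢(Conf d, ℂ)) (k n : ℕ) : ∃ C : ℝ, ∀ q : Phase d, ‖q‖ ^ k *
    ‖iteratedFDeriv ℝ n (fun q : Phase d => A q.1 * B q.2) q‖ ≤ C := by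
  set S := fun (k n : ℕ) (f : 𝓢(Conf d, ℂ)) => SchwartzMap.seminorm ℝ k n f with hS
  refine ⟨∑ i ∈ Finset.range (n + 1), (n.choose i : ℝ) *
    (S k i A * S 0 (n - i) B + S 0 i A * S k (n - i) B), fun q => ?_⟩
  have h1 := norm_iteratedFDeriv_mul_le (𝕜 := ℝ) (n := n) (N := ((⊤ : ℕ∞) : WithTop ℕ∞))
    (f := fun q : Phase d => A q.1) (g := fun q : Phase d => B q.2)
    ((A.smooth ⊤).comp contDiff_fst) ((B.smooth ⊤).comp contDiff_snd) q (by exact_mod_cast le_top)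
  refine (mul_le_mul_of_nonneg_left h1 (by positivity)).trans ?_
  rw [Finset.mul_sum]
  refine Finset.sum_le_sum fun i _ => ?_
  have a1 := norm_iteratedFDeriv_comp_clm_le (ContinuousLinearMap.fst ℝ (Conf d) (Conf d))
    (ContinuousLinearMap.norm_fst_le ..) A i q
  have b1 := norm_iteratedFDeriv_comp_clm_le (ContinuousLinearMap.snd ℝ (Conf d) (Conf d))
    (ContinuousLinearMap.norm_snd_le ..) B (n - i) q
  simp only [ContinuousLinearMap.coe_fst', ContinuousLinearMap.coe_snd'] at a1 b1
  have hk : ‖q‖ ^ k ≤ ‖q.1‖ ^ k + ‖q.2‖ ^ k := by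
    rw [Prod.norm_def]
    rcases max_cases ‖q.1‖ ‖q.2‖ with h | h
    · rw [h.1]; nlinarith [pow_nonneg (norm_nonneg q.2) k]
    · rw [h.1]; nlinarith [pow_nonneg (norm_nonneg q.1) k]
  have a2 := SchwartzMap.le_seminorm ℝ k i A q.1
  have a3 := SchwartzMap.norm_iteratedFDeriv_le_seminorm ℝ A i q.1
  have b2 := SchwartzMap.le_seminorm ℝ k (n - i) B q.2
  have b3 := SchwartzMap.norm_iteratedFDeriv_le_seminorm ℝ B (n - i) q.2
  calc ‖q‖ ^ k * ((n.choose i : ℝ) * ‖iteratedFDeriv ℝ i (fun q : Phase d => A q.1) q‖ *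
        ‖iteratedFDeriv ℝ (n - i) (fun q : Phase d => B q.2) q‖)
      ≤ (‖q.1‖ ^ k + ‖q.2‖ ^ k) * ((n.choose i : ℝ) * ‖iteratedFDeriv ℝ i A q.1‖ *
        ‖iteratedFDeriv ℝ (n - i) B q.2‖) := by gcongr
    _ = (n.choose i : ℝ) * ((‖q.1‖ ^ k * ‖iteratedFDeriv ℝ i A q.1‖) *
          ‖iteratedFDeriv ℝ (n - i) B q.2‖ + ‖iteratedFDeriv ℝ i A q.1‖ *
          (‖q.2‖ ^ k * ‖iteratedFDeriv ℝ (n - i) B q.2‖)) := by ring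
    _ ≤ _ := by simp only [hS]; gcongr

/-- The tensor product of two Schwartz functions. -/
def tensS (A B : 𝓢(Conf d, ℂ)) : 𝓢(Phase d, ℂ) where
  toFun := fun q => A q.1 * B q.2
  smooth' := ((A.smooth ⊤).comp contDiff_fst).mul ((B.smooth ⊤).comp contDiff_snd)
  decay' := tensor_decay A B

@[simp] lemma tensS_apply (A B : 𝓢(Conf d, ℂ)) (q : Phase d) : tensS A B q = A q.1 * B q.2 := rfl

/-- The change of variables `(q₁, q₂) ↦ (q₁ + ħq₂/2, q₁ - ħq₂/2)`. -/
def wignerEquiv (ħ : ℝ) (hħ : 0 < ħ) : (Conf d × Conf d) ≃ᵐ (Conf d × Conf d) where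
  toFun := fun q => (q.1 + (ħ / 2) • q.2, q.1 - (ħ / 2) • q.2)
  invFun := fun p => ((1 / 2 : ℝ) • (p.1 + p.2), ħ⁻¹ • (p.1 - p.2))
  left_inv := by
    intro q
    ext1
    · ext l; simp; ring
    · ext l; simp; field_simp; ring
  right_inv := by
    intro q
    ext1
    · ext l; simp; field_simp; ring
    · ext l; simp; field_simp; ring
  measurable_toFun := by
    simp only [Equiv.coe_fn_mk]; fun_prop
  measurable_invFun := by
    simp only [Equiv.coe_fn_symm_mk]; fun_prop

lemma wignerEquiv_apply (ħ : ℝ) (hħ : 0 < ħ) (q : Conf d × Conf d) :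
    wignerEquiv ħ hħ q = (q.1 + (ħ / 2) • q.2, q.1 - (ħ / 2) • q.2) := rfl

lemma map_sub_smul_volume (ħ : ℝ) (hħ : 0 < ħ) (x : Conf d) :
    Measure.map (fun q : Conf d => x - ħ • q) volume =
      ENNReal.ofReal ((ħ ^ d)⁻¹) • (volume : Measure (Conf d)) := by
  have h := Measure.map_addHaar_smul (volume : Measure (Conf d)) hħ.ne'
  have e : (fun q : Conf d => x - ħ • q) = (fun y => x - y) ∘ (fun q => ħ • q) := rfl
  have h3 : Measure.map (fun y : Conf d => x - y) volume = volume :=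
    (Measure.measurePreserving_sub_left (volume : Measure (Conf d)) x).map_eq
  rw [e, ← Measure.map_map (by fun_prop) (by fun_prop), h, Measure.map_smul, h3]
  simp only [finrank_euclideanSpace, Fintype.card_fin]
  rw [abs_of_pos (by positivity)]

/-- The linear change of variables factors through a measure-preserving shear, two swaps and (x, y)
↦ (x, x - ħy), so the Jacobian reduces to a scaling of ℝ^d and no determinant has to be computed. -/
lemma map_wignerEquiv (ħ : ℝ) (hħ : 0 < ħ) :
    Measure.map (wignerEquiv (d := d) ħ hħ) volume =
      ENNReal.ofReal ((ħ ^ d)⁻¹) • (volume : Measure (Conf d × Conf d)) := by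
  have h1 : MeasurePreserving (fun p : Conf d × Conf d => (p.1, p.2 + (ħ / 2) • p.1))
      (volume.prod volume) (volume.prod volume) :=
    (MeasurePreserving.id volume).skew_product (g := fun a b => b + (ħ / 2) • a)
      (by fun_prop) (ae_of_all _ fun a => (measurePreserving_add_right volume _).map_eq)
  have h2 : MeasurePreserving (fun p : Conf d × Conf d => (p.1, p.1 - ħ • p.2))
      (volume.prod volume) (volume.prod (ENNReal.ofReal ((ħ ^ d)⁻¹) • volume)) :=
    (MeasurePreserving.id volume).skew_product (g := fun a b => a - ħ • b)
      (by fun_prop) (ae_of_all _ fun a => map_sub_smul_volume ħ hħ a)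
  have hsw : MeasurePreserving (Prod.swap : Conf d × Conf d → Conf d × Conf d)
      (volume.prod volume) (volume.prod volume) := Measure.measurePreserving_swap
  have h3 := h2.comp (hsw.comp (h1.comp hsw))
  have e : (wignerEquiv (d := d) ħ hħ : Conf d × Conf d → Conf d × Conf d) =
      (fun p : Conf d × Conf d => (p.1, p.1 - ħ • p.2)) ∘ Prod.swap ∘
      (fun p : Conf d × Conf d => (p.1, p.2 + (ħ / 2) • p.1)) ∘ Prod.swap := by
    ext1 q
    simp only [wignerEquiv_apply, Function.comp_apply, Prod.swap_prod_mk, Prod.fst_swap,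
      Prod.snd_swap]
    congr 1
    module
  rw [e, Measure.volume_eq_prod, h3.map_eq, Measure.prod_smul_right]

lemma integral_wigner_change (ħ : ℝ) (hħ : 0 < ħ) (F : Conf d × Conf d → ℂ) :
    ∫ q : Conf d × Conf d, F (q.1 + (ħ / 2) • q.2, q.1 - (ħ / 2) • q.2) =
      (((ħ ^ d)⁻¹ : ℝ) : ℂ) * ∫ p, F p := by
  have h := (wignerEquiv (d := d) ħ hħ).measurableEmbedding.integral_map (μ := volume) F
  rw [map_wignerEquiv, integral_smul_measure, ENNReal.toReal_ofReal (by positivity)] at h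
  simp only [wignerEquiv_apply] at h
  rw [← h, Complex.real_smul]

lemma memLp_tensor (f g : 𝓢(Conf d, ℂ)) :
    MemLp (fun p : Conf d × Conf d => f p.1 * g p.2) 2 volume :=
  (tensS f g).memLp 2 volume

lemma inner_kernel (T : Op d) (r : Conf d × Conf d → ℂ) (hr : IsKernel T r)
    (f g : 𝓢(Conf d, ℂ)) :
    ⟪sL2 f, T (sL2 g)⟫_ℂ = ∫ p : Conf d × Conf d, r p * ((starRingEnd ℂ) (f p.1) * g p.2) := by
  have hint : Integrable (fun p : Conf d × Conf d => r p * ((starRingEnd ℂ) (f p.1) * g p.2)) :=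
    hr.1.integrable_mul (memLp_tensor (conjS f) g)
  rw [inner_sL2_left, Measure.volume_eq_prod, integral_prod _ hint]
  refine integral_congr_ae ?_
  filter_upwards [hr.2 (sL2 g)] with x hx
  rw [hx, ← integral_const_mul]
  refine integral_congr_ae ?_
  filter_upwards [sL2_coeFn g] with y hy
  rw [hy]; ring

lemma integral_gauss_phase (ħ : ℝ) (hħ : 0 < ħ) (ξ y : Conf d) :
    ∫ η : Conf d, Complex.exp (-(Complex.I * (⟪η, y⟫_ℝ : ℂ))) *
      ((Real.exp (-(1 / ħ) * ‖η - ξ‖ ^ 2) : ℝ) : ℂ) =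
    (((Real.pi * ħ) ^ ((d : ℝ) / 2) : ℝ) : ℂ) * (Complex.exp (-(Complex.I * (⟪ξ, y⟫_ℝ : ℂ))) *
      ((Real.exp (-(ħ / 4) * ‖y‖ ^ 2) : ℝ) : ℂ)) := by
  rw [← integral_add_right_eq_self _ ξ]
  have h := GaussianFourier.integral_cexp_neg_mul_sq_norm_add (V := Conf d) (b := ((1 / ħ : ℝ) : ℂ))
    (by rw [Complex.ofReal_re]; positivity) (-Complex.I) y
  have e : ∀ η : Conf d, Complex.exp (-(Complex.I * (⟪η + ξ, y⟫_ℝ : ℂ))) *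
      ((Real.exp (-(1 / ħ) * ‖η + ξ - ξ‖ ^ 2) : ℝ) : ℂ) =
      Complex.exp (-(Complex.I * (⟪ξ, y⟫_ℝ : ℂ))) *
        Complex.exp (-((1 / ħ : ℝ) : ℂ) * ‖η‖ ^ 2 + -Complex.I * ⟪y, η⟫_ℝ) := by
    intro η
    rw [add_sub_cancel_right, inner_add_left, real_inner_comm y η, Complex.ofReal_exp,
      ← Complex.exp_add, ← Complex.exp_add]
    congr 1
    push_cast
    ring
  simp_rw [e]
  rw [integral_const_mul, h]
  simp only [finrank_euclideanSpace, Fintype.card_fin]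
  have e1 : (Real.pi / ((1 / ħ : ℝ) : ℂ)) = ((Real.pi * ħ : ℝ) : ℂ) := by
    push_cast; field_simp
  rw [e1, Complex.ofReal_cpow (by positivity)]
  have e2 : Complex.exp ((-Complex.I) ^ 2 * ‖y‖ ^ 2 / (4 * ((1 / ħ : ℝ) : ℂ))) =
      ((Real.exp (-(ħ / 4) * ‖y‖ ^ 2) : ℝ) : ℂ) := by
    rw [Complex.ofReal_exp]
    congr 1
    rw [neg_sq, Complex.I_sq]
    push_cast
    have h' : (ħ : ℂ) ≠ 0 := by exact_mod_cast hħ.ne'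
    field_simp
  rw [e2]
  push_cast
  ring

/-- In centre and difference coordinates the cross terms of the two squares cancel and the phase
depends on the difference only. The product separates, and it is therefore proportional to the
partial Fourier transform of a Gaussian on phase space. -/
lemma conj_cohS_mul_cohS (ħ : ℝ) (hħ : 0 < ħ) (z : Phase d) (q : Conf d × Conf d) :
    (starRingEnd ℂ) (cohS ħ hħ z (q.1 + (ħ / 2) • q.2)) * cohS ħ hħ z (q.1 - (ħ / 2) • q.2) =
      (((Real.pi * ħ) ^ (-(d : ℝ) / 2) : ℝ) : ℂ) * (((Real.exp (-(1 / ħ) * ‖q.1 - z.1‖ ^ 2) : ℝ) : ℂ) *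
        (Complex.exp (-(Complex.I * (⟪z.2, q.2⟫_ℝ : ℂ))) *
          ((Real.exp (-(ħ / 4) * ‖q.2‖ ^ 2) : ℝ) : ℂ))) := by
  rw [cohS_coe, coherentFun, coherentFun]
  have n1 : ‖q.1 + (ħ / 2) • q.2 - z.1‖ ^ 2 =
      ‖q.1 - z.1‖ ^ 2 + ħ * ⟪q.1 - z.1, q.2⟫_ℝ + ħ ^ 2 / 4 * ‖q.2‖ ^ 2 := by
    rw [show q.1 + (ħ / 2) • q.2 - z.1 = (q.1 - z.1) + (ħ / 2) • q.2 by abel, norm_add_sq_real,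
      inner_smul_right, norm_smul, Real.norm_of_nonneg (by positivity)]
    ring
  have n2 : ‖q.1 - (ħ / 2) • q.2 - z.1‖ ^ 2 =
      ‖q.1 - z.1‖ ^ 2 - ħ * ⟪q.1 - z.1, q.2⟫_ℝ + ħ ^ 2 / 4 * ‖q.2‖ ^ 2 := by
    rw [show q.1 - (ħ / 2) • q.2 - z.1 = (q.1 - z.1) - (ħ / 2) • q.2 by abel, norm_sub_sq_real,
      inner_smul_right, norm_smul, Real.norm_of_nonneg (by positivity)]
    ring
  have i1 : ⟪z.2, q.1 + (ħ / 2) • q.2 - z.1⟫_ℝ = ⟪z.2, q.1 - z.1⟫_ℝ + ħ / 2 * ⟪z.2, q.2⟫_ℝ := by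
    rw [show q.1 + (ħ / 2) • q.2 - z.1 = (q.1 - z.1) + (ħ / 2) • q.2 by abel, inner_add_right,
      inner_smul_right]
  have i2 : ⟪z.2, q.1 - (ħ / 2) • q.2 - z.1⟫_ℝ = ⟪z.2, q.1 - z.1⟫_ℝ - ħ / 2 * ⟪z.2, q.2⟫_ℝ := by
    rw [show q.1 - (ħ / 2) • q.2 - z.1 = (q.1 - z.1) - (ħ / 2) • q.2 by abel, inner_sub_right,
      inner_smul_right]
  rw [n1, n2, i1, i2, map_mul, Complex.conj_ofReal, ← Complex.exp_conj, map_mul, Complex.conj_I,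
    Complex.conj_ofReal]
  have hp : (Real.pi * ħ) ^ (-(d : ℝ) / 2) =
      (Real.pi * ħ) ^ (-(d : ℝ) / 4) * (Real.pi * ħ) ^ (-(d : ℝ) / 4) := by
    rw [← Real.rpow_add (by positivity)]; congr 1; ring
  rw [hp]
  simp only [Complex.ofReal_mul, Complex.ofReal_exp]
  have h' : (ħ : ℂ) ≠ 0 := by exact_mod_cast hħ.ne'
  generalize (((Real.pi * ħ) ^ (-(d : ℝ) / 4) : ℝ) : ℂ) = K
  have : ∀ a b c e f g h : ℂ, a + b + (c + e) = f + (g + h) →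
      K * Complex.exp a * Complex.exp b * (K * Complex.exp c * Complex.exp e) =
      K * K * (Complex.exp f * (Complex.exp g * Complex.exp h)) := by
    intro a b c e f g h he
    rw [← Complex.exp_add g, ← Complex.exp_add f, ← he, Complex.exp_add, Complex.exp_add,
      Complex.exp_add]
    ring
  apply this
  push_cast
  field_simp
  ring

/-- The Husimi function is `(2πħ)^{-d} ⟨z|R|z⟩`. -/
theorem husimi_eq (ħ : ℝ) (hħ : 0 < ħ) (R : Op d) (W : Phase d → ℂ) (hW : IsWigner ħ R W)
    (z : Phase d) : husimi ħ W z =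
      ((2 * Real.pi * ħ) ^ d)⁻¹ * RCLike.re ⟪sL2 (cohS ħ hħ z), R (sL2 (cohS ħ hħ z))⟫_ℂ := by
  obtain ⟨hW2, r, hr, hφ⟩ := hW
  have ha : 0 < 1 / ħ := by positivity
  set A : 𝓢(Conf d, ℂ) := SchwartzMap.compSubConstCLM ℂ z.1 (gaussS (1 / ħ) ha) with hA
  set B : 𝓢(Conf d, ℂ) := SchwartzMap.compSubConstCLM ℂ z.2 (gaussS (1 / ħ) ha) with hB
  have hAa : ∀ y, A y = ((Real.exp (-(1 / ħ) * ‖y - z.1‖ ^ 2) : ℝ) : ℂ) := fun y => rfl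
  have hBa : ∀ y, B y = ((Real.exp (-(1 / ħ) * ‖y - z.2‖ ^ 2) : ℝ) : ℂ) := fun y => rfl
  -- The weak definition of W is tested against the heat kernel centred at z, whose partial Fourier
  -- transform is, up to a constant, the kernel of |z⟩⟨z| in centre and difference coordinates.
  have h1 := hφ (tensS A B)
  have hint : Integrable (fun z' => W z' * tensS A B z') :=
    hW2.integrable_mul ((tensS A B).memLp 2 volume)
  have hK := inner_kernel R r hr (cohS ħ hħ z) (cohS ħ hħ z)
  have hcv := integral_wigner_change ħ hħ (fun p : Conf d × Conf d =>
    r p * ((starRingEnd ℂ) (cohS ħ hħ z p.1) * cohS ħ hħ z p.2))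
  rw [← hK] at hcv
  have hq : ∀ q : Conf d × Conf d, r (q.1 + (ħ / 2) • q.2, q.1 - (ħ / 2) • q.2) *
      ∫ ξ : Conf d, Complex.exp (-(Complex.I * (⟪ξ, q.2⟫_ℝ : ℂ))) * tensS A B (q.1, ξ) =
      (((Real.pi * ħ) ^ d : ℝ) : ℂ) * (r (q.1 + (ħ / 2) • q.2, q.1 - (ħ / 2) • q.2) *
        ((starRingEnd ℂ) (cohS ħ hħ z (q.1 + (ħ / 2) • q.2)) * cohS ħ hħ z (q.1 - (ħ / 2) • q.2))) := by
    intro q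
    rw [conj_cohS_mul_cohS]
    have e : ∫ ξ : Conf d, Complex.exp (-(Complex.I * (⟪ξ, q.2⟫_ℝ : ℂ))) * tensS A B (q.1, ξ) =
        A q.1 * ∫ ξ : Conf d, Complex.exp (-(Complex.I * (⟪ξ, q.2⟫_ℝ : ℂ))) *
          ((Real.exp (-(1 / ħ) * ‖ξ - z.2‖ ^ 2) : ℝ) : ℂ) := by
      rw [← integral_const_mul]
      congr 1; ext ξ
      rw [tensS_apply, hBa]; ring
    rw [e, integral_gauss_phase ħ hħ, hAa]
    have hp : (Real.pi * ħ) ^ ((d : ℝ) / 2) = (Real.pi * ħ) ^ d * (Real.pi * ħ) ^ (-(d : ℝ) / 2) := by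
      rw [← Real.rpow_natCast, ← Real.rpow_add (by positivity)]; congr 1; ring
    rw [hp, Complex.ofReal_mul]
    ring
  simp_rw [hq] at h1
  rw [integral_const_mul, hcv] at h1
  have h2 : ∫ z' : Phase d, Real.exp (-(‖z.1 - z'.1‖ ^ 2 + ‖z.2 - z'.2‖ ^ 2) / ħ) * (W z').re =
      RCLike.re (∫ z', W z' * tensS A B z') := by
    rw [← integral_re hint]
    congr 1; ext z'
    rw [tensS_apply, hAa, hBa, ← Complex.ofReal_mul, ← Real.exp_add, mul_comm (W z')]
    simp only [RCLike.re_to_complex, Complex.re_ofReal_mul]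
    congr 2
    rw [norm_sub_rev z.1, norm_sub_rev z.2]
    field_simp
    ring
  rw [husimi, h2, h1]
  have e3 : ((((2 * Real.pi) ^ d)⁻¹ : ℂ) * ((((Real.pi * ħ) ^ d : ℝ) : ℂ) * ((((ħ ^ d)⁻¹ : ℝ) : ℂ) *
      ⟪sL2 (cohS ħ hħ z), R (sL2 (cohS ħ hħ z))⟫_ℂ))) =
      (((((2 * Real.pi) ^ d)⁻¹ * ((Real.pi * ħ) ^ d * (ħ ^ d)⁻¹) : ℝ)) : ℂ) *
        ⟪sL2 (cohS ħ hħ z), R (sL2 (cohS ħ hħ z))⟫_ℂ := by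
    push_cast; ring
  rw [e3]
  simp only [RCLike.re_to_complex, Complex.re_ofReal_mul]
  rw [← mul_assoc]
  congr 1
  simp only [mul_pow]
  field_simp

end Husimi
end SemiWass
end

noncomputable section
namespace SemiWass

/-! ### The coupling `(2πħ)^{-d} √R |z⟩⟨z| √R` -/

section Coupling
variable {d : ℕ}

lemma integral_norm_sq_of_lintegral {α E : Type*} [MeasurableSpace α] {μ : Measure α}
    [NormedAddCommGroup E] (f : α → ℂ) (hf : AEStronglyMeasurable f μ) (x : E)
    (h : ∫⁻ z, ‖f z‖ₑ ^ 2 ∂μ = ‖x‖ₑ ^ 2) :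
    Integrable (fun z => ‖f z‖ ^ 2) μ ∧ ∫ z, ‖f z‖ ^ 2 ∂μ = ‖x‖ ^ 2 := by
  have hi : Integrable (fun z => ‖f z‖ ^ 2) μ := by
    refine ⟨hf.norm.pow 2, ?_⟩
    have : ∀ z, ‖‖f z‖ ^ 2‖ₑ = ‖f z‖ₑ ^ 2 := fun z => by
      rw [enorm_sq_eq_ofReal, Real.enorm_eq_ofReal (by positivity)]
    simp only [HasFiniteIntegral, this, h]
    exact ENNReal.pow_lt_top enorm_lt_top
  refine ⟨hi, ?_⟩
  rw [integral_eq_lintegral_of_nonneg_ae (ae_of_all _ fun z => by positivity) hi.1]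
  simp_rw [← enorm_sq_eq_ofReal]
  rw [h, enorm_sq_eq_ofReal, ENNReal.toReal_ofReal (by positivity)]

/-- Polarization of an identity between quadratic forms. -/
lemma integral_conj_mul_of_lintegral {α E E' : Type*} [MeasurableSpace α] {μ : Measure α}
    [NormedAddCommGroup E] [NormedSpace ℂ E] [NormedAddCommGroup E'] [InnerProductSpace ℂ E']
    (l : α → E →ₗ[ℂ] ℂ) (hl : ∀ u, AEStronglyMeasurable (fun z => l z u) μ) (A : E →L[ℂ] E')
    (h : ∀ u, ∫⁻ z, ‖l z u‖ₑ ^ 2 ∂μ = ‖A u‖ₑ ^ 2) (u v : E) :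
    Integrable (fun z => (starRingEnd ℂ) (l z u) * l z v) μ ∧
      ∫ z, (starRingEnd ℂ) (l z u) * l z v ∂μ = ⟪A u, A v⟫_ℂ := by
  have key := fun u => integral_norm_sq_of_lintegral (fun z => l z u) (hl u) (A u) (h u)
  have e : ∀ z, (starRingEnd ℂ) (l z u) * l z v =
      (((‖l z (u + v)‖ ^ 2 : ℝ) : ℂ) - ((‖l z (u - v)‖ ^ 2 : ℝ) : ℂ) +
        (((‖l z (u - Complex.I • v)‖ ^ 2 : ℝ) : ℂ) - ((‖l z (u + Complex.I • v)‖ ^ 2 : ℝ) : ℂ)) *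
          Complex.I) / 4 := by
    intro z
    have := inner_eq_sum_norm_sq_div_four (𝕜 := ℂ) (l z u) (l z v)
    rw [RCLike.inner_apply, mul_comm] at this
    rw [this]
    simp [map_add, map_sub]
  have i1 := ((key (u + v)).1.ofReal (𝕜 := ℂ))
  have i2 := ((key (u - v)).1.ofReal (𝕜 := ℂ))
  have i3 := ((key (u - Complex.I • v)).1.ofReal (𝕜 := ℂ))
  have i4 := ((key (u + Complex.I • v)).1.ofReal (𝕜 := ℂ))
  simp only [RCLike.ofReal_eq_complex_ofReal] at i1 i2 i3 i4
  simp_rw [e]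
  refine ⟨((i1.sub i2).add ((i3.sub i4).mul_const _)).div_const _, ?_⟩
  have s := integral_add (i1.sub i2) ((i3.sub i4).mul_const Complex.I)
  simp only [Pi.sub_apply] at s
  rw [integral_div, s, integral_sub i1 i2, integral_mul_const, integral_sub i3 i4,
    inner_eq_sum_norm_sq_div_four]
  simp only [integral_complex_ofReal, (key _).2]
  simp only [map_add, map_sub, map_smul]
  simp

lemma stronglyMeasurable_inner_coh (ħ : ℝ) (hħ : 0 < ħ) (u : L2 d) :
    StronglyMeasurable (fun z : Phase d => ⟪sL2 (cohS ħ hħ z), u⟫_ℂ) :=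
  stronglyMeasurable_inner_wp ħ _ u

/-- The resolution of the identity. -/
lemma integral_inner_coh (ħ : ℝ) (hħ : 0 < ħ) (u v : L2 d) :
    Integrable (fun z : Phase d => ⟪u, sL2 (cohS ħ hħ z)⟫_ℂ * ⟪sL2 (cohS ħ hħ z), v⟫_ℂ) ∧
      ∫ z : Phase d, ⟪u, sL2 (cohS ħ hħ z)⟫_ℂ * ⟪sL2 (cohS ħ hħ z), v⟫_ℂ =
        (((2 * Real.pi * ħ) ^ d : ℝ) : ℂ) * ⟪u, v⟫_ℂ := by
  have hK : 0 ≤ (2 * Real.pi * ħ) ^ d := by positivity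
  have h := integral_conj_mul_of_lintegral
    (fun z : Phase d => ((innerSL ℂ (sL2 (cohS ħ hħ z)) : L2 d →L[ℂ] ℂ) : L2 d →ₗ[ℂ] ℂ))
    (μ := volume) (fun u => (stronglyMeasurable_inner_coh ħ hħ u).aestronglyMeasurable)
    (((Real.sqrt ((2 * Real.pi * ħ) ^ d) : ℝ) : ℂ) • ContinuousLinearMap.id ℂ (L2 d))
    (fun u => by
      simp only [ContinuousLinearMap.coe_coe, innerSL_apply_apply, smul_apply,
        ContinuousLinearMap.id_apply]
      rw [lintegral_coherent', enorm_smul, mul_pow ‖((Real.sqrt _ : ℝ) : ℂ)‖ₑ, enorm_sq_eq_ofReal (((Real.sqrt _ : ℝ) : ℂ))]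
      congr 2
      rw [Complex.norm_real, Real.norm_eq_abs, sq_abs, Real.sq_sqrt hK]) u v
  simp only [ContinuousLinearMap.coe_coe, innerSL_apply_apply, smul_apply,
        ContinuousLinearMap.id_apply, inner_conj_symm] at h
  refine ⟨h.1, h.2.trans ?_⟩
  rw [inner_smul_left, inner_smul_right, Complex.conj_ofReal, ← mul_assoc, ← Complex.ofReal_mul,
    Real.mul_self_sqrt hK]

/-- The operator `t |v⟩⟨v|`. -/
def rk (t : ℝ) (v : L2 d) : Op d := (t : ℂ) • InnerProductSpace.rankOne ℂ v v

lemma inner_rk (t : ℝ) (v f g : L2 d) : ⟪f, rk t v g⟫_ℂ = t * (⟪f, v⟫_ℂ * ⟪v, g⟫_ℂ) := by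
  rw [rk, smul_apply, InnerProductSpace.rankOne_apply, inner_smul_right, inner_smul_right]
  ring

lemma isPositive_rk (t : ℝ) (ht : 0 ≤ t) (v : L2 d) : (rk t v).IsPositive :=
  (InnerProductSpace.isPositive_rankOne_self v).smul_of_nonneg (by exact_mod_cast ht)

lemma ofReal_re_inner_rk (t : ℝ) (ht : 0 ≤ t) (v f : L2 d) :
    ENNReal.ofReal (RCLike.re ⟪f, rk t v f⟫_ℂ) = ENNReal.ofReal t * ‖⟪f, v⟫_ℂ‖ₑ ^ 2 := by
  rw [inner_rk, ← inner_conj_symm v f, Complex.mul_conj, enorm_sq_eq_ofReal,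
    ← ENNReal.ofReal_mul ht, ← Complex.ofReal_mul, Complex.normSq_eq_norm_sq]
  rfl

lemma opTrace_rk (t : ℝ) (ht : 0 ≤ t) (v : L2 d) :
    opTrace (rk t v) = ENNReal.ofReal t * ‖v‖ₑ ^ 2 := by
  simp only [opTrace, ofReal_re_inner_rk t ht, ENNReal.tsum_mul_left, tsum_enorm_sq_inner]

lemma costTrace_rk (ħ : ℝ) (hħ : 0 < ħ) (z : Phase d) (t : ℝ) (ht : 0 ≤ t) (v : L2 d) :
    costTrace ħ z (rk t v) = ENNReal.ofReal t * costForm ħ z v := by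
  rw [costTrace_eq ħ hħ z _ (isPositive_rk t ht v), costForm_eq ħ hħ]
  simp only [ofReal_re_inner_rk t ht, ENNReal.tsum_mul_left, ← mul_add, ← Finset.mul_sum]
  ring

/-- The field of operators `(2πħ)^{-d} √R |z⟩⟨z| √R`. -/
def cohCoupling (ħ : ℝ) (hħ : 0 < ħ) (R : Op d) (z : Phase d) : Op d :=
  rk ((2 * Real.pi * ħ) ^ d)⁻¹ (posSqrt R (sL2 (cohS ħ hħ z)))

/-- The trace is (2πħ)^{-d}‖√R|z⟩‖² = (2πħ)^{-d}⟨z|R|z⟩, the Husimi function; the integral is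
√R·1·√R by the resolution of the identity. -/
lemma isCoupling_cohCoupling (ħ : ℝ) (hħ : 0 < ħ) (R : Op d) (hR : R.IsPositive)
    (W : Phase d → ℂ) (hW : IsWigner ħ R W) :
    IsCoupling (husimi ħ W) R (cohCoupling ħ hħ R) := by
  have hK : 0 < (2 * Real.pi * ħ) ^ d := by positivity
  have e : ∀ u v (z : Phase d), ⟪u, cohCoupling ħ hħ R z v⟫_ℂ = ((((2 * Real.pi * ħ) ^ d)⁻¹ : ℝ) : ℂ) *
      (⟪posSqrt R u, sL2 (cohS ħ hħ z)⟫_ℂ * ⟪sL2 (cohS ħ hħ z), posSqrt R v⟫_ℂ) := by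
    intro u v z
    rw [cohCoupling, inner_rk, posSqrt_isSelfAdjoint R u, posSqrt_isSelfAdjoint R _ v]
  have hi : ∀ u v, Integrable (fun z => ⟪u, cohCoupling ħ hħ R z v⟫_ℂ) := by
    intro u v
    simp_rw [e]
    exact (integral_inner_coh ħ hħ _ _).1.const_mul _
  refine ⟨fun u v => (hi u v).1.aemeasurable, ae_of_all _ fun z => isPositive_rk _ (by positivity) _,
    ae_of_all _ fun z => ?_, hi, fun u v => ?_⟩
  · rw [cohCoupling, opTrace_rk _ (by positivity), husimi_eq ħ hħ R W hW,
      ENNReal.ofReal_mul (by positivity), enorm_posSqrt_sq R hR]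
  · simp_rw [e]
    rw [integral_const_mul, (integral_inner_coh ħ hħ _ _).2, ← mul_assoc, ← Complex.ofReal_mul,
      inv_mul_cancel₀ hK.ne', Complex.ofReal_one, one_mul, posSqrt_isSelfAdjoint,
      posSqrt_mul_self R hR]

lemma hermiteElt_eq (ħ : ℝ) (hħ : 0 < ħ) (A : Op d) (m n : Fin d → ℕ) :
    hermiteElt ħ A m n = ⟪sL2 (hermS ħ hħ m), A (sL2 (hermS ħ hħ n))⟫_ℂ := by
  rw [hermiteElt, ← hermS_coe ħ hħ, ← hermS_coe ħ hħ, toL2_coe, toL2_coe]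

lemma hermiteCommElt_eq (ħ : ℝ) (hħ : 0 < ħ) (O : Obs d) (A : Op d) (m n : Fin d → ℕ) :
    hermiteCommElt ħ O A m n = ⟪sL2 (actS ħ O.adj (hermS ħ hħ m)), A (sL2 (hermS ħ hħ n))⟫_ℂ -
      ⟪sL2 (hermS ħ hħ m), A (sL2 (actS ħ O (hermS ħ hħ n)))⟫_ℂ := by
  rw [hermiteCommElt, ← hermS_coe ħ hħ, ← hermS_coe ħ hħ, ← actS_coe, ← actS_coe, toL2_coe,
    toL2_coe, toL2_coe, toL2_coe]

/-- If the `m`-th row of the matrix of the commutator `[O, A]` is square summable, it is given by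
a vector. -/
lemma exists_comm_vector (ħ : ℝ) (hħ : 0 < ħ) (O : Obs d) (hO : O ≠ Obs.osc) (A : Op d)
    (hA : ∀ u v, ⟪A u, v⟫_ℂ = ⟪u, A v⟫_ℂ) (m : Fin d → ℕ)
    (h : ∑' n, ‖hermiteCommElt ħ O A m n‖ₑ ^ 2 ≠ ∞) :
    ∃ κ : L2 d, ‖κ‖ₑ ^ 2 = ∑' n, ‖hermiteCommElt ħ O A m n‖ₑ ^ 2 ∧
      ∀ g : 𝓢(Conf d, ℂ), ⟪sL2 g, A (sL2 (actS ħ O.adj (hermS ħ hħ m)))⟫_ℂ =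
        ⟪sL2 (actS ħ O g), A (sL2 (hermS ħ hħ m))⟫_ℂ + ⟪sL2 g, κ⟫_ℂ := by
  -- The vector κ plays the part of [O, A]* H_m, hence the conjugated coefficients.
  obtain ⟨κ, hκ⟩ := exists_of_tsum_enorm_sq_ne_top (hermB ħ hħ)
    (fun n => (starRingEnd ℂ) (hermiteCommElt ħ O A m n)) (by simpa only [RCLike.enorm_conj] using h)
  refine ⟨κ, ?_, fun g => ?_⟩
  · rw [← tsum_enorm_sq_inner (hermB ħ hħ)]
    simp only [hκ, RCLike.enorm_conj]
  · have := (hermiteSummable_actS ħ hħ O hO).inner_eq (φ := A (sL2 (hermS ħ hħ m)))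
      (ψ := A (sL2 (actS ħ O.adj (hermS ħ hħ m))) - κ) (fun n => by
        have h1 := hκ n
        rw [hermB_apply, hermiteCommElt_eq ħ hħ, map_sub, inner_conj_symm, inner_conj_symm, hA,
          hA] at h1
        rw [inner_sub_right, h1]
        ring) g
    rw [this, inner_sub_right]
    ring

/-- Up to conjugation the integrand is ⟨φ_j(z), A H_m⟩ - ⟨z, κ⟩, with κ the adjoint commutator
applied to H_m. The orthogonality relation `lintegral_coherent` then gives the two squared norms
exactly, without a factor 2 from the triangle inequality. If the row is not square summable the
right side is infinite. -/
lemma lintegral_pos_comm_le (ħ : ℝ) (hħ : 0 < ħ) (A : Op d)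
    (hA : ∀ u v, ⟪A u, v⟫_ℂ = ⟪u, A v⟫_ℂ) (j : Fin d) (m : Fin d → ℕ) :
    ∫⁻ z : Phase d, ‖⟪sL2 (posOp z j (hermS ħ hħ m)), A (sL2 (cohS ħ hħ z))⟫_ℂ‖ₑ ^ 2 ≤
      ENNReal.ofReal ((2 * Real.pi * ħ) ^ d) * (∑' n, ‖hermiteCommElt ħ (Obs.pos j) A m n‖ₑ ^ 2 +
        ENNReal.ofReal (ħ / 2) * ‖A (sL2 (hermS ħ hħ m))‖ₑ ^ 2) := by
  by_cases h : ∑' n, ‖hermiteCommElt ħ (Obs.pos j) A m n‖ₑ ^ 2 = ∞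
  · rw [h, top_add, ENNReal.mul_top (by simp only [ne_eq, ENNReal.ofReal_eq_zero, not_le]; positivity)]
    exact le_top
  obtain ⟨κ, h1, h2⟩ := exists_comm_vector ħ hħ (Obs.pos j) (by simp) A hA m h
  rw [← h1, ← enorm_neg κ, ← lintegral_coherent ħ hħ j]
  refine le_of_eq (lintegral_congr fun z => ?_)
  have h3 := h2 (cohS ħ hħ z)
  simp only [Obs.adj, actS] at h3
  rw [mulS_cohS] at h3
  simp only [map_sub, map_smul, inner_sub_left, inner_smul_left, Complex.conj_ofReal] at h3
  rw [← hA, ← inner_conj_symm, RCLike.enorm_conj]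
  simp only [posOp, add_apply, smul_apply, ContinuousLinearMap.id_apply, map_add, map_smul,
    inner_add_right, inner_smul_right, h3, inner_neg_right]
  congr 2
  ring

/-- The mechanism is that of positions. The observable is -ħ∂_j because its formal adjoint ħ∂_j is
what acts on H_m inside the shifted momentum. -/
lemma lintegral_mom_comm_le (ħ : ℝ) (hħ : 0 < ħ) (A : Op d)
    (hA : ∀ u v, ⟪A u, v⟫_ℂ = ⟪u, A v⟫_ℂ) (j : Fin d) (m : Fin d → ℕ) :
    ∫⁻ z : Phase d, ‖⟪sL2 (momOp ħ z j (hermS ħ hħ m)), A (sL2 (cohS ħ hħ z))⟫_ℂ‖ₑ ^ 2 ≤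
      ENNReal.ofReal ((2 * Real.pi * ħ) ^ d) *
        (∑' n, ‖hermiteCommElt ħ (Obs.gradMinus j) A m n‖ₑ ^ 2 +
        ENNReal.ofReal (ħ / 2) * ‖A (sL2 (hermS ħ hħ m))‖ₑ ^ 2) := by
  by_cases h : ∑' n, ‖hermiteCommElt ħ (Obs.gradMinus j) A m n‖ₑ ^ 2 = ∞
  · rw [h, top_add, ENNReal.mul_top (by simp only [ne_eq, ENNReal.ofReal_eq_zero, not_le]; positivity)]
    exact le_top
  obtain ⟨κ, h1, h2⟩ := exists_comm_vector ħ hħ (Obs.gradMinus j) (by simp) A hA m h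
  rw [← h1, ← enorm_neg κ, ← lintegral_coherent ħ hħ j]
  refine le_of_eq (lintegral_congr fun z => ?_)
  have h3 := h2 (cohS ħ hħ z)
  simp only [Obs.adj, actS, smul_apply, neg_apply] at h3
  rw [gradS_cohS] at h3
  simp only [map_add, map_neg, map_smul, inner_add_left, inner_neg_left, inner_smul_left,
    inner_smul_right, Complex.conj_ofReal, map_mul, Complex.conj_I] at h3
  rw [← hA, ← inner_conj_symm, RCLike.enorm_conj]
  simp only [momOp, add_apply, smul_apply, ContinuousLinearMap.id_apply, map_add, map_smul,
    inner_add_right, inner_smul_right, inner_neg_right, mul_assoc, h3]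
  -- A unimodular factor -i aligns the phase of the momentum term with that of `phiS`.
  rw [← one_mul (‖-_ + _‖ₑ), show (1 : ℝ≥0∞) = ‖-Complex.I‖ₑ by simp [← ofReal_norm], ← enorm_mul]
  congr 2
  ring_nf
  rw [Complex.I_sq]
  ring

lemma measurable_enorm_inner_posOp (ħ : ℝ) (hħ : 0 < ħ) (A : Op d)
    (hA : ∀ u v, ⟪A u, v⟫_ℂ = ⟪u, A v⟫_ℂ) (j : Fin d) (g : 𝓢(Conf d, ℂ)) :
    Measurable fun z : Phase d => ‖⟪sL2 (posOp z j g), A (sL2 (cohS ħ hħ z))⟫_ℂ‖ₑ ^ 2 := by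
  have e : ∀ z : Phase d, ‖⟪sL2 (posOp z j g), A (sL2 (cohS ħ hħ z))⟫_ℂ‖ₑ =
      ‖((z.1 j : ℝ) : ℂ) * ⟪sL2 (cohS ħ hħ z), A (sL2 g)⟫_ℂ +
        (-1) * ⟪sL2 (cohS ħ hħ z), A (sL2 (mulS j g))⟫_ℂ‖ₑ := by
    intro z
    rw [← hA, ← inner_conj_symm, RCLike.enorm_conj]
    simp only [posOp, add_apply, smul_apply, ContinuousLinearMap.id_apply, map_add, map_smul,
      inner_add_right, inner_smul_right]
  simp_rw [e]
  have m1 := (stronglyMeasurable_inner_coh ħ hħ (A (sL2 g))).measurable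
  have m2 := (stronglyMeasurable_inner_coh ħ hħ (A (sL2 (mulS j g)))).measurable
  fun_prop

lemma measurable_enorm_inner_momOp (ħ : ℝ) (hħ : 0 < ħ) (A : Op d)
    (hA : ∀ u v, ⟪A u, v⟫_ℂ = ⟪u, A v⟫_ℂ) (j : Fin d) (g : 𝓢(Conf d, ℂ)) :
    Measurable fun z : Phase d => ‖⟪sL2 (momOp ħ z j g), A (sL2 (cohS ħ hħ z))⟫_ℂ‖ₑ ^ 2 := by
  have e : ∀ z : Phase d, ‖⟪sL2 (momOp ħ z j g), A (sL2 (cohS ħ hħ z))⟫_ℂ‖ₑ =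
      ‖((z.2 j : ℝ) : ℂ) * ⟪sL2 (cohS ħ hħ z), A (sL2 g)⟫_ℂ +
        (Complex.I * ħ) * ⟪sL2 (cohS ħ hħ z), A (sL2 (gradS j g))⟫_ℂ‖ₑ := by
    intro z
    rw [← hA, ← inner_conj_symm, RCLike.enorm_conj]
    simp only [momOp, add_apply, smul_apply, ContinuousLinearMap.id_apply, map_add, map_smul,
      inner_add_right, inner_smul_right]
  simp_rw [e]
  have m1 := (stronglyMeasurable_inner_coh ħ hħ (A (sL2 g))).measurable
  have m2 := (stronglyMeasurable_inner_coh ħ hħ (A (sL2 (gradS j g)))).measurable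
  fun_prop

/-- The transport cost is controlled by the Hilbert–Schmidt norms of the commutators of `√R` with
the position and momentum operators. -/
theorem quantumWass_le_comm (ħ : ℝ) (hħ : 0 < ħ) (R : Op d) (hR : IsDensityOp R)
    (W : Phase d → ℂ) (hW : IsWigner ħ R W) :
    quantumWass ħ (husimi ħ W) R ≤ (ENNReal.ofReal (d * ħ / 2) + (1 / 2) * ∑ j : Fin d,
      (∑' m, ∑' n, ‖hermiteCommElt ħ (Obs.pos j) (posSqrt R) m n‖ₑ ^ 2 +
        ∑' m, ∑' n, ‖hermiteCommElt ħ (Obs.gradMinus j) (posSqrt R) m n‖ₑ ^ 2)) ^ (1 / 2 : ℝ) := by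
  have hK : 0 < (2 * Real.pi * ħ) ^ d := by positivity
  have hA := posSqrt_isSelfAdjoint R
  rw [quantumWass]
  refine ENNReal.rpow_le_rpow ?_ (by norm_num)
  -- The infimum is bounded by the coupling (2πħ)^{-d} √R|z⟩⟨z|√R.
  refine (iInf₂_le _ (isCoupling_cohCoupling ħ hħ R hR.1 W hW)).trans ?_
  -- The squared Hilbert–Schmidt norm of √R is the trace of R. The zero-point terms of all rows
  -- therefore add up to exactly ħ/2 for each of the 2d operators.
  have htr : ∑' m, ‖posSqrt R (sL2 (hermS ħ hħ m))‖ₑ ^ 2 = 1 := by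
    rw [← opTrace_eq_hermite ħ hħ R hR.1, hR.2]
  have hc : ENNReal.ofReal ((2 * Real.pi * ħ) ^ d)⁻¹ * ENNReal.ofReal ((2 * Real.pi * ħ) ^ d) = 1 := by
    rw [← ENNReal.ofReal_mul (by positivity), inv_mul_cancel₀ hK.ne', ENNReal.ofReal_one]
  have mP := measurable_enorm_inner_posOp ħ hħ (posSqrt R) hA
  have mM := measurable_enorm_inner_momOp ħ hħ (posSqrt R) hA
  have hP : ∀ j : Fin d, ∫⁻ z : Phase d, ∑' m, ‖⟪sL2 (posOp z j (hermS ħ hħ m)),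
      posSqrt R (sL2 (cohS ħ hħ z))⟫_ℂ‖ₑ ^ 2 ≤ ENNReal.ofReal ((2 * Real.pi * ħ) ^ d) *
        (∑' m, ∑' n, ‖hermiteCommElt ħ (Obs.pos j) (posSqrt R) m n‖ₑ ^ 2 +
          ENNReal.ofReal (ħ / 2)) := by
    intro j
    rw [lintegral_tsum fun m => (mP j _).aemeasurable]
    refine (ENNReal.tsum_le_tsum fun m => lintegral_pos_comm_le ħ hħ _ hA j m).trans ?_
    rw [ENNReal.tsum_mul_left, ENNReal.tsum_add, ENNReal.tsum_mul_left, htr, mul_one]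
  have hM : ∀ j : Fin d, ∫⁻ z : Phase d, ∑' m, ‖⟪sL2 (momOp ħ z j (hermS ħ hħ m)),
      posSqrt R (sL2 (cohS ħ hħ z))⟫_ℂ‖ₑ ^ 2 ≤ ENNReal.ofReal ((2 * Real.pi * ħ) ^ d) *
        (∑' m, ∑' n, ‖hermiteCommElt ħ (Obs.gradMinus j) (posSqrt R) m n‖ₑ ^ 2 +
          ENNReal.ofReal (ħ / 2)) := by
    intro j
    rw [lintegral_tsum fun m => (mM j _).aemeasurable]
    refine (ENNReal.tsum_le_tsum fun m => lintegral_mom_comm_le ħ hħ _ hA j m).trans ?_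
    rw [ENNReal.tsum_mul_left, ENNReal.tsum_add, ENNReal.tsum_mul_left, htr, mul_one]
  have mP' : ∀ j : Fin d, Measurable fun z : Phase d => ∑' m, ‖⟪sL2 (posOp z j (hermS ħ hħ m)),
      posSqrt R (sL2 (cohS ħ hħ z))⟫_ℂ‖ₑ ^ 2 := fun j => Measurable.tsum fun m => mP j _
  have mM' : ∀ j : Fin d, Measurable fun z : Phase d => ∑' m, ‖⟪sL2 (momOp ħ z j (hermS ħ hħ m)),
      posSqrt R (sL2 (cohS ħ hħ z))⟫_ℂ‖ₑ ^ 2 := fun j => Measurable.tsum fun m => mM j _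
  simp only [cohCoupling, costTrace_rk ħ hħ _ _ (inv_nonneg.2 hK.le), costForm_eq ħ hħ]
  clear htr mP mM hA
  revert hP hM mP' mM'
  generalize hPf : (fun (j : Fin d) (z : Phase d) => ∑' m, ‖⟪sL2 (posOp z j (hermS ħ hħ m)),
      posSqrt R (sL2 (cohS ħ hħ z))⟫_ℂ‖ₑ ^ 2) = P
  generalize hMf : (fun (j : Fin d) (z : Phase d) => ∑' m, ‖⟪sL2 (momOp ħ z j (hermS ħ hħ m)),
      posSqrt R (sL2 (cohS ħ hħ z))⟫_ℂ‖ₑ ^ 2) = M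
  have hP1 : ∀ j z, ∑' m, ‖⟪sL2 (posOp z j (hermS ħ hħ m)),
      posSqrt R (sL2 (cohS ħ hħ z))⟫_ℂ‖ₑ ^ 2 = P j z := fun j z => by rw [← hPf]
  have hM1 : ∀ j z, ∑' m, ‖⟪sL2 (momOp ħ z j (hermS ħ hħ m)),
      posSqrt R (sL2 (cohS ħ hħ z))⟫_ℂ‖ₑ ^ 2 = M j z := fun j z => by rw [← hMf]
  simp only [hP1, hM1]
  intro hP hM mP mM
  rw [lintegral_const_mul _ (by fun_prop), lintegral_const_mul _ (by fun_prop),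
    lintegral_finsetSum _ (fun j _ => by fun_prop)]
  calc ENNReal.ofReal ((2 * Real.pi * ħ) ^ d)⁻¹ * (1 / 2 * ∑ j : Fin d, ∫⁻ z : Phase d,
        (P j z + M j z))
      ≤ ENNReal.ofReal ((2 * Real.pi * ħ) ^ d)⁻¹ * (1 / 2 * ∑ j : Fin d,
        (ENNReal.ofReal ((2 * Real.pi * ħ) ^ d) *
        (∑' m, ∑' n, ‖hermiteCommElt ħ (Obs.pos j) (posSqrt R) m n‖ₑ ^ 2 +
          ENNReal.ofReal (ħ / 2)) + ENNReal.ofReal ((2 * Real.pi * ħ) ^ d) *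
        (∑' m, ∑' n, ‖hermiteCommElt ħ (Obs.gradMinus j) (posSqrt R) m n‖ₑ ^ 2 +
          ENNReal.ofReal (ħ / 2)))) := by
        gcongr with j
        rw [lintegral_add_left (mP j)]
        exact add_le_add (hP j) (hM j)
    _ = (ENNReal.ofReal ((2 * Real.pi * ħ) ^ d)⁻¹ * ENNReal.ofReal ((2 * Real.pi * ħ) ^ d)) *
        (1 / 2 * ∑ j : Fin d,
        ((∑' m, ∑' n, ‖hermiteCommElt ħ (Obs.pos j) (posSqrt R) m n‖ₑ ^ 2 +
        ∑' m, ∑' n, ‖hermiteCommElt ħ (Obs.gradMinus j) (posSqrt R) m n‖ₑ ^ 2) +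
          2 * ENNReal.ofReal (ħ / 2))) := by
        simp only [← mul_add, ← Finset.mul_sum]
        have : ∀ a b e : ℝ≥0∞, a + e + (b + e) = a + b + 2 * e := fun a b e => by ring
        simp only [this]
        ring
    _ = _ := by
        rw [hc, one_mul, Finset.sum_add_distrib, mul_add, add_comm]
        congr 1
        rw [Finset.sum_const, Finset.card_univ, Fintype.card_fin, nsmul_eq_mul,
          show d * ħ / 2 = d * (ħ / 2) by ring, ENNReal.ofReal_mul (by positivity),
          ENNReal.ofReal_natCast, mul_left_comm, ← mul_assoc (1 / 2 : ℝ≥0∞) 2,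
          ENNReal.div_mul_cancel (by norm_num) (by norm_num), one_mul]

end Coupling
end SemiWass
end

noncomputable section
namespace SemiWass

/-! ### Bounds on the matrix elements between Hermite functions -/

section Hermite
variable {d : ℕ}

/-- Sums over multi-indices factor one coordinate at a time; with values in [0, ∞] no summability is
needed. -/
lemma tsum_pi_prod {ι : Type*} : ∀ {d : ℕ} (f : Fin d → ι → ℝ≥0∞),
    ∑' k : Fin d → ι, ∏ l, f l (k l) = ∏ l, ∑' a, f l a
  | 0, f => by simp
  | d + 1, f => by
    rw [← (Fin.consEquiv fun _ : Fin (d + 1) => ι).tsum_eq, ENNReal.tsum_prod',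
      Fin.prod_univ_succ, ← tsum_pi_prod]
    simp only [Fin.consEquiv_apply, Fin.prod_univ_succ, Fin.cons_zero, Fin.cons_succ]
    simp only [ENNReal.tsum_mul_left, ENNReal.tsum_mul_right]

/-- Comparison of a sum of powers with a telescoping sum. -/
lemma mul_rpow_neg_le_sub (p a h : ℝ) (hp : 1 < p) (ha : 0 < a) (hh : 0 < h) :
    h * (a + h) ^ (-p) ≤ (a ^ (1 - p) - (a + h) ^ (1 - p)) / (p - 1) := by
  rw [le_div_iff₀ (by linarith)]
  have hb : 0 < a + h := by linarith
  -- With L = log((a + h)/a), the inequalities h/(a + h) ≤ L and 1 + (p - 1)L ≤ e^{(p-1)L} replace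
  -- an integral comparison.
  have h1 : 1 - ((a + h) / a)⁻¹ ≤ Real.log ((a + h) / a) := Real.one_sub_inv_le_log_of_pos (by positivity)
  have h2 := Real.add_one_le_exp ((p - 1) * Real.log ((a + h) / a))
  have h3 : Real.exp ((p - 1) * Real.log ((a + h) / a)) = a ^ (1 - p) / (a + h) ^ (1 - p) := by
    rw [← Real.div_rpow ha.le hb.le, mul_comm, ← Real.rpow_def_of_pos (by positivity),
      ← inv_div a, Real.inv_rpow (by positivity), ← Real.rpow_neg (by positivity)]
    congr 1; ring
  have h4 : (p - 1) * (h / (a + h)) + 1 ≤ a ^ (1 - p) / (a + h) ^ (1 - p) := by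
    rw [← h3]
    refine le_trans ?_ h2
    have : h / (a + h) = 1 - ((a + h) / a)⁻¹ := by field_simp; ring
    rw [this]
    gcongr
  have h5 : (a + h) ^ (1 - p) = (a + h) * (a + h) ^ (-p) := by
    rw [sub_eq_add_neg, Real.rpow_add hb, Real.rpow_one]
  have h6 : 0 < (a + h) ^ (1 - p) := by positivity
  rw [le_div_iff₀ h6] at h4
  have h7 : ((p - 1) * (h / (a + h)) + 1) * (a + h) ^ (1 - p) =
      h * (a + h) ^ (-p) * (p - 1) + (a + h) ^ (1 - p) := by
    rw [h5]; field_simp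
  linarith

lemma sum_range_mul_rpow_le (p ħ b : ℝ) (hp : 1 < p) (hħ : 0 < ħ) (hb : 0 < b) (N : ℕ) :
    ∑ j ∈ Finset.range N, ħ * (ħ * j + b) ^ (-p) ≤ ħ * b ^ (-p) + b ^ (1 - p) / (p - 1) := by
  -- The term j = 0 is kept apart, since the comparison bounds each later term by the interval that
  -- ends at it. The induction carries the negative remainder, which is dropped at the end.
  have key : ∀ N : ℕ, ∑ j ∈ Finset.range (N + 1), ħ * (ħ * j + b) ^ (-p) ≤
      ħ * b ^ (-p) + (b ^ (1 - p) - (ħ * N + b) ^ (1 - p)) / (p - 1) := by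
    intro N
    induction N with
    | zero => simp
    | succ N ih =>
      rw [Finset.sum_range_succ]
      have h := mul_rpow_neg_le_sub p (ħ * N + b) ħ hp (by positivity) hħ
      have e : ħ * ((N + 1 : ℕ) : ℝ) + b = ħ * N + b + ħ := by push_cast; ring
      rw [e]
      refine (add_le_add ih h).trans (le_of_eq ?_)
      ring
  have hp' : 0 < p - 1 := by linarith
  cases N with
  | zero => simp only [Finset.range_zero, Finset.sum_empty]; positivity
  | succ N =>
    refine (key N).trans ?_
    gcongr
    have : 0 < (ħ * N + b) ^ (1 - p) := by positivity
    linarith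

lemma tsum_mul_rpow_le (p ħ b : ℝ) (hp : 1 < p) (hħ : 0 < ħ) (hb : 0 < b) :
    ∑' j : ℕ, ENNReal.ofReal (ħ * (ħ * j + b) ^ (-p)) ≤
      ENNReal.ofReal (ħ * b ^ (-p) + b ^ (1 - p) / (p - 1)) := by
  refine ENNReal.tsum_le_of_sum_range_le fun N => ?_
  rw [← ENNReal.ofReal_sum_of_nonneg (fun j _ => by positivity)]
  exact ENNReal.ofReal_le_ofReal (sum_range_mul_rpow_le p ħ b hp hħ hb N)

/-- The sum of (n + 2)^{-2} telescopes to at most 1, and the excess exponent contributes at most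
2^{2-q} because n + 2 ≥ 2. -/
lemma tsum_nat_succ_rpow_le (q : ℝ) (hq : 2 ≤ q) :
    ∑' n : ℕ, ENNReal.ofReal (((n : ℝ) + 2) ^ (-q)) ≤ ENNReal.ofReal (2 ^ (2 - q)) := by
  have h1 : ∀ N : ℕ, ∑ n ∈ Finset.range N, (((n : ℝ) + 2) ^ 2)⁻¹ ≤ 1 - 1 / ((N : ℝ) + 1) := by
    intro N
    induction N with
    | zero => simp
    | succ N ih =>
      rw [Finset.sum_range_succ]
      refine (add_le_add_left ih _).trans ?_
      push_cast
      have : (((N : ℝ) + 2) ^ 2)⁻¹ ≤ 1 / ((N : ℝ) + 1) - 1 / ((N : ℝ) + 1 + 1) := by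
        rw [div_sub_div _ _ (by positivity) (by positivity), inv_eq_one_div,
          div_le_div_iff₀ (by positivity) (by positivity)]
        nlinarith
      linarith
  refine ENNReal.tsum_le_of_sum_range_le fun N => ?_
  rw [← ENNReal.ofReal_sum_of_nonneg (fun j _ => by positivity)]
  refine ENNReal.ofReal_le_ofReal ?_
  calc ∑ n ∈ Finset.range N, ((n : ℝ) + 2) ^ (-q)
      ≤ ∑ n ∈ Finset.range N, 2 ^ (2 - q) * (((n : ℝ) + 2) ^ 2)⁻¹ := by
        refine Finset.sum_le_sum fun n _ => ?_
        rw [show -q = (2 - q) + (-2) by ring, Real.rpow_add (by positivity),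
          Real.rpow_neg (by positivity) 2, Real.rpow_two]
        refine mul_le_mul_of_nonneg_right ?_ (by positivity)
        have h2 : (2 : ℝ) ≤ (n : ℝ) + 2 := le_add_of_nonneg_left (Nat.cast_nonneg n)
        exact Real.rpow_le_rpow_of_nonpos (by norm_num) h2 (sub_nonpos.2 hq)
    _ ≤ 2 ^ (2 - q) := by
        rw [← Finset.mul_sum]
        refine mul_le_of_le_one_right (by positivity) ((h1 N).trans ?_)
        have : 0 ≤ 1 / ((N : ℝ) + 1) := by positivity
        linarith

lemma tsum_int_rpow_le (q : ℝ) (hq : 2 ≤ q) :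
    ∑' k : ℤ, ENNReal.ofReal ((|(k : ℝ)| + 1) ^ (-q)) ≤ ENNReal.ofReal (1 + 2 * 2 ^ (2 - q)) := by
  have h := tsum_nat_succ_rpow_le q hq
  have e1 : ∑' n : ℕ, ENNReal.ofReal ((|((n : ℤ) : ℝ)| + 1) ^ (-q)) =
      1 + ∑' n : ℕ, ENNReal.ofReal (((n : ℝ) + 2) ^ (-q)) := by
    rw [tsum_eq_zero_add' ENNReal.summable]
    congr 1
    · simp
    · refine tsum_congr fun n => ?_
      congr 2
      rw [Int.cast_natCast, abs_of_nonneg (by positivity)]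
      push_cast; ring
  have e2 : ∑' n : ℕ, ENNReal.ofReal ((|((-((n : ℤ) + 1) : ℤ) : ℝ)| + 1) ^ (-q)) =
      ∑' n : ℕ, ENNReal.ofReal (((n : ℝ) + 2) ^ (-q)) := by
    refine tsum_congr fun n => ?_
    congr 2
    push_cast
    rw [abs_neg, abs_of_nonneg (by positivity)]
    ring
  rw [tsum_of_nat_of_neg_add_one ENNReal.summable ENNReal.summable, e1, e2,
    ENNReal.ofReal_add (by norm_num) (by positivity), ENNReal.ofReal_one, two_mul,
    ENNReal.ofReal_add (by positivity) (by positivity), ← add_assoc]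
  gcongr

/-- The map i ↦ i - j embeds ℕ in ℤ, where the full sum is at most 1 + 2·2^{2-q} ≤ 3, uniformly in
j. -/
lemma tsum_nat_sub_rpow_le (q : ℝ) (hq : 2 ≤ q) (j : ℕ) :
    ∑' i : ℕ, ENNReal.ofReal ((|(i : ℝ) - j| + 1) ^ (-q)) ≤ 3 := by
  have h := ENNReal.tsum_comp_le_tsum_of_injective (f := fun i : ℕ => (i : ℤ) - j)
    (fun a b hab => by simpa using hab) (fun k : ℤ => ENNReal.ofReal ((|(k : ℝ)| + 1) ^ (-q)))
  push_cast at h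
  refine h.trans ((tsum_int_rpow_le q hq).trans ?_)
  have : (2 : ℝ) ^ (2 - q) ≤ 1 := Real.rpow_le_one_of_one_le_of_nonpos (by norm_num) (by linarith)
  calc ENNReal.ofReal (1 + 2 * 2 ^ (2 - q)) ≤ ENNReal.ofReal 3 := ENNReal.ofReal_le_ofReal (by linarith)
    _ = 3 := by norm_num

/-- The square sum of a matrix which decays away from the diagonal. -/
lemma tsum_matrix_sq_le (ħ : ℝ) (hħ : 0 < ħ) (hħ1 : ħ ≤ 1) (s t ν : ℝ) (hs : 1 / 2 < s) (ht : 1 ≤ t)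
    (k : (Fin d → ℕ) → (Fin d → ℕ) → ℂ) (hk : ∀ i j, ‖k i j‖ ≤ (2 * Real.pi * ħ) ^ ((d : ℝ) / 2) * ν *
      ∏ l, ((ħ * j l + 1 / 2) ^ (-s) * (|(i l : ℝ) - (j l : ℝ)| + 1) ^ (-t))) :
    ∑' i, ∑' j, ‖k i j‖ₑ ^ 2 ≤ ENNReal.ofReal (ν ^ 2 *
      (6 * Real.pi * (2 ^ (2 * s) + 2 ^ (2 * s - 1) / (2 * s - 1))) ^ d) := by
  have e : ∀ i j, ‖k i j‖ₑ ^ 2 ≤ ENNReal.ofReal (ν ^ 2) * ∏ l : Fin d,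
      (ENNReal.ofReal (2 * Real.pi * (ħ * (ħ * j l + 1 / 2) ^ (-(2 * s)))) *
        ENNReal.ofReal ((|(i l : ℝ) - (j l : ℝ)| + 1) ^ (-(2 * t)))) := by
    intro i j
    rw [enorm_sq_eq_ofReal]
    have e1 : ∀ l : Fin d, (2 * Real.pi * ħ) * ((ħ * j l + 1 / 2) ^ (-s) *
        (|(i l : ℝ) - (j l : ℝ)| + 1) ^ (-t)) ^ 2 = (2 * Real.pi * (ħ * (ħ * j l + 1 / 2) ^ (-(2 * s)))) *
        ((|(i l : ℝ) - (j l : ℝ)| + 1) ^ (-(2 * t))) := by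
      intro l
      have a1 : ((ħ * j l + 1 / 2) ^ (-s)) ^ 2 = (ħ * j l + 1 / 2) ^ (-(2 * s)) := by
        rw [← Real.rpow_natCast, ← Real.rpow_mul (by positivity)]; congr 1; push_cast; ring
      have a2 : ((|(i l : ℝ) - (j l : ℝ)| + 1) ^ (-t)) ^ 2 = (|(i l : ℝ) - (j l : ℝ)| + 1) ^ (-(2 * t)) := by
        rw [← Real.rpow_natCast, ← Real.rpow_mul (by positivity)]; congr 1; push_cast; ring
      rw [mul_pow, a1, a2]; ring
    have e2 : ((2 * Real.pi * ħ) ^ ((d : ℝ) / 2) * ν *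
      ∏ l, ((ħ * j l + 1 / 2) ^ (-s) * (|(i l : ℝ) - (j l : ℝ)| + 1) ^ (-t))) ^ 2 =
      ν ^ 2 * ∏ l : Fin d, (2 * Real.pi * (ħ * (ħ * j l + 1 / 2) ^ (-(2 * s)))) *
        ((|(i l : ℝ) - (j l : ℝ)| + 1) ^ (-(2 * t))) := by
      simp_rw [← e1]
      rw [Finset.prod_mul_distrib (f := fun _ => 2 * Real.pi * ħ), Finset.prod_const,
        Finset.card_univ, Fintype.card_fin, Finset.prod_pow, mul_pow, mul_pow, ← Real.rpow_natCast (_ ^ ((d : ℝ) / 2)),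
        ← Real.rpow_mul (by positivity), ← Real.rpow_natCast (2 * Real.pi * ħ) d]
      rw [show (d : ℝ) / 2 * ((2 : ℕ) : ℝ) = d by push_cast; ring]
      ring
    have h := pow_le_pow_left₀ (norm_nonneg _) (hk i j) 2
    rw [e2] at h
    refine (ENNReal.ofReal_le_ofReal h).trans (le_of_eq ?_)
    rw [ENNReal.ofReal_mul (by positivity), ENNReal.ofReal_prod_of_nonneg (fun l _ => by positivity)]
    congr 1
    exact Finset.prod_congr rfl fun l _ => ENNReal.ofReal_mul (by positivity)
  -- Contribution of one coordinate: 2πħ is its share of the prefactor, 3 bounds the off-diagonal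
  -- sum, and ħ ≤ 1 makes the sum over j uniform in ħ. Hence the constant 6π.
  have hb : ∑' j : ℕ, ENNReal.ofReal (2 * Real.pi * (ħ * (ħ * j + 1 / 2) ^ (-(2 * s)))) * 3 ≤
      ENNReal.ofReal (6 * Real.pi * (2 ^ (2 * s) + 2 ^ (2 * s - 1) / (2 * s - 1))) := by
    have h := tsum_mul_rpow_le (2 * s) ħ (1 / 2) (by linarith) hħ (by norm_num)
    have c1 : ((1 : ℝ) / 2) ^ (-(2 * s)) = 2 ^ (2 * s) := by
      rw [one_div, Real.inv_rpow (by norm_num), Real.rpow_neg (by norm_num), inv_inv]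
    have c2 : ((1 : ℝ) / 2) ^ (1 - 2 * s) = 2 ^ (2 * s - 1) := by
      rw [one_div, Real.inv_rpow (by norm_num), ← Real.rpow_neg (by norm_num)]; congr 1; ring
    rw [c1, c2] at h
    have c3 : ∀ j : ℕ, ENNReal.ofReal (2 * Real.pi * (ħ * (ħ * j + 1 / 2) ^ (-(2 * s)))) =
        ENNReal.ofReal (2 * Real.pi) * ENNReal.ofReal (ħ * (ħ * j + 1 / 2) ^ (-(2 * s))) :=
      fun j => ENNReal.ofReal_mul (by positivity)
    simp_rw [c3]
    rw [ENNReal.tsum_mul_right, ENNReal.tsum_mul_left]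
    have h2s : 0 < 2 * s - 1 := by linarith
    calc _ ≤ ENNReal.ofReal (2 * Real.pi) * ENNReal.ofReal (ħ * 2 ^ (2 * s) + 2 ^ (2 * s - 1) / (2 * s - 1)) *
          ENNReal.ofReal 3 := by
          rw [show ENNReal.ofReal 3 = 3 by norm_num]
          gcongr
      _ = ENNReal.ofReal (6 * Real.pi * (ħ * 2 ^ (2 * s) + 2 ^ (2 * s - 1) / (2 * s - 1))) := by
          rw [← ENNReal.ofReal_mul (by positivity), ← ENNReal.ofReal_mul (by positivity)]
          congr 1; ring
      _ ≤ _ := by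
          refine ENNReal.ofReal_le_ofReal ?_
          gcongr
          exact mul_le_of_le_one_left (by positivity) hħ1
  rw [ENNReal.tsum_comm]
  calc ∑' j, ∑' i, ‖k i j‖ₑ ^ 2 ≤ ∑' (j : Fin d → ℕ) (i : Fin d → ℕ), ENNReal.ofReal (ν ^ 2) * ∏ l : Fin d,
      (ENNReal.ofReal (2 * Real.pi * (ħ * (ħ * j l + 1 / 2) ^ (-(2 * s)))) *
        ENNReal.ofReal ((|(i l : ℝ) - (j l : ℝ)| + 1) ^ (-(2 * t)))) :=
        ENNReal.tsum_le_tsum fun j => ENNReal.tsum_le_tsum fun i => e i j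
    _ = ENNReal.ofReal (ν ^ 2) * ∑' j : Fin d → ℕ, ∏ l : Fin d, ∑' i : ℕ,
      (ENNReal.ofReal (2 * Real.pi * (ħ * (ħ * j l + 1 / 2) ^ (-(2 * s)))) *
        ENNReal.ofReal ((|(i : ℝ) - (j l : ℝ)| + 1) ^ (-(2 * t)))) := by
        simp_rw [ENNReal.tsum_mul_left]
        congr 1
        refine tsum_congr fun j => ?_
        rw [tsum_pi_prod (fun l (i : ℕ) => ENNReal.ofReal (2 * Real.pi * (ħ * (ħ * j l + 1 / 2) ^ (-(2 * s)))) *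
        ENNReal.ofReal ((|(i : ℝ) - (j l : ℝ)| + 1) ^ (-(2 * t))))]
        simp_rw [ENNReal.tsum_mul_left]
    _ ≤ ENNReal.ofReal (ν ^ 2) * ∑' j : Fin d → ℕ, ∏ l : Fin d,
      (ENNReal.ofReal (2 * Real.pi * (ħ * (ħ * j l + 1 / 2) ^ (-(2 * s)))) * 3) := by
        gcongr with j l
        rw [ENNReal.tsum_mul_left]
        gcongr
        exact tsum_nat_sub_rpow_le _ (by linarith) _
    _ = ENNReal.ofReal (ν ^ 2) * (∑' j : ℕ,
      ENNReal.ofReal (2 * Real.pi * (ħ * (ħ * j + 1 / 2) ^ (-(2 * s)))) * 3) ^ d := by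
        rw [tsum_pi_prod (fun _ (j : ℕ) => ENNReal.ofReal (2 * Real.pi * (ħ * (ħ * j + 1 / 2) ^ (-(2 * s)))) * 3)]
        simp
    _ ≤ _ := by
        have h2s : 0 < 2 * s - 1 := by linarith
        have h0 : 0 ≤ 6 * Real.pi * (2 ^ (2 * s) + 2 ^ (2 * s - 1) / (2 * s - 1)) := by positivity
        rw [ENNReal.ofReal_mul (by positivity), ENNReal.ofReal_pow h0]
        gcongr

lemma rpow_half_le (X : ℝ≥0∞) (c : ℝ) (hc : 0 ≤ c) (h : X ≤ ENNReal.ofReal (c ^ 2)) :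
    X ^ (1 / 2 : ℝ) ≤ ENNReal.ofReal c := by
  refine (ENNReal.rpow_le_rpow h (by norm_num)).trans (le_of_eq ?_)
  rw [ENNReal.ofReal_rpow_of_nonneg (by positivity) (by norm_num), ← Real.sqrt_eq_rpow,
    Real.sqrt_sq hc]

/-- The singularity 1/ε comes from the first factor only, where 2s - 1 = 2ε; in the second one 2s -
1 exceeds 1/2. The brackets are at most 10/ε and 24, and 36·240·π² = 8640π² < 9·10⁴. -/
lemma hermite_const_le (ε : ℝ) (hε : 0 < ε) (hε1 : ε < 1) :
    (6 * Real.pi * (2 ^ (2 * (1 / 2 + ε)) + 2 ^ (2 * (1 / 2 + ε) - 1) / (2 * (1 / 2 + ε) - 1))) *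
    (6 * Real.pi * (2 ^ (2 * (3 / 4 + ε)) + 2 ^ (2 * (3 / 4 + ε) - 1) / (2 * (3 / 4 + ε) - 1))) ≤
      9 * 10 ^ 4 / ε := by
  have hpi := Real.pi_lt_d2
  have hpi0 := Real.pi_pos
  have h0 : ∀ x y : ℝ, x ≤ y → (2 : ℝ) ^ x ≤ 2 ^ y := fun x y h =>
    Real.rpow_le_rpow_of_exponent_le (by norm_num) h
  have p3 : (2 : ℝ) ^ (3 : ℝ) = 8 := by norm_num
  have p2 : (2 : ℝ) ^ (2 : ℝ) = 4 := by norm_num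
  have ph : (2 : ℝ) ^ (1 / 2 : ℝ) ≤ 3 / 2 := by
    rw [← Real.sqrt_eq_rpow, Real.sqrt_le_left (by norm_num)]; norm_num
  have p35 : (2 : ℝ) ^ (7 / 2 : ℝ) ≤ 12 := by
    rw [show (7 / 2 : ℝ) = 3 + 1 / 2 by norm_num, Real.rpow_add (by norm_num), p3]; linarith
  have p25 : (2 : ℝ) ^ (5 / 2 : ℝ) ≤ 6 := by
    rw [show (5 / 2 : ℝ) = 2 + 1 / 2 by norm_num, Real.rpow_add (by norm_num), p2]; linarith
  have a1 : (2 : ℝ) ^ (2 * (1 / 2 + ε)) ≤ 8 := (h0 _ 3 (by linarith)).trans p3.le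
  have a2 : (2 : ℝ) ^ (2 * (1 / 2 + ε) - 1) ≤ 4 := (h0 _ 2 (by linarith)).trans p2.le
  have b1 : (2 : ℝ) ^ (2 * (3 / 4 + ε)) ≤ 12 := (h0 _ (7 / 2) (by linarith)).trans p35
  have b2 : (2 : ℝ) ^ (2 * (3 / 4 + ε) - 1) ≤ 6 := (h0 _ (5 / 2) (by linarith)).trans p25
  have A : 2 ^ (2 * (1 / 2 + ε)) + 2 ^ (2 * (1 / 2 + ε) - 1) / (2 * (1 / 2 + ε) - 1) ≤ 10 / ε := by
    have : 2 ^ (2 * (1 / 2 + ε) - 1) / (2 * (1 / 2 + ε) - 1) ≤ 4 / (2 * ε) := by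
      rw [show 2 * (1 / 2 + ε) - 1 = 2 * ε by ring] at *
      gcongr
    have h8 : 8 ≤ 8 / ε := by rw [le_div_iff₀ hε]; linarith
    calc _ ≤ 8 / ε + 4 / (2 * ε) := by linarith
      _ = 10 / ε := by field_simp; norm_num
  have B : 2 ^ (2 * (3 / 4 + ε)) + 2 ^ (2 * (3 / 4 + ε) - 1) / (2 * (3 / 4 + ε) - 1) ≤ 24 := by
    have : 2 ^ (2 * (3 / 4 + ε) - 1) / (2 * (3 / 4 + ε) - 1) ≤ 6 / (1 / 2) := by
      gcongr
      linarith
    linarith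
  have hB0 : 0 ≤ 2 ^ (2 * (3 / 4 + ε)) + 2 ^ (2 * (3 / 4 + ε) - 1) / (2 * (3 / 4 + ε) - 1) := by
    have : 0 < 2 * (3 / 4 + ε) - 1 := by linarith
    positivity
  calc _ ≤ (6 * Real.pi * (10 / ε)) * (6 * Real.pi * 24) := by gcongr
    _ = 8640 * Real.pi ^ 2 / ε := by ring
    _ ≤ 9 * 10 ^ 4 / ε := div_le_div_of_nonneg_right (by nlinarith) hε.le

/-- The transport cost under bounds on the matrix elements between Hermite functions. -/
theorem quantumWass_le_of_hermiteHyp (hd : 1 ≤ d) (ħ : ℝ) (hħ : 0 < ħ) (hħ1 : ħ ≤ 1) (ε μ ν : ℝ)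
    (hε : 0 < ε) (hε1 : ε < 1) (R : Op d) (hR : IsDensityOp R) (W : Phase d → ℂ)
    (hW : IsWigner ħ R W) (h : HermiteHyp ħ ε μ ν R) :
    0 ≤ μ * ν ∧ quantumWass ħ (husimi ħ W) R ≤
      (ENNReal.ofReal (d * ħ / 2 + d * (9 * 10 ^ 4 / ε) ^ d * (μ * ν) ^ 2)) ^ (1 / 2 : ℝ) := by
  obtain ⟨h1, h2⟩ := h
  have pos : ∀ s t : ℝ, ∀ i j : Fin d → ℕ, 0 < ∏ l, ((ħ * j l + 1 / 2) ^ s *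
      (|(i l : ℝ) - (j l : ℝ)| + 1) ^ t) := fun s t i j => Finset.prod_pos fun l _ => by positivity
  have hK : 0 < (2 * Real.pi * ħ) ^ ((d : ℝ) / 2) := by positivity
  -- The bound at i = j = 0 dominates a norm, which forces the sign of μ; the same argument gives
  -- the sign of ν.
  have hμ : 0 ≤ μ := by
    have := (norm_nonneg _).trans (h1 0 0)
    rw [mul_assoc] at this
    have h' := nonneg_of_mul_nonneg_right this hK
    by_contra hc
    exact absurd h' (not_le.2 (mul_neg_of_neg_of_pos (not_le.1 hc) (pos _ _ _ _)))
  have hν : 0 ≤ ν := by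
    have := (norm_nonneg _).trans (h2 (Obs.pos ⟨0, hd⟩) (by simp) 0 0)
    rw [mul_assoc] at this
    have h' := nonneg_of_mul_nonneg_right this hK
    by_contra hc
    exact absurd h' (not_le.2 (mul_neg_of_neg_of_pos (not_le.1 hc) (pos _ _ _ _)))
  refine ⟨mul_nonneg hμ hν, (quantumWass_le_comm ħ hħ R hR W hW).trans ?_⟩
  refine ENNReal.rpow_le_rpow ?_ (by norm_num)
  have hC := hermite_const_le ε hε hε1
  have hA0 : 0 ≤ 6 * Real.pi * (2 ^ (2 * (1 / 2 + ε)) + 2 ^ (2 * (1 / 2 + ε) - 1) / (2 * (1 / 2 + ε) - 1)) := by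
    have : 0 < 2 * (1 / 2 + ε) - 1 := by linarith
    positivity
  have hB0 : 0 ≤ 6 * Real.pi * (2 ^ (2 * (3 / 4 + ε)) + 2 ^ (2 * (3 / 4 + ε) - 1) / (2 * (3 / 4 + ε) - 1)) := by
    have : 0 < 2 * (3 / 4 + ε) - 1 := by linarith
    positivity
  have hk : ∀ O : Obs d, O ≠ Obs.osc → ∑' m, ∑' n, ‖hermiteCommElt ħ O (posSqrt R) m n‖ₑ ^ 2 ≤ _ :=
    fun O hO => tsum_matrix_sq_le ħ hħ hħ1 (1 / 2 + ε) (1 + ε) ν (by linarith) (by linarith)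
      (hermiteCommElt ħ O (posSqrt R)) (fun i j => by
        have := h2 O hO i j
        rwa [show -(1 / 2) - ε = -(1 / 2 + ε) by ring, show -1 - ε = -(1 + ε) by ring] at this)
  have hS := tsum_matrix_sq_le ħ hħ hħ1 (3 / 4 + ε) (2 + ε) μ (by linarith) (by linarith)
      (hermiteElt ħ (posSqrt R)) (fun i j => by
        have := h1 i j
        rwa [show -(3 / 4) - ε = -(3 / 4 + ε) by ring, show -2 - ε = -(2 + ε) by ring] at this)
  have htr : ∑' i, ∑' j, ‖hermiteElt ħ (posSqrt R) i j‖ₑ ^ 2 = 1 := by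
    rw [ENNReal.tsum_comm, ← hR.2, opTrace_eq_hermite ħ hħ R hR.1]
    refine tsum_congr fun j => ?_
    rw [← tsum_enorm_sq_inner (hermB ħ hħ)]
    simp only [hermiteElt_eq ħ hħ, hermB_apply]
  rw [htr] at hS
  generalize 6 * Real.pi * (2 ^ (2 * (1 / 2 + ε)) + 2 ^ (2 * (1 / 2 + ε) - 1) / (2 * (1 / 2 + ε) - 1)) = A at *
  generalize 6 * Real.pi * (2 ^ (2 * (3 / 4 + ε)) + 2 ^ (2 * (3 / 4 + ε) - 1) / (2 * (3 / 4 + ε) - 1)) = B at *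
  -- The matrix bound applied to √R itself, whose Hilbert–Schmidt norm is 1, keeps μ away from zero.
  have hS' : 1 ≤ μ ^ 2 * B ^ d := by
    rw [← ENNReal.ofReal_one] at hS
    exact (ENNReal.ofReal_le_ofReal_iff (by positivity)).1 hS
  -- Multiplying by this quantity, which is at least 1, trades ν² for a constant times (μν)².
  have hνA : ν ^ 2 * A ^ d ≤ (9 * 10 ^ 4 / ε) ^ d * (μ * ν) ^ 2 := by
    calc ν ^ 2 * A ^ d ≤ ν ^ 2 * A ^ d * (μ ^ 2 * B ^ d) := le_mul_of_one_le_right (by positivity) hS'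
      _ = (A * B) ^ d * (μ * ν) ^ 2 := by ring
      _ ≤ _ := by gcongr
  calc _ ≤ ENNReal.ofReal (d * ħ / 2) + 1 / 2 * ∑ j : Fin d, (ENNReal.ofReal (ν ^ 2 * A ^ d) +
        ENNReal.ofReal (ν ^ 2 * A ^ d)) := by
        gcongr with j
        · exact hk _ (by simp)
        · exact hk _ (by simp)
    _ = ENNReal.ofReal (d * ħ / 2 + d * (ν ^ 2 * A ^ d)) := by
        rw [ENNReal.ofReal_add (by positivity) (by positivity), ENNReal.ofReal_mul (by positivity : (0 : ℝ) ≤ d),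
          ENNReal.ofReal_natCast, Finset.sum_const, Finset.card_univ, Fintype.card_fin, nsmul_eq_mul,
          ← two_mul, mul_left_comm, ← mul_assoc (1 / 2 : ℝ≥0∞) 2,
          ENNReal.div_mul_cancel (by norm_num) (by norm_num), one_mul]
    _ ≤ _ := by
        refine ENNReal.ofReal_le_ofReal ?_
        rw [mul_assoc]
        gcongr

lemma sq_div_sqrt_two_mul (D M : ℝ) : (D / Real.sqrt 2 * M) ^ 2 = D ^ 2 / 2 * M ^ 2 := by
  rw [mul_pow, div_pow, Real.sq_sqrt (by norm_num)]

lemma sq_max_sqrt (ħ μ P : ℝ) (hħ : 0 ≤ ħ) (hP : 0 ≤ P) :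
    ħ ≤ (max (Real.sqrt ħ) (max (Real.sqrt ħ * μ) (Real.sqrt P))) ^ 2 ∧
      P ≤ (max (Real.sqrt ħ) (max (Real.sqrt ħ * μ) (Real.sqrt P))) ^ 2 := by
  constructor
  · calc ħ = Real.sqrt ħ ^ 2 := (Real.sq_sqrt hħ).symm
      _ ≤ _ := by gcongr; exact le_max_left _ _
  · calc P = Real.sqrt P ^ 2 := (Real.sq_sqrt hP).symm
      _ ≤ _ := by gcongr; exact (le_max_right _ _).trans (le_max_right _ _)

lemma two_sqrt_le_constIII (F : Phase d → ℝ) : 2 * Real.sqrt d ≤ constIII F := by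
  rw [constIII]; gcongr; exact le_max_right _ _

/-- The prefactor of the density constant exceeds 1. This lower bound is all that the estimates
below need from D_II. -/
lemma le_constII (ε : ℝ) (hε : 0 < ε) : 2 * Real.sqrt d ≤ constII d ε := by
  have h := two_sqrt_le_constIII (refDensity d ε)
  have h0 : 0 ≤ Real.sqrt d := Real.sqrt_nonneg _
  rw [constII]
  refine h.trans (le_mul_of_one_le_left (by linarith) ?_)
  have : 0 < (ε ^ d)⁻¹ := by positivity
  nlinarith

theorem quantumWass_hermite_uniform (hd : 1 ≤ d) (ħ : ℝ) (hħ : 0 < ħ) (hħ1 : ħ ≤ 1) (ε μ ν : ℝ)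
    (hε : 0 < ε) (hε1 : ε < 1) (R : Op d) (hR : IsDensityOp R) (W : Phase d → ℂ)
    (hW : IsWigner ħ R W) (h : HermiteHyp ħ ε μ ν R) (hμν : μ * ν ≤ 1) :
    quantumWass ħ (husimi ħ W) R ≤ ENNReal.ofReal (constII' d ε / Real.sqrt 2 *
      max (Real.sqrt ħ) (max (Real.sqrt ħ * μ) (Real.sqrt (μ * ν)))) := by
  obtain ⟨hP, h1⟩ := quantumWass_le_of_hermiteHyp hd ħ hħ hħ1 ε μ ν hε hε1 R hR W hW h
  refine h1.trans (rpow_half_le _ _ ?_ (ENNReal.ofReal_le_ofReal ?_))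
  · have : 0 ≤ max (Real.sqrt ħ) (max (Real.sqrt ħ * μ) (Real.sqrt (μ * ν))) :=
      (Real.sqrt_nonneg _).trans (le_max_left _ _)
    rw [constII']
    positivity
  obtain ⟨m1, m2⟩ := sq_max_sqrt ħ μ (μ * ν) hħ.le hP
  rw [sq_div_sqrt_two_mul, constII', Real.sq_sqrt (by positivity)]
  generalize (max (Real.sqrt ħ) (max (Real.sqrt ħ * μ) (Real.sqrt (μ * ν)))) ^ 2 = M at *
  have hC : 9 * 10 ^ 4 / ε = 9 / 10 * (10 ^ 5 / ε) := by ring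
  -- Replacing 9·10⁴ by 10⁵ leaves at least a tenth of (10⁵/ε)^d, which is at least 1 and covers the
  -- term dħ/2.
  have hC1 : (9 * 10 ^ 4 / ε) ^ d ≤ 9 / 10 * (10 ^ 5 / ε) ^ d := by
    rw [hC, mul_pow]
    gcongr
    exact pow_le_of_le_one (by norm_num) (by norm_num) (by omega)
  have hC2 : 10 ≤ (10 ^ 5 / ε) ^ d := by
    have : (10 : ℝ) ≤ 10 ^ 5 / ε := by rw [le_div_iff₀ hε]; nlinarith
    exact this.trans (le_self_pow₀ (by linarith) (by omega))
  generalize (10 ^ 5 / ε) ^ d = C at *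
  have hd' : (0 : ℝ) < d := by exact_mod_cast hd
  -- Here μν ≤ 1 lets one factor be dropped.
  have hP2 : (μ * ν) ^ 2 ≤ M := by nlinarith
  calc d * ħ / 2 + d * (9 * 10 ^ 4 / ε) ^ d * (μ * ν) ^ 2 ≤ d * M / 2 + d * (9 / 10 * C) * M := by
        gcongr
    _ = d * M * (1 / 2 + 9 / 10 * C) := by ring
    _ ≤ d * M * C := by
        have : 0 ≤ M := hħ.le.trans m1
        gcongr
        linarith
    _ = _ := by ring

theorem quantumWass_hermite (hd : 1 ≤ d) (ħ : ℝ) (hħ : 0 < ħ) (hħ1 : ħ ≤ 1) (ε μ ν : ℝ)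
    (hε : 0 < ε) (hε1 : ε < 1) (R : Op d) (hR : IsDensityOp R) (W : Phase d → ℂ)
    (hW : IsWigner ħ R W) (h : HermiteHyp ħ ε μ ν R)
    (hμν : μ * ν < ((9 * 10 ^ 4 / ε) ^ d)⁻¹) :
    quantumWass ħ (husimi ħ W) R ≤ ENNReal.ofReal (constII d ε / Real.sqrt 2 *
      max (Real.sqrt ħ) (max (Real.sqrt ħ * μ) (Real.sqrt (μ * ν)))) := by
  obtain ⟨hP, h1⟩ := quantumWass_le_of_hermiteHyp hd ħ hħ hħ1 ε μ ν hε hε1 R hR W hW h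
  have hc := le_constII (d := d) ε hε
  have hc0 : 0 ≤ constII d ε := le_trans (by positivity) hc
  refine h1.trans (rpow_half_le _ _ ?_ (ENNReal.ofReal_le_ofReal ?_))
  · have : 0 ≤ max (Real.sqrt ħ) (max (Real.sqrt ħ * μ) (Real.sqrt (μ * ν))) :=
      (Real.sqrt_nonneg _).trans (le_max_left _ _)
    positivity
  obtain ⟨m1, m2⟩ := sq_max_sqrt ħ μ (μ * ν) hħ.le hP
  rw [sq_div_sqrt_two_mul]
  generalize (max (Real.sqrt ħ) (max (Real.sqrt ħ * μ) (Real.sqrt (μ * ν)))) ^ 2 = M at *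
  have hc2 : 4 * (d : ℝ) ≤ constII d ε ^ 2 := by
    have := pow_le_pow_left₀ (by positivity) hc 2
    rwa [mul_pow, Real.sq_sqrt (by positivity), show (2 : ℝ) ^ 2 = 4 by norm_num] at this
  have hM : 0 ≤ M := hħ.le.trans m1
  have hC : 0 < (9 * 10 ^ 4 / ε) ^ d := by positivity
  -- Below the threshold one factor μν absorbs the constant, so only the lower bound 2√d of D_II is
  -- needed afterwards.
  have h3 : (9 * 10 ^ 4 / ε) ^ d * (μ * ν) ^ 2 ≤ M := by
    have : (9 * 10 ^ 4 / ε) ^ d * (μ * ν) ≤ 1 := by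
      rw [← mul_inv_cancel₀ hC.ne']; gcongr
    calc (9 * 10 ^ 4 / ε) ^ d * (μ * ν) ^ 2 = ((9 * 10 ^ 4 / ε) ^ d * (μ * ν)) * (μ * ν) := by ring
      _ ≤ 1 * (μ * ν) := by gcongr
      _ ≤ M := by linarith
  calc d * ħ / 2 + d * (9 * 10 ^ 4 / ε) ^ d * (μ * ν) ^ 2
      = d * (ħ / 2) + d * ((9 * 10 ^ 4 / ε) ^ d * (μ * ν) ^ 2) := by ring
    _ ≤ d * M + d * M := by gcongr; linarith
    _ = (4 * d) / 2 * M := by ring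
    _ ≤ _ := by gcongr

theorem hermite_case (hd : 1 ≤ d) (R : ℝ → Op d) (W : ℝ → Phase d → ℂ)
    (hR : ∀ ħ ∈ Set.Ioc (0 : ℝ) 1, IsDensityOp (R ħ))
    (hW : ∀ ħ ∈ Set.Ioc (0 : ℝ) 1, IsWigner ħ (R ħ) (W ħ)) (ε : ℝ) (μ ν : ℝ → ℝ)
    (hε : 0 < ε) (hε1 : ε < 1) (hμν : Tendsto (fun ħ => μ ħ * ν ħ) (𝓝[>] 0) (𝓝 0))
    (h : ∀ ħ ∈ Set.Ioc (0 : ℝ) 1, HermiteHyp ħ ε (μ ħ) (ν ħ) (R ħ)) :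
    ∃ ħ₀ ∈ Set.Ioc (0 : ℝ) 1, ∀ ħ ∈ Set.Ioc (0 : ℝ) ħ₀,
      quantumWass ħ (husimi ħ (W ħ)) (R ħ) ≤ ENNReal.ofReal (constII d ε / Real.sqrt 2 *
        max (Real.sqrt ħ) (max (Real.sqrt ħ * μ ħ) (Real.sqrt (μ ħ * ν ħ)))) := by
  have hC : 0 < ((9 * 10 ^ 4 / ε) ^ d)⁻¹ := by positivity
  -- The threshold is reached for small ħ since μν tends to 0, and this fixes ħ₀.
  have he := hμν.eventually (gt_mem_nhds hC)
  obtain ⟨δ, hδ, hs⟩ := (mem_nhdsGT_iff_exists_Ioc_subset).1 he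
  refine ⟨min δ 1, ⟨lt_min hδ one_pos, min_le_right _ _⟩, fun ħ hħ => ?_⟩
  have h1 : ħ ∈ Set.Ioc (0 : ℝ) 1 := ⟨hħ.1, hħ.2.trans (min_le_right _ _)⟩
  exact quantumWass_hermite hd ħ h1.1 h1.2 ε _ _ hε hε1 (R ħ) (hR ħ h1) (W ħ) (hW ħ h1) (h ħ h1)
    (hs ⟨hħ.1, hħ.2.trans (min_le_left _ _)⟩)

end Hermite
end SemiWass
end

noncomputable section
namespace SemiWass

/-! ### Töplitz operators -/

section Toeplitz
variable {d : ℕ}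

/-- The coherent state is the pointwise limit of its finite Hermite sums, whose coefficients are
measurable in z. -/
lemma stronglyMeasurable_coh (ħ : ℝ) (hħ : 0 < ħ) :
    StronglyMeasurable (fun z : Phase d => sL2 (cohS ħ hħ z)) := by
  refine stronglyMeasurable_of_tendsto (ι := Finset (Fin d → ℕ)) atTop
    (f := fun s z => ∑ m ∈ s, ⟪hermB ħ hħ m, sL2 (cohS ħ hħ z)⟫_ℂ • hermB ħ hħ m) (fun s => ?_) ?_
  · refine Finset.stronglyMeasurable_fun_sum s fun m _ => ?_
    refine StronglyMeasurable.smul_const ?_ _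
    have h := (stronglyMeasurable_inner_coh ħ hħ (hermB ħ hħ m)).measurable
    have : Measurable fun z : Phase d => ⟪hermB ħ hħ m, sL2 (cohS ħ hħ z)⟫_ℂ := by
      simp_rw [← inner_conj_symm (hermB ħ hħ m)]
      fun_prop
    exact this.stronglyMeasurable
  · rw [tendsto_pi_nhds]
    intro z
    have := (hermB ħ hħ).hasSum_repr (sL2 (cohS ħ hħ z))
    simpa only [HilbertBasis.repr_apply_apply, HasSum, SummationFilter.unconditional_filter] using this

lemma continuous_rankOne_self : Continuous fun v : L2 d => InnerProductSpace.rankOne ℂ v v := by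
  rw [continuous_iff_continuousAt]
  intro u
  rw [ContinuousAt, tendsto_iff_norm_sub_tendsto_zero]
  have h : Tendsto (fun v : L2 d => ‖v - u‖ * ‖v‖ + ‖u‖ * ‖v - u‖) (𝓝 u) (𝓝 0) := by
    have h1 : Continuous fun v : L2 d => ‖v - u‖ * ‖v‖ + ‖u‖ * ‖v - u‖ := by fun_prop
    simpa using h1.tendsto u
  refine squeeze_zero (fun v => norm_nonneg _) (fun v => ?_) h
  have e : InnerProductSpace.rankOne ℂ v v - InnerProductSpace.rankOne ℂ u u =
      InnerProductSpace.rankOne ℂ (v - u) v + InnerProductSpace.rankOne ℂ u (v - u) := by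
    rw [map_sub, map_sub, sub_apply]; abel
  rw [e]
  refine (norm_add_le _ _).trans (le_of_eq ?_)
  rw [InnerProductSpace.norm_rankOne, InnerProductSpace.norm_rankOne]

lemma norm_coh (ħ : ℝ) (hħ : 0 < ħ) (z : Phase d) : ‖sL2 (cohS ħ hħ z)‖ = 1 := by
  have h : ‖sL2 (cohS ħ hħ z)‖ₑ ^ 2 = ‖sL2 (hermS ħ hħ (0 : Fin d → ℕ))‖ₑ ^ 2 := by
    rw [← lintegral_enorm_sq_schwartz, ← lintegral_enorm_sq_schwartz,
      ← lintegral_sub_right_eq_self (fun y => ‖hermS ħ hħ (0 : Fin d → ℕ) y‖ₑ ^ 2) z.1]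
    refine lintegral_congr fun y => ?_
    rw [cohS, wp_apply, enorm_mul]
    have : ‖Complex.exp (Complex.I * ((⟪z.2, y - z.1⟫_ℝ / ħ : ℝ) : ℂ))‖ₑ = 1 := by
      rw [← ofReal_norm, mul_comm, Complex.norm_exp_ofReal_mul_I, ENNReal.ofReal_one]
    rw [this, one_mul]
  rw [enorm_sq_eq_ofReal, enorm_sq_eq_ofReal, norm_hermS,
    ENNReal.ofReal_eq_ofReal_iff (by positivity) (by positivity)] at h
  rw [one_pow] at h
  exact (pow_eq_one_iff_of_nonneg (norm_nonneg _) two_ne_zero).1 h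

/-- The probability measure of density `F`. -/
def densMeasure (F : Phase d → ℝ) : Measure (Phase d) := volume.withDensity fun z => ENNReal.ofReal (F z)

lemma isProbabilityMeasure_densMeasure {F : Phase d → ℝ} (hF : IsPosDensity F) :
    IsProbabilityMeasure (densMeasure F) := by
  refine ⟨?_⟩
  rw [densMeasure, withDensity_apply _ MeasurableSet.univ, Measure.restrict_univ,
    ← ofReal_integral_eq_lintegral_ofReal hF.integrable (ae_of_all _ fun z => (hF.pos z).le),
    hF.integral_eq_one, ENNReal.ofReal_one]

lemma integral_densMeasure {E : Type*} [NormedAddCommGroup E] [NormedSpace ℝ E]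
    {F : Phase d → ℝ} (hF : IsPosDensity F) (g : Phase d → E) :
    ∫ z, g z ∂(densMeasure F) = ∫ z, F z • g z := by
  rw [densMeasure, integral_withDensity_eq_integral_toReal_smul₀
    hF.integrable.1.aemeasurable.ennreal_ofReal (ae_of_all _ fun z => ENNReal.ofReal_lt_top)]
  simp_rw [ENNReal.toReal_ofReal (hF.pos _).le]

/-- Since F > 0 everywhere, Lebesgue measure is absolutely continuous with respect to F dz; the
injectivity of the Töplitz operator needs this. -/
lemma ae_of_ae_densMeasure {F : Phase d → ℝ} (hF : IsPosDensity F) {p : Phase d → Prop}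
    (h : ∀ᵐ z ∂(densMeasure F), p z) : ∀ᵐ z, p z := by
  rw [densMeasure, ae_withDensity_iff' hF.integrable.1.aemeasurable.ennreal_ofReal] at h
  filter_upwards [h] with z hz
  exact hz (by simp [hF.pos z])

/-- `∫ |z⟩⟨z| dν(z)`. -/
def cohMix (ħ : ℝ) (hħ : 0 < ħ) (ν : Measure (Phase d)) : Op d :=
  ∫ z, InnerProductSpace.rankOne ℂ (sL2 (cohS ħ hħ z)) (sL2 (cohS ħ hħ z)) ∂ν

lemma toeplitz_eq (ħ : ℝ) (hħ : 0 < ħ) {F : Phase d → ℝ} (hF : IsPosDensity F) :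
    toeplitz ħ (fun z => (2 * Real.pi * ħ) ^ d * F z) = cohMix ħ hħ (densMeasure F) := by
  rw [toeplitz, cohMix, integral_densMeasure hF]
  have e : ∀ z : Phase d, (((2 * Real.pi * ħ) ^ d * F z : ℝ) : ℂ) •
      InnerProductSpace.rankOne ℂ (coherent ħ z) (coherent ħ z) =
      (((2 * Real.pi * ħ) ^ d : ℝ) : ℂ) • (F z • InnerProductSpace.rankOne ℂ (sL2 (cohS ħ hħ z)) (sL2 (cohS ħ hħ z))) := by
    intro z
    rw [coherent_eq ħ hħ, Complex.ofReal_mul, mul_smul]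
    rfl
  simp_rw [e]
  rw [integral_smul, smul_smul]
  have : (((2 * Real.pi * ħ) ^ d)⁻¹ : ℂ) * (((2 * Real.pi * ħ) ^ d : ℝ) : ℂ) = 1 := by
    have h : ((2 * Real.pi * ħ : ℝ) : ℂ) ≠ 0 := by
      rw [Complex.ofReal_ne_zero]; positivity
    push_cast at h ⊢
    exact inv_mul_cancel₀ (pow_ne_zero _ h)
  rw [this, one_smul]

lemma inner_integral_op {α : Type*} [MeasurableSpace α] {ν : Measure α} (Q : α → Op d)
    (hQ : Integrable Q ν) (u v : L2 d) :
    Integrable (fun z => ⟪u, Q z v⟫_ℂ) ν ∧ ⟪u, (∫ z, Q z ∂ν) v⟫_ℂ = ∫ z, ⟪u, Q z v⟫_ℂ ∂ν := by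
  have h : ∀ T : Op d, ⟪u, T v⟫_ℂ = ((innerSL ℂ u).comp (ContinuousLinearMap.apply ℂ (L2 d) v)) T :=
    fun T => rfl
  simp_rw [h]
  exact ⟨ContinuousLinearMap.integrable_comp _ hQ, (ContinuousLinearMap.integral_comp_comm _ hQ).symm⟩

variable (ħ : ℝ) (hħ : 0 < ħ) (ν : Measure (Phase d)) [IsProbabilityMeasure ν]

lemma integrable_cohProj : Integrable (fun z : Phase d =>
    InnerProductSpace.rankOne ℂ (sL2 (cohS ħ hħ z)) (sL2 (cohS ħ hħ z))) ν := by
  refine Integrable.of_bound (C := 1)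
    (continuous_rankOne_self.comp_stronglyMeasurable (stronglyMeasurable_coh ħ hħ)).aestronglyMeasurable
    (ae_of_all _ fun z => ?_)
  rw [InnerProductSpace.norm_rankOne, norm_coh, one_mul]

lemma inner_cohMix (u v : L2 d) :
    Integrable (fun z : Phase d => ⟪u, sL2 (cohS ħ hħ z)⟫_ℂ * ⟪sL2 (cohS ħ hħ z), v⟫_ℂ) ν ∧
    ⟪u, cohMix ħ hħ ν v⟫_ℂ =
      ∫ z, ⟪u, sL2 (cohS ħ hħ z)⟫_ℂ * ⟪sL2 (cohS ħ hħ z), v⟫_ℂ ∂ν := by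
  have h := inner_integral_op _ (integrable_cohProj ħ hħ ν) u v
  simp only [InnerProductSpace.rankOne_apply, inner_smul_right] at h
  simp_rw [mul_comm ⟪u, _⟫_ℂ]
  exact h

lemma inner_cohMix_self (v : L2 d) : ⟪v, cohMix ħ hħ ν v⟫_ℂ =
    ((∫ z, ‖⟪sL2 (cohS ħ hħ z), v⟫_ℂ‖ ^ 2 ∂ν : ℝ) : ℂ) := by
  rw [(inner_cohMix ħ hħ ν v v).2, ← integral_complex_ofReal]
  refine integral_congr_ae (ae_of_all _ fun z => ?_)
  simp only
  rw [← inner_conj_symm v, Complex.conj_mul']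
  push_cast; rfl

lemma isPositive_cohMix : (cohMix ħ hħ ν).IsPositive := by
  rw [ContinuousLinearMap.isPositive_iff_complex]
  intro v
  have h := inner_cohMix_self ħ hħ ν v
  have h2 : ⟪cohMix ħ hħ ν v, v⟫_ℂ = ((∫ z, ‖⟪sL2 (cohS ħ hħ z), v⟫_ℂ‖ ^ 2 ∂ν : ℝ) : ℂ) := by
    rw [← inner_conj_symm, h, Complex.conj_ofReal]
  rw [h2]
  refine ⟨?_, ?_⟩
  · rfl
  · exact integral_nonneg fun z => by positivity

/-- On the kernel the quadratic form ∫ |⟨z, v⟩|² dν vanishes, so ⟨z, v⟩ = 0 for almost every z, and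
the resolution of the identity gives v = 0. -/
lemma posSqrt_cohMix_injective (hν : ∀ p : Phase d → Prop, (∀ᵐ z ∂ν, p z) → ∀ᵐ z, p z) :
    LinearMap.ker ((posSqrt (cohMix ħ hħ ν) : Op d) : L2 d →ₗ[ℂ] L2 d) = ⊥ := by
  rw [LinearMap.ker_eq_bot']
  intro v hv
  have h0 : posSqrt (cohMix ħ hħ ν) v = 0 := hv
  have h1 : cohMix ħ hħ ν v = 0 := by
    rw [← posSqrt_mul_self _ (isPositive_cohMix ħ hħ ν), h0, map_zero]
  have h2 := inner_cohMix_self ħ hħ ν v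
  rw [h1, inner_zero_right] at h2
  have h3 : ∫ z, ‖⟪sL2 (cohS ħ hħ z), v⟫_ℂ‖ ^ 2 ∂ν = 0 := by exact_mod_cast h2.symm
  have hi : Integrable (fun z => ‖⟪sL2 (cohS ħ hħ z), v⟫_ℂ‖ ^ 2) ν := by
    have := (inner_cohMix ħ hħ ν v v).1.norm
    refine this.congr (ae_of_all _ fun z => ?_)
    simp only
    rw [norm_mul, norm_inner_symm, sq]
  rw [integral_eq_zero_iff_of_nonneg (fun z => by positivity) hi] at h3
  have h4 := hν _ h3
  have h5 := lintegral_coherent' ħ hħ v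
  have h6 : ∫⁻ z : Phase d, ‖⟪sL2 (cohS ħ hħ z), v⟫_ℂ‖ₑ ^ 2 = 0 := by
    rw [lintegral_eq_zero_iff' ((stronglyMeasurable_inner_coh ħ hħ v).measurable.enorm.pow_const 2).aemeasurable]
    filter_upwards [h4] with z hz
    simpa using hz
  rw [h6] at h5
  have h7 := (mul_eq_zero.1 h5.symm).resolve_left (by
    simp only [ENNReal.ofReal_eq_zero, not_le]; positivity)
  simpa using h7

/-- The operator `√R T^{-1/2}`, its adjoint, and the factorization `R = B T B*`. -/
lemma toeplitz_factor (T R B C : Op d) (hT : T.IsPositive)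
    (hker : LinearMap.ker ((posSqrt T : Op d) : L2 d →ₗ[ℂ] L2 d) = ⊥) (hR : R.IsPositive)
    (hB : ExtendsRight (posSqrt R) (negSqrt T) B) (hC : ExtendsLeft (negSqrt T) (posSqrt R) C) :
    C = ContinuousLinearMap.adjoint B ∧
      ∀ v, R v = B (T (ContinuousLinearMap.adjoint B v)) := by
  set f : L2 d →ₗ.[ℂ] L2 d := ((posSqrt T : Op d) : L2 d →ₗ[ℂ] L2 d).toPMap ⊤ with hf
  have hk : LinearMap.ker f.toFun = ⊥ := by
    rw [LinearMap.ker_eq_bot'] at hker ⊢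
    intro x hx
    have := hker (x : L2 d) hx
    exact Subtype.ext this
  have hdom : ∀ v, posSqrt T v ∈ (negSqrt T).domain := by
    intro v
    change _ ∈ (LinearPMap.inverse f).domain
    rw [LinearPMap.inverse_domain]
    exact ⟨⟨v, trivial⟩, rfl⟩
  have hinv : ∀ (v y : L2 d) (hy : y ∈ (negSqrt T).domain), posSqrt T v = y → negSqrt T ⟨y, hy⟩ = v := by
    intro v y hy hvy
    exact LinearPMap.inverse_apply_eq hk (y := ⟨y, hy⟩) (x := ⟨v, trivial⟩) hvy
  have h1 : ∀ v, B (posSqrt T v) = posSqrt R v := by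
    intro v
    rw [hB ⟨_, hdom v⟩, hinv v _ _ rfl]
  -- Taking adjoints in B √T = √R shows that √R maps into the domain of T^{-1/2}. Hence C is defined
  -- through T^{-1/2} everywhere and equals B*.
  have h2 : ∀ v, posSqrt T (ContinuousLinearMap.adjoint B v) = posSqrt R v := by
    intro v
    refine ext_inner_left ℂ fun u => ?_
    rw [← posSqrt_isSelfAdjoint, ContinuousLinearMap.adjoint_inner_right, h1,
      posSqrt_isSelfAdjoint]
  constructor
  · ext1 v
    have hv : posSqrt R v ∈ (negSqrt T).domain := by rw [← h2]; exact hdom _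
    rw [hC v hv]
    exact hinv _ _ _ (h2 v)
  · intro v
    rw [← posSqrt_mul_self T hT, h1, h2, posSqrt_mul_self R hR]

end Toeplitz
end SemiWass
end

noncomputable section
namespace SemiWass

/-! ### The transport cost for one coherent state -/

section PureCost
variable {d : ℕ}

lemma enorm_add_sq_of_inner_eq_zero {E : Type*} [NormedAddCommGroup E] [InnerProductSpace ℂ E]
    (u v : E) (h : ⟪u, v⟫_ℂ = 0) : ‖u + v‖ₑ ^ 2 = ‖u‖ₑ ^ 2 + ‖v‖ₑ ^ 2 := by
  rw [enorm_sq_eq_ofReal, enorm_sq_eq_ofReal, enorm_sq_eq_ofReal,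
    ← ENNReal.ofReal_add (by positivity) (by positivity)]
  congr 1
  have := norm_add_sq_eq_norm_sq_add_norm_sq_of_inner_eq_zero u v h
  simpa only [sq] using this

/-- This handles one coordinate of the product coupling of the pure state b. Here β is the operator
centred at a reference point applied to b, and s(z) is the shift from that point to z. Write β = m b
+ γ with γ orthogonal to b. The fluctuation m + s(z), weighted by |⟨z, b⟩|², integrates to ‖γ‖² +
(ħ/2)‖b‖² by the orthogonality relation, and the quantum part contributes ‖γ‖² once more. Finally
‖γ‖ ≤ ‖β‖. -/
lemma lintegral_coh_mul_shift_le (ħ : ℝ) (hħ : 0 < ħ) (j : Fin d) (b β : L2 d) (s : Phase d → ℝ)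
    (e : ℂ) (he : ‖e‖ = 1) (h : ∀ z, ⟪sL2 (cohS ħ hħ z), β⟫_ℂ + s z * ⟪sL2 (cohS ħ hħ z), b⟫_ℂ =
      e * ⟪sL2 (phiS ħ hħ j z), b⟫_ℂ) :
    ∫⁻ z, ‖⟪sL2 (cohS ħ hħ z), b⟫_ℂ‖ₑ ^ 2 * ‖β + (s z : ℂ) • b‖ₑ ^ 2 ≤
      ENNReal.ofReal ((2 * Real.pi * ħ) ^ d) *
        (‖b‖ₑ ^ 2 * (2 * ‖β‖ₑ ^ 2 + ENNReal.ofReal (ħ / 2) * ‖b‖ₑ ^ 2)) := by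
  by_cases hb : b = 0
  · simp [hb]
  have hb' : (‖b‖ : ℂ) ^ 2 ≠ 0 := by simpa using hb
  -- The projection coefficient of β on b, well defined as b ≠ 0.
  set m : ℂ := ⟪b, β⟫_ℂ / (‖b‖ : ℂ) ^ 2 with hm
  set γ : L2 d := β - m • b with hγ
  have horth : ⟪b, γ⟫_ℂ = 0 := by
    rw [hγ, inner_sub_right, inner_smul_right, inner_self_eq_norm_sq_to_K, hm]
    exact sub_eq_zero.2 (div_mul_cancel₀ _ hb').symm
  have hβ : ‖β‖ₑ ^ 2 = ‖m • b‖ₑ ^ 2 + ‖γ‖ₑ ^ 2 := by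
    rw [← enorm_add_sq_of_inner_eq_zero _ _ (by rw [inner_smul_left, horth, mul_zero])]
    congr 2
    rw [hγ]; abel
  have hγβ : ‖γ‖ₑ ^ 2 ≤ ‖β‖ₑ ^ 2 := hβ ▸ le_add_self
  have e1 : ∀ z, ‖⟪sL2 (cohS ħ hħ z), b⟫_ℂ‖ₑ ^ 2 * ‖β + (s z : ℂ) • b‖ₑ ^ 2 =
      ‖⟪sL2 (cohS ħ hħ z), -γ⟫_ℂ + ⟪sL2 (phiS ħ hħ j z), e • b⟫_ℂ‖ₑ ^ 2 * ‖b‖ₑ ^ 2 +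
        ‖⟪sL2 (cohS ħ hħ z), b⟫_ℂ‖ₑ ^ 2 * ‖γ‖ₑ ^ 2 := by
    intro z
    have a1 : β + (s z : ℂ) • b = (m + s z) • b + γ := by rw [hγ]; module
    have a2 : ⟪sL2 (cohS ħ hħ z), -γ⟫_ℂ + ⟪sL2 (phiS ħ hħ j z), e • b⟫_ℂ =
        ⟪sL2 (cohS ħ hħ z), b⟫_ℂ * (m + s z) := by
      rw [inner_smul_right, ← h z, hγ, inner_neg_right, inner_sub_right, inner_smul_right]
      ring
    rw [a1, enorm_add_sq_of_inner_eq_zero _ _ (by rw [inner_smul_left, horth, mul_zero]), a2,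
      enorm_smul, enorm_mul]
    ring
  simp_rw [e1]
  have m1 := (stronglyMeasurable_inner_coh ħ hħ b).measurable.enorm.pow_const 2
  rw [lintegral_add_right _ (m1.mul_const _), lintegral_mul_const _ m1,
    lintegral_mul_const' _ _ (by simp), lintegral_coherent, lintegral_coherent', enorm_neg,
    enorm_smul, mul_pow ‖e‖ₑ]
  have he' : ‖e‖ₑ = 1 := by rw [← ofReal_norm, he, ENNReal.ofReal_one]
  rw [he', one_pow, one_mul]
  calc _ = ENNReal.ofReal ((2 * Real.pi * ħ) ^ d) *
        (‖b‖ₑ ^ 2 * (2 * ‖γ‖ₑ ^ 2 + ENNReal.ofReal (ħ / 2) * ‖b‖ₑ ^ 2)) := by ring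
    _ ≤ _ := by gcongr

/-- `p j = y_j b` and `q j = ħ∂_j b` in the weak sense. -/
structure HasMoments (ħ : ℝ) (b : L2 d) (p q : Fin d → L2 d) : Prop where
  pos : ∀ j (g : 𝓢(Conf d, ℂ)), ⟪sL2 (mulS j g), b⟫_ℂ = ⟪sL2 g, p j⟫_ℂ
  mom : ∀ j (g : 𝓢(Conf d, ℂ)), ⟪sL2 ((ħ : ℂ) • gradS j g), b⟫_ℂ = -⟪sL2 g, q j⟫_ℂ

lemma HasMoments.inner_posOp {ħ : ℝ} {b : L2 d} {p q : Fin d → L2 d} (h : HasMoments ħ b p q)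
    (z : Phase d) (j : Fin d) (g : 𝓢(Conf d, ℂ)) :
    ⟪sL2 (posOp z j g), b⟫_ℂ = ⟪sL2 g, ((z.1 j : ℝ) : ℂ) • b - p j⟫_ℂ := by
  simp only [posOp, add_apply, smul_apply, ContinuousLinearMap.id_apply, map_add, map_smul,
    inner_add_left, inner_smul_left, h.pos, inner_sub_right, inner_smul_right]
  simp; ring

lemma HasMoments.inner_momOp {ħ : ℝ} {b : L2 d} {p q : Fin d → L2 d} (h : HasMoments ħ b p q)
    (z : Phase d) (j : Fin d) (g : 𝓢(Conf d, ℂ)) :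
    ⟪sL2 (momOp ħ z j g), b⟫_ℂ = ⟪sL2 g, ((z.2 j : ℝ) : ℂ) • b + Complex.I • q j⟫_ℂ := by
  have h1 := h.mom j g
  rw [map_smul, inner_smul_left, Complex.conj_ofReal] at h1
  simp only [momOp, add_apply, smul_apply, ContinuousLinearMap.id_apply, map_add, map_smul,
    inner_add_left, inner_smul_left, inner_add_right, inner_smul_right, map_mul, Complex.conj_I,
    Complex.conj_ofReal]
  rw [mul_assoc, h1]
  ring

lemma HasMoments.costForm_eq {ħ : ℝ} (hħ : 0 < ħ) {b : L2 d} {p q : Fin d → L2 d} (h : HasMoments ħ b p q)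
    (z : Phase d) : costForm ħ z b = (1 / 2) * ∑ j : Fin d,
    (‖((z.1 j : ℝ) : ℂ) • b - p j‖ₑ ^ 2 + ‖((z.2 j : ℝ) : ℂ) • b + Complex.I • q j‖ₑ ^ 2) := by
  rw [SemiWass.costForm_eq ħ hħ]
  simp_rw [tsum_hermite_eq ħ hħ _ b _ (h.inner_posOp z _),
    tsum_hermite_eq ħ hħ _ b _ (h.inner_momOp z _)]

/-- The product coupling pays the spread of the state and that of its Husimi function, the latter
being the former plus the zero-point term. Each spread is at most the cost from any reference point
w. The unimodular constants are 1 for positions and -i for momenta. -/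
lemma HasMoments.lintegral_costForm_le {ħ : ℝ} (hħ : 0 < ħ) {b : L2 d} {p q : Fin d → L2 d} (h : HasMoments ħ b p q)
    (w : Phase d) :
    ∫⁻ z, ‖⟪sL2 (cohS ħ hħ z), b⟫_ℂ‖ₑ ^ 2 * costForm ħ z b ≤
      ENNReal.ofReal ((2 * Real.pi * ħ) ^ d) *
        (‖b‖ₑ ^ 2 * (2 * costForm ħ w b + ENNReal.ofReal (d * ħ / 2) * ‖b‖ₑ ^ 2)) := by
  have m1 := (stronglyMeasurable_inner_coh ħ hħ b).measurable.enorm.pow_const 2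
  have P : ∀ j : Fin d, ∫⁻ z : Phase d, ‖⟪sL2 (cohS ħ hħ z), b⟫_ℂ‖ₑ ^ 2 *
      ‖((z.1 j : ℝ) : ℂ) • b - p j‖ₑ ^ 2 ≤ ENNReal.ofReal ((2 * Real.pi * ħ) ^ d) *
        (‖b‖ₑ ^ 2 * (2 * ‖((w.1 j : ℝ) : ℂ) • b - p j‖ₑ ^ 2 + ENNReal.ofReal (ħ / 2) * ‖b‖ₑ ^ 2)) := by
    intro j
    refine le_trans (le_of_eq ?_) (lintegral_coh_mul_shift_le ħ hħ j b
      (((w.1 j : ℝ) : ℂ) • b - p j) (fun z => z.1 j - w.1 j) 1 (by simp) fun z => ?_)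
    · refine lintegral_congr fun z => ?_
      congr 3
      push_cast
      module
    · have h1 := h.inner_posOp z j (cohS ħ hħ z)
      simp only [posOp, add_apply, smul_apply, ContinuousLinearMap.id_apply, mulS_cohS] at h1
      rw [show ((z.1 j : ℝ) : ℂ) • cohS ħ hħ z + (-1 : ℂ) • (((z.1 j : ℝ) : ℂ) • cohS ħ hħ z - phiS ħ hħ j z) =
        phiS ħ hħ j z by module] at h1
      rw [one_mul, h1, inner_sub_right, inner_sub_right, inner_smul_right, inner_smul_right]
      push_cast
      ring
  have M : ∀ j : Fin d, ∫⁻ z : Phase d, ‖⟪sL2 (cohS ħ hħ z), b⟫_ℂ‖ₑ ^ 2 *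
      ‖((z.2 j : ℝ) : ℂ) • b + Complex.I • q j‖ₑ ^ 2 ≤ ENNReal.ofReal ((2 * Real.pi * ħ) ^ d) *
        (‖b‖ₑ ^ 2 * (2 * ‖((w.2 j : ℝ) : ℂ) • b + Complex.I • q j‖ₑ ^ 2 +
          ENNReal.ofReal (ħ / 2) * ‖b‖ₑ ^ 2)) := by
    intro j
    refine le_trans (le_of_eq ?_) (lintegral_coh_mul_shift_le ħ hħ j b
      (((w.2 j : ℝ) : ℂ) • b + Complex.I • q j) (fun z => z.2 j - w.2 j) (-Complex.I) (by simp) fun z => ?_)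
    · refine lintegral_congr fun z => ?_
      congr 3
      push_cast
      module
    · have h1 := h.inner_momOp z j (cohS ħ hħ z)
      simp only [momOp, add_apply, smul_apply, ContinuousLinearMap.id_apply, mul_smul, gradS_cohS] at h1
      rw [show ((z.2 j : ℝ) : ℂ) • cohS ħ hħ z + Complex.I • (Complex.I • ((z.2 j : ℝ) : ℂ) • cohS ħ hħ z
        + phiS ħ hħ j z) = Complex.I • phiS ħ hħ j z by
          rw [smul_add, smul_smul Complex.I Complex.I, Complex.I_mul_I]; module] at h1
      rw [map_smul, inner_smul_left, Complex.conj_I] at h1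
      rw [h1, inner_add_right, inner_add_right, inner_smul_right, inner_smul_right, inner_smul_right]
      push_cast
      ring
  have mP : ∀ j : Fin d, Measurable fun z : Phase d => ‖((z.1 j : ℝ) : ℂ) • b - p j‖ₑ ^ 2 := by
    intro j
    have : Continuous fun z : Phase d => ((z.1 j : ℝ) : ℂ) • b - p j := by fun_prop
    exact this.enorm.measurable.pow_const 2
  have mM : ∀ j : Fin d, Measurable fun z : Phase d => ‖((z.2 j : ℝ) : ℂ) • b + Complex.I • q j‖ₑ ^ 2 := by
    intro j
    have : Continuous fun z : Phase d => ((z.2 j : ℝ) : ℂ) • b + Complex.I • q j := by fun_prop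
    exact this.enorm.measurable.pow_const 2
  have hf : ∀ j : Fin d, Measurable fun z : Phase d => 1 / 2 * (‖⟪sL2 (cohS ħ hħ z), b⟫_ℂ‖ₑ ^ 2 *
      ‖((z.1 j : ℝ) : ℂ) • b - p j‖ₑ ^ 2) + 1 / 2 * (‖⟪sL2 (cohS ħ hħ z), b⟫_ℂ‖ₑ ^ 2 *
      ‖((z.2 j : ℝ) : ℂ) • b + Complex.I • q j‖ₑ ^ 2) :=
    fun j => ((m1.mul (mP j)).const_mul _).add ((m1.mul (mM j)).const_mul _)
  have hint : ∀ z : Phase d, ‖⟪sL2 (cohS ħ hħ z), b⟫_ℂ‖ₑ ^ 2 * costForm ħ z b =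
      ∑ j : Fin d, (1 / 2 * (‖⟪sL2 (cohS ħ hħ z), b⟫_ℂ‖ₑ ^ 2 *
      ‖((z.1 j : ℝ) : ℂ) • b - p j‖ₑ ^ 2) + 1 / 2 * (‖⟪sL2 (cohS ħ hħ z), b⟫_ℂ‖ₑ ^ 2 *
      ‖((z.2 j : ℝ) : ℂ) • b + Complex.I • q j‖ₑ ^ 2)) := by
    intro z
    rw [h.costForm_eq hħ, Finset.mul_sum, Finset.mul_sum]
    exact Finset.sum_congr rfl fun j _ => by ring
  simp_rw [hint]
  rw [lintegral_finsetSum _ fun j _ => hf j, h.costForm_eq hħ]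
  have hs : ∀ j : Fin d, ∫⁻ z : Phase d, (1 / 2 * (‖⟪sL2 (cohS ħ hħ z), b⟫_ℂ‖ₑ ^ 2 *
      ‖((z.1 j : ℝ) : ℂ) • b - p j‖ₑ ^ 2) + 1 / 2 * (‖⟪sL2 (cohS ħ hħ z), b⟫_ℂ‖ₑ ^ 2 *
      ‖((z.2 j : ℝ) : ℂ) • b + Complex.I • q j‖ₑ ^ 2)) ≤
      ENNReal.ofReal ((2 * Real.pi * ħ) ^ d) * (‖b‖ₑ ^ 2 * (1 / 2 * (2 * (‖((w.1 j : ℝ) : ℂ) • b - p j‖ₑ ^ 2 +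
        ‖((w.2 j : ℝ) : ℂ) • b + Complex.I • q j‖ₑ ^ 2)) + ENNReal.ofReal (ħ / 2) * ‖b‖ₑ ^ 2)) := by
    intro j
    have m2 : Measurable fun z : Phase d => ‖⟪sL2 (cohS ħ hħ z), b⟫_ℂ‖ₑ ^ 2 *
      ‖((z.1 j : ℝ) : ℂ) • b - p j‖ₑ ^ 2 := m1.mul (mP j)
    have m3 : Measurable fun z : Phase d => ‖⟪sL2 (cohS ħ hħ z), b⟫_ℂ‖ₑ ^ 2 *
      ‖((z.2 j : ℝ) : ℂ) • b + Complex.I • q j‖ₑ ^ 2 := m1.mul (mM j)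
    rw [lintegral_add_left (m2.const_mul _), lintegral_const_mul _ m2,
      lintegral_const_mul _ m3, ← mul_add]
    refine (mul_le_mul_right (add_le_add (P j) (M j)) _).trans (le_of_eq ?_)
    have h2 : (1 / 2 : ℝ≥0∞) * 2 = 1 := ENNReal.div_mul_cancel (by norm_num) (by norm_num)
    calc _ = ENNReal.ofReal ((2 * Real.pi * ħ) ^ d) * (‖b‖ₑ ^ 2 * (1 / 2 * (2 * (‖((w.1 j : ℝ) : ℂ) • b - p j‖ₑ ^ 2 +
        ‖((w.2 j : ℝ) : ℂ) • b + Complex.I • q j‖ₑ ^ 2)) + (1 / 2 * 2) * (ENNReal.ofReal (ħ / 2) * ‖b‖ₑ ^ 2))) := by ring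
      _ = _ := by rw [h2, one_mul]
  refine (Finset.sum_le_sum fun j _ => hs j).trans (le_of_eq ?_)
  rw [← Finset.mul_sum, ← Finset.mul_sum, Finset.sum_add_distrib, Finset.sum_const, Finset.card_univ,
    Fintype.card_fin, nsmul_eq_mul, show d * ħ / 2 = d * (ħ / 2) by ring,
    ENNReal.ofReal_mul (by positivity : (0 : ℝ) ≤ d), ENNReal.ofReal_natCast, mul_assoc (d : ℝ≥0∞),
    Finset.mul_sum, Finset.mul_sum]
  congr 3
  refine Finset.sum_congr rfl fun j _ => ?_
  ring

/-- The oscillator energy in terms of the moments. -/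
lemma HasMoments.energy_eq {ħ : ℝ} (hħ : 0 < ħ) {b : L2 d} {p q : Fin d → L2 d} (h : HasMoments ħ b p q)
    (j : Fin d) : ‖p j‖ₑ ^ 2 + ‖q j‖ₑ ^ 2 =
    ∑' m, ENNReal.ofReal (ħ * (2 * m j + 1)) * ‖⟪sL2 (hermS ħ hħ m), b⟫_ℂ‖ₑ ^ 2 := by
  -- The vectors p + q and p - q are the lowered and the raised b, whose squared norms are diagonal
  -- in the Hermite coefficients, with weights 2ħm_j and 2ħ(m_j + 1).
  have hpar : ‖p j + q j‖ₑ ^ 2 + ‖p j - q j‖ₑ ^ 2 = 2 * (‖p j‖ₑ ^ 2 + ‖q j‖ₑ ^ 2) := by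
    simp only [enorm_sq_eq_ofReal]
    rw [← ENNReal.ofReal_add (by positivity) (by positivity),
      ← ENNReal.ofReal_add (by positivity) (by positivity), two_mul,
      ← ENNReal.ofReal_add (by positivity) (by positivity)]
    congr 1
    have := parallelogram_law_with_norm ℂ (p j) (q j)
    linarith
  have c2 : ∀ t : ℝ, 0 ≤ t → ‖((2 * Real.sqrt (ħ / 2) * Real.sqrt t : ℝ) : ℂ)‖ₑ ^ 2 =
      ENNReal.ofReal (2 * ħ * t) := by
    intro t ht
    rw [enorm_sq_eq_ofReal, Complex.norm_real, Real.norm_eq_abs, sq_abs, mul_pow, mul_pow,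
      Real.sq_sqrt (by positivity), Real.sq_sqrt ht]
    congr 1; ring
  have hplus : ‖p j + q j‖ₑ ^ 2 = ∑' m, ENNReal.ofReal (2 * ħ * m j) * ‖⟪sL2 (hermS ħ hħ m), b⟫_ℂ‖ₑ ^ 2 := by
    rw [← tsum_enorm_sq_inner (hermB ħ hħ), ← (up_injective j).tsum_eq (f := fun m : Fin d → ℕ =>
      ENNReal.ofReal (2 * ħ * m j) * ‖⟪sL2 (hermS ħ hħ m), b⟫_ℂ‖ₑ ^ 2)]
    · refine tsum_congr fun m => ?_
      rw [hermB_apply, inner_add_right, ← h.pos, ← neg_eq_iff_eq_neg.2 (h.mom j _), ← sub_eq_add_neg,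
        ← inner_sub_left, ← map_sub, raise_hermS, map_smul, inner_smul_left, Complex.conj_ofReal,
        enorm_mul, mul_pow, c2 _ (by positivity), up_self]
      push_cast; rfl
    · intro m hm
      by_contra hc
      exact hm (by simp [notMem_range_up j m hc])
  have hminus : ‖p j - q j‖ₑ ^ 2 =
      ∑' m, ENNReal.ofReal (2 * ħ * (m j + 1)) * ‖⟪sL2 (hermS ħ hħ m), b⟫_ℂ‖ₑ ^ 2 := by
    have e : ∀ m : Fin d → ℕ, ‖⟪hermB ħ hħ m, p j - q j⟫_ℂ‖ₑ ^ 2 =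
        ENNReal.ofReal (2 * ħ * m j) * ‖⟪sL2 (hermS ħ hħ (dn m j)), b⟫_ℂ‖ₑ ^ 2 := by
      intro m
      rw [hermB_apply, inner_sub_right, ← h.pos, ← neg_eq_iff_eq_neg.2 (h.mom j _), sub_neg_eq_add,
        ← inner_add_left, ← map_add, lower_hermS, map_smul, inner_smul_left, Complex.conj_ofReal,
        enorm_mul, mul_pow, c2 _ (by positivity)]
    rw [← tsum_enorm_sq_inner (hermB ħ hħ)]
    simp_rw [e]
    rw [← (up_injective j).tsum_eq]
    · refine tsum_congr fun m => ?_
      rw [dn_up, up_self]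
      push_cast; rfl
    · intro m hm
      by_contra hc
      exact hm (by simp [notMem_range_up j m hc])
  have h2 : (2 : ℝ≥0∞)⁻¹ * 2 = 1 := ENNReal.inv_mul_cancel (by norm_num) (by norm_num)
  rw [← one_mul (‖p j‖ₑ ^ 2 + ‖q j‖ₑ ^ 2), ← h2, mul_assoc, ← hpar, hplus, hminus, ← ENNReal.tsum_add,
    ← ENNReal.tsum_mul_left]
  refine tsum_congr fun m => ?_
  rw [← add_mul, ← mul_assoc, ← ENNReal.ofReal_add (by positivity) (by positivity)]
  congr 1
  rw [show (2 : ℝ≥0∞)⁻¹ = ENNReal.ofReal (1 / 2) by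
    rw [one_div, ENNReal.ofReal_inv_of_pos (by norm_num)]; norm_num, ← ENNReal.ofReal_mul (by norm_num)]
  congr 1; ring

lemma actS_osc_hermS {ħ : ℝ} (hħ : 0 < ħ) (m : Fin d → ℕ) : actS ħ Obs.osc (hermS ħ hħ m) =
    ((∑ j, ħ * (2 * m j + 1) : ℝ) : ℂ) • hermS ħ hħ m := by
  have e : ∀ j : Fin d, mulS j (mulS j (hermS ħ hħ m)) - ((ħ : ℂ) ^ 2) • gradS j (gradS j (hermS ħ hħ m)) =
      ((ħ * (2 * m j + 1) : ℝ) : ℂ) • hermS ħ hħ m := by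
    intro j
    -- The oscillator is the mean of lowering-after-raising and raising-after-lowering; in this
    -- symmetric form no commutation relation is used.
    have key : ∀ f : 𝓢(Conf d, ℂ), mulS j (mulS j f) - ((ħ : ℂ) ^ 2) • gradS j (gradS j f) =
        (1 / 2 : ℂ) • ((mulS j (mulS j f - (ħ : ℂ) • gradS j f) + (ħ : ℂ) • gradS j (mulS j f - (ħ : ℂ) • gradS j f)) +
        (mulS j (mulS j f + (ħ : ℂ) • gradS j f) - (ħ : ℂ) • gradS j (mulS j f + (ħ : ℂ) • gradS j f))) := by
      intro f
      simp only [map_sub, map_add, map_smul]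
      module
    rw [key, raise_hermS, lower_hermS]
    simp only [map_smul]
    have hr := lower_hermS ħ hħ (up m j) j
    rw [dn_up, up_self] at hr
    have hh : ((Real.sqrt (ħ / 2) : ℝ) : ℂ) * ((Real.sqrt (ħ / 2) : ℝ) : ℂ) = (ħ : ℂ) / 2 := by
      rw [← Complex.ofReal_mul, Real.mul_self_sqrt (by positivity)]; push_cast; ring
    have hm1 : ((Real.sqrt (m j + 1) : ℝ) : ℂ) * ((Real.sqrt (m j + 1) : ℝ) : ℂ) = (m j : ℂ) + 1 := by
      rw [← Complex.ofReal_mul, Real.mul_self_sqrt (by positivity)]; push_cast; ring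
    have hm0 : ((Real.sqrt (m j) : ℝ) : ℂ) * ((Real.sqrt (m j) : ℝ) : ℂ) = (m j : ℂ) := by
      rw [← Complex.ofReal_mul, Real.mul_self_sqrt (by positivity)]; push_cast; ring
    have t1 : mulS j (hermS ħ hħ (up m j)) + (ħ : ℂ) • gradS j (hermS ħ hħ (up m j)) =
      ((2 * Real.sqrt (ħ / 2) * Real.sqrt (m j + 1) : ℝ) : ℂ) • hermS ħ hħ m := by
      rw [hr]; push_cast; rfl
    have t2 : ((2 * Real.sqrt (ħ / 2) * Real.sqrt (m j) : ℝ) : ℂ) •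
        (mulS j (hermS ħ hħ (dn m j)) - (ħ : ℂ) • gradS j (hermS ħ hħ (dn m j))) =
        (2 * (ħ : ℂ) * m j) • hermS ħ hħ m := by
      by_cases h0 : m j = 0
      · simp [h0]
      · rw [raise_hermS, up_dn m j h0, smul_smul]
        have : ((dn m j j : ℕ) : ℝ) + 1 = m j := by
          rw [dn, Function.update_self]
          have : 1 ≤ m j := Nat.one_le_iff_ne_zero.2 h0
          push_cast [this]; ring
        rw [this]
        congr 1
        push_cast
        calc _ = 4 * (((Real.sqrt (ħ / 2) : ℝ) : ℂ) * ((Real.sqrt (ħ / 2) : ℝ) : ℂ)) *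
              (((Real.sqrt (m j) : ℝ) : ℂ) * ((Real.sqrt (m j) : ℝ) : ℂ)) := by ring
          _ = _ := by rw [hh, hm0]; ring
    rw [smul_comm (ħ : ℂ), ← smul_add, t1, smul_comm (ħ : ℂ), ← smul_sub, t2, smul_smul, ← add_smul, smul_smul]
    congr 1
    push_cast
    calc _ = 2 * (((Real.sqrt (ħ / 2) : ℝ) : ℂ) * ((Real.sqrt (ħ / 2) : ℝ) : ℂ)) *
              (((Real.sqrt (m j + 1) : ℝ) : ℂ) * ((Real.sqrt (m j + 1) : ℝ) : ℂ)) + (ħ : ℂ) * m j := by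
          ring
      _ = _ := by rw [hh, hm1]; ring
  simp only [actS, sum_apply, sub_apply, smul_apply, ContinuousLinearMap.comp_apply, e]
  rw [← Finset.sum_smul]
  push_cast; rfl

/-- The energy identity holds for a weak image o of the oscillator without integrating by parts on
b: both sides equal the eigenvalue-weighted sum of |⟨H_m, b⟩|². -/
lemma HasMoments.sum_norm_sq_eq {ħ : ℝ} (hħ : 0 < ħ) {b : L2 d} {p q : Fin d → L2 d} (h : HasMoments ħ b p q)
    (o : L2 d)
    (ho : ∀ g : 𝓢(Conf d, ℂ), ⟪sL2 (actS ħ Obs.osc g), b⟫_ℂ = ⟪sL2 g, o⟫_ℂ) :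
    ∑ j, (‖p j‖ ^ 2 + ‖q j‖ ^ 2) = RCLike.re ⟪b, o⟫_ℂ := by
  have h1 := (hermB ħ hħ).hasSum_inner_mul_inner b o
  have e1 : ∀ m : Fin d → ℕ, ⟪b, hermB ħ hħ m⟫_ℂ * ⟪hermB ħ hħ m, o⟫_ℂ =
      (((∑ j, ħ * (2 * m j + 1)) * ‖⟪sL2 (hermS ħ hħ m), b⟫_ℂ‖ ^ 2 : ℝ) : ℂ) := by
    intro m
    rw [hermB_apply, ← ho, actS_osc_hermS, map_smul, inner_smul_left, Complex.conj_ofReal, mul_left_comm,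
      ← inner_conj_symm b, Complex.conj_mul']
    push_cast; rfl
  simp only [e1] at h1
  have h2 : HasSum (fun m : Fin d → ℕ => (∑ j, ħ * (2 * m j + 1)) * ‖⟪sL2 (hermS ħ hħ m), b⟫_ℂ‖ ^ 2)
      (RCLike.re ⟪b, o⟫_ℂ) := by
    have := Complex.hasSum_re h1
    simp only [Complex.ofReal_re] at this
    exact this
  have hnn : ∀ m : Fin d → ℕ, 0 ≤ (∑ j, ħ * (2 * m j + 1)) * ‖⟪sL2 (hermS ħ hħ m), b⟫_ℂ‖ ^ 2 := fun m =>
    mul_nonneg (Finset.sum_nonneg fun j _ => by positivity) (by positivity)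
  have h3 : ENNReal.ofReal (RCLike.re ⟪b, o⟫_ℂ) = ENNReal.ofReal (∑ j, (‖p j‖ ^ 2 + ‖q j‖ ^ 2)) := by
    rw [← h2.tsum_eq, ENNReal.ofReal_tsum_of_nonneg hnn h2.summable,
      ENNReal.ofReal_sum_of_nonneg (fun j _ => by positivity)]
    have e2 : ∀ j, ENNReal.ofReal (‖p j‖ ^ 2 + ‖q j‖ ^ 2) =
        ∑' m, ENNReal.ofReal (ħ * (2 * m j + 1)) * ‖⟪sL2 (hermS ħ hħ m), b⟫_ℂ‖ₑ ^ 2 := by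
      intro j
      rw [← h.energy_eq hħ j, ENNReal.ofReal_add (by positivity) (by positivity), enorm_sq_eq_ofReal,
        enorm_sq_eq_ofReal]
    simp_rw [e2]
    rw [← Summable.tsum_finsetSum (fun _ _ => ENNReal.summable)]
    refine tsum_congr fun m => ?_
    rw [← Finset.sum_mul, ENNReal.ofReal_mul (Finset.sum_nonneg fun j _ => by positivity),
      ENNReal.ofReal_sum_of_nonneg (fun j _ => by positivity), ← enorm_sq_eq_ofReal]
  rw [ENNReal.ofReal_eq_ofReal_iff (h2.nonneg hnn) (Finset.sum_nonneg fun j _ => by positivity)] at h3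
  exact h3.symm

end PureCost
end SemiWass
end

noncomputable section
namespace SemiWass

/-! ### The coupling built from a Töplitz factorization -/

section ToeplitzCoupling
variable {d : ℕ}

lemma gradS_mulS (j : Fin d) (f : 𝓢(Conf d, ℂ)) : gradS j (mulS j f) = f + mulS j (gradS j f) := by
  ext y
  rw [add_apply, mulS_apply, gradS_apply, gradS_apply]
  have h1 : HasLineDerivAt ℝ (fun y : Conf d => ((y j : ℝ) : ℂ)) 1 y (basisVec j) := by
    have h : HasDerivAt (fun t : ℝ => ((y j + t : ℝ) : ℂ)) 1 0 := by
      simpa using ((hasDerivAt_id (0 : ℝ)).const_add (y j)).ofReal_comp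
    rw [HasLineDerivAt]
    refine h.congr_of_eventuallyEq (Eventually.of_forall fun t => ?_)
    simp [basisVec]
  have h2 := (f.differentiableAt (x := y)).lineDifferentiableAt (v := basisVec j) |>.hasLineDerivAt
  have h3 := HasDerivAt.mul h1 h2
  have h4 : HasLineDerivAt ℝ (mulS j f : Conf d → ℂ) (f y + ((y j : ℝ) : ℂ) * lineDeriv ℝ f y (basisVec j)) y
      (basisVec j) := by
    have e : (fun t : ℝ => mulS j f (y + t • basisVec j)) =
        (fun t : ℝ => (((y + t • basisVec j) j : ℝ) : ℂ)) * fun t : ℝ => f (y + t • basisVec j) := by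
      ext t; simp [mulS_apply]
    rw [HasLineDerivAt, e]
    simpa using h3
  exact h4.lineDeriv

/-- Keeping `phiS` explicit makes the remainders of the oscillator, position and momentum terms
multiples of one vector; in `costForm_coh_le` they cancel. -/
lemma osc_cohS (ħ : ℝ) (hħ : 0 < ħ) (w : Phase d) : actS ħ Obs.osc (cohS ħ hħ w) =
    ∑ j, (((w.1 j ^ 2 + w.2 j ^ 2 + ħ : ℝ) : ℂ) • cohS ħ hħ w -
      (2 * ((w.1 j : ℂ) + Complex.I * (w.2 j : ℂ))) • phiS ħ hħ j w) := by
  simp only [actS, sum_apply, sub_apply, smul_apply, ContinuousLinearMap.comp_apply]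
  refine Finset.sum_congr rfl fun j _ => ?_
  have hg := gradS_cohS ħ hħ j w
  have hm := mulS_cohS ħ hħ j w
  have hgp : (ħ : ℂ) • gradS j (phiS ħ hħ j w) = ((w.1 j : ℂ) + Complex.I * (w.2 j : ℂ)) • phiS ħ hħ j w -
      (ħ : ℂ) • cohS ħ hħ w - mulS j (phiS ħ hħ j w) := by
    rw [phiS_eq, map_sub, map_smul, gradS_mulS, ← phiS_eq, smul_sub, smul_add, smul_comm (ħ : ℂ), hg,
      ← map_smul, hg, map_add, map_smul, hm]
    module
  have e2 : ((ħ : ℂ) ^ 2) • gradS j (gradS j (cohS ħ hħ w)) =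
      (ħ : ℂ) • gradS j ((ħ : ℂ) • gradS j (cohS ħ hħ w)) := by
    rw [map_smul, smul_smul, sq]
  rw [e2, hg, map_add, map_smul, smul_add, smul_comm (ħ : ℂ), hg, hgp, hm, map_sub, map_smul, hm,
    smul_add, smul_smul, show Complex.I * ((w.2 j : ℝ) : ℂ) * (Complex.I * ((w.2 j : ℝ) : ℂ)) =
      -((w.2 j : ℝ) : ℂ) ^ 2 by ring_nf; rw [Complex.I_sq]; ring]
  push_cast
  module

/-- The transport cost from `|w⟩` to `B|w⟩` when `B*[O, B]` is small. -/
lemma costForm_coh_le (ħ : ℝ) (hħ : 0 < ħ) (w : Phase d) (B : Op d) (τ : ℝ) (p q : Fin d → L2 d)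
    (o : L2 d) (h : HasMoments ħ (B (sL2 (cohS ħ hħ w))) p q)
    (ho : ∀ g : 𝓢(Conf d, ℂ), ⟪sL2 (actS ħ Obs.osc g), B (sL2 (cohS ħ hħ w))⟫_ℂ = ⟪sL2 g, o⟫_ℂ)
    (bo : ‖⟪B (sL2 (cohS ħ hħ w)), o - B (sL2 (actS ħ Obs.osc (cohS ħ hħ w)))⟫_ℂ‖ ≤ τ)
    (bp : ∀ j, ‖⟪B (sL2 (cohS ħ hħ w)), p j - B (sL2 (mulS j (cohS ħ hħ w)))⟫_ℂ‖ ≤ τ)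
    (bq : ∀ j, ‖⟪B (sL2 (cohS ħ hħ w)), q j - B (sL2 ((ħ : ℂ) • gradS j (cohS ħ hħ w)))⟫_ℂ‖ ≤ τ) :
    2 * costForm ħ w (B (sL2 (cohS ħ hħ w))) ≤
      ENNReal.ofReal (d * ħ * ‖B (sL2 (cohS ħ hħ w))‖ ^ 2 + τ * (1 + 2 * ∑ j, (|w.1 j| + |w.2 j|))) := by
  set b := B (sL2 (cohS ħ hħ w)) with hb
  rw [h.costForm_eq hħ, ← mul_assoc, show (2 : ℝ≥0∞) * (1 / 2) = 1 by
    rw [mul_comm]; exact ENNReal.div_mul_cancel (by norm_num) (by norm_num), one_mul]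
  simp only [enorm_sq_eq_ofReal]
  simp only [← ENNReal.ofReal_add (sq_nonneg ‖_‖) (sq_nonneg ‖_‖)]
  rw [← ENNReal.ofReal_sum_of_nonneg (fun j _ => by positivity)]
  refine ENNReal.ofReal_le_ofReal ?_
  have hen := h.sum_norm_sq_eq hħ o ho
  have hbb : ⟪b, b⟫_ℂ = ((‖b‖ ^ 2 : ℝ) : ℂ) := by
    rw [inner_self_eq_norm_sq_to_K]; push_cast; rfl
  -- The only unknown inner products left after commuting with B. They cancel between the oscillator
  -- and the linear observables, since twice the cost operator at w maps |w⟩ to dħ|w⟩.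
  set β : Fin d → ℂ := fun j => ⟪b, B (sL2 (phiS ħ hħ j w))⟫_ℂ with hβ
  have e0 : ⟪b, o - B (sL2 (actS ħ Obs.osc (cohS ħ hħ w)))⟫_ℂ = ⟪b, o⟫_ℂ -
      ∑ j, (((w.1 j ^ 2 + w.2 j ^ 2 + ħ : ℝ) : ℂ) * ((‖b‖ ^ 2 : ℝ) : ℂ) -
      (2 * ((w.1 j : ℂ) + Complex.I * (w.2 j : ℂ))) * β j) := by
    rw [inner_sub_right, osc_cohS]
    simp only [map_sum, map_sub, map_smul, inner_sum, inner_sub_right, inner_smul_right, ← hb, hbb, hβ]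
  have ep : ∀ j, ⟪b, p j - B (sL2 (mulS j (cohS ħ hħ w)))⟫_ℂ =
      ⟪b, p j⟫_ℂ - (((w.1 j : ℝ) : ℂ) * ((‖b‖ ^ 2 : ℝ) : ℂ) - β j) := by
    intro j
    rw [inner_sub_right, mulS_cohS]
    simp only [map_sub, map_smul, inner_sub_right, inner_smul_right, ← hb, hbb, hβ]
  have eQ : ∀ j, ⟪b, q j - B (sL2 ((ħ : ℂ) • gradS j (cohS ħ hħ w)))⟫_ℂ =
      ⟪b, q j⟫_ℂ - ((Complex.I * ((w.2 j : ℝ) : ℂ)) * ((‖b‖ ^ 2 : ℝ) : ℂ) + β j) := by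
    intro j
    rw [inner_sub_right, gradS_cohS]
    simp only [map_add, map_smul, inner_add_right, inner_smul_right, ← hb, hbb, hβ]
  rw [e0] at bo
  simp only [ep] at bp
  simp only [eQ] at bq
  have bo' := (Complex.abs_re_le_norm _).trans bo
  have bp' : ∀ j, _ := fun j => (Complex.abs_re_le_norm _).trans (bp j)
  have bq' : ∀ j, _ := fun j => (Complex.abs_im_le_norm _).trans (bq j)
  have hterm : ∀ j, ‖((w.1 j : ℝ) : ℂ) • b - p j‖ ^ 2 + ‖((w.2 j : ℝ) : ℂ) • b + Complex.I • q j‖ ^ 2 =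
      (‖p j‖ ^ 2 + ‖q j‖ ^ 2) + ((w.1 j ^ 2 + w.2 j ^ 2) * ‖b‖ ^ 2 - 2 * w.1 j * (⟪b, p j⟫_ℂ).re
        - 2 * w.2 j * (⟪b, q j⟫_ℂ).im) := by
    intro j
    rw [norm_sub_sq (𝕜 := ℂ), norm_add_sq (𝕜 := ℂ), inner_smul_left, inner_smul_left, inner_smul_right]
    simp only [Complex.conj_ofReal, norm_smul, Complex.norm_real, Real.norm_eq_abs, Complex.norm_I,
      RCLike.re_to_complex, Complex.re_ofReal_mul, Complex.I_mul_re, mul_pow, sq_abs]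
    ring
  simp only [hterm]
  rw [Finset.sum_add_distrib, hen]
  simp only [Complex.sub_re, Complex.re_sum, Complex.mul_re, Complex.ofReal_re,
    Complex.ofReal_im, Complex.add_re, Complex.I_re, Complex.I_im, Complex.add_im, Complex.mul_im,
    Complex.sub_im, Complex.re_ofNat, Complex.im_ofNat] at bo' bp' bq'
  have hN : 0 ≤ ‖b‖ ^ 2 := by positivity
  generalize ‖b‖ ^ 2 = N at *
  -- The commutator with the oscillator costs τ once, and those with the linear observables are
  -- weighted by 2|w.1 j| and 2|w.2 j|; what remains is the zero-point energy dħ‖b‖².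
  have key : RCLike.re ⟪b, o⟫_ℂ + ∑ j, ((w.1 j ^ 2 + w.2 j ^ 2) * N - 2 * w.1 j * (⟪b, p j⟫_ℂ).re
        - 2 * w.2 j * (⟪b, q j⟫_ℂ).im) ≤ d * ħ * N + τ +
        ∑ j, (2 * τ * (|w.1 j| + |w.2 j|)) := by
    have b1 := (le_abs_self _).trans bo'
    have b2 : ∀ j, (w.1 j ^ 2 + w.2 j ^ 2) * N - 2 * w.1 j * (⟪b, p j⟫_ℂ).re
        - 2 * w.2 j * (⟪b, q j⟫_ℂ).im ≤ 2 * τ * (|w.1 j| + |w.2 j|) + (ħ * N -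
        ((w.1 j ^ 2 + w.2 j ^ 2 + ħ) * N - 2 * (w.1 j * (β j).re - w.2 j * (β j).im))) := by
      intro j
      have a1 := mul_le_mul_of_nonneg_left (bp' j) (abs_nonneg (w.1 j))
      have a2 := mul_le_mul_of_nonneg_left (bq' j) (abs_nonneg (w.2 j))
      rw [← abs_mul] at a1 a2
      have a3 := (neg_le_abs _).trans a1
      have a4 := (neg_le_abs _).trans a2
      ring_nf at a3 a4 ⊢
      linarith
    have b3 := Finset.sum_le_sum fun j (_ : j ∈ Finset.univ) => b2 j
    rw [Finset.sum_add_distrib, Finset.sum_sub_distrib (f := fun _ => ħ * N), Finset.sum_const, Finset.card_univ,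
      Fintype.card_fin, nsmul_eq_mul] at b3
    have b4 : ∀ j : Fin d, ((w.1 j ^ 2 + w.2 j ^ 2 + ħ) * N - 0 * 0 -
        ((2 * (w.1 j + (0 * w.2 j - 1 * 0)) - 0 * (0 + (0 * 0 + 1 * w.2 j))) * (β j).re -
          (2 * (0 + (0 * 0 + 1 * w.2 j)) + 0 * (w.1 j + (0 * w.2 j - 1 * 0))) * (β j).im)) =
        ((w.1 j ^ 2 + w.2 j ^ 2 + ħ) * N - 2 * (w.1 j * (β j).re - w.2 j * (β j).im)) := fun j => by ring
    simp only [b4] at b1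
    have b5 : (⟪b, o⟫_ℂ).re = RCLike.re ⟪b, o⟫_ℂ := rfl
    rw [b5] at b1
    linarith
  refine key.trans (le_of_eq ?_)
  rw [← Finset.mul_sum]
  ring

end ToeplitzCoupling
end SemiWass
end

noncomputable section
namespace SemiWass

/-! ### Superposition of product couplings over the pure pieces B|w⟩ -/

section MixedCoupling
variable {d : ℕ}

lemma isPositive_of_inner_eq_ofReal (T : Op d) (r : L2 d → ℝ) (hr : ∀ v, 0 ≤ r v)
    (h : ∀ v, ⟪v, T v⟫_ℂ = (r v : ℂ)) : T.IsPositive := by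
  rw [ContinuousLinearMap.isPositive_iff_complex]
  intro v
  have h2 : ⟪T v, v⟫_ℂ = (r v : ℂ) := by
    rw [← inner_conj_symm, h, Complex.conj_ofReal]
  rw [h2]
  exact ⟨rfl, hr v⟩

/-- The vector `B|w⟩`. -/
def imgCoh (ħ : ℝ) (hħ : 0 < ħ) (B : Op d) (w : Phase d) : L2 d := B (sL2 (cohS ħ hħ w))

lemma stronglyMeasurable_imgCoh (ħ : ℝ) (hħ : 0 < ħ) (B : Op d) :
    StronglyMeasurable (imgCoh ħ hħ B) :=
  B.continuous.comp_stronglyMeasurable (stronglyMeasurable_coh ħ hħ)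

lemma measurable_inner_imgCoh (ħ : ℝ) (hħ : 0 < ħ) (B : Op d) (u : L2 d) :
    Measurable fun w => ⟪u, imgCoh ħ hħ B w⟫_ℂ :=
  (stronglyMeasurable_const.inner (stronglyMeasurable_imgCoh ħ hħ B)).measurable

/-- The weight `(2πħ)^{-d} |⟨z|B|w⟩|² / ‖B|w⟩‖²`. -/
def mixWeight (ħ : ℝ) (hħ : 0 < ħ) (B : Op d) (z w : Phase d) : ℝ :=
  ((2 * Real.pi * ħ) ^ d)⁻¹ *
    (‖⟪sL2 (cohS ħ hħ z), imgCoh ħ hħ B w⟫_ℂ‖ ^ 2 / ‖imgCoh ħ hħ B w‖ ^ 2)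

lemma mixWeight_nonneg (ħ : ℝ) (hħ : 0 < ħ) (B : Op d) (z w : Phase d) :
    0 ≤ mixWeight ħ hħ B z w := by
  rw [mixWeight]; positivity

lemma measurable_mixWeight (ħ : ℝ) (hħ : 0 < ħ) (B : Op d) :
    Measurable fun p : Phase d × Phase d => mixWeight ħ hħ B p.1 p.2 := by
  have m1 : Measurable fun p : Phase d × Phase d => ⟪sL2 (cohS ħ hħ p.1), imgCoh ħ hħ B p.2⟫_ℂ :=
    (((stronglyMeasurable_coh ħ hħ).comp_measurable measurable_fst).inner
      ((stronglyMeasurable_imgCoh ħ hħ B).comp_measurable measurable_snd)).measurable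
  have m2 : Measurable fun p : Phase d × Phase d => ‖imgCoh ħ hħ B p.2‖ :=
    ((stronglyMeasurable_imgCoh ħ hħ B).comp_measurable measurable_snd).norm.measurable
  exact ((m1.norm.pow_const 2).div (m2.pow_const 2)).const_mul _

lemma measurable_mixWeight_right (ħ : ℝ) (hħ : 0 < ħ) (B : Op d) (z : Phase d) :
    Measurable fun w => mixWeight ħ hħ B z w := by
  have m1 : Measurable fun w => ⟪sL2 (cohS ħ hħ z), imgCoh ħ hħ B w⟫_ℂ :=
    measurable_inner_imgCoh ħ hħ B _
  have m2 : Measurable fun w => ‖imgCoh ħ hħ B w‖ :=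
    (stronglyMeasurable_imgCoh ħ hħ B).norm.measurable
  exact ((m1.norm.pow_const 2).div (m2.pow_const 2)).const_mul _

lemma measurable_ofReal_mixWeight_mul (ħ : ℝ) (hħ : 0 < ħ) (B : Op d) (z : Phase d)
    {f : Phase d → ℝ≥0∞} (hf : Measurable f) :
    Measurable fun w => ENNReal.ofReal (mixWeight ħ hħ B z w) * f w :=
  (measurable_mixWeight_right ħ hħ B z).ennreal_ofReal.mul hf

/-- If B|w⟩ = 0 the division by zero returns 0 and both sides vanish, so the identity needs no
exception. -/
lemma mixWeight_mul (ħ : ℝ) (hħ : 0 < ħ) (B : Op d) (z w : Phase d) :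
    mixWeight ħ hħ B z w * ‖imgCoh ħ hħ B w‖ ^ 2 =
      ((2 * Real.pi * ħ) ^ d)⁻¹ * ‖⟪sL2 (cohS ħ hħ z), imgCoh ħ hħ B w⟫_ℂ‖ ^ 2 := by
  by_cases h : imgCoh ħ hħ B w = 0
  · simp [h]
  · have : ‖imgCoh ħ hħ B w‖ ^ 2 ≠ 0 := by simpa using h
    rw [mixWeight, mul_assoc, div_mul_cancel₀ _ this]

lemma ofReal_mixWeight_mul (ħ : ℝ) (hħ : 0 < ħ) (B : Op d) (z w : Phase d) :
    ENNReal.ofReal (mixWeight ħ hħ B z w) * ‖imgCoh ħ hħ B w‖ₑ ^ 2 =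
      ENNReal.ofReal ((2 * Real.pi * ħ) ^ d)⁻¹ * ‖⟪sL2 (cohS ħ hħ z), imgCoh ħ hħ B w⟫_ℂ‖ₑ ^ 2 := by
  rw [enorm_sq_eq_ofReal, enorm_sq_eq_ofReal, ← ENNReal.ofReal_mul (mixWeight_nonneg ..),
    ← ENNReal.ofReal_mul (by positivity), mixWeight_mul]

/-- Integrals against the weight in the first variable. -/
lemma lintegral_mixWeight_mul_le (ħ : ℝ) (hħ : 0 < ħ) (B : Op d) (w : Phase d) (f : Phase d → ℝ≥0∞)
    (X : ℝ≥0∞) (h : ∫⁻ z, ‖⟪sL2 (cohS ħ hħ z), imgCoh ħ hħ B w⟫_ℂ‖ₑ ^ 2 * f z ≤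
      ENNReal.ofReal ((2 * Real.pi * ħ) ^ d) * (‖imgCoh ħ hħ B w‖ₑ ^ 2 * X)) :
    ∫⁻ z, ENNReal.ofReal (mixWeight ħ hħ B z w) * f z ≤ X := by
  by_cases hb : imgCoh ħ hħ B w = 0
  · simp [mixWeight, hb]
  have hN : 0 < ‖imgCoh ħ hħ B w‖ ^ 2 := by
    have : ‖imgCoh ħ hħ B w‖ ≠ 0 := by simpa using hb
    positivity
  have hc : 0 < ((2 * Real.pi * ħ) ^ d)⁻¹ / ‖imgCoh ħ hħ B w‖ ^ 2 := by positivity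
  have e : ∀ z, ENNReal.ofReal (mixWeight ħ hħ B z w) * f z =
      ENNReal.ofReal (((2 * Real.pi * ħ) ^ d)⁻¹ / ‖imgCoh ħ hħ B w‖ ^ 2) *
        (‖⟪sL2 (cohS ħ hħ z), imgCoh ħ hħ B w⟫_ℂ‖ₑ ^ 2 * f z) := by
    intro z
    rw [enorm_sq_eq_ofReal, ← mul_assoc, ← ENNReal.ofReal_mul hc.le, mixWeight]
    congr 2; ring
  simp_rw [e]
  rw [lintegral_const_mul' _ _ ENNReal.ofReal_ne_top]
  refine (mul_le_mul_right h _).trans (le_of_eq ?_)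
  rw [enorm_sq_eq_ofReal, ← mul_assoc, ← mul_assoc, ← ENNReal.ofReal_mul hc.le,
    ← ENNReal.ofReal_mul (by positivity)]
  have : ((2 * Real.pi * ħ) ^ d)⁻¹ / ‖imgCoh ħ hħ B w‖ ^ 2 * (2 * Real.pi * ħ) ^ d *
      ‖imgCoh ħ hħ B w‖ ^ 2 = 1 := by field_simp
  rw [this, ENNReal.ofReal_one, one_mul]

/-- For B|w⟩ ≠ 0 the weight is a probability density in z, the Husimi function of the normalized
state; where B|w⟩ = 0 the other factor vanishes. -/
lemma lintegral_mixWeight_mul_inner (ħ : ℝ) (hħ : 0 < ħ) (B : Op d) (w : Phase d) (u : L2 d) :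
    ∫⁻ z, ENNReal.ofReal (mixWeight ħ hħ B z w) * ‖⟪imgCoh ħ hħ B w, u⟫_ℂ‖ₑ ^ 2 =
      ‖⟪imgCoh ħ hħ B w, u⟫_ℂ‖ₑ ^ 2 := by
  by_cases hb : imgCoh ħ hħ B w = 0
  · simp [hb]
  have hN : 0 < ‖imgCoh ħ hħ B w‖ ^ 2 := by
    have : ‖imgCoh ħ hħ B w‖ ≠ 0 := by simpa using hb
    positivity
  have hc : 0 < ((2 * Real.pi * ħ) ^ d)⁻¹ / ‖imgCoh ħ hħ B w‖ ^ 2 := by positivity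
  have e : ∀ z, ENNReal.ofReal (mixWeight ħ hħ B z w) =
      ENNReal.ofReal (((2 * Real.pi * ħ) ^ d)⁻¹ / ‖imgCoh ħ hħ B w‖ ^ 2) *
        ‖⟪sL2 (cohS ħ hħ z), imgCoh ħ hħ B w⟫_ℂ‖ₑ ^ 2 := by
    intro z
    rw [enorm_sq_eq_ofReal, ← ENNReal.ofReal_mul hc.le, mixWeight]
    congr 1; ring
  rw [lintegral_mul_const' _ _ (by simp)]
  simp_rw [e]
  rw [lintegral_const_mul' _ _ ENNReal.ofReal_ne_top, lintegral_coherent', enorm_sq_eq_ofReal,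
    ← mul_assoc, ← ENNReal.ofReal_mul hc.le, ← ENNReal.ofReal_mul (by positivity)]
  have : ((2 * Real.pi * ħ) ^ d)⁻¹ / ‖imgCoh ħ hħ B w‖ ^ 2 * (2 * Real.pi * ħ) ^ d *
      ‖imgCoh ħ hħ B w‖ ^ 2 = 1 := by field_simp
  rw [this, ENNReal.ofReal_one, one_mul]

/-- The coupling `∫ (2πħ)^{-d} |⟨z|B|w⟩|² / ‖B|w⟩‖² B|w⟩⟨w|B* dν(w)`. -/
def mixCoupling (ħ : ℝ) (hħ : 0 < ħ) (B : Op d) (ν : Measure (Phase d)) (z : Phase d) : Op d :=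
  ∫ w, rk (mixWeight ħ hħ B z w) (imgCoh ħ hħ B w) ∂ν

variable (ħ : ℝ) (hħ : 0 < ħ) (B R : Op d) (ν : Measure (Phase d)) [IsProbabilityMeasure ν]

/-- The factorization R = B T B* read as a quadratic form: R is the mixture of the pure pieces
B|w⟩⟨w|B*. -/
lemma lintegral_inner_imgCoh (hR : R.IsPositive)
    (hRB : ∀ v, R v = B (cohMix ħ hħ ν (ContinuousLinearMap.adjoint B v))) (u : L2 d) :
    ∫⁻ w, ‖⟪imgCoh ħ hħ B w, u⟫_ℂ‖ₑ ^ 2 ∂ν = ‖posSqrt R u‖ₑ ^ 2 := by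
  have h1 := inner_cohMix_self ħ hħ ν (ContinuousLinearMap.adjoint B u)
  rw [ContinuousLinearMap.adjoint_inner_left, ← hRB] at h1
  have e : ∀ w, ⟪sL2 (cohS ħ hħ w), ContinuousLinearMap.adjoint B u⟫_ℂ = ⟪imgCoh ħ hħ B w, u⟫_ℂ :=
    fun w => ContinuousLinearMap.adjoint_inner_right _ _ _
  simp only [e] at h1
  rw [enorm_posSqrt_sq R hR, h1]
  have hi : Integrable (fun w => ‖⟪imgCoh ħ hħ B w, u⟫_ℂ‖ ^ 2) ν := by
    have := (inner_cohMix ħ hħ ν (ContinuousLinearMap.adjoint B u) (ContinuousLinearMap.adjoint B u)).1.norm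
    refine this.congr (ae_of_all _ fun z => ?_)
    simp only [e]
    rw [norm_mul, norm_inner_symm, e, sq]
  have h2 := ofReal_integral_eq_lintegral_ofReal hi (ae_of_all _ fun w => by positivity)
  simp_rw [enorm_sq_eq_ofReal]
  exact h2.symm

lemma lintegral_enorm_imgCoh (hR : R.IsPositive)
    (hRB : ∀ v, R v = B (cohMix ħ hħ ν (ContinuousLinearMap.adjoint B v))) :
    ∫⁻ w, ‖imgCoh ħ hħ B w‖ₑ ^ 2 ∂ν = opTrace R := by
  rw [opTrace_eq_hermite ħ hħ R hR]
  simp_rw [← tsum_enorm_sq_inner (hermB ħ hħ) (imgCoh ħ hħ B _)]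
  rw [lintegral_tsum fun m => ((measurable_inner_imgCoh ħ hħ B _).enorm.pow_const 2).aemeasurable]
  refine tsum_congr fun m => ?_
  rw [← lintegral_inner_imgCoh ħ hħ B R ν hR hRB]
  refine lintegral_congr fun w => ?_
  rw [← inner_conj_symm, RCLike.enorm_conj, hermB_apply]

lemma integrable_mix (hR : R.IsPositive)
    (hRB : ∀ v, R v = B (cohMix ħ hħ ν (ContinuousLinearMap.adjoint B v))) (z : Phase d) :
    Integrable (fun w => rk (mixWeight ħ hħ B z w) (imgCoh ħ hħ B w)) ν := by
  have m1 : StronglyMeasurable fun w => ((mixWeight ħ hħ B z w : ℝ) : ℂ) :=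
    (Complex.measurable_ofReal.comp (measurable_mixWeight_right ħ hħ B z)).stronglyMeasurable
  have m2 : StronglyMeasurable fun w =>
      (InnerProductSpace.rankOne ℂ (imgCoh ħ hħ B w) (imgCoh ħ hħ B w) : Op d) :=
    continuous_rankOne_self.comp_stronglyMeasurable (stronglyMeasurable_imgCoh ħ hħ B)
  have m3 : StronglyMeasurable fun w => rk (mixWeight ħ hħ B z w) (imgCoh ħ hħ B w) := m1.smul m2
  refine ⟨m3.aestronglyMeasurable, ?_⟩
  -- The operator norm of the rank-one piece is ‖B|w⟩‖², which cancels the normalization; the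
  -- remaining integral is the quadratic form of R at |z⟩.
  have e : ∀ w, ‖rk (mixWeight ħ hħ B z w) (imgCoh ħ hħ B w)‖ₑ = ENNReal.ofReal ((2 * Real.pi * ħ) ^ d)⁻¹ *
      ‖⟪imgCoh ħ hħ B w, sL2 (cohS ħ hħ z)⟫_ℂ‖ₑ ^ 2 := by
    intro w
    rw [rk, enorm_smul, InnerProductSpace.enorm_rankOne, ← sq, ← inner_conj_symm, RCLike.enorm_conj,
      ← ofReal_mixWeight_mul, ← ofReal_norm, Complex.norm_real, Real.norm_of_nonneg (mixWeight_nonneg ..)]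
  simp only [HasFiniteIntegral, e]
  rw [lintegral_const_mul' _ _ ENNReal.ofReal_ne_top, lintegral_inner_imgCoh ħ hħ B R ν hR hRB]
  exact ENNReal.mul_lt_top ENNReal.ofReal_lt_top (ENNReal.pow_lt_top enorm_lt_top)

lemma ofReal_re_inner_mixCoupling (hR : R.IsPositive)
    (hRB : ∀ v, R v = B (cohMix ħ hħ ν (ContinuousLinearMap.adjoint B v))) (z : Phase d) (f : L2 d) :
    (mixCoupling ħ hħ B ν z).IsPositive ∧
    ENNReal.ofReal (RCLike.re ⟪f, mixCoupling ħ hħ B ν z f⟫_ℂ) =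
      ∫⁻ w, ENNReal.ofReal (mixWeight ħ hħ B z w) * ‖⟪f, imgCoh ħ hħ B w⟫_ℂ‖ₑ ^ 2 ∂ν := by
  have key : ∀ f : L2 d, ⟪f, mixCoupling ħ hħ B ν z f⟫_ℂ =
      ((∫ w, mixWeight ħ hħ B z w * ‖⟪f, imgCoh ħ hħ B w⟫_ℂ‖ ^ 2 ∂ν : ℝ) : ℂ) ∧
      Integrable (fun w => mixWeight ħ hħ B z w * ‖⟪f, imgCoh ħ hħ B w⟫_ℂ‖ ^ 2) ν := by
    intro f
    have h1 := inner_integral_op _ (integrable_mix ħ hħ B R ν hR hRB z) f f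
    have e : ∀ w, ⟪f, rk (mixWeight ħ hħ B z w) (imgCoh ħ hħ B w) f⟫_ℂ =
        ((mixWeight ħ hħ B z w * ‖⟪f, imgCoh ħ hħ B w⟫_ℂ‖ ^ 2 : ℝ) : ℂ) := by
      intro w
      rw [inner_rk, ← inner_conj_symm _ f, Complex.mul_conj']
      push_cast; rfl
    simp only [e] at h1
    refine ⟨?_, ?_⟩
    · rw [mixCoupling, h1.2, integral_complex_ofReal]
    · have := h1.1.re
      simp only [RCLike.re_to_complex, Complex.ofReal_re] at this
      exact this
  have hnn : ∀ (f : L2 d) (w : Phase d), 0 ≤ mixWeight ħ hħ B z w * ‖⟪f, imgCoh ħ hħ B w⟫_ℂ‖ ^ 2 :=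
    fun f w => mul_nonneg (mixWeight_nonneg ..) (by positivity)
  refine ⟨isPositive_of_inner_eq_ofReal _ _ (fun f => integral_nonneg (hnn f)) fun f => (key f).1, ?_⟩
  rw [(key f).1]
  simp only [RCLike.re_to_complex, Complex.ofReal_re]
  rw [ofReal_integral_eq_lintegral_ofReal (key f).2 (ae_of_all _ (hnn f))]
  refine lintegral_congr fun w => ?_
  rw [ENNReal.ofReal_mul (mixWeight_nonneg ..), enorm_sq_eq_ofReal]

/-- Polarization of the quadratic form on the product space, with the square root of the weight
attached to each factor. This gives the joint integrability that Fubini requires, as well as the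
value of the integral. -/
lemma integral_prod_rk (hR : R.IsPositive)
    (hRB : ∀ v, R v = B (cohMix ħ hħ ν (ContinuousLinearMap.adjoint B v))) (u v : L2 d) :
    Integrable (fun p : Phase d × Phase d => ⟪u, rk (mixWeight ħ hħ B p.1 p.2) (imgCoh ħ hħ B p.2) v⟫_ℂ)
      (volume.prod ν) ∧
    ∫ p : Phase d × Phase d, ⟪u, rk (mixWeight ħ hħ B p.1 p.2) (imgCoh ħ hħ B p.2) v⟫_ℂ ∂(volume.prod ν) =
      ⟪posSqrt R u, posSqrt R v⟫_ℂ := by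
  have hprod := integral_conj_mul_of_lintegral
    (fun p : Phase d × Phase d => ((Real.sqrt (mixWeight ħ hħ B p.1 p.2) : ℝ) : ℂ) •
      ((innerSL ℂ (imgCoh ħ hħ B p.2) : L2 d →L[ℂ] ℂ) : L2 d →ₗ[ℂ] ℂ))
    (μ := (volume : Measure (Phase d)).prod ν) (fun u => by
      have m2 : Measurable fun p : Phase d × Phase d => ⟪imgCoh ħ hħ B p.2, u⟫_ℂ :=
        (((stronglyMeasurable_imgCoh ħ hħ B).comp_measurable measurable_snd).inner
          stronglyMeasurable_const).measurable
      exact ((Complex.continuous_ofReal.measurable.comp (measurable_mixWeight ħ hħ B).sqrt).mul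
        m2).aestronglyMeasurable) (posSqrt R) (fun u => by
      have m2 : Measurable fun p : Phase d × Phase d => ⟪imgCoh ħ hħ B p.2, u⟫_ℂ :=
        (((stronglyMeasurable_imgCoh ħ hħ B).comp_measurable measurable_snd).inner
          stronglyMeasurable_const).measurable
      have e : ∀ p : Phase d × Phase d, ‖(((Real.sqrt (mixWeight ħ hħ B p.1 p.2) : ℝ) : ℂ) •
          ((innerSL ℂ (imgCoh ħ hħ B p.2) : L2 d →L[ℂ] ℂ) : L2 d →ₗ[ℂ] ℂ)) u‖ₑ ^ 2 =
          ENNReal.ofReal (mixWeight ħ hħ B p.1 p.2) * ‖⟪imgCoh ħ hħ B p.2, u⟫_ℂ‖ₑ ^ 2 := by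
        intro p
        rw [LinearMap.smul_apply, enorm_smul, mul_pow, enorm_sq_eq_ofReal ((Real.sqrt _ : ℝ) : ℂ),
          Complex.norm_real, Real.norm_eq_abs, sq_abs, Real.sq_sqrt (mixWeight_nonneg ..)]
        rfl
      have m3 : Measurable fun p : Phase d × Phase d =>
          ENNReal.ofReal (mixWeight ħ hħ B p.1 p.2) * ‖⟪imgCoh ħ hħ B p.2, u⟫_ℂ‖ₑ ^ 2 :=
        (measurable_mixWeight ħ hħ B).ennreal_ofReal.mul (m2.enorm.pow_const 2)
      simp_rw [e]
      rw [lintegral_prod_symm _ m3.aemeasurable]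
      simp_rw [lintegral_mixWeight_mul_inner]
      exact lintegral_inner_imgCoh ħ hħ B R ν hR hRB u)
  have e : ∀ (u v : L2 d) (p : Phase d × Phase d), (starRingEnd ℂ) ((((Real.sqrt (mixWeight ħ hħ B p.1 p.2) : ℝ) : ℂ) •
      ((innerSL ℂ (imgCoh ħ hħ B p.2) : L2 d →L[ℂ] ℂ) : L2 d →ₗ[ℂ] ℂ)) u) *
      (((Real.sqrt (mixWeight ħ hħ B p.1 p.2) : ℝ) : ℂ) •
      ((innerSL ℂ (imgCoh ħ hħ B p.2) : L2 d →L[ℂ] ℂ) : L2 d →ₗ[ℂ] ℂ)) v =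
      ⟪u, rk (mixWeight ħ hħ B p.1 p.2) (imgCoh ħ hħ B p.2) v⟫_ℂ := by
    intro u v p
    simp only [LinearMap.smul_apply, ContinuousLinearMap.coe_coe, innerSL_apply_apply, smul_eq_mul,
      map_mul, Complex.conj_ofReal, inner_conj_symm]
    rw [inner_rk, mul_mul_mul_comm, ← Complex.ofReal_mul, Real.mul_self_sqrt (mixWeight_nonneg ..)]
  simp only [e] at hprod
  exact hprod u v

/-- The trace of each piece restores the factor ‖B|w⟩‖² of the weight's denominator, leaving the
mixture of |⟨z|B|w⟩|², which is ⟨z|R|z⟩. -/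
lemma opTrace_mixCoupling (hR : R.IsPositive)
    (hRB : ∀ v, R v = B (cohMix ħ hħ ν (ContinuousLinearMap.adjoint B v))) (z : Phase d) :
    opTrace (mixCoupling ħ hħ B ν z) = ENNReal.ofReal ((2 * Real.pi * ħ) ^ d)⁻¹ *
      ‖posSqrt R (sL2 (cohS ħ hħ z))‖ₑ ^ 2 := by
  have hpos := (ofReal_re_inner_mixCoupling ħ hħ B R ν hR hRB z 0).1
  have m1 : ∀ m : Fin d → ℕ, Measurable fun w => ENNReal.ofReal (mixWeight ħ hħ B z w) *
      ‖⟪sL2 (hermS ħ hħ m), imgCoh ħ hħ B w⟫_ℂ‖ₑ ^ 2 := fun m =>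
    measurable_ofReal_mixWeight_mul ħ hħ B z ((measurable_inner_imgCoh ħ hħ B _).enorm.pow_const 2)
  rw [opTrace_eq_hermite ħ hħ _ hpos]
  simp_rw [enorm_posSqrt_sq _ hpos, (ofReal_re_inner_mixCoupling ħ hħ B R ν hR hRB z _).2]
  rw [← lintegral_tsum fun m => (m1 m).aemeasurable]
  simp_rw [ENNReal.tsum_mul_left, ← hermB_apply, tsum_enorm_sq_inner, ofReal_mixWeight_mul]
  rw [lintegral_const_mul' _ _ ENNReal.ofReal_ne_top, ← lintegral_inner_imgCoh ħ hħ B R ν hR hRB]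
  congr 1
  refine lintegral_congr fun w => ?_
  rw [← inner_conj_symm, RCLike.enorm_conj]

lemma isCoupling_mixCoupling (hR : R.IsPositive)
    (hRB : ∀ v, R v = B (cohMix ħ hħ ν (ContinuousLinearMap.adjoint B v)))
    (W : Phase d → ℂ) (hW : IsWigner ħ R W) :
    IsCoupling (husimi ħ W) R (mixCoupling ħ hħ B ν) := by
  have hprod := integral_prod_rk ħ hħ B R ν hR hRB
  have hin : ∀ u v z, ⟪u, mixCoupling ħ hħ B ν z v⟫_ℂ =
      ∫ w, ⟪u, rk (mixWeight ħ hħ B z w) (imgCoh ħ hħ B w) v⟫_ℂ ∂ν := fun u v z =>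
    (inner_integral_op _ (integrable_mix ħ hħ B R ν hR hRB z) u v).2
  have hi : ∀ u v, Integrable (fun z => ⟪u, mixCoupling ħ hħ B ν z v⟫_ℂ) := by
    intro u v
    simp_rw [hin]
    exact (hprod u v).1.integral_prod_left
  refine ⟨fun u v => (hi u v).1.aemeasurable,
    ae_of_all _ fun z => (ofReal_re_inner_mixCoupling ħ hħ B R ν hR hRB z 0).1,
    ae_of_all _ fun z => ?_, hi, fun u v => ?_⟩
  · rw [opTrace_mixCoupling ħ hħ B R ν hR hRB, husimi_eq ħ hħ R W hW,
      ENNReal.ofReal_mul (by positivity), ← enorm_posSqrt_sq R hR]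
  · simp_rw [hin]
    rw [← integral_prod _ (hprod u v).1, (hprod u v).2, posSqrt_isSelfAdjoint, posSqrt_mul_self R hR]

/-- Measurability is read off the Hermite series; it is not visible from the infimum over weak
derivatives. -/
lemma measurable_costForm_imgCoh :
    Measurable fun p : Phase d × Phase d => costForm ħ p.1 (imgCoh ħ hħ B p.2) := by
  have m2 : ∀ u : L2 d, Measurable fun p : Phase d × Phase d => ⟪u, imgCoh ħ hħ B p.2⟫_ℂ := fun u =>
    (measurable_inner_imgCoh ħ hħ B u).comp measurable_snd
  have mP : ∀ (j : Fin d) (g : 𝓢(Conf d, ℂ)), Measurable fun p : Phase d × Phase d =>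
      ‖⟪sL2 (posOp p.1 j g), imgCoh ħ hħ B p.2⟫_ℂ‖ₑ ^ 2 := by
    intro j g
    simp only [posOp, add_apply, smul_apply, ContinuousLinearMap.id_apply, map_add, map_smul,
      inner_add_left, inner_smul_left, Complex.conj_ofReal]
    have := m2 (sL2 g)
    have := m2 (sL2 (mulS j g))
    fun_prop
  have mM : ∀ (j : Fin d) (g : 𝓢(Conf d, ℂ)), Measurable fun p : Phase d × Phase d =>
      ‖⟪sL2 (momOp ħ p.1 j g), imgCoh ħ hħ B p.2⟫_ℂ‖ₑ ^ 2 := by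
    intro j g
    simp only [momOp, add_apply, smul_apply, ContinuousLinearMap.id_apply, map_add, map_smul,
      inner_add_left, inner_smul_left, Complex.conj_ofReal]
    have := m2 (sL2 g)
    have := m2 (sL2 (gradS j g))
    fun_prop
  simp_rw [costForm_eq ħ hħ]
  refine Measurable.const_mul (Finset.measurable_fun_sum _ fun j _ => ?_) _
  exact (Measurable.tsum fun m => mP j _).add (Measurable.tsum fun m => mM j _)

/-- The cost trace is linear in Q although it is defined through √Q: `costTrace_eq` expresses it by
the quadratic form of Q, and Tonelli does the rest. -/
lemma costTrace_mixCoupling (hR : R.IsPositive)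
    (hRB : ∀ v, R v = B (cohMix ħ hħ ν (ContinuousLinearMap.adjoint B v))) (z : Phase d) :
    costTrace ħ z (mixCoupling ħ hħ B ν z) =
      ∫⁻ w, ENNReal.ofReal (mixWeight ħ hħ B z w) * costForm ħ z (imgCoh ħ hħ B w) ∂ν := by
  have hpos := (ofReal_re_inner_mixCoupling ħ hħ B R ν hR hRB z 0).1
  have m1 : Measurable fun w => ENNReal.ofReal (mixWeight ħ hħ B z w) :=
    (measurable_mixWeight_right ħ hħ B z).ennreal_ofReal
  have m2 : ∀ u : L2 d, Measurable fun w => ‖⟪u, imgCoh ħ hħ B w⟫_ℂ‖ₑ ^ 2 := fun u =>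
    (measurable_inner_imgCoh ħ hħ B u).enorm.pow_const 2
  rw [costTrace_eq ħ hħ z _ hpos]
  simp_rw [(ofReal_re_inner_mixCoupling ħ hħ B R ν hR hRB z _).2, costForm_eq ħ hħ]
  have e : ∀ f : (Fin d → ℕ) → L2 d, ∑' m, ∫⁻ w, ENNReal.ofReal (mixWeight ħ hħ B z w) *
      ‖⟪f m, imgCoh ħ hħ B w⟫_ℂ‖ₑ ^ 2 ∂ν = ∫⁻ w, ENNReal.ofReal (mixWeight ħ hħ B z w) *
        ∑' m, ‖⟪f m, imgCoh ħ hħ B w⟫_ℂ‖ₑ ^ 2 ∂ν := by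
    intro f
    have m3 : ∀ m, Measurable fun w => ENNReal.ofReal (mixWeight ħ hħ B z w) *
        ‖⟪f m, imgCoh ħ hħ B w⟫_ℂ‖ₑ ^ 2 := fun m => measurable_ofReal_mixWeight_mul ħ hħ B z (m2 _)
    rw [← lintegral_tsum fun m => (m3 m).aemeasurable]
    simp_rw [ENNReal.tsum_mul_left]
  rw [Finset.sum_congr rfl fun j _ => by rw [e fun m => sL2 (posOp z j (hermS ħ hħ m)),
    e fun m => sL2 (momOp ħ z j (hermS ħ hħ m))]]
  have mP : ∀ j : Fin d, Measurable fun w => ∑' m, ‖⟪sL2 (posOp z j (hermS ħ hħ m)), imgCoh ħ hħ B w⟫_ℂ‖ₑ ^ 2 :=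
    fun j => Measurable.tsum fun m => m2 _
  have mM : ∀ j : Fin d, Measurable fun w => ∑' m, ‖⟪sL2 (momOp ħ z j (hermS ħ hħ m)), imgCoh ħ hħ B w⟫_ℂ‖ₑ ^ 2 :=
    fun j => Measurable.tsum fun m => m2 _
  have e2 : ∀ w, ENNReal.ofReal (mixWeight ħ hħ B z w) * (1 / 2 * ∑ j : Fin d,
      (∑' m, ‖⟪sL2 (posOp z j (hermS ħ hħ m)), imgCoh ħ hħ B w⟫_ℂ‖ₑ ^ 2 +
      ∑' m, ‖⟪sL2 (momOp ħ z j (hermS ħ hħ m)), imgCoh ħ hħ B w⟫_ℂ‖ₑ ^ 2)) =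
      1 / 2 * ∑ j : Fin d, (ENNReal.ofReal (mixWeight ħ hħ B z w) *
        ∑' m, ‖⟪sL2 (posOp z j (hermS ħ hħ m)), imgCoh ħ hħ B w⟫_ℂ‖ₑ ^ 2 +
        ENNReal.ofReal (mixWeight ħ hħ B z w) *
          ∑' m, ‖⟪sL2 (momOp ħ z j (hermS ħ hħ m)), imgCoh ħ hħ B w⟫_ℂ‖ₑ ^ 2) := by
    intro w
    rw [mul_left_comm, Finset.mul_sum]
    simp_rw [mul_add]
  have m4 : ∀ j : Fin d, Measurable fun w => ENNReal.ofReal (mixWeight ħ hħ B z w) *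
        ∑' m, ‖⟪sL2 (posOp z j (hermS ħ hħ m)), imgCoh ħ hħ B w⟫_ℂ‖ₑ ^ 2 +
        ENNReal.ofReal (mixWeight ħ hħ B z w) *
          ∑' m, ‖⟪sL2 (momOp ħ z j (hermS ħ hħ m)), imgCoh ħ hħ B w⟫_ℂ‖ₑ ^ 2 := fun j =>
    (measurable_ofReal_mixWeight_mul ħ hħ B z (mP j)).add (measurable_ofReal_mixWeight_mul ħ hħ B z (mM j))
  simp_rw [e2]
  rw [lintegral_const_mul _ (Finset.measurable_fun_sum _ fun j _ => m4 j),
    lintegral_finsetSum _ fun j _ => m4 j]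
  congr 1
  refine Finset.sum_congr rfl fun j _ => ?_
  exact (lintegral_add_left (measurable_ofReal_mixWeight_mul ħ hħ B z (mP j)) _).symm

lemma quantumWass_le_mix (hR : R.IsPositive)
    (hRB : ∀ v, R v = B (cohMix ħ hħ ν (ContinuousLinearMap.adjoint B v)))
    (W : Phase d → ℂ) (hW : IsWigner ħ R W) (G : Phase d → ℝ≥0∞)
    (hG : ∀ w, ∫⁻ z, ‖⟪sL2 (cohS ħ hħ z), imgCoh ħ hħ B w⟫_ℂ‖ₑ ^ 2 * costForm ħ z (imgCoh ħ hħ B w) ≤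
      ENNReal.ofReal ((2 * Real.pi * ħ) ^ d) * (‖imgCoh ħ hħ B w‖ₑ ^ 2 * G w)) :
    quantumWass ħ (husimi ħ W) R ≤ (∫⁻ w, G w ∂ν) ^ (1 / 2 : ℝ) := by
  rw [quantumWass]
  refine ENNReal.rpow_le_rpow ?_ (by norm_num)
  refine (iInf₂_le _ (isCoupling_mixCoupling ħ hħ B R ν hR hRB W hW)).trans ?_
  simp_rw [costTrace_mixCoupling ħ hħ B R ν hR hRB]
  rw [lintegral_lintegral_swap ((measurable_mixWeight ħ hħ B).ennreal_ofReal.mul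
    (measurable_costForm_imgCoh ħ hħ B)).aemeasurable]
  exact lintegral_mono fun w => lintegral_mixWeight_mul_le ħ hħ B w _ _ (hG w)

end MixedCoupling
end SemiWass
end

noncomputable section
namespace SemiWass

/-! ### The Töplitz case -/

section ToeplitzCase
variable {d : ℕ}

/-- The first moment `∫ (1 + |x| + |ξ|) F`. -/
def firstMoment (F : Phase d → ℝ) : ℝ := ∫ z, (1 + ‖z.1‖ + ‖z.2‖) * F z

lemma integrable_firstMoment {F : Phase d → ℝ} (hF : IsPosDensity F) :
    Integrable fun z => (1 + ‖z.1‖ + ‖z.2‖) * F z := by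
  refine (hF.integrable.add hF.integrable_moment).congr (ae_of_all _ fun z => ?_)
  simp only [Pi.add_apply]; ring

lemma one_le_firstMoment {F : Phase d → ℝ} (hF : IsPosDensity F) : 1 ≤ firstMoment F := by
  refine hF.integral_eq_one.symm.le.trans ?_
  refine integral_mono hF.integrable (integrable_firstMoment hF) fun z => ?_
  have h1 := hF.pos z
  have h2 : 0 ≤ (‖z.1‖ + ‖z.2‖) * F z := by positivity
  show F z ≤ (1 + ‖z.1‖ + ‖z.2‖) * F z
  nlinarith

lemma lintegral_firstMoment {F : Phase d → ℝ} (hF : IsPosDensity F) (c : ℝ) (hc : 0 ≤ c) :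
    ∫⁻ z, ENNReal.ofReal (c * (1 + ‖z.1‖ + ‖z.2‖)) ∂(densMeasure F) =
      ENNReal.ofReal (c * firstMoment F) := by
  have m1 : Measurable fun z : Phase d => ENNReal.ofReal (c * (1 + ‖z.1‖ + ‖z.2‖)) := by fun_prop
  rw [densMeasure, lintegral_withDensity_eq_lintegral_mul₀
    hF.integrable.1.aemeasurable.ennreal_ofReal m1.aemeasurable, firstMoment, ← integral_const_mul,
    ofReal_integral_eq_lintegral_ofReal ((integrable_firstMoment hF).const_mul c)
      (ae_of_all _ fun z => by have := (hF.pos z).le; positivity)]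
  refine lintegral_congr fun z => ?_
  rw [Pi.mul_apply, ← ENNReal.ofReal_mul (hF.pos z).le]
  congr 1; ring

lemma sum_abs_le_sqrt_mul_norm (x : Conf d) : ∑ j, |x j| ≤ Real.sqrt d * ‖x‖ := by
  have h := Finset.sum_mul_sq_le_sq_mul_sq Finset.univ (fun _ : Fin d => (1 : ℝ)) fun j => |x j|
  simp only [one_mul, one_pow, Finset.sum_const, Finset.card_univ, Fintype.card_fin, nsmul_eq_mul,
    mul_one, sq_abs] at h
  refine abs_le_of_sq_le_sq' ?_ (by positivity) |>.2
  rw [mul_pow, Real.sq_sqrt (Nat.cast_nonneg _), EuclideanSpace.norm_sq_eq]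
  simpa using h

/-- Cauchy–Schwarz in each sum gives the factor √d, whose square root is the d^{1/4} of the final
bound. -/
lemma one_add_sum_abs_le (hd : 1 ≤ d) (w : Phase d) :
    1 + 2 * ∑ j, (|w.1 j| + |w.2 j|) ≤ 2 * Real.sqrt d * (1 + ‖w.1‖ + ‖w.2‖) := by
  have h1 := sum_abs_le_sqrt_mul_norm w.1
  have h2 := sum_abs_le_sqrt_mul_norm w.2
  have h3 : 1 ≤ Real.sqrt d := by
    rw [Real.one_le_sqrt]; exact_mod_cast hd
  rw [Finset.sum_add_distrib]
  nlinarith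

lemma norm_inner_le_of_adjoint (B : Op d) (u v : L2 d) (hu : ‖u‖ = 1) {τ : ℝ}
    (h : ‖ContinuousLinearMap.adjoint B v‖ ≤ τ) : ‖⟪B u, v⟫_ℂ‖ ≤ τ := by
  rw [← ContinuousLinearMap.adjoint_inner_right]
  refine (norm_inner_le_norm _ _).trans ?_
  rwa [hu, one_mul]

lemma exists_moments (ħ : ℝ) (hħ : 0 < ħ) (τ : ℝ) (B : Op d)
    (h : ∀ (O : Obs d) (g : 𝓢(Conf d, ℂ)), ∃ w : L2 d,
      O.IsImage ħ (B (toL2 (g : Conf d → ℂ))) w ∧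
        ‖ContinuousLinearMap.adjoint B (w - B (toL2 (O.act ħ g)))‖ ≤ τ * ‖toL2 (g : Conf d → ℂ)‖)
    (w : Phase d) :
    ∃ p q, HasMoments ħ (imgCoh ħ hħ B w) p q ∧ 2 * costForm ħ w (imgCoh ħ hħ B w) ≤
      ENNReal.ofReal (d * ħ * ‖imgCoh ħ hħ B w‖ ^ 2 + τ * (1 + 2 * ∑ j, (|w.1 j| + |w.2 j|))) := by
  have h' : ∀ O : Obs d, ∃ o : L2 d, (∀ g : 𝓢(Conf d, ℂ), ⟪sL2 (actS ħ O.adj g), imgCoh ħ hħ B w⟫_ℂ =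
      ⟪sL2 g, o⟫_ℂ) ∧ ‖⟪imgCoh ħ hħ B w, o - B (sL2 (actS ħ O (cohS ħ hħ w)))⟫_ℂ‖ ≤ τ := by
    intro O
    obtain ⟨o, h1, h2⟩ := h O (cohS ħ hħ w)
    rw [← actS_coe, toL2_coe, toL2_coe, norm_coh, mul_one] at h2
    rw [toL2_coe, isImage_iff] at h1
    exact ⟨o, h1, norm_inner_le_of_adjoint B _ _ (norm_coh ħ hħ w) h2⟩
  choose img h1 h2 using h'
  -- The image under ħ∂_j is tested through its adjoint -ħ∂_j, which accounts for the sign in the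
  -- momentum field.
  have hm : HasMoments ħ (imgCoh ħ hħ B w) (fun j => img (Obs.pos j)) (fun j => img (Obs.gradPlus j)) := by
    refine ⟨fun j g => h1 (Obs.pos j) g, fun j g => ?_⟩
    have := h1 (Obs.gradPlus j) g
    rw [← this]
    simp [Obs.adj, actS, inner_neg_left]
  exact ⟨_, _, hm, costForm_coh_le ħ hħ w B τ _ _ (img Obs.osc) hm (h1 Obs.osc) (h2 Obs.osc)
    (fun j => h2 (Obs.pos j)) fun j => h2 (Obs.gradPlus j)⟩

theorem toeplitz_case (hd : 1 ≤ d) (ħ : ℝ) (hħ : 0 < ħ) (R : Op d) (hR : IsDensityOp R)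
    (W : Phase d → ℂ) (hW : IsWigner ħ R W) (F : Phase d → ℝ) (hF : IsPosDensity F) (τ : ℝ)
    (h : ToeplitzHyp ħ τ F R) :
    quantumWass ħ (husimi ħ W) R ≤
      ENNReal.ofReal ((d : ℝ) ^ (1 / 4 : ℝ) * constIII F * max (Real.sqrt ħ) (Real.sqrt τ)) := by
  have := isProbabilityMeasure_densMeasure hF
  obtain ⟨B, C, hB, hC, hO⟩ := h
  rw [toeplitz_eq ħ hħ hF] at hB hC
  obtain ⟨rfl, hRB⟩ := toeplitz_factor _ R B C (isPositive_cohMix ħ hħ _)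
    (posSqrt_cohMix_injective ħ hħ _ fun p hp => ae_of_ae_densMeasure hF hp) hR.1 hB hC
  have hτ : 0 ≤ τ := by
    obtain ⟨o, -, h2⟩ := hO Obs.osc (cohS ħ hħ (0 : Phase d))
    rw [toL2_coe, norm_coh, mul_one] at h2
    exact (norm_nonneg _).trans h2
  have hG := fun w => exists_moments ħ hħ τ B hO w
  have key := quantumWass_le_mix ħ hħ B R (densMeasure F) hR.1 hRB W hW
    (fun w => 2 * costForm ħ w (imgCoh ħ hħ B w) + ENNReal.ofReal (d * ħ / 2) * ‖imgCoh ħ hħ B w‖ₑ ^ 2)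
    (fun w => by
      obtain ⟨p, q, hm, -⟩ := hG w
      exact hm.lintegral_costForm_le hħ w)
  refine key.trans (rpow_half_le _ _ ?_ ?_)
  · have : 0 ≤ constIII F := by rw [constIII]; positivity
    positivity
  -- The coefficient 3/2 is dħ from the cost at w plus dħ/2 from the product coupling.
  have hpt : ∀ w, 2 * costForm ħ w (imgCoh ħ hħ B w) + ENNReal.ofReal (d * ħ / 2) * ‖imgCoh ħ hħ B w‖ₑ ^ 2 ≤
      ENNReal.ofReal (3 / 2 * d * ħ) * ‖imgCoh ħ hħ B w‖ₑ ^ 2 +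
        ENNReal.ofReal (2 * Real.sqrt d * τ * (1 + ‖w.1‖ + ‖w.2‖)) := by
    intro w
    obtain ⟨p, q, -, hc⟩ := hG w
    have h1 := mul_le_mul_of_nonneg_left (one_add_sum_abs_le hd w) hτ
    refine (add_le_add_left hc _).trans ?_
    rw [enorm_sq_eq_ofReal, ← ENNReal.ofReal_mul (by positivity), ← ENNReal.ofReal_mul (by positivity),
      ← ENNReal.ofReal_add (by positivity) (by positivity),
      ← ENNReal.ofReal_add (by positivity) (by positivity)]
    exact ENNReal.ofReal_le_ofReal (by linarith)
  refine (lintegral_mono hpt).trans ?_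
  have m1 : Measurable fun w => ENNReal.ofReal (3 / 2 * d * ħ) * ‖imgCoh ħ hħ B w‖ₑ ^ 2 :=
    ((stronglyMeasurable_imgCoh ħ hħ B).enorm.pow_const 2).const_mul _
  rw [lintegral_add_left m1, lintegral_const_mul' _ _ ENNReal.ofReal_ne_top,
    lintegral_enorm_imgCoh ħ hħ B R _ hR.1 hRB, hR.2, mul_one,
    lintegral_firstMoment hF _ (by positivity), ← ENNReal.ofReal_add (by positivity)
      (by have := one_le_firstMoment hF; positivity)]
  refine ENNReal.ofReal_le_ofReal ?_
  have e1 : ((d : ℝ) ^ (1 / 4 : ℝ)) ^ 2 = Real.sqrt d := by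
    rw [← Real.rpow_natCast, ← Real.rpow_mul (Nat.cast_nonneg _), Real.sqrt_eq_rpow]; norm_num
  have e2 : (max (Real.sqrt ħ) (Real.sqrt τ)) ^ 2 = max ħ τ := by
    rw [← Monotone.map_max (f := Real.sqrt) Real.sqrt_monotone]
    exact Real.sq_sqrt (le_max_of_le_left hħ.le)
  have e3 : constIII F ^ 2 = 4 * max (firstMoment F) d := by
    rw [constIII, mul_pow, ← Monotone.map_max (f := Real.sqrt) Real.sqrt_monotone, Real.sq_sqrt
      (le_max_of_le_right (Nat.cast_nonneg _)), firstMoment]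
    norm_num
  rw [mul_pow, mul_pow, e1, e2, e3]
  have h3 : 1 ≤ Real.sqrt d := by
    rw [Real.one_le_sqrt]; exact_mod_cast hd
  have hM : 0 ≤ firstMoment F := zero_le_one.trans (one_le_firstMoment hF)
  have a1 : (d : ℝ) * ħ ≤ max (firstMoment F) d * max ħ τ :=
    mul_le_mul (le_max_right _ _) (le_max_left _ _) hħ.le (le_max_of_le_left hM)
  have a2 : firstMoment F * τ ≤ max (firstMoment F) d * max ħ τ :=
    mul_le_mul (le_max_left _ _) (le_max_right _ _) hτ (le_max_of_le_left hM)
  set X := max (firstMoment F) d * max ħ τ with hX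
  have hX0 : 0 ≤ X := le_trans (by positivity) a1
  calc 3 / 2 * (d : ℝ) * ħ + 2 * Real.sqrt d * τ * firstMoment F
      = 3 / 2 * (d * ħ) + 2 * Real.sqrt d * (firstMoment F * τ) := by ring
    _ ≤ 3 / 2 * X + 2 * Real.sqrt d * X := by gcongr
    -- As √d ≥ 1, the term 3/2 fits in the remaining 2√d; the 4 is the square of the factor 2 in
    -- D_III.
    _ ≤ 4 * Real.sqrt d * X := by nlinarith
    _ = _ := by rw [hX]; ring

end ToeplitzCase
end SemiWass
end

noncomputable section
namespace SemiWass

/-! ### Partial Fourier transform -/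

section PartialFourier
open scoped FourierTransform LineDeriv
variable {d : ℕ}

lemma hasTemperateGrowth_slice (x : Conf d) :
    Function.HasTemperateGrowth fun ξ : Conf d => ((x, ξ) : Phase d) := by
  have h := (Function.HasTemperateGrowth.const (E := Conf d) ((x, 0) : Phase d)).add
    (ContinuousLinearMap.inr ℝ (Conf d) (Conf d)).hasTemperateGrowth
  convert h using 2 with ξ
  simp

/-- The Schwartz function `ξ ↦ φ (x, ξ)`. -/
def sliceS (φ : 𝓢(Phase d, ℂ)) (x : Conf d) : 𝓢(Conf d, ℂ) :=
  SchwartzMap.compCLM ℂ (hasTemperateGrowth_slice x)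
    ⟨1, 1, fun ξ => by
      have : ‖ξ‖ ≤ ‖((x, ξ) : Phase d)‖ := le_max_right _ _
      rw [one_mul, pow_one]; linarith⟩ φ

@[simp] lemma sliceS_apply (φ : 𝓢(Phase d, ℂ)) (x ξ : Conf d) : sliceS φ x ξ = φ (x, ξ) := rfl

/-- The Fourier transform with respect to the second variable. -/
def pf (φ : 𝓢(Phase d, ℂ)) (q : Phase d) : ℂ :=
  ∫ ξ : Conf d, Complex.exp (-(Complex.I * (⟪ξ, q.2⟫_ℝ : ℂ))) * φ (q.1, ξ)

lemma pf_eq_fourier (φ : 𝓢(Phase d, ℂ)) (q : Phase d) :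
    pf φ q = 𝓕 (sliceS φ q.1) ((2 * Real.pi)⁻¹ • q.2) := by
  rw [SchwartzMap.fourier_coe, Real.fourier_eq', pf]
  refine integral_congr_ae (ae_of_all _ fun ξ => ?_)
  simp only [sliceS_apply, smul_eq_mul]
  congr 2
  rw [inner_smul_right]
  push_cast
  have : (Real.pi : ℂ) ≠ 0 := by exact_mod_cast Real.pi_ne_zero
  field_simp

lemma pf_add (φ ψ : 𝓢(Phase d, ℂ)) (q : Phase d) : pf (φ + ψ) q = pf φ q + pf ψ q := by
  simp only [pf_eq_fourier]
  have : sliceS (φ + ψ) q.1 = sliceS φ q.1 + sliceS ψ q.1 := by ext; rfl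
  rw [this, FourierTransform.fourier_add, add_apply]

lemma pf_smul (c : ℂ) (φ : 𝓢(Phase d, ℂ)) (q : Phase d) : pf (c • φ) q = c * pf φ q := by
  simp only [pf_eq_fourier]
  have : sliceS (c • φ) q.1 = c • sliceS φ q.1 := by ext; rfl
  rw [this, FourierTransform.fourier_smul, smul_apply, smul_eq_mul]

lemma pf_sum {ι : Type*} (s : Finset ι) (φ : ι → 𝓢(Phase d, ℂ)) (q : Phase d) :
    pf (∑ i ∈ s, φ i) q = ∑ i ∈ s, pf (φ i) q := by
  classical
  induction s using Finset.induction_on with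
  | empty =>
    have := pf_smul 0 (0 : 𝓢(Phase d, ℂ)) q
    simpa using this
  | insert i s hi ih => rw [Finset.sum_insert hi, Finset.sum_insert hi, pf_add, ih]

lemma hasTemperateGrowth_coord_fst (l : Fin d) :
    Function.HasTemperateGrowth fun z : Phase d => ((z.1 l : ℝ) : ℂ) :=
  (Complex.ofRealCLM.comp ((EuclideanSpace.proj (𝕜 := ℝ) l).comp
    (ContinuousLinearMap.fst ℝ (Conf d) (Conf d)))).hasTemperateGrowth

lemma pf_mul_fst (l : Fin d) (φ : 𝓢(Phase d, ℂ)) (q : Phase d) :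
    pf (SchwartzMap.smulLeftCLM ℂ (fun z : Phase d => ((z.1 l : ℝ) : ℂ)) φ) q =
      ((q.1 l : ℝ) : ℂ) * pf φ q := by
  rw [pf, pf, ← integral_const_mul]
  refine integral_congr_ae (ae_of_all _ fun ξ => ?_)
  simp only [SchwartzMap.smulLeftCLM_apply_apply (hasTemperateGrowth_coord_fst l), smul_eq_mul]
  ring

lemma pf_deriv_snd (l : Fin d) (φ : 𝓢(Phase d, ℂ)) (q : Phase d) :
    pf (∂_{((0, basisVec l) : Phase d)} φ) q = Complex.I * ((q.2 l : ℝ) : ℂ) * pf φ q := by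
  have h : sliceS (∂_{((0, basisVec l) : Phase d)} φ) q.1 = ∂_{basisVec l} (sliceS φ q.1) := by
    ext ξ
    rw [sliceS_apply, SchwartzMap.lineDerivOp_apply, SchwartzMap.lineDerivOp_apply]
    simp [lineDeriv]
  rw [pf_eq_fourier, pf_eq_fourier, h, SchwartzMap.fourier_lineDerivOp_eq, smul_apply,
    SchwartzMap.smulLeftCLM_apply_apply (by fun_prop)]
  simp only [smul_eq_mul, Complex.real_smul, basisVec, EuclideanSpace.inner_single_right]
  simp
  have : (Real.pi : ℂ) ≠ 0 := by exact_mod_cast Real.pi_ne_zero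
  field_simp

/-- The majorant does not depend on x, which is what differentiation under the integral in x
requires. -/
lemma exists_integrable_bound (φ : 𝓢(Phase d, ℂ)) :
    ∃ b : Conf d → ℝ, Integrable b ∧ ∀ x ξ, ‖φ (x, ξ)‖ ≤ b ξ := by
  obtain ⟨N, hN⟩ : ∃ N : ℕ, N = d + 1 := ⟨_, rfl⟩
  set C := 2 ^ N * ((Finset.Iic ((N, 0) : ℕ × ℕ)).sup fun m => SchwartzMap.seminorm ℝ m.1 m.2) φ with hC
  refine ⟨fun ξ => C * (1 + ‖ξ‖) ^ (-(N : ℝ)), (integrable_one_add_norm ?_).const_mul C, fun x ξ => ?_⟩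
  · rw [finrank_euclideanSpace, Fintype.card_fin, hN]; push_cast; linarith
  have h := SchwartzMap.one_add_le_sup_seminorm_apply (𝕜 := ℝ) (m := (N, 0)) (k := N) (n := 0)
    le_rfl le_rfl φ (x, ξ)
  rw [norm_iteratedFDeriv_zero] at h
  have h2 : (1 + ‖ξ‖) ^ N ≤ (1 + ‖((x, ξ) : Phase d)‖) ^ N := by
    have : ‖ξ‖ ≤ ‖((x, ξ) : Phase d)‖ := le_max_right _ _
    gcongr
  beta_reduce
  rw [Real.rpow_neg (by positivity), Real.rpow_natCast, ← div_eq_mul_inv, le_div_iff₀ (by positivity),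
    mul_comm]
  exact (mul_le_mul_of_nonneg_right h2 (norm_nonneg _)).trans h

lemma hasDerivAt_pf (l : Fin d) (φ : 𝓢(Phase d, ℂ)) (q : Phase d) :
    HasDerivAt (fun t : ℝ => pf φ (q.1 + t • basisVec l, q.2))
      (pf (∂_{((basisVec l, 0) : Phase d)} φ) q) 0 := by
  obtain ⟨b, hb, hbd⟩ := exists_integrable_bound (∂_{((basisVec l, 0) : Phase d)} φ)
  have hn : ∀ ξ : Conf d, ‖Complex.exp (-(Complex.I * (⟪ξ, q.2⟫_ℝ : ℂ)))‖ = 1 := by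
    intro ξ
    rw [show -(Complex.I * (⟪ξ, q.2⟫_ℝ : ℂ)) = ((-⟪ξ, q.2⟫_ℝ : ℝ) : ℂ) * Complex.I by push_cast; ring,
      Complex.norm_exp_ofReal_mul_I]
  have hcont : ∀ (ψ : 𝓢(Phase d, ℂ)) (x : Conf d),
      Continuous fun ξ : Conf d => Complex.exp (-(Complex.I * (⟪ξ, q.2⟫_ℝ : ℂ))) * ψ (x, ξ) := by
    intro ψ x
    have := ψ.continuous
    fun_prop
  have hint : ∀ (ψ : 𝓢(Phase d, ℂ)) (x : Conf d),
      Integrable fun ξ : Conf d => Complex.exp (-(Complex.I * (⟪ξ, q.2⟫_ℝ : ℂ))) * ψ (x, ξ) := by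
    intro ψ x
    obtain ⟨b, hb, hbd⟩ := exists_integrable_bound ψ
    refine hb.mono' (hcont ψ x).aestronglyMeasurable (ae_of_all _ fun ξ => ?_)
    rw [norm_mul, hn, one_mul]; exact hbd x ξ
  have h := hasDerivAt_integral_of_dominated_loc_of_deriv_le (μ := (volume : Measure (Conf d)))
    (bound := b) (x₀ := (0 : ℝ)) (s := Set.univ)
    (F := fun t ξ => Complex.exp (-(Complex.I * (⟪ξ, q.2⟫_ℝ : ℂ))) * φ (q.1 + t • basisVec l, ξ))
    (F' := fun t ξ => Complex.exp (-(Complex.I * (⟪ξ, q.2⟫_ℝ : ℂ))) *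
      (∂_{((basisVec l, 0) : Phase d)} φ) (q.1 + t • basisVec l, ξ))
    univ_mem (Eventually.of_forall fun t => (hcont φ _).aestronglyMeasurable) (hint φ _)
    (hcont _ _).aestronglyMeasurable
    (ae_of_all _ fun ξ t _ => by rw [norm_mul, hn, one_mul]; exact hbd _ ξ) hb
    (ae_of_all _ fun ξ t _ => by
      refine HasDerivAt.const_mul _ ?_
      rw [SchwartzMap.lineDerivOp_apply_eq_fderiv]
      have h1 : HasDerivAt (fun t : ℝ => ((q.1 + t • basisVec l, ξ) : Phase d)) (basisVec l, 0) t := by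
        refine HasDerivAt.prodMk ?_ (hasDerivAt_const _ _)
        simpa using ((hasDerivAt_id t).smul_const (basisVec l)).const_add q.1
      exact (φ.hasFDerivAt (q.1 + t • basisVec l, ξ)).comp_hasDerivAt t h1)
  have h2 := h.2
  simp only [zero_smul, add_zero] at h2
  exact h2

/-- Plancherel on each slice x = const; the factor (2π)^d comes from the convention e^{-iξ·y}. -/
lemma lintegral_enorm_pf (φ : 𝓢(Phase d, ℂ)) :
    ∫⁻ q, ‖pf φ q‖ₑ ^ 2 = ENNReal.ofReal ((2 * Real.pi) ^ d) * ∫⁻ z, ‖φ z‖ₑ ^ 2 := by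
  have hslice : ∀ x : Conf d, ∫⁻ y, ‖pf φ (x, y)‖ₑ ^ 2 =
      ENNReal.ofReal ((2 * Real.pi) ^ d) * ∫⁻ ξ, ‖φ (x, ξ)‖ₑ ^ 2 := by
    intro x
    simp only [pf_eq_fourier]
    rw [lintegral_comp_smul_conf (fun η => ‖𝓕 (sliceS φ x) η‖ₑ ^ 2)
      ((𝓕 (sliceS φ x)).continuous.enorm.measurable.pow_const 2) _ (by positivity),
      lintegral_enorm_sq_schwartz]
    have : ∫⁻ ξ, ‖φ (x, ξ)‖ₑ ^ 2 = ‖sL2 (sliceS φ x)‖ₑ ^ 2 := by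
      rw [← lintegral_enorm_sq_schwartz]; rfl
    rw [this]
    congr 2
    rw [← ofReal_norm, ← ofReal_norm]
    congr 1
    exact SchwartzMap.norm_fourier_toL2_eq (sliceS φ x)
  have hm2 : Measurable fun z : Phase d => ‖φ z‖ₑ ^ 2 := φ.continuous.enorm.measurable.pow_const 2
  have hpm : StronglyMeasurable (pf φ) := by
    have hc : Continuous fun p : Phase d × Conf d =>
        Complex.exp (-(Complex.I * (⟪p.2, p.1.2⟫_ℝ : ℂ))) * φ (p.1.1, p.2) := by
      have := φ.continuous
      fun_prop
    exact hc.stronglyMeasurable.integral_prod_right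
  have hm1 : Measurable fun q : Phase d => ‖pf φ q‖ₑ ^ 2 := hpm.measurable.enorm.pow_const 2
  rw [Measure.volume_eq_prod, lintegral_prod _ hm1.aemeasurable, lintegral_prod _ hm2.aemeasurable]
  simp_rw [hslice]
  rw [lintegral_const_mul' _ _ ENNReal.ofReal_ne_top]

end PartialFourier

/-! ### Cross-Wigner functions -/

section CrossWigner
open scoped LineDeriv
variable {d : ℕ}

/-- `φ` is, up to normalization, the cross-Wigner function of `f` and `g`. -/
def IsCross (ħ : ℝ) (f g : 𝓢(Conf d, ℂ)) (φ : 𝓢(Phase d, ℂ)) : Prop :=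
  ∀ q : Phase d, pf φ q = f (q.1 + (ħ / 2) • q.2) * g (q.1 - (ħ / 2) • q.2)

/-- Changing the sign of ħ exchanges the two factors, so closure properties proved for the left
factor serve for both. -/
lemma IsCross.symm {ħ : ℝ} {f g : 𝓢(Conf d, ℂ)} {φ : 𝓢(Phase d, ℂ)} (h : IsCross ħ f g φ) :
    IsCross (-ħ) g f φ := by
  intro q
  rw [h q, mul_comm, neg_div, neg_smul, sub_neg_eq_add, ← sub_eq_add_neg]

lemma IsCross.add_left {ħ : ℝ} {f f' g : 𝓢(Conf d, ℂ)} {φ φ' : 𝓢(Phase d, ℂ)}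
    (h : IsCross ħ f g φ) (h' : IsCross ħ f' g φ') : IsCross ħ (f + f') g (φ + φ') := by
  intro q
  rw [pf_add, h q, h' q, add_apply, add_mul]

lemma IsCross.smul_left {ħ : ℝ} {f g : 𝓢(Conf d, ℂ)} {φ : 𝓢(Phase d, ℂ)} (c : ℂ)
    (h : IsCross ħ f g φ) : IsCross ħ (c • f) g (c • φ) := by
  intro q
  rw [pf_smul, h q, smul_apply, smul_eq_mul, mul_assoc]

/-- The left argument is q₁ + ħq₂/2: multiplication by q₁ is multiplication by x on phase space, and
multiplication by q₂ is -i∂_ξ. -/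
lemma IsCross.mul_left {ħ : ℝ} {f g : 𝓢(Conf d, ℂ)} {φ : 𝓢(Phase d, ℂ)} (l : Fin d)
    (h : IsCross ħ f g φ) : IsCross ħ (mulS l f) g
      (SchwartzMap.smulLeftCLM ℂ (fun z : Phase d => ((z.1 l : ℝ) : ℂ)) φ +
        (-(Complex.I * (ħ / 2 : ℂ))) • ∂_{((0, basisVec l) : Phase d)} φ) := by
  intro q
  rw [pf_add, pf_smul, pf_mul_fst, pf_deriv_snd, h q, mulS_apply]
  have : (((q.1 + (ħ / 2) • q.2) l : ℝ) : ℂ) = (q.1 l : ℂ) + ħ / 2 * (q.2 l : ℂ) := by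
    simp
  rw [this]
  linear_combination (-(ħ / 2 * (q.2 l : ℂ)) * (f (q.1 + (ħ / 2) • q.2) * g (q.1 - (ħ / 2) • q.2))) * Complex.I_sq

/-- By the three-term recursion, H_m is a combination of y_l H_{m-e_l} and H_{m-2e_l}, so
multiplications by coordinates generate all Hermite functions from H_0. -/
lemma hermS_induction (ħ : ℝ) (hħ : 0 < ħ) (P : 𝓢(Conf d, ℂ) → Prop) (h0 : P (hermS ħ hħ 0))
    (hadd : ∀ f g, P f → P g → P (f + g)) (hsmul : ∀ (c : ℂ) f, P f → P (c • f))
    (hmul : ∀ l f, P f → P (mulS l f)) (m : Fin d → ℕ) : P (hermS ħ hħ m) := by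
  obtain ⟨N, hN⟩ : ∃ N, N = ∑ l, m l := ⟨_, rfl⟩
  induction N using Nat.strong_induction_on generalizing m with
  | _ N ih =>
  by_cases hm : m = 0
  · rwa [hm]
  obtain ⟨l, hl⟩ : ∃ l, m l ≠ 0 := by
    by_contra! h
    exact hm (funext h)
  have h1 := mulS_hermS ħ hħ (dn m l) l
  rw [up_dn m l hl] at h1
  have hlt := sum_dn m l hl
  -- If the index is already 0, the truncated second lowering does nothing, and a weak inequality is
  -- enough for the induction.
  have hle : ∑ i, dn (dn m l) l i ≤ ∑ i, dn m l i := by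
    by_cases h : dn m l l = 0
    · rw [show dn (dn m l) l = dn m l by
        conv_lhs => rw [dn]
        rw [h]
        exact Function.update_eq_self_iff.2 h.symm]
    · exact (sum_dn _ l h).le
  set c : ℂ := ((Real.sqrt (ħ / 2) * Real.sqrt ((dn m l l : ℕ) + 1) : ℝ) : ℂ) with hc
  have hc0 : c ≠ 0 := by
    rw [hc]
    have : 0 < Real.sqrt (ħ / 2) * Real.sqrt ((dn m l l : ℕ) + 1) := by positivity
    exact_mod_cast this.ne'
  have h2 : hermS ħ hħ m = c⁻¹ • (mulS l (hermS ħ hħ (dn m l)) + (-((Real.sqrt (ħ / 2) * Real.sqrt (dn m l l) : ℝ) : ℂ)) •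
      hermS ħ hħ (dn (dn m l) l)) := by
    rw [h1, neg_smul, add_neg_cancel_comm, smul_smul, inv_mul_cancel₀ hc0, one_smul]
  rw [h2]
  exact hsmul _ _ (hadd _ _ (hmul _ _ (ih _ (hN ▸ hlt) _ rfl))
    (hsmul _ _ (ih _ (hN ▸ (hle.trans_lt hlt)) _ rfl)))

lemma isCross_zero (ħ : ℝ) (hħ : 0 < ħ) :
    ∃ φ : 𝓢(Phase d, ℂ), IsCross ħ (hermS ħ hħ 0) (hermS ħ hħ 0) φ := by
  have ha : 0 < 1 / ħ := by positivity
  refine ⟨((((Real.pi * ħ) ^ d)⁻¹ : ℝ) : ℂ) • tensS (gaussS (1 / ħ) ha) (gaussS (1 / ħ) ha), fun q => ?_⟩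
  have h1 := conj_cohS_mul_cohS ħ hħ (0 : Phase d) q
  have h2 : ∀ y, cohS ħ hħ (0 : Phase d) y = hermS ħ hħ 0 y := by
    intro y
    rw [cohS, wp_apply]
    simp
  have h3 : ∀ y : Conf d, (starRingEnd ℂ) (hermS ħ hħ 0 y) = hermS ħ hħ 0 y := by
    intro y
    rw [hermS_zero_apply, Complex.conj_ofReal]
  rw [h2, h2, h3] at h1
  rw [h1, pf_smul]
  have e : pf (tensS (gaussS (1 / ħ) ha) (gaussS (1 / ħ) ha)) q = gaussS (1 / ħ) ha q.1 *
      ∫ ξ : Conf d, Complex.exp (-(Complex.I * (⟪ξ, q.2⟫_ℝ : ℂ))) *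
          ((Real.exp (-(1 / ħ) * ‖ξ - 0‖ ^ 2) : ℝ) : ℂ) := by
    rw [pf, ← integral_const_mul]
    congr 1; ext ξ
    rw [tensS_apply, gaussS_apply, gaussS_apply, sub_zero]; ring
  rw [e, integral_gauss_phase ħ hħ, gaussS_apply]
  have hp : (Real.pi * ħ) ^ ((d : ℝ) / 2) = (Real.pi * ħ) ^ d * (Real.pi * ħ) ^ (-(d : ℝ) / 2) := by
    rw [← Real.rpow_natCast, ← Real.rpow_add (by positivity)]; congr 1; ring
  have hne : (((Real.pi * ħ) ^ d : ℝ) : ℂ) ≠ 0 := by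
    have : 0 < (Real.pi * ħ) ^ d := by positivity
    exact_mod_cast this.ne'
  rw [hp, Complex.ofReal_mul, Complex.ofReal_inv, Prod.fst_zero, Prod.snd_zero, sub_zero]
  field_simp

/-- Two inductions from the Gaussian case, one per factor, with the sign of ħ reversed in between.
They build the Schwartz function directly, so no inversion of the partial Fourier transform is
required. -/
lemma exists_isCross (ħ : ℝ) (hħ : 0 < ħ) (m n : Fin d → ℕ) :
    ∃ φ : 𝓢(Phase d, ℂ), IsCross ħ (hermS ħ hħ m) (hermS ħ hħ n) φ := by
  have h1 : ∃ φ : 𝓢(Phase d, ℂ), IsCross ħ (hermS ħ hħ m) (hermS ħ hħ 0) φ :=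
    hermS_induction ħ hħ (fun f => ∃ φ : 𝓢(Phase d, ℂ), IsCross ħ f (hermS ħ hħ 0) φ)
      (isCross_zero ħ hħ) (fun f g ⟨φ, h⟩ ⟨ψ, h'⟩ => ⟨_, h.add_left h'⟩)
      (fun c f ⟨φ, h⟩ => ⟨_, h.smul_left c⟩) (fun l f ⟨φ, h⟩ => ⟨_, h.mul_left l⟩) m
  obtain ⟨φ, h2⟩ := hermS_induction ħ hħ (fun f => ∃ φ : 𝓢(Phase d, ℂ), IsCross (-ħ) f (hermS ħ hħ m) φ)
      (h1.imp fun φ h => h.symm) (fun f g ⟨φ, h⟩ ⟨ψ, h'⟩ => ⟨_, h.add_left h'⟩)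
      (fun c f ⟨φ, h⟩ => ⟨_, h.smul_left c⟩) (fun l f ⟨φ, h⟩ => ⟨_, h.mul_left l⟩) n
  exact ⟨φ, by simpa using h2.symm⟩

end CrossWigner
end SemiWass
end

noncomputable section
namespace SemiWass

/-! ### Commutators in terms of Wigner functions -/

section WignerComm
open scoped LineDeriv
variable {d : ℕ}

/-- The pairing of an operator with a kernel equals, up to (2πħ)^d, the phase-space pairing of their
Wigner functions; ħ^d is the Jacobian and (2π)^d the Fourier normalization. -/
lemma integral_kernel_eq (ħ : ℝ) (hħ : 0 < ħ) (r : Conf d × Conf d → ℂ) (a : Phase d → ℂ)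
    (h : ∀ φ : 𝓢(Phase d, ℂ), ∫ z, a z * φ z = (((2 * Real.pi) ^ d)⁻¹ : ℂ) *
      ∫ q : Conf d × Conf d, r (q.1 + (ħ / 2) • q.2, q.1 - (ħ / 2) • q.2) *
        ∫ ξ : Conf d, Complex.exp (-(Complex.I * (⟪ξ, q.2⟫_ℝ : ℂ))) * φ (q.1, ξ))
    (χ : 𝓢(Phase d, ℂ)) (θ : Conf d × Conf d → ℂ)
    (hχ : ∀ q : Phase d, pf χ q = θ (q.1 + (ħ / 2) • q.2, q.1 - (ħ / 2) • q.2)) :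
    ∫ p, r p * θ p = (((2 * Real.pi * ħ) ^ d : ℝ) : ℂ) * ∫ z, a z * χ z := by
  have h1 := h χ
  have h2 := integral_wigner_change ħ hħ fun p => r p * θ p
  have e : ∀ q : Conf d × Conf d, r (q.1 + (ħ / 2) • q.2, q.1 - (ħ / 2) • q.2) *
        ∫ ξ : Conf d, Complex.exp (-(Complex.I * (⟪ξ, q.2⟫_ℝ : ℂ))) * χ (q.1, ξ) =
      r (q.1 + (ħ / 2) • q.2, q.1 - (ħ / 2) • q.2) *
        θ (q.1 + (ħ / 2) • q.2, q.1 - (ħ / 2) • q.2) := fun q => by rw [← hχ]; rfl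
  simp_rw [e] at h1
  rw [h1, h2]
  have hp : (Real.pi : ℂ) ≠ 0 := by exact_mod_cast Real.pi_ne_zero
  have hh : (ħ : ℂ) ≠ 0 := by exact_mod_cast hħ.ne'
  push_cast
  rw [mul_pow]
  field_simp

lemma conj_hermS (ħ : ℝ) (hħ : 0 < ħ) (m : Fin d → ℕ) : conjS (hermS ħ hħ m) = hermS ħ hħ m := by
  ext y
  rw [conjS_apply, hermS_coe, hermiteFun, Complex.conj_ofReal]

lemma inner_kernel_sub (T : Op d) (r : Conf d × Conf d → ℂ) (hr : IsKernel T r)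
    (f g f' g' : 𝓢(Conf d, ℂ)) (hf : conjS f = f) (hf' : conjS f' = f') :
    ⟪sL2 f, T (sL2 g)⟫_ℂ - ⟪sL2 f', T (sL2 g')⟫_ℂ =
      ∫ p : Conf d × Conf d, r p * (f p.1 * g p.2 - f' p.1 * g' p.2) := by
  have h1 : ∀ f g : 𝓢(Conf d, ℂ), Integrable (fun p : Conf d × Conf d => r p * (f p.1 * g p.2)) :=
    fun f g => hr.1.integrable_mul (memLp_tensor f g)
  rw [inner_kernel T r hr, inner_kernel T r hr]
  have e : ∀ {f : 𝓢(Conf d, ℂ)}, conjS f = f → ∀ y, (starRingEnd ℂ) (f y) = f y :=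
    fun {f} h y => DFunLike.congr_fun h y
  simp_rw [e hf, e hf']
  rw [← integral_sub (h1 f g) (h1 f' g')]
  simp_rw [mul_sub]

lemma conjS_mulS {f : 𝓢(Conf d, ℂ)} (hf : conjS f = f) (j : Fin d) : conjS (mulS j f) = mulS j f := by
  ext y
  have := DFunLike.congr_fun hf y
  rw [conjS_apply] at this
  rw [conjS_apply, mulS_apply, map_mul, this, Complex.conj_ofReal]

lemma conjS_smul_gradS {f : 𝓢(Conf d, ℂ)} (hf : conjS f = f) (c : ℝ) (j : Fin d) :
    conjS ((c : ℂ) • gradS j f) = (c : ℂ) • gradS j f := by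
  ext y
  have := lineDerivOp_conjS f (basisVec j) y
  rw [hf] at this
  rw [conjS_apply, smul_apply, smul_eq_mul, map_mul, Complex.conj_ofReal]
  congr 1
  exact this.symm

/-- Commuting with y_j multiplies the kernel by the difference of its arguments, ħq₂ in the new
variables, which is -iħ∂_ξ on phase space. The derivative stays on the cross-Wigner function, as a
is only known to be in L² here. -/
lemma comm_pos_eq (ħ : ℝ) (hħ : 0 < ħ) (T : Op d) (a : Phase d → ℂ) (ha : IsWigner ħ T a)
    (m n : Fin d → ℕ) (φ : 𝓢(Phase d, ℂ)) (hφ : IsCross ħ (hermS ħ hħ m) (hermS ħ hħ n) φ) (j : Fin d) :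
    hermiteCommElt ħ (Obs.pos j) T m n = (((2 * Real.pi * ħ) ^ d : ℝ) : ℂ) * (-(Complex.I * ħ)) *
      ∫ z, a z * ∂_{((0, basisVec j) : Phase d)} φ z := by
  obtain ⟨-, r, hr, h⟩ := ha
  rw [hermiteCommElt_eq ħ hħ]
  change ⟪sL2 (mulS j _), _⟫_ℂ - ⟪_, T (sL2 (mulS j _))⟫_ℂ = _
  rw [inner_kernel_sub T r hr _ _ _ _ (conjS_mulS (conj_hermS ħ hħ m) j) (conj_hermS ħ hħ m),
    integral_kernel_eq ħ hħ r a h ((-(Complex.I * ħ)) • ∂_{((0, basisVec j) : Phase d)} φ)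
      (fun p => mulS j (hermS ħ hħ m) p.1 * hermS ħ hħ n p.2 - hermS ħ hħ m p.1 * mulS j (hermS ħ hħ n) p.2)]
  · rw [mul_assoc (_ : ℂ), ← integral_const_mul (-(Complex.I * ħ))]
    congr 2; ext z
    rw [smul_apply, smul_eq_mul]; ring
  · intro q
    rw [pf_smul, pf_deriv_snd, hφ q, mulS_apply, mulS_apply]
    have e1 : (((q.1 + (ħ / 2) • q.2) j : ℝ) : ℂ) = (q.1 j : ℂ) + ħ / 2 * (q.2 j : ℂ) := by simp
    have e2 : (((q.1 - (ħ / 2) • q.2) j : ℝ) : ℂ) = (q.1 j : ℂ) - ħ / 2 * (q.2 j : ℂ) := by simp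
    rw [e1, e2]
    linear_combination (-(ħ * (q.2 j : ℂ)) * (hermS ħ hħ m (q.1 + (ħ / 2) • q.2) *
      hermS ħ hħ n (q.1 - (ħ / 2) • q.2))) * Complex.I_sq

lemma hasDerivAt_schwartz_line (f : 𝓢(Conf d, ℂ)) (y : Conf d) (j : Fin d) :
    HasDerivAt (fun t : ℝ => f (y + t • basisVec j)) (gradS j f y) 0 := by
  rw [gradS_apply]
  have h := (f.differentiableAt (x := y)).lineDifferentiableAt (v := basisVec j)
  exact h.hasLineDerivAt

/-- Integrating by parts in one slot, the commutator differentiates both slots with the same sign;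
this is the derivative in the centre variable. -/
lemma comm_gradMinus_eq (ħ : ℝ) (hħ : 0 < ħ) (T : Op d) (a : Phase d → ℂ) (ha : IsWigner ħ T a)
    (m n : Fin d → ℕ) (φ : 𝓢(Phase d, ℂ)) (hφ : IsCross ħ (hermS ħ hħ m) (hermS ħ hħ n) φ) (j : Fin d) :
    hermiteCommElt ħ (Obs.gradMinus j) T m n = (((2 * Real.pi * ħ) ^ d : ℝ) : ℂ) * ħ *
      ∫ z, a z * ∂_{((basisVec j, 0) : Phase d)} φ z := by
  obtain ⟨-, r, hr, h⟩ := ha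
  rw [hermiteCommElt_eq ħ hħ]
  change ⟪sL2 ((ħ : ℂ) • gradS j _), _⟫_ℂ - ⟪_, T (sL2 (-((ħ : ℂ) • gradS j _)))⟫_ℂ = _
  rw [inner_kernel_sub T r hr _ _ _ _ (conjS_smul_gradS (conj_hermS ħ hħ m) ħ j) (conj_hermS ħ hħ m),
    integral_kernel_eq ħ hħ r a h ((ħ : ℂ) • ∂_{((basisVec j, 0) : Phase d)} φ)
      (fun p => ((ħ : ℂ) • gradS j (hermS ħ hħ m)) p.1 * hermS ħ hħ n p.2 -
        hermS ħ hħ m p.1 * (-((ħ : ℂ) • gradS j (hermS ħ hħ n))) p.2)]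
  · rw [mul_assoc (_ : ℂ), ← integral_const_mul (ħ : ℂ)]
    congr 2; ext z
    rw [smul_apply, smul_eq_mul]; ring
  · intro q
    have h1 := hasDerivAt_pf j φ q
    have h2 := (hasDerivAt_schwartz_line (hermS ħ hħ m) (q.1 + (ħ / 2) • q.2) j).mul
      (hasDerivAt_schwartz_line (hermS ħ hħ n) (q.1 - (ħ / 2) • q.2) j)
    have e : (fun t : ℝ => pf φ (q.1 + t • basisVec j, q.2)) =
        (fun t : ℝ => hermS ħ hħ m (q.1 + (ħ / 2) • q.2 + t • basisVec j)) *
          fun t : ℝ => hermS ħ hħ n (q.1 - (ħ / 2) • q.2 + t • basisVec j) := by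
      ext t
      rw [hφ, Pi.mul_apply, add_right_comm, add_sub_right_comm]
    rw [e] at h1
    rw [pf_smul, h1.unique h2]
    simp only [smul_apply, neg_apply, smul_eq_mul, zero_smul, add_zero]
    ring

lemma lintegral_sum_hermS (ħ : ℝ) (hħ : 0 < ħ) (s : Finset (Fin d → ℕ)) (c : (Fin d → ℕ) → ℂ) :
    ∫⁻ y, ‖∑ m ∈ s, c m * hermS ħ hħ m y‖ₑ ^ 2 = ∑ m ∈ s, ‖c m‖ₑ ^ 2 := by
  have h1 := lintegral_enorm_sq_schwartz (∑ m ∈ s, c m • hermS ħ hħ m)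
  simp only [sum_apply, smul_apply, smul_eq_mul, map_sum, map_smul] at h1
  rw [h1, enorm_sq_eq_ofReal]
  have h2 := (orthonormal_hermS (d := d) ħ hħ).inner_sum c c s
  have h3 : ‖∑ m ∈ s, c m • sL2 (hermS ħ hħ m)‖ ^ 2 = ∑ m ∈ s, ‖c m‖ ^ 2 := by
    have h4 := inner_self_eq_norm_sq_to_K (𝕜 := ℂ) (∑ m ∈ s, c m • sL2 (hermS ħ hħ m))
    rw [h2] at h4
    have h5 : ∀ m, (starRingEnd ℂ) (c m) * c m = ((‖c m‖ ^ 2 : ℝ) : ℂ) := by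
      intro m; rw [Complex.conj_mul']; push_cast; rfl
    simp_rw [h5] at h4
    rw [← Complex.ofReal_sum] at h4
    have h6 : ((∑ m ∈ s, ‖c m‖ ^ 2 : ℝ) : ℂ) = ((‖∑ m ∈ s, c m • sL2 (hermS ħ hħ m)‖ ^ 2 : ℝ) : ℂ) := by
      rw [h4]; push_cast; rfl
    exact (Complex.ofReal_injective h6).symm
  rw [h3, ENNReal.ofReal_sum_of_nonneg fun _ _ => by positivity]
  exact Finset.sum_congr rfl fun m _ => (enorm_sq_eq_ofReal _).symm

lemma lintegral_sum_tensor_hermS (ħ : ℝ) (hħ : 0 < ħ) (s : Finset (Fin d → ℕ))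
    (c : (Fin d → ℕ) → (Fin d → ℕ) → ℂ) :
    ∫⁻ p : Conf d × Conf d, ‖∑ m ∈ s, ∑ n ∈ s, c m n * (hermS ħ hħ m p.1 * hermS ħ hħ n p.2)‖ₑ ^ 2 =
      ∑ m ∈ s, ∑ n ∈ s, ‖c m n‖ₑ ^ 2 := by
  have hc : Continuous fun p : Conf d × Conf d =>
      ∑ m ∈ s, ∑ n ∈ s, c m n * (hermS ħ hħ m p.1 * hermS ħ hħ n p.2) := by
    have := fun m => (hermS (d := d) ħ hħ m).continuous
    fun_prop
  have hm : Measurable fun p : Conf d × Conf d =>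
      ‖∑ m ∈ s, ∑ n ∈ s, c m n * (hermS ħ hħ m p.1 * hermS ħ hħ n p.2)‖ₑ ^ 2 :=
    hc.enorm.measurable.pow_const 2
  rw [Measure.volume_eq_prod, lintegral_prod _ hm.aemeasurable]
  have e : ∀ x y : Conf d, ∑ m ∈ s, ∑ n ∈ s, c m n * (hermS ħ hħ m x * hermS ħ hħ n y) =
      ∑ n ∈ s, (∑ m ∈ s, c m n * hermS ħ hħ m x) * hermS ħ hħ n y := by
    intro x y
    rw [Finset.sum_comm]
    refine Finset.sum_congr rfl fun n _ => ?_
    rw [Finset.sum_mul]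
    exact Finset.sum_congr rfl fun m _ => by ring
  simp_rw [e, lintegral_sum_hermS]
  rw [lintegral_finsetSum _ fun n _ => ?_, Finset.sum_comm]
  · exact Finset.sum_congr rfl fun n _ => lintegral_sum_hermS ħ hħ s fun m => c m n
  · have hc2 : Continuous fun x : Conf d => ∑ m ∈ s, c m n * hermS ħ hħ m x := by
      have := fun m => (hermS (d := d) ħ hħ m).continuous
      fun_prop
    exact hc2.enorm.measurable.pow_const 2

lemma lintegral_wigner_change (ħ : ℝ) (hħ : 0 < ħ) (F : Conf d × Conf d → ℝ≥0∞) :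
    ∫⁻ q : Conf d × Conf d, F (q.1 + (ħ / 2) • q.2, q.1 - (ħ / 2) • q.2) =
      ENNReal.ofReal ((ħ ^ d)⁻¹) * ∫⁻ p, F p := by
  have h := (wignerEquiv (d := d) ħ hħ).measurableEmbedding.lintegral_map (μ := volume) F
  rw [map_wignerEquiv, lintegral_smul_measure, smul_eq_mul] at h
  exact h.symm

/-- The cross-Wigner functions are orthogonal with squared norm (2πħ)^{-d}: Plancherel for `pf` and
the change of variables reduce this to the tensor products of Hermite functions. -/
lemma lintegral_sum_cross (ħ : ℝ) (hħ : 0 < ħ) (φ : (Fin d → ℕ) → (Fin d → ℕ) → 𝓢(Phase d, ℂ))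
    (hφ : ∀ m n, IsCross ħ (hermS ħ hħ m) (hermS ħ hħ n) (φ m n)) (s : Finset (Fin d → ℕ))
    (c : (Fin d → ℕ) → (Fin d → ℕ) → ℂ) :
    ENNReal.ofReal ((2 * Real.pi * ħ) ^ d) * ∫⁻ z, ‖(∑ m ∈ s, ∑ n ∈ s, c m n • φ m n) z‖ₑ ^ 2 =
      ∑ m ∈ s, ∑ n ∈ s, ‖c m n‖ₑ ^ 2 := by
  have h1 := lintegral_enorm_pf (∑ m ∈ s, ∑ n ∈ s, c m n • φ m n)
  simp only [pf_sum, pf_smul, hφ _ _ _] at h1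
  rw [lintegral_wigner_change ħ hħ fun p =>
    ‖∑ m ∈ s, ∑ n ∈ s, c m n * (hermS ħ hħ m p.1 * hermS ħ hħ n p.2)‖ₑ ^ 2,
    lintegral_sum_tensor_hermS] at h1
  rw [mul_pow, mul_comm ((2 * Real.pi) ^ d), ENNReal.ofReal_mul (by positivity), mul_assoc, ← h1,
    ← mul_assoc, ← ENNReal.ofReal_mul (by positivity), mul_inv_cancel₀ (by positivity),
    ENNReal.ofReal_one, one_mul]

lemma enorm_integral_mul_sq_le {α : Type*} [MeasurableSpace α] {μ : Measure α} {f g : α → ℂ}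
    (hf : AEStronglyMeasurable f μ) (hg : AEStronglyMeasurable g μ) :
    ‖∫ z, f z * g z ∂μ‖ₑ ^ 2 ≤ (∫⁻ z, ‖f z‖ₑ ^ 2 ∂μ) * ∫⁻ z, ‖g z‖ₑ ^ 2 ∂μ := by
  have h1 : ‖∫ z, f z * g z ∂μ‖ₑ ≤ ∫⁻ z, ‖f z‖ₑ * ‖g z‖ₑ ∂μ := by
    refine (enorm_integral_le_lintegral_enorm _).trans (le_of_eq ?_)
    simp_rw [enorm_mul]
  have h2 := ENNReal.lintegral_mul_le_Lp_mul_Lq μ Real.HolderConjugate.two_two hf.enorm hg.enorm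
  have h3 := pow_le_pow_left₀ (zero_le) (h1.trans h2) 2
  refine h3.trans (le_of_eq ?_)
  rw [mul_pow, ← ENNReal.rpow_natCast, ← ENNReal.rpow_natCast, ← ENNReal.rpow_mul, ← ENNReal.rpow_mul]
  norm_num

/-- Bessel's inequality for the cross-Wigner functions of the Hermite functions. -/
lemma tsum_cross_le (ħ : ℝ) (hħ : 0 < ħ) (φ : (Fin d → ℕ) → (Fin d → ℕ) → 𝓢(Phase d, ℂ))
    (hφ : ∀ m n, IsCross ħ (hermS ħ hħ m) (hermS ħ hħ n) (φ m n)) (g : Phase d → ℂ)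
    (hg : AEStronglyMeasurable g) (hi : ∀ m n, Integrable fun z => g z * φ m n z) :
    ∑' m, ∑' n, ‖∫ z, g z * φ m n z‖ₑ ^ 2 ≤
      ENNReal.ofReal (((2 * Real.pi * ħ) ^ d)⁻¹) * ∫⁻ z, ‖g z‖ₑ ^ 2 := by
  classical
  have key : ∀ s : Finset (Fin d → ℕ), ∑ m ∈ s, ∑ n ∈ s, ‖∫ z, g z * φ m n z‖ₑ ^ 2 ≤
      ENNReal.ofReal (((2 * Real.pi * ħ) ^ d)⁻¹) * ∫⁻ z, ‖g z‖ₑ ^ 2 := by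
    intro s
    set k : (Fin d → ℕ) → (Fin d → ℕ) → ℂ := fun m n => ∫ z, g z * φ m n z with hk
    set X := ∑ m ∈ s, ∑ n ∈ s, ‖k m n‖ₑ ^ 2 with hX
    -- Pairing g with this combination returns the sum X of squares, while ‖ψ‖² is (2πħ)^{-d} X.
    -- Cauchy–Schwarz gives X² ≤ ‖g‖²‖ψ‖², and X cancels.
    set ψ := ∑ m ∈ s, ∑ n ∈ s, (starRingEnd ℂ) (k m n) • φ m n with hψ
    have h1 := lintegral_sum_cross ħ hħ φ hφ s fun m n => (starRingEnd ℂ) (k m n)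
    simp only [RCLike.enorm_conj] at h1
    have h2 : ‖∫ z, g z * ψ z‖ₑ = X := by
      have e : ∀ z, g z * ψ z = ∑ m ∈ s, ∑ n ∈ s, (starRingEnd ℂ) (k m n) * (g z * φ m n z) := by
        intro z
        simp only [hψ, sum_apply, smul_apply, smul_eq_mul, Finset.mul_sum]
        exact Finset.sum_congr rfl fun m _ => Finset.sum_congr rfl fun n _ => by ring
      simp_rw [e]
      rw [integral_finsetSum _ fun m _ => integrable_finsetSum _ fun n _ => (hi m n).const_mul _]
      simp_rw [integral_finsetSum s fun n _ => (hi _ n).const_mul _, integral_const_mul]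
      have e2 : ∀ m n, (starRingEnd ℂ) (k m n) * ∫ z, g z * φ m n z = ((‖k m n‖ ^ 2 : ℝ) : ℂ) := by
        intro m n
        change (starRingEnd ℂ) (k m n) * k m n = _
        rw [Complex.conj_mul']; push_cast; rfl
      simp_rw [e2, ← Complex.ofReal_sum]
      rw [← ofReal_norm, Complex.norm_real, Real.norm_of_nonneg (by positivity),
        ENNReal.ofReal_sum_of_nonneg fun _ _ => by positivity]
      refine Finset.sum_congr rfl fun m _ => ?_
      rw [ENNReal.ofReal_sum_of_nonneg fun _ _ => by positivity]
      exact Finset.sum_congr rfl fun n _ => (enorm_sq_eq_ofReal _).symm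
    have h3 := enorm_integral_mul_sq_le (μ := volume) hg ψ.continuous.aestronglyMeasurable
    rw [h2] at h3
    have h4 : ∫⁻ z, ‖ψ z‖ₑ ^ 2 = ENNReal.ofReal (((2 * Real.pi * ħ) ^ d)⁻¹) * X := by
      rw [hX, ← h1, ← mul_assoc, ← ENNReal.ofReal_mul (by positivity), inv_mul_cancel₀ (by positivity),
        ENNReal.ofReal_one, one_mul]
    rw [h4, sq] at h3
    by_cases hX0 : X = 0
    · rw [hX0]; exact zero_le
    have hXt : X ≠ ⊤ := by
      rw [hX]
      exact (ENNReal.sum_lt_top.2 fun m _ => ENNReal.sum_lt_top.2 fun n _ =>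
        ENNReal.pow_lt_top enorm_lt_top).ne
    refine (ENNReal.mul_le_mul_iff_left hX0 hXt).1 (h3.trans (le_of_eq ?_))
    ring
  rw [← ENNReal.tsum_prod, ENNReal.tsum_eq_iSup_sum]
  refine iSup_le fun T => ?_
  -- A finite set of pairs is enclosed in a square s × s.
  set s := T.image Prod.fst ∪ T.image Prod.snd with hs
  refine le_trans ?_ (key s)
  rw [← Finset.sum_product']
  refine Finset.sum_le_sum_of_subset fun p hp => ?_
  rw [Finset.mem_product, hs]
  exact ⟨Finset.mem_union_left _ (Finset.mem_image_of_mem _ hp),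
    Finset.mem_union_right _ (Finset.mem_image_of_mem _ hp)⟩

end WignerComm
end SemiWass
end

noncomputable section
namespace SemiWass

/-! ### Commutators and derivatives of Wigner functions -/

section WignerDeriv
open scoped LineDeriv
variable {d : ℕ}

lemma integral_mul_lineDeriv_eq {a g : Phase d → ℂ} (ha : MemLp a 2 (volume : Measure (Phase d)))
    (hg : Continuous g) {C : ℝ} (hC : ∀ z, ‖g z‖ ≤ C) {D : Phase d}
    (h : ∀ z, HasLineDerivAt ℝ a (g z) z D) (φ : 𝓢(Phase d, ℂ)) :
    Integrable (fun z => g z * φ z) ∧ ∫ z, a z * ∂_{D} φ z = -∫ z, g z * φ z := by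
  have hi : Integrable (fun z => g z * φ z) :=
    (φ.integrable (μ := volume)).bdd_mul hg.aestronglyMeasurable (ae_of_all _ hC)
  refine ⟨hi, ?_⟩
  have h1 : ∀ ψ : 𝓢(Phase d, ℂ), Integrable (fun z => a z * ψ z) := fun ψ =>
    ha.integrable_mul (ψ.memLp 2 volume)
  exact integral_bilinear_hasLineDerivAt_right_eq_neg_left_of_integrable
    (μ := (volume : Measure (Phase d))) (B := ContinuousLinearMap.mul ℝ ℂ) (f := a) (f' := g) (g := φ)
    (g' := fun z => (∂_{D} φ : 𝓢(Phase d, ℂ)) z) (v := D) hi (h1 _) (h1 _) (fun z _ => h z) fun z _ => by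
      rw [SchwartzMap.lineDerivOp_apply]
      exact (φ.differentiableAt.lineDifferentiableAt).hasLineDerivAt

/-- Integration by parts moves the derivative to a, and Bessel bounds the coefficients: the factor
(2πħ)^{2d}ħ² from the commutator formula loses (2πħ)^d to the normalization of the cross-Wigner
functions. -/
lemma tsum_comm_le (ħ : ℝ) (hħ : 0 < ħ) {a g : Phase d → ℂ}
    (ha : MemLp a 2 (volume : Measure (Phase d)))
    (hg : Continuous g) {C : ℝ} (hC : ∀ z, ‖g z‖ ≤ C) {D : Phase d}
    (h : ∀ z, HasLineDerivAt ℝ a (g z) z D) (k : (Fin d → ℕ) → (Fin d → ℕ) → ℂ) (e : ℂ)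
    (he : ‖e‖ ≤ 1)
    (hk : ∀ m n φ, IsCross ħ (hermS ħ hħ m) (hermS ħ hħ n) φ →
      k m n = (((2 * Real.pi * ħ) ^ d : ℝ) : ℂ) * (e * ħ) * ∫ z, a z * ∂_{D} φ z) :
    ∑' m, ∑' n, ‖k m n‖ₑ ^ 2 ≤ ENNReal.ofReal ((2 * Real.pi * ħ) ^ d * ħ ^ 2) * ∫⁻ z, ‖g z‖ₑ ^ 2 := by
  choose φ hφ using exists_isCross (d := d) ħ hħ
  have h1 := fun m n => integral_mul_lineDeriv_eq ha hg hC h (φ m n)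
  have h2 := tsum_cross_le ħ hħ φ hφ g hg.aestronglyMeasurable fun m n => (h1 m n).1
  have h3 : ∀ m n, ‖k m n‖ₑ ^ 2 ≤ ENNReal.ofReal (((2 * Real.pi * ħ) ^ d * ħ) ^ 2) *
      ‖∫ z, g z * φ m n z‖ₑ ^ 2 := by
    intro m n
    rw [hk m n _ (hφ m n), (h1 m n).2, enorm_sq_eq_ofReal, enorm_sq_eq_ofReal,
      ← ENNReal.ofReal_mul (by positivity)]
    refine ENNReal.ofReal_le_ofReal ?_
    rw [norm_mul, norm_mul, norm_mul, norm_neg, Complex.norm_real, Complex.norm_real,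
      Real.norm_of_nonneg (by positivity : 0 ≤ (2 * Real.pi * ħ) ^ d), Real.norm_of_nonneg hħ.le, ← mul_pow]
    have h4 : ‖e‖ * ħ ≤ ħ := by nlinarith
    gcongr
  calc ∑' m, ∑' n, ‖k m n‖ₑ ^ 2
      ≤ ∑' m, ∑' n, ENNReal.ofReal (((2 * Real.pi * ħ) ^ d * ħ) ^ 2) * ‖∫ z, g z * φ m n z‖ₑ ^ 2 :=
        ENNReal.tsum_le_tsum fun m => ENNReal.tsum_le_tsum fun n => h3 m n
    _ = ENNReal.ofReal (((2 * Real.pi * ħ) ^ d * ħ) ^ 2) * ∑' m, ∑' n, ‖∫ z, g z * φ m n z‖ₑ ^ 2 := by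
        simp_rw [ENNReal.tsum_mul_left]
    _ ≤ _ := by
        refine (mul_le_mul_right h2 _).trans (le_of_eq ?_)
        rw [← mul_assoc, ← ENNReal.ofReal_mul (by positivity)]
        congr 2
        field_simp

/-- Bound on the distance by the first derivatives of the Wigner function of `√R`. -/
theorem quantumWass_le_wigner (ħ : ℝ) (hħ : 0 < ħ) (R : Op d) (hR : IsDensityOp R)
    (W : Phase d → ℂ) (hW : IsWigner ħ R W) (a : Phase d → ℂ) (ha : IsWigner ħ (posSqrt R) a)
    (g : Fin d × Bool → Phase d → ℂ) (hg : ∀ m, Continuous (g m)) (C : ℝ) (hC : ∀ m z, ‖g m z‖ ≤ C)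
    (h : ∀ m z, HasLineDerivAt ℝ a (g m z) z (dir m)) (Y : ℝ) (hY : 0 ≤ Y)
    (hgY : ∀ m, ENNReal.ofReal ((2 * Real.pi * ħ) ^ d * ħ ^ 2) * ∫⁻ z, ‖g m z‖ₑ ^ 2 ≤ ENNReal.ofReal Y) :
    quantumWass ħ (husimi ħ W) R ≤ (ENNReal.ofReal (d * ħ / 2 + d * Y)) ^ (1 / 2 : ℝ) := by
  refine (quantumWass_le_comm ħ hħ R hR W hW).trans (ENNReal.rpow_le_rpow ?_ (by norm_num))
  rw [ENNReal.ofReal_add (by positivity) (by positivity)]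
  refine add_le_add_right ?_ _
  have h1 : ∀ j, ∑' m, ∑' n, ‖hermiteCommElt ħ (Obs.pos j) (posSqrt R) m n‖ₑ ^ 2 ≤ ENNReal.ofReal Y := by
    intro j
    refine (tsum_comm_le ħ hħ ha.1 (hg (j, true)) (hC _) (h _) _ (-Complex.I) (by simp) ?_).trans (hgY (j, true))
    intro m n φ hφ
    rw [comm_pos_eq ħ hħ _ a ha m n φ hφ j, neg_mul]
    simp [dir]
  have h2 : ∀ j, ∑' m, ∑' n, ‖hermiteCommElt ħ (Obs.gradMinus j) (posSqrt R) m n‖ₑ ^ 2 ≤ ENNReal.ofReal Y := by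
    intro j
    refine (tsum_comm_le ħ hħ ha.1 (hg (j, false)) (hC _) (h _) _ 1 (by simp) ?_).trans (hgY (j, false))
    intro m n φ hφ
    rw [comm_gradMinus_eq ħ hħ _ a ha m n φ hφ j, one_mul]
    simp [dir]
  refine (mul_le_mul_right (Finset.sum_le_sum fun j _ => add_le_add (h1 j) (h2 j)) _).trans (le_of_eq ?_)
  rw [Finset.sum_const, Finset.card_univ, Fintype.card_fin, nsmul_eq_mul,
    ← ENNReal.ofReal_add hY hY, ← ENNReal.ofReal_natCast, ← ENNReal.ofReal_mul (by positivity),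
    show (1 / 2 : ℝ≥0∞) = ENNReal.ofReal (1 / 2) by
      rw [ENNReal.ofReal_div_of_pos (by norm_num)]; simp, ← ENNReal.ofReal_mul (by norm_num)]
  congr 1; ring

end WignerDeriv
end SemiWass
end

noncomputable section
namespace SemiWass

/-! ### Fourier series in the angular variables -/

section AngularFourier
open scoped Pointwise
variable {d : ℕ}

/-- The rotation of phase space by a point of the torus. -/
def torusRot (z : Phase d) (t : UnitAddTorus (Fin d)) : Phase d :=
  (WithLp.toLp 2 fun l => (AddCircle.toCircle (t l) : ℂ).re * z.1 l - (AddCircle.toCircle (t l) : ℂ).im * z.2 l,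
    WithLp.toLp 2 fun l => (AddCircle.toCircle (t l) : ℂ).im * z.1 l + (AddCircle.toCircle (t l) : ℂ).re * z.2 l)

lemma continuous_torusRot (z : Phase d) : Continuous (torusRot z) := by
  have hc : ∀ l : Fin d, Continuous fun t : UnitAddTorus (Fin d) => (AddCircle.toCircle (t l) : ℂ) :=
    fun l => continuous_subtype_val.comp (AddCircle.continuous_toCircle.comp (continuous_apply l))
  have hr := fun l => Complex.continuous_re.comp (hc l)
  have hi := fun l => Complex.continuous_im.comp (hc l)
  simp only [Function.comp_def] at hr hi
  unfold torusRot
  refine Continuous.prodMk ?_ ?_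
  · refine (PiLp.continuous_toLp 2 _).comp (continuous_pi fun l => ?_)
    exact ((hr l).mul continuous_const).sub ((hi l).mul continuous_const)
  · refine (PiLp.continuous_toLp 2 _).comp (continuous_pi fun l => ?_)
    exact ((hi l).mul continuous_const).add ((hr l).mul continuous_const)

lemma torusRot_coe (z : Phase d) (s : Fin d → ℝ) :
    torusRot z (fun l => (s l : UnitAddCircle)) = rotate ((2 * Real.pi) • s) z := by
  have h : ∀ l : Fin d, (AddCircle.toCircle ((s l : UnitAddCircle)) : ℂ) =
      Complex.exp ((((2 * Real.pi) • s) l : ℝ) * Complex.I) := by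
    intro l
    rw [AddCircle.toCircle_apply_mk, Circle.coe_exp]
    simp
  simp only [torusRot, rotate, h, Complex.exp_ofReal_mul_I_re, Complex.exp_ofReal_mul_I_im]

lemma torusRot_zero (z : Phase d) : torusRot z 0 = z := by
  have h := torusRot_coe z 0
  have e : (fun l : Fin d => (((0 : Fin d → ℝ) l : ℝ) : UnitAddCircle)) = 0 := by
    ext l; simp
  rw [e] at h
  rw [h]
  simp [rotate]

lemma mFourier_coe (n : Fin d → ℤ) (s : Fin d → ℝ) :
    UnitAddTorus.mFourier n (fun l => (s l : UnitAddCircle)) =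
      Complex.exp (Complex.I * ((∑ l, (n l : ℝ) * ((2 * Real.pi) • s) l : ℝ) : ℂ)) := by
  simp only [UnitAddTorus.mFourier, ContinuousMap.coe_mk, fourier_coe_apply]
  rw [← Complex.exp_sum]
  congr 1
  push_cast
  rw [Finset.mul_sum]
  refine Finset.sum_congr rfl fun l _ => ?_
  simp only [Pi.smul_apply, smul_eq_mul]
  push_cast
  ring

/-- The component a_k is defined with e^{+ik·θ}, hence the sign -n. The angles are rescaled from [0,
2π] to the unit torus, and half-open and closed cubes differ by a null set. -/
lemma mFourierCoeff_rot (a : Phase d → ℂ) (z : Phase d) (n : Fin d → ℤ) :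
    UnitAddTorus.mFourierCoeff (fun t => a (torusRot z t)) n =
      (((2 * Real.pi) ^ d)⁻¹ : ℝ) * fourierCoef a (-n) z := by
  rw [UnitAddTorus.mFourierCoeff_eq_integral _ n 0, fourierCoef]
  simp only [mFourier_coe, torusRot_coe]
  have hs := Measure.setIntegral_comp_smul (volume : Measure (Fin d → ℝ))
    (fun θ : Fin d → ℝ => Complex.exp (Complex.I * ((∑ l, ((-n) l : ℝ) * θ l : ℝ) : ℂ)) • a (rotate θ z))
    (R := 2 * Real.pi) (Set.pi Set.univ fun _ => Set.Icc (0 : ℝ) 1) (by positivity)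
  have hset : (2 * Real.pi) • (Set.pi Set.univ fun _ : Fin d => Set.Icc (0 : ℝ) 1) =
      Set.pi Set.univ fun _ : Fin d => Set.Icc (0 : ℝ) (2 * Real.pi) := by
    ext θ
    rw [Set.mem_smul_set_iff_inv_smul_mem₀ (by positivity)]
    simp only [Set.mem_pi, Set.mem_univ, forall_true_left, Set.mem_Icc, Pi.smul_apply, smul_eq_mul]
    refine forall_congr' fun l => ?_
    have hp : 0 < 2 * Real.pi := by positivity
    rw [inv_mul_le_iff₀ hp, mul_one]
    refine and_congr_left fun _ => ?_
    exact mul_nonneg_iff_of_pos_left (by positivity)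
  have hae : {x : Fin d → ℝ | ∀ i, x i ∈ Set.Ioc ((0 : Fin d → ℝ) i) ((0 : Fin d → ℝ) i + 1)} =ᵐ[volume]
      Set.pi Set.univ fun _ : Fin d => Set.Icc (0 : ℝ) 1 := by
    have h1 := Measure.univ_pi_Ioc_ae_eq_Icc (μ := fun _ : Fin d => (volume : Measure ℝ))
      (f := fun _ => 0) (g := fun _ => 1)
    rw [← Set.pi_univ_Icc] at h1
    have h2 : {x : Fin d → ℝ | ∀ i, x i ∈ Set.Ioc ((0 : Fin d → ℝ) i) ((0 : Fin d → ℝ) i + 1)} =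
        Set.pi Set.univ fun _ : Fin d => Set.Ioc (0 : ℝ) 1 := by
      ext x; simp
    rw [h2]
    exact h1
  rw [setIntegral_congr_set hae, hs, hset]
  simp only [Module.finrank_fintype_fun_eq_card, Fintype.card_fin]
  rw [abs_of_pos (by positivity), Complex.real_smul]
  congr 1
  refine integral_congr_ae (ae_of_all _ fun θ => ?_)
  simp only [smul_eq_mul, Pi.neg_apply]
  exact mul_comm _ _

/-- A continuous function is the sum of its angular Fourier components if these are summable. -/
lemma hasSum_fourierCoef {a : Phase d → ℂ} (ha : Continuous a) (z : Phase d)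
    (hs : Summable fun k : Fin d → ℤ => fourierCoef a k z) :
    HasSum (fun k : Fin d → ℤ => (((2 * Real.pi) ^ d)⁻¹ : ℝ) * fourierCoef a k z) (a z) := by
  set f : C(UnitAddTorus (Fin d), ℂ) := ⟨fun t => a (torusRot z t), ha.comp (continuous_torusRot z)⟩ with hf
  have hc : ∀ n, UnitAddTorus.mFourierCoeff f n = (((2 * Real.pi) ^ d)⁻¹ : ℝ) * fourierCoef a (-n) z :=
    mFourierCoeff_rot a z
  have hs' : Summable (UnitAddTorus.mFourierCoeff f) := by
    rw [funext hc]
    exact ((Equiv.neg (Fin d → ℤ)).summable_iff.2 hs).mul_left _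
  -- The Fourier series is evaluated at the neutral element, where every character equals 1 and the
  -- rotation is trivial.
  have h := UnitAddTorus.hasSum_mFourier_series_apply_of_summable hs' 0
  have h0 : ∀ n : Fin d → ℤ, UnitAddTorus.mFourier n (0 : UnitAddTorus (Fin d)) = 1 := by
    intro n
    simp [UnitAddTorus.mFourier]
  simp only [h0, smul_eq_mul, mul_one, hc] at h
  rw [show f 0 = a z by rw [hf]; simp [torusRot_zero]] at h
  exact (Equiv.neg (Fin d → ℤ)).hasSum_iff.1 h

lemma hasDerivAt_of_hasLineDerivAt {E : Type*} [NormedAddCommGroup E] [NormedSpace ℝ E] {a : E → ℂ}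
    {q w : E} {s : ℝ} {b : ℂ} (h : HasLineDerivAt ℝ a b (q + s • w) w) :
    HasDerivAt (fun x : ℝ => a (q + x • w)) b s := by
  have h1 : HasDerivAt (fun t : ℝ => a (q + s • w + t • w)) b (s - s) := by
    rw [sub_self]; exact h
  have h2 := h1.comp_sub_const s s
  have e : (fun t : ℝ => a (q + s • w + (t - s) • w)) = fun x : ℝ => a (q + x • w) := by
    ext t; congr 1; module
  rwa [e] at h2

/-- Line derivatives need not be linear in the direction. Continuity of the two partial derivatives
makes the restriction of a to the plane through p spanned by u and v strictly differentiable, and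
linearity follows there. -/
lemma hasLineDerivAt_combination {E : Type*} [NormedAddCommGroup E] [NormedSpace ℝ E] {a gu gv : E → ℂ}
    {u v : E} (hu : ∀ p, HasLineDerivAt ℝ a (gu p) p u) (hv : ∀ p, HasLineDerivAt ℝ a (gv p) p v)
    (cu : Continuous gu) (cv : Continuous gv) (α β : ℝ) (p : E) :
    HasLineDerivAt ℝ a (α • gu p + β • gv p) p (α • u + β • v) := by
  have hline : ∀ {g : E → ℂ} {w : E}, (∀ p, HasLineDerivAt ℝ a (g p) p w) → ∀ (q : E) (s : ℝ),
      HasFDerivAt (fun x : ℝ => a (q + x • w)) (ContinuousLinearMap.toSpanSingleton ℝ (g (q + s • w))) s := by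
    exact fun h q s => (hasDerivAt_of_hasLineDerivAt (h _)).hasFDerivAt
  have key := hasStrictFDerivAt_uncurry_coprod (𝕜 := ℝ) (u := ((0, 0) : ℝ × ℝ))
    (f := fun x y => a (p + x • u + y • v))
    (f₁ := fun x y => ContinuousLinearMap.toSpanSingleton ℝ (gu (p + x • u + y • v)))
    (f₂ := fun x y => ContinuousLinearMap.toSpanSingleton ℝ (gv (p + x • u + y • v)))
    (Eventually.of_forall fun w => by
      have := hline hu (p + w.2 • v) w.1
      simp only [add_right_comm p (w.2 • v)] at this
      exact this)
    (Eventually.of_forall fun w => by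
      have := hline hv (p + w.1 • u) w.2
      exact this)
    (by
      have : Continuous fun w : ℝ × ℝ => ContinuousLinearMap.toSpanSingleton ℝ (gu (p + w.1 • u + w.2 • v)) :=
        (ContinuousLinearMap.toSpanSingletonCLE (𝕜 := ℝ) (E := ℂ)).continuous.comp (by fun_prop)
      exact this.continuousAt)
    (by
      have : Continuous fun w : ℝ × ℝ => ContinuousLinearMap.toSpanSingleton ℝ (gv (p + w.1 • u + w.2 • v)) :=
        (ContinuousLinearMap.toSpanSingletonCLE (𝕜 := ℝ) (E := ℂ)).continuous.comp (by fun_prop)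
      exact this.continuousAt)
  have hlin : HasDerivAt (fun t : ℝ => ((t * α, t * β) : ℝ × ℝ)) (α, β) 0 := by
    simpa using ((hasDerivAt_id (0 : ℝ)).mul_const α).prodMk ((hasDerivAt_id (0 : ℝ)).mul_const β)
  have h3 := key.hasFDerivAt.comp_hasDerivAt_of_eq (0 : ℝ) hlin (by simp)
  rw [HasLineDerivAt]
  convert h3 using 1
  · ext t
    simp only [Function.comp, Function.HasUncurry.uncurry, id]
    congr 1; module
  · simp [Function.HasUncurry.uncurry, ContinuousLinearMap.toSpanSingleton_apply]

end AngularFourier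
end SemiWass
end

noncomputable section
namespace SemiWass

/-! ### Derivatives of the angular Fourier components -/

section AngularDeriv
variable {d : ℕ}

/-- The image of `dir m` under the rotation by `θ` is
`(rotDir m θ).1 • dir (m.1, false) + (rotDir m θ).2 • dir (m.1, true)`. -/
def rotDir (m : Fin d × Bool) (θ : Fin d → ℝ) : ℝ × ℝ :=
  if m.2 then (-Real.sin (θ m.1), Real.cos (θ m.1)) else (Real.cos (θ m.1), Real.sin (θ m.1))

lemma continuous_rotDir (m : Fin d × Bool) : Continuous (rotDir m) := by
  rcases m with ⟨l, b⟩
  cases b <;> (unfold rotDir; simp only [if_true, Bool.false_eq_true, if_false]; fun_prop)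

lemma rotate_add_smul (θ : Fin d → ℝ) (z : Phase d) (t : ℝ) (m : Fin d × Bool) :
    rotate θ (z + t • dir m) = rotate θ z +
      t • ((rotDir m θ).1 • dir (m.1, false) + (rotDir m θ).2 • dir (m.1, true)) := by
  rcases m with ⟨j, b⟩
  cases b
  all_goals
    ext l
    all_goals
      by_cases h : l = j
      · subst h
        simp [rotate, dir, basisVec, rotDir]
        ring
      · simp [rotate, dir, basisVec, rotDir, h]

lemma continuous_rotate (z : Phase d) : Continuous fun θ : Fin d → ℝ => rotate θ z := by
  unfold rotate
  refine Continuous.prodMk ?_ ?_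
  · exact (PiLp.continuous_toLp 2 _).comp (continuous_pi fun l => by fun_prop)
  · exact (PiLp.continuous_toLp 2 _).comp (continuous_pi fun l => by fun_prop)

lemma hasDerivAt_setIntegral_of_continuous {K : Set (Fin d → ℝ)} (hK : IsCompact K)
    {F F' : ℝ → (Fin d → ℝ) → ℂ} (hF : Continuous (Function.uncurry F))
    (hF' : Continuous (Function.uncurry F')) (h : ∀ θ t, HasDerivAt (fun s => F s θ) (F' t θ) t) :
    HasDerivAt (fun t => ∫ θ in K, F t θ) (∫ θ in K, F' 0 θ) 0 := by
  obtain ⟨C, hC⟩ := ((isCompact_Icc (a := (-1 : ℝ)) (b := 1)).prod hK).exists_bound_of_continuousOn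
    hF'.continuousOn
  have hslice : ∀ t, Continuous (F t) := fun t => hF.comp (Continuous.prodMk_right t)
  have hslice' : ∀ t, Continuous (F' t) := fun t => hF'.comp (Continuous.prodMk_right t)
  have : IsFiniteMeasure ((volume : Measure (Fin d → ℝ)).restrict K) :=
    ⟨by rw [Measure.restrict_apply_univ]; exact hK.measure_lt_top⟩
  exact (hasDerivAt_integral_of_dominated_loc_of_deriv_le
    (μ := (volume : Measure (Fin d → ℝ)).restrict K) (bound := fun _ => C) (F := F) (F' := F')
    (x₀ := (0 : ℝ)) (s := Set.Icc (-1 : ℝ) 1) (Icc_mem_nhds (by norm_num) (by norm_num))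
    (Eventually.of_forall fun t => (hslice t).aestronglyMeasurable)
    ((hslice 0).continuousOn.integrableOn_compact hK) (hslice' 0).aestronglyMeasurable
    ((ae_restrict_iff' hK.measurableSet).2 (ae_of_all _ fun θ hθ t ht => hC (t, θ) ⟨ht, hθ⟩))
    (integrable_const C) (ae_of_all _ fun θ t _ => h θ t)).2

/-- Rotation carries a coordinate direction to a θ-dependent combination of the two directions of
the same plane, and the integral over the compact torus can be differentiated under the sign. Only
existence matters, as the size of the derivative is bounded by hypothesis where the lemma is used.
-/
lemma lineDifferentiableAt_fourierCoef {a : Phase d → ℂ} (ha : Continuous a)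
    {g : Fin d × Bool → Phase d → ℂ} (hg : ∀ m, Continuous (g m))
    (h : ∀ m z, HasLineDerivAt ℝ a (g m z) z (dir m)) (k : Fin d → ℤ) (z : Phase d) (m : Fin d × Bool) :
    LineDifferentiableAt ℝ (fourierCoef a k) z (dir m) := by
  set K : Set (Fin d → ℝ) := Set.pi Set.univ fun _ => Set.Icc (0 : ℝ) (2 * Real.pi) with hK
  have hKc : IsCompact K := isCompact_univ_pi fun _ => isCompact_Icc
  set w : (Fin d → ℝ) → Phase d := fun θ =>
    (rotDir m θ).1 • dir (m.1, false) + (rotDir m θ).2 • dir (m.1, true) with hw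
  set e : (Fin d → ℝ) → ℂ := fun θ => Complex.exp (Complex.I * ((∑ l, (k l : ℝ) * θ l : ℝ) : ℂ)) with he
  have hrc := continuous_rotDir m
  have hr1 : Continuous fun θ => (rotDir m θ).1 := continuous_fst.comp hrc
  have hr2 : Continuous fun θ => (rotDir m θ).2 := continuous_snd.comp hrc
  have hwc : Continuous w := by
    exact (hr1.smul continuous_const).add (hr2.smul continuous_const)
  have hec : Continuous e := by
    have : Continuous fun θ : Fin d → ℝ => ∑ l, (k l : ℝ) * θ l := by fun_prop
    exact Complex.continuous_exp.comp (continuous_const.mul (Complex.continuous_ofReal.comp this))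
  have hrot := continuous_rotate z
  have hpath : Continuous fun p : ℝ × (Fin d → ℝ) => rotate p.2 z + p.1 • w p.2 :=
    (hrot.comp continuous_snd).add (continuous_fst.smul (hwc.comp continuous_snd))
  have hFc : Continuous (Function.uncurry fun (t : ℝ) θ => a (rotate θ z + t • w θ) * e θ) :=
    (ha.comp hpath).mul (hec.comp continuous_snd)
  have hFc' : Continuous (Function.uncurry fun (t : ℝ) θ =>
      ((rotDir m θ).1 • g (m.1, false) (rotate θ z + t • w θ) +
        (rotDir m θ).2 • g (m.1, true) (rotate θ z + t • w θ)) * e θ) :=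
    (((hr1.comp continuous_snd).smul ((hg _).comp hpath)).add
      ((hr2.comp continuous_snd).smul ((hg _).comp hpath))).mul (hec.comp continuous_snd)
  have key := hasDerivAt_setIntegral_of_continuous hKc hFc hFc' fun θ t =>
    (hasDerivAt_of_hasLineDerivAt (q := rotate θ z) (w := w θ) (s := t)
      (hasLineDerivAt_combination (h (m.1, false)) (h (m.1, true)) (hg _) (hg _) _ _ _)).mul_const (e θ)
  have e1 : (fun t : ℝ => fourierCoef a k (z + t • dir m)) =
      fun t => ∫ θ in K, a (rotate θ z + t • w θ) * e θ := by
    ext t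
    simp only [fourierCoef, rotate_add_smul]
    rfl
  rw [← e1] at key
  exact HasLineDerivAt.lineDifferentiableAt key

/-- Bound on the derivatives of `a` by those of its angular Fourier components. -/
lemma norm_deriv_le_of_fourierCoef {a : Phase d → ℂ} (ha : Continuous a)
    {g : Fin d × Bool → Phase d → ℂ} (hg : ∀ m, Continuous (g m))
    (h : ∀ m z, HasLineDerivAt ℝ a (g m z) z (dir m)) (P : (Fin d → ℤ) → ℝ) (hP : Summable P)
    (hP0 : ∀ k, 0 ≤ P k) (V : Phase d → ℝ) (hV : ∀ z, V z ≤ 1) (X Y : ℝ) (hY0 : 0 ≤ Y)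
    (hX : ∀ k z, ‖fourierCoef a k z‖ ≤ X * V z * P k) (m : Fin d × Bool)
    (hY : ∀ k z, ‖lineDeriv ℝ (fourierCoef a k) z (dir m)‖ ≤ Y * V z * P k) (z : Phase d) :
    ‖g m z‖ ≤ ((2 * Real.pi) ^ d)⁻¹ * (Y * V z * ∑' k, P k) := by
  have hs : ∀ z, Summable fun k => fourierCoef a k z := fun z =>
    Summable.of_norm_bounded (hP.mul_left (X * V z)) fun k => hX k z
  set c : ℝ := ((2 * Real.pi) ^ d)⁻¹ with hc
  have hc0 : 0 ≤ c := by rw [hc]; positivity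
  have hsum := fun z => hasSum_fourierCoef ha z (hs z)
  -- Termwise differentiation of the angular series along a line; V ≤ 1 makes the majorant
  -- independent of the point.
  have hder : HasDerivAt (fun t : ℝ => ∑' k, (c : ℂ) * fourierCoef a k (z + t • dir m))
      (∑' k, (c : ℂ) * lineDeriv ℝ (fourierCoef a k) (z + (0 : ℝ) • dir m) (dir m)) 0 := by
    refine hasDerivAt_tsum (u := fun k => c * (Y * P k)) (y₀ := 0)
      (g := fun k (t : ℝ) => (c : ℂ) * fourierCoef a k (z + t • dir m))
      (g' := fun k (t : ℝ) => (c : ℂ) * lineDeriv ℝ (fourierCoef a k) (z + t • dir m) (dir m))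
      ((hP.mul_left Y).mul_left c) (fun k t => ?_) (fun k t => ?_) ((hs _).mul_left _) 0
    · exact (hasDerivAt_of_hasLineDerivAt
        (lineDifferentiableAt_fourierCoef ha hg h k _ m).hasLineDerivAt).const_mul _
    · rw [norm_mul, Complex.norm_real, Real.norm_of_nonneg hc0]
      refine mul_le_mul_of_nonneg_left ((hY k _).trans ?_) hc0
      have := hP0 k
      have := hV (z + t • dir m)
      calc Y * V (z + t • dir m) * P k ≤ Y * 1 * P k := by gcongr
        _ = Y * P k := by ring
  have e : (fun t : ℝ => ∑' k, (c : ℂ) * fourierCoef a k (z + t • dir m)) = fun t => a (z + t • dir m) :=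
    funext fun t => (hsum _).tsum_eq
  rw [e, zero_smul, add_zero] at hder
  rw [HasDerivAt.unique (h m z) hder, tsum_mul_left, norm_mul, Complex.norm_real, Real.norm_of_nonneg hc0]
  refine mul_le_mul_of_nonneg_left ?_ hc0
  rw [← tsum_mul_left]
  exact tsum_of_norm_bounded ((hP.mul_left _).hasSum) fun k => hY k z

/-- The exponent 3 gives 1 + 2·2^{-1} = 2 for each coordinate. -/
lemma summable_prod_int :
    Summable (fun k : Fin d → ℤ => ∏ l, (|(k l : ℝ)| + 1) ^ (-3 : ℝ)) ∧
      ∑' k : Fin d → ℤ, ∏ l, (|(k l : ℝ)| + 1) ^ (-3 : ℝ) ≤ 2 ^ d := by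
  have h1 : ∑' k : Fin d → ℤ, ENNReal.ofReal (∏ l, (|(k l : ℝ)| + 1) ^ (-3 : ℝ)) ≤ ENNReal.ofReal (2 ^ d) := by
    have e : ∀ k : Fin d → ℤ, ENNReal.ofReal (∏ l, (|(k l : ℝ)| + 1) ^ (-3 : ℝ)) =
        ∏ l, ENNReal.ofReal ((|(k l : ℝ)| + 1) ^ (-3 : ℝ)) := fun k =>
      ENNReal.ofReal_prod_of_nonneg fun l _ => by positivity
    simp_rw [e]
    rw [tsum_pi_prod fun (_ : Fin d) (k : ℤ) => ENNReal.ofReal ((|(k : ℝ)| + 1) ^ (-3 : ℝ))]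
    have h2 := tsum_int_rpow_le 3 (by norm_num)
    rw [Finset.prod_const, Finset.card_univ, Fintype.card_fin, ENNReal.ofReal_pow (by norm_num)]
    refine pow_le_pow_left₀ zero_le (h2.trans (ENNReal.ofReal_le_ofReal ?_)) d
    norm_num
  have h0 : ∀ k : Fin d → ℤ, 0 ≤ ∏ l, (|(k l : ℝ)| + 1) ^ (-3 : ℝ) := fun k =>
    Finset.prod_nonneg fun l _ => by positivity
  have hs : Summable (fun k : Fin d → ℤ => ∏ l, (|(k l : ℝ)| + 1) ^ (-3 : ℝ)) := by
    have := ENNReal.summable_toReal (h1.trans_lt ENNReal.ofReal_lt_top).ne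
    simpa only [ENNReal.toReal_ofReal (h0 _)] using this
  refine ⟨hs, ?_⟩
  rw [← ENNReal.ofReal_tsum_of_nonneg h0 hs] at h1
  exact (ENNReal.ofReal_le_ofReal_iff (by positivity)).1 h1

end AngularDeriv
end SemiWass
end

noncomputable section
namespace SemiWass

/-! ### Bounds on Wigner functions -/

section WignerCase
variable {d : ℕ}

lemma integral_Ioi_mul_rpow : ∫ y in Set.Ioi (0 : ℝ), y * (1 + y ^ 2) ^ (-3 / 2 : ℝ) = 1 := by
  have hd : ∀ y : ℝ, HasDerivAt (fun y : ℝ => -(1 + y ^ 2) ^ (-1 / 2 : ℝ)) (y * (1 + y ^ 2) ^ (-3 / 2 : ℝ)) y := by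
    intro y
    have h1 : HasDerivAt (fun y : ℝ => 1 + y ^ 2) (2 * y) y := by
      simpa using (hasDerivAt_pow 2 y).const_add 1
    have h2 := (h1.rpow_const (p := (-1 / 2 : ℝ)) (Or.inl (by positivity))).neg
    refine h2.congr_deriv ?_
    rw [show (-1 / 2 - 1 : ℝ) = -3 / 2 by norm_num]; ring
  have ht : Tendsto (fun y : ℝ => -(1 + y ^ 2) ^ (-1 / 2 : ℝ)) atTop (𝓝 0) := by
    rw [← neg_zero]
    refine Tendsto.neg ?_
    have h1 : Tendsto (fun y : ℝ => 1 + y ^ 2) atTop atTop :=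
      tendsto_atTop_add_const_left _ _ (tendsto_pow_atTop (by norm_num))
    have h2 := (tendsto_rpow_neg_atTop (y := (1 / 2 : ℝ)) (by norm_num)).comp h1
    simpa [Function.comp_def, neg_div] using h2
  rw [integral_Ioi_of_hasDerivAt_of_nonneg (hd 0).continuousAt.continuousWithinAt (fun y _ => hd y)
    (fun y hy => by have : 0 < y := hy; positivity) ht]
  simp

/-- Polar coordinates, with the plane identified with ℂ: the angular integral is 2π and the radial
one is 1. The exponent 3/2 is twice that of `planeWeight`. -/
lemma integral_plane : Integrable (fun p : ℝ × ℝ => (p.1 ^ 2 + p.2 ^ 2 + 1) ^ (-3 / 2 : ℝ)) ∧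
    ∫ p : ℝ × ℝ, (p.1 ^ 2 + p.2 ^ 2 + 1) ^ (-3 / 2 : ℝ) = 2 * Real.pi := by
  have e : ∀ w : ℂ, (((Complex.measurableEquivRealProd w).1 ^ 2 + (Complex.measurableEquivRealProd w).2 ^ 2 + 1 : ℝ)) ^ (-3 / 2 : ℝ) =
      (1 + ‖w‖ ^ 2) ^ (-3 / 2 : ℝ) := by
    intro w
    rw [Complex.sq_norm, Complex.normSq_apply]
    simp only [Complex.measurableEquivRealProd_apply]
    congr 1; ring
  have mp := Complex.volume_preserving_equiv_real_prod
  constructor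
  · rw [← mp.integrable_comp_emb Complex.measurableEquivRealProd.measurableEmbedding]
    simp only [Function.comp_def, e]
    have := integrable_rpow_neg_one_add_norm_sq (E := ℂ) (μ := volume) (r := 3) (by
      rw [Complex.finrank_real_complex]; norm_num)
    exact this
  · rw [← mp.integral_comp Complex.measurableEquivRealProd.measurableEmbedding]
    simp only [e]
    rw [integral_fun_norm_addHaar volume (fun y : ℝ => (1 + y ^ 2) ^ (-3 / 2 : ℝ)),
      Complex.finrank_real_complex]
    simp only [Nat.add_one_sub_one, pow_one, smul_eq_mul, integral_Ioi_mul_rpow, mul_one]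
    rw [Measure.real, Complex.volume_ball]
    simp

/-- The weight `∏ (1 + |z_l|²)^{-3/4}`. -/
def planeWeight (z : Phase d) : ℝ := ∏ l, (z.1 l ^ 2 + z.2 l ^ 2 + 1) ^ (-3 / 4 : ℝ)

lemma planeWeight_nonneg (z : Phase d) : 0 ≤ planeWeight z :=
  Finset.prod_nonneg fun l _ => by positivity

lemma planeWeight_le_one (z : Phase d) : planeWeight z ≤ 1 :=
  Finset.prod_le_one (fun l _ => by positivity) fun l _ =>
    Real.rpow_le_one_of_one_le_of_nonpos (by nlinarith [sq_nonneg (z.1 l), sq_nonneg (z.2 l)]) (by norm_num)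

lemma lintegral_planeWeight_sq :
    ∫⁻ z : Phase d, ENNReal.ofReal (planeWeight z ^ 2) = ENNReal.ofReal ((2 * Real.pi) ^ d) := by
  have mp1 := volume_measurePreserving_arrowProdEquivProdArrow ℝ ℝ (Fin d)
  have mp2 : MeasurePreserving (Prod.map (WithLp.toLp 2) (WithLp.toLp 2) :
      (Fin d → ℝ) × (Fin d → ℝ) → Phase d) volume volume :=
    (PiLp.volume_preserving_toLp (Fin d)).prod (PiLp.volume_preserving_toLp (Fin d))
  have mp := mp2.comp mp1
  have hm : Measurable fun z : Phase d => ENNReal.ofReal (planeWeight z ^ 2) := by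
    have : ∀ l : Fin d, Measurable fun z : Phase d => (z.1 l ^ 2 + z.2 l ^ 2 + 1) ^ (-3 / 4 : ℝ) := by
      intro l; fun_prop
    exact ((Finset.measurable_fun_prod _ fun l _ => this l).pow_const 2).ennreal_ofReal
  rw [← mp.lintegral_comp hm]
  have e : ∀ x : Fin d → ℝ × ℝ, planeWeight ((Prod.map (WithLp.toLp 2) (WithLp.toLp 2) ∘
      (MeasurableEquiv.arrowProdEquivProdArrow ℝ ℝ (Fin d))) x : Phase d) ^ 2 =
      ∏ l, ((x l).1 ^ 2 + (x l).2 ^ 2 + 1) ^ (-3 / 2 : ℝ) := by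
    intro x
    rw [planeWeight, ← Finset.prod_pow]
    refine Finset.prod_congr rfl fun l _ => ?_
    rw [← Real.rpow_natCast, ← Real.rpow_mul (by positivity)]
    norm_num
    rfl
  simp_rw [e]
  have hi : Integrable fun x : Fin d → ℝ × ℝ => ∏ l, ((x l).1 ^ 2 + (x l).2 ^ 2 + 1) ^ (-3 / 2 : ℝ) :=
    Integrable.fintype_prod (f := fun _ (p : ℝ × ℝ) => (p.1 ^ 2 + p.2 ^ 2 + 1) ^ (-3 / 2 : ℝ))
      fun _ => integral_plane.1
  rw [← ofReal_integral_eq_lintegral_ofReal hi (ae_of_all _ fun x => Finset.prod_nonneg fun l _ => by positivity),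
    integral_fintype_prod_volume_eq_prod (𝕜 := ℝ)
      (fun (_ : Fin d) (p : ℝ × ℝ) => (p.1 ^ 2 + p.2 ^ 2 + 1) ^ (-3 / 2 : ℝ))]
  simp only [integral_plane.2, Finset.prod_const, Finset.card_univ, Fintype.card_fin]

/-- The weights are weakened to what the summation requires: 3/4 + ε to 3/4, 7/2 + 3ε to 3, and
|k_l| + d to |k_l| + 1. Finiteness of the norm also yields the differentiability of a. -/
lemma bound_of_mknNorm_le (hd : 1 ≤ d) {ħ ε X : ℝ} (hε : 0 < ε) {a : Phase d → ℂ} (hX0 : 0 ≤ X)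
    (h : mknNorm ħ (3 / 4 + ε) (7 / 2 + 3 * ε) 3 a ≤ ENNReal.ofReal X) :
    MixedContDiff 3 a ∧ ∀ (k : Fin d → ℤ) (z : Phase d) (w : List (Fin d × Bool)), Admissible 3 w →
      Real.sqrt ħ ^ w.length * ‖partialD w (fourierCoef a k) z‖ ≤
        X * planeWeight z * ∏ l, (|(k l : ℝ)| + 1) ^ (-3 : ℝ) := by
  rw [mknNorm] at h
  split_ifs at h with hm
  swap
  · exact absurd (top_le_iff.1 h) ENNReal.ofReal_ne_top
  refine ⟨hm, fun k z w hw => ?_⟩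
  have h1 := ((le_iSup₂_of_le k z (le_iSup₂_of_le w hw le_rfl)).trans h)
  rw [ENNReal.ofReal_le_ofReal_iff hX0] at h1
  set D := Real.sqrt ħ ^ w.length * ‖partialD w (fourierCoef a k) z‖ with hD
  have hD0 : 0 ≤ D := by rw [hD]; positivity
  set A := ∏ l, ((z.1 l ^ 2 + z.2 l ^ 2 + 1) ^ (3 / 4 + ε) * (|(k l : ℝ)| + d) ^ (7 / 2 + 3 * ε)) with hA
  have hP0 : 0 ≤ ∏ l, (|(k l : ℝ)| + 1) ^ (-3 : ℝ) := Finset.prod_nonneg fun l _ => by positivity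
  have hV := planeWeight_nonneg z
  have h2 : 1 ≤ planeWeight z * (∏ l, (|(k l : ℝ)| + 1) ^ (-3 : ℝ)) * A := by
    rw [planeWeight, hA, ← Finset.prod_mul_distrib, ← Finset.prod_mul_distrib]
    refine Finset.one_le_prod fun l _ => ?_
    have r1 : 1 ≤ z.1 l ^ 2 + z.2 l ^ 2 + 1 := by nlinarith [sq_nonneg (z.1 l), sq_nonneg (z.2 l)]
    have k1 : (1 : ℝ) ≤ |(k l : ℝ)| + 1 := by linarith [abs_nonneg (k l : ℝ)]
    have d1 : (1 : ℝ) ≤ d := by exact_mod_cast hd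
    have k2 : |(k l : ℝ)| + 1 ≤ |(k l : ℝ)| + d := by linarith
    have a1 : 1 ≤ (z.1 l ^ 2 + z.2 l ^ 2 + 1) ^ (-3 / 4 : ℝ) * (z.1 l ^ 2 + z.2 l ^ 2 + 1) ^ (3 / 4 + ε) := by
      rw [← Real.rpow_add (by linarith)]
      exact Real.one_le_rpow r1 (by linarith)
    have a2 : 1 ≤ (|(k l : ℝ)| + 1) ^ (-3 : ℝ) * (|(k l : ℝ)| + d) ^ (7 / 2 + 3 * ε) := by
      calc (1 : ℝ) ≤ (|(k l : ℝ)| + 1) ^ (-3 + (7 / 2 + 3 * ε)) := Real.one_le_rpow k1 (by linarith)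
        _ = (|(k l : ℝ)| + 1) ^ (-3 : ℝ) * (|(k l : ℝ)| + 1) ^ (7 / 2 + 3 * ε) :=
          Real.rpow_add (by linarith) _ _
        _ ≤ _ := mul_le_mul_of_nonneg_left
          (Real.rpow_le_rpow (by linarith) k2 (by linarith)) (by positivity)
    calc (1 : ℝ) = 1 * 1 := by ring
      _ ≤ _ := mul_le_mul a1 a2 zero_le_one (zero_le_one.trans a1)
      _ = _ := by ring
  calc D = 1 * D := by ring
    _ ≤ planeWeight z * (∏ l, (|(k l : ℝ)| + 1) ^ (-3 : ℝ)) * A * D := mul_le_mul_of_nonneg_right h2 hD0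
    _ = planeWeight z * (∏ l, (|(k l : ℝ)| + 1) ^ (-3 : ℝ)) * (A * D) := by ring
    _ ≤ planeWeight z * (∏ l, (|(k l : ℝ)| + 1) ^ (-3 : ℝ)) * X := mul_le_mul_of_nonneg_left h1 (by positivity)
    _ = _ := by ring

lemma admissible_of_length_le {w : List (Fin d × Bool)} {N : ℕ} (h : w.length ≤ N) : Admissible N w :=
  fun l => (List.count_le_length).trans (by simpa using h)

/-- The first summand of the prefactor, √(2π)/2, already exceeds 1. -/
lemma constII_le_constI (ε : ℝ) (hε : 0 < ε) : constII d ε ≤ constI d ε := by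
  have h0 : 0 ≤ constII d ε := (by positivity : 0 ≤ 2 * Real.sqrt d).trans (le_constII ε hε)
  rw [constI]
  refine le_mul_of_one_le_left h0 ?_
  have h1 : 2 ≤ Real.sqrt (2 * Real.pi) := by
    rw [Real.le_sqrt (by norm_num)]
    · nlinarith [Real.pi_gt_three]
    · positivity
  have h2 : 0 ≤ 2 * (2 * Real.pi) ^ (5 / 2 : ℝ) * Real.exp (1 / 8) *
      (4 * (9 / 4 + ε) / Real.exp 1) ^ (9 / 4 + ε) := by positivity
  linarith

lemma lintegral_sq_le_of_planeWeight {g : Phase d → ℂ} {c : ℝ}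
    (h : ∀ z, ‖g z‖ ≤ c * planeWeight z) :
    ∫⁻ z, ‖g z‖ₑ ^ 2 ≤ ENNReal.ofReal (c ^ 2 * (2 * Real.pi) ^ d) := by
  calc ∫⁻ z, ‖g z‖ₑ ^ 2 ≤ ∫⁻ z, ENNReal.ofReal (c ^ 2) * ENNReal.ofReal (planeWeight z ^ 2) := by
        refine lintegral_mono fun z => ?_
        rw [enorm_sq_eq_ofReal, ← ENNReal.ofReal_mul (by positivity), ← mul_pow]
        exact ENNReal.ofReal_le_ofReal (pow_le_pow_left₀ (norm_nonneg _) (h z) 2)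
    _ = _ := by
        rw [lintegral_const_mul' _ _ ENNReal.ofReal_ne_top, lintegral_planeWeight_sq,
          ← ENNReal.ofReal_mul (by positivity)]

theorem wigner_case (hd : 1 ≤ d) (ħ : ℝ) (hħ : 0 < ħ) (ε μ ν : ℝ) (hε : 0 < ε) (R : Op d)
    (hR : IsDensityOp R) (W : Phase d → ℂ) (hW : IsWigner ħ R W) (h : WignerHyp ħ ε μ ν R) :
    quantumWass ħ (husimi ħ W) R ≤ ENNReal.ofReal (constI d ε / Real.sqrt 2 *
      max (Real.sqrt ħ) (max (Real.sqrt ħ * μ) (Real.sqrt (ħ * μ * ν)))) := by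
  obtain ⟨a, ha, h1, -⟩ := h
  -- The sign of μ is not prescribed. The positive part leaves the hypothesis valid and does not
  -- affect the final maximum.
  set N := max μ 0 with hN
  have hN0 : 0 ≤ N := le_max_right _ _
  set X := (2 * Real.pi * ħ) ^ (-(d : ℝ) / 2) * N with hX
  have hX0 : 0 ≤ X := by rw [hX]; positivity
  have hXsq : X ^ 2 = ((2 * Real.pi * ħ) ^ d)⁻¹ * N ^ 2 := by
    rw [hX, mul_pow, ← Real.rpow_natCast, ← Real.rpow_mul (by positivity), ← Real.rpow_natCast (_ * ħ) d,
      ← Real.rpow_neg (by positivity)]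
    congr 2; push_cast; ring
  have hle : (2 * Real.pi * ħ) ^ (-(d : ℝ) / 2) * μ ≤ X :=
    mul_le_mul_of_nonneg_left (le_max_left _ _) (by positivity)
  obtain ⟨hm, hb⟩ := bound_of_mknNorm_le hd hε hX0 (h1.trans (ENNReal.ofReal_le_ofReal hle))
  have hs : 0 < Real.sqrt ħ := Real.sqrt_pos.2 hħ
  set P : (Fin d → ℤ) → ℝ := fun k => ∏ l, (|(k l : ℝ)| + 1) ^ (-3 : ℝ) with hP
  have hP0 : ∀ k, 0 ≤ P k := fun k => Finset.prod_nonneg fun l _ => by positivity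
  obtain ⟨hPs, hP2⟩ := summable_prod_int (d := d)
  have hcont : Continuous a := hm.1 [] (admissible_of_length_le (by simp))
  have hg : ∀ m, Continuous (partialD [m] a) := fun m => hm.1 [m] (admissible_of_length_le (by simp))
  have hder : ∀ m z, HasLineDerivAt ℝ a (partialD [m] a z) z (dir m) := fun m z =>
    (hm.2 m [] (admissible_of_length_le (by simp)) z).hasLineDerivAt
  -- The factor (2π)^{-d} comes from Fourier inversion, 2^d from the sum over k, and 1/√ħ from the
  -- √ħ attached to each derivative in the norm.
  set c := ((2 * Real.pi) ^ d)⁻¹ * (X / Real.sqrt ħ * 2 ^ d) with hc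
  have hc0 : 0 ≤ c := by rw [hc]; positivity
  have hbd : ∀ m z, ‖partialD [m] a z‖ ≤ c * planeWeight z := by
    intro m z
    have hV := planeWeight_nonneg z
    refine (norm_deriv_le_of_fourierCoef hcont hg hder P hPs hP0 planeWeight planeWeight_le_one X
      (X / Real.sqrt ħ) (by positivity) (fun k z => ?_) m (fun k z => ?_) z).trans ?_
    · have := hb k z [] (admissible_of_length_le (by simp))
      simpa only [partialD, List.length_nil, pow_zero, one_mul] using this
    · have := hb k z [m] (admissible_of_length_le (by simp))
      simp only [partialD, List.length_singleton, pow_one] at this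
      rw [div_mul_eq_mul_div, div_mul_eq_mul_div, le_div_iff₀ hs, mul_comm]
      exact this
    · rw [hc, mul_assoc _ _ (planeWeight z)]
      refine mul_le_mul_of_nonneg_left ?_ (by positivity)
      rw [mul_right_comm]
      exact mul_le_mul_of_nonneg_right (mul_le_mul_of_nonneg_left hP2 (by positivity)) hV
  have hY : ∀ m, ENNReal.ofReal ((2 * Real.pi * ħ) ^ d * ħ ^ 2) * ∫⁻ z, ‖partialD [m] a z‖ₑ ^ 2 ≤
      ENNReal.ofReal (ħ * N ^ 2) := by
    intro m
    refine (mul_le_mul_right (lintegral_sq_le_of_planeWeight (hbd m)) _).trans ?_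
    rw [← ENNReal.ofReal_mul (by positivity)]
    refine ENNReal.ofReal_le_ofReal ?_
    -- Bookkeeping: (2π)^{-2d}·4^d comes from c², (2π)^d from the integral of the weight, and
    -- (2πħ)^{±d} cancel. Since 4 < 2π, the resulting constant is at most 1.
    have e : (2 * Real.pi * ħ) ^ d * ħ ^ 2 * (c ^ 2 * (2 * Real.pi) ^ d) = (4 / (2 * Real.pi)) ^ d * (ħ * N ^ 2) := by
      have e1 : (X / Real.sqrt ħ) ^ 2 = ((2 * Real.pi * ħ) ^ d)⁻¹ * N ^ 2 / ħ := by
        rw [div_pow, Real.sq_sqrt hħ.le, hXsq]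
      have e2 : c ^ 2 = (((2 * Real.pi) ^ d)⁻¹) ^ 2 * ((X / Real.sqrt ħ) ^ 2 * 4 ^ d) := by
        rw [hc, mul_pow, mul_pow _ ((2 : ℝ) ^ d), ← pow_mul, mul_comm d 2, pow_mul]; norm_num
      rw [e2, e1, div_pow]
      field_simp
    rw [e]
    refine mul_le_of_le_one_left (by positivity) (pow_le_one₀ (by positivity) ?_)
    rw [div_le_one (by positivity)]
    linarith [Real.pi_gt_three]
  refine (quantumWass_le_wigner ħ hħ R hR W hW a ha (fun m => partialD [m] a) hg c (fun m z =>
    (hbd m z).trans (mul_le_of_le_one_right hc0 (planeWeight_le_one z))) hder (ħ * N ^ 2) (by positivity)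
    hY).trans (rpow_half_le _ _ ?_ (ENNReal.ofReal_le_ofReal ?_))
  all_goals
    have hI : 2 * Real.sqrt d ≤ constI d ε := (le_constII ε hε).trans (constII_le_constI ε hε)
    have hI0 : 0 ≤ constI d ε := (by positivity : 0 ≤ 2 * Real.sqrt d).trans hI
    set Q := max (Real.sqrt ħ) (max (Real.sqrt ħ * μ) (Real.sqrt (ħ * μ * ν))) with hQ
    have hQ1 : Real.sqrt ħ ≤ Q := le_max_left _ _
    have hQ0 : 0 ≤ Q := hs.le.trans hQ1
  · positivity
  -- If μ is negative, N is zero and there is nothing to compare.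
  have hQ2 : Real.sqrt ħ * N ≤ Q := by
    rcases max_cases μ 0 with hh | hh
    · rw [hN, hh.1]; exact (le_max_left _ _).trans (le_max_right _ _)
    · rw [hN, hh.1, mul_zero]; exact hQ0
  have b1 : ħ ≤ Q ^ 2 := by
    have := pow_le_pow_left₀ hs.le hQ1 2
    rwa [Real.sq_sqrt hħ.le] at this
  have b2 : ħ * N ^ 2 ≤ Q ^ 2 := by
    have := pow_le_pow_left₀ (by positivity) hQ2 2
    rwa [mul_pow, Real.sq_sqrt hħ.le] at this
  have b3 : 4 * (d : ℝ) ≤ constI d ε ^ 2 := by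
    have := pow_le_pow_left₀ (by positivity) hI 2
    rw [mul_pow, Real.sq_sqrt (Nat.cast_nonneg _)] at this
    linarith
  rw [sq_div_sqrt_two_mul]
  have hd0 : (0 : ℝ) ≤ d := Nat.cast_nonneg _
  calc (d : ℝ) * ħ / 2 + d * (ħ * N ^ 2) ≤ d * Q ^ 2 / 2 + d * Q ^ 2 := by gcongr
    _ ≤ 4 * d / 2 * Q ^ 2 := by nlinarith [mul_nonneg hd0 (sq_nonneg Q)]
    _ ≤ _ := by gcongr

end WignerCase
end SemiWass
end

/-! ### The three cases together -/

theorem theorem4p1 (d : ℕ) (hd : 1 ≤ d)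
    -- a family of density operators, with their Wigner functions
    (R : ℝ → SemiWass.Op d) (W : ℝ → SemiWass.Phase d → ℂ)
    (hR : ∀ ħ ∈ Set.Ioc (0 : ℝ) 1, SemiWass.IsDensityOp (R ħ))
    (hW : ∀ ħ ∈ Set.Ioc (0 : ℝ) 1, SemiWass.IsWigner ħ (R ħ) (W ħ)) :
    -- (I)
    (∀ (ε : ℝ) (μ ν : ℝ → ℝ), 0 < ε → ε < 1 →
      Filter.Tendsto (fun ħ => Real.sqrt ħ * μ ħ) (nhdsWithin 0 (Set.Ioi 0)) (nhds 0) →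
      Filter.Tendsto (fun ħ => μ ħ * ν ħ) (nhdsWithin 0 (Set.Ioi 0)) (nhds 0) →
      (∀ ħ ∈ Set.Ioc (0 : ℝ) 1, SemiWass.WignerHyp ħ ε (μ ħ) (ν ħ) (R ħ)) →
      ∀ ħ ∈ Set.Ioc (0 : ℝ) 1,
        SemiWass.quantumWass ħ (SemiWass.husimi ħ (W ħ)) (R ħ) ≤
          ENNReal.ofReal (SemiWass.constI d ε / Real.sqrt 2 *
            max (Real.sqrt ħ) (max (Real.sqrt ħ * μ ħ) (Real.sqrt (ħ * μ ħ * ν ħ))))) ∧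
    -- (II)
    (∀ (ε : ℝ) (μ' ν' : ℝ → ℝ), 0 < ε → ε < 1 →
      Filter.Tendsto (fun ħ => Real.sqrt ħ * μ' ħ) (nhdsWithin 0 (Set.Ioi 0)) (nhds 0) →
      Filter.Tendsto (fun ħ => μ' ħ * ν' ħ) (nhdsWithin 0 (Set.Ioi 0)) (nhds 0) →
      (∀ ħ ∈ Set.Ioc (0 : ℝ) 1, SemiWass.HermiteHyp ħ ε (μ' ħ) (ν' ħ) (R ħ)) →
      (∃ ħ₀ ∈ Set.Ioc (0 : ℝ) 1, ∀ ħ ∈ Set.Ioc (0 : ℝ) ħ₀,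
        SemiWass.quantumWass ħ (SemiWass.husimi ħ (W ħ)) (R ħ) ≤
          ENNReal.ofReal (SemiWass.constII d ε / Real.sqrt 2 *
            max (Real.sqrt ħ) (max (Real.sqrt ħ * μ' ħ) (Real.sqrt (μ' ħ * ν' ħ))))) ∧
      (∀ ħ ∈ Set.Ioc (0 : ℝ) 1, μ' ħ * ν' ħ ≤ 1 →
        SemiWass.quantumWass ħ (SemiWass.husimi ħ (W ħ)) (R ħ) ≤
          ENNReal.ofReal (SemiWass.constII' d ε / Real.sqrt 2 *
            max (Real.sqrt ħ) (max (Real.sqrt ħ * μ' ħ) (Real.sqrt (μ' ħ * ν' ħ)))))) ∧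
    -- (III)
    (∀ (F : SemiWass.Phase d → ℝ) (τ : ℝ → ℝ), SemiWass.IsPosDensity F →
      Filter.Tendsto τ (nhdsWithin 0 (Set.Ioi 0)) (nhds 0) →
      (∀ ħ ∈ Set.Ioc (0 : ℝ) 1, SemiWass.ToeplitzHyp ħ (τ ħ) F (R ħ)) →
      ∀ ħ ∈ Set.Ioc (0 : ℝ) 1,
        SemiWass.quantumWass ħ (SemiWass.husimi ħ (W ħ)) (R ħ) ≤
          ENNReal.ofReal ((d : ℝ) ^ (1 / 4 : ℝ) * SemiWass.constIII F *
            max (Real.sqrt ħ) (Real.sqrt (τ ħ)))) := by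
  refine ⟨?_, ?_, ?_⟩
  · intro ε μ ν hε _ _ _ h ħ hħ
    exact SemiWass.wigner_case hd ħ hħ.1 ε (μ ħ) (ν ħ) hε (R ħ) (hR ħ hħ) (W ħ) (hW ħ hħ) (h ħ hħ)
  · intro ε μ ν hε hε1 _ hμν h
    exact ⟨SemiWass.hermite_case hd R W hR hW ε μ ν hε hε1 hμν h, fun ħ hħ hP =>
      SemiWass.quantumWass_hermite_uniform hd ħ hħ.1 hħ.2 ε _ _ hε hε1 (R ħ) (hR ħ hħ) (W ħ)
        (hW ħ hħ) (h ħ hħ) hP⟩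
  · intro F τ hF _ h ħ hħ
    exact SemiWass.toeplitz_case hd ħ hħ.1 (R ħ) (hR ħ hħ) (W ħ) (hW ħ hħ) F hF (τ ħ) (h ħ hħ)
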